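/- Let $n\ge 2$, let $(M,\xi=\ker\alpha)$ be a closed contact manifold of dimension $2n+1$, and let $\Gamma\subset M$ be a contact divisor, i.e. a closed embedded submanifold of dimension $2n-1$ on which $\xi_\Gamma=\xi\cap T\Gamma$ is a contact structure (the intrinsic contact structure of $\Gamma$). *Handles.* On $\mathbb R^{2n}=\mathbb R^n_x\times\mathbb R^n_y$ put $\beta_n=\tfrac12\sum(x_i\,dy_i-y_i\,dx_i)+d\big(\sum x_iy_i\big)$. For $\epsilon>0$ let $B^\pm_\epsilon$ be smooth functions with $B^-_\epsilon(\rho)=0$ and $B^+_\epsilon(\rho)=2\epsilon$ for $\rho<\epsilon$, $B^-_\epsilon$ strictly increasing on $[\epsilon,3\epsilon]$ with positive derivative on $(\epsilon,3\epsilon)$, $B_\epsilon^+$ nondecreasing, $B^-_\epsilon(\rho)<\rho<B^+_\epsilon(\rho)$ for $0<\rho<3\epsilon$ and $B^\pm_\epsilon(\rho)=\rho$ for $\rho\ge 3\epsilon$. A model handle, for $\epsilon^{\mathcal S},\epsilon^{\mathcal U}>0$, is $$H_n=\{B^-_{\epsilon^{\mathcal S}}(\|y\|)\le B^+_{\epsilon^{\mathcal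 S}}(\|x\|),\ B^-_{\epsilon^{\mathcal U}}(\|x\|)\le B^+_{\epsilon^{\mathcal U}}(\|y\|),\ \|x\|,\|y\|\le 3\max(\epsilon^{\mathcal S},\epsilon^{\mathcal U})\};$$ equality in the first (second) inequality defines $\partial^-H_n$ ($\partial^+H_n$), and $\mathcal U_n=H_n\cap\{y=0\}$ is the unstable disk. An ambient Weinstein handle is an embedding $H_n\to M$ that extends to an embedding of some $[-a,a]_t\times H_n$, $a>0$, carrying $\ker(dt+\beta_n)$ to $\xi$; we write $H_n,\partial^\pm H_n,\mathcal U_n$ also for the images in $M$. If $H_n\cap\Gamma=\partial^-H_n$, the surgery of $\Gamma$ along $H_n$ is $\Gamma^+=(\Gamma\setminus\partial^-H_n)\cup\partial^+H_n$. If $H_n\cap\Gamma^+=\partial^+H_n$, the anti-surgery of $\Gamma^+$ along $H_n$ is $(\Gamma^+\setminus\partial^+H_n)\cup\partial^-H_n$. *Legendrian stabilization.* In $(\mathbb R_t\times\mathbb R^n_p\times\mathbb R^n_q,\ \ker(dt+\sum p_i\,dq_i))$ let $\Lambda_C$ be the image of $$u\mapsto\big(f(u_1^3),\,(-\tfrac32u_1f'(u_1^3),0,\dots,0),\,(u_1^2,u_2,\dots,u_n)\big),$$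 where $f$ is smooth and nondecreasing, $f'(0)>0$, and, for some $\epsilon>0$, $f(\rho)=-1$ for $\rho<-\epsilon$ and $f(\rho)=1$ for $\rho>\epsilon$. A cusp chart for a Legendrian $\Lambda\subset M$ is an embedded ball $D\subset M$ such that $(D,D\cap\Lambda)$ is contactomorphic to a closed round ball centred at $0$ in $(\mathbb R^{2n+1},\Lambda_C)$. Let $N_\gamma\cong\gamma\times\mathbb D^{n-1}_x$ be a tubular neighbourhood of an embedded circle $\gamma$ in $\{q_1^3>\epsilon^2\}\subset\mathbb R^n$, let $0<\delta<1$, let $b$ be a smooth function with $b(0)=1+\delta$ and $b(\rho)=-1$ for $\rho>\delta$, and let $g=b(|x|^2)$ on $N_\gamma$ and $g=-1$ elsewhere. A stabilization of $\Lambda$ replaces, in a cusp chart, the points $(-1,0,q)$, $q_1^3>\epsilon^2$, of the lower sheet by the points $(g(q),-dg(q),q)$, this modification taking place in the interior of the ball; every other point of $\Lambda$ is kept. *Stabilization of divisors.* $\Gamma'\subset M$ is a stabilization of $\Gamma$ if there are: an ambient Weinstein handle $H_n$ with $H_n\cap\Gamma=\partial^-H_n$, with resulting $\Gamma^+$; a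 cusp chart $D$ for $\mathcal U_n$ disjoint from $\Gamma^+$; a Legendrian stabilization $\mathcal U_n'$ of $\mathcal U_n$ in $D$; and an ambient Weinstein handle $H_n'$, an embedding of the same model, that agrees with $H_n$ outside of $D$, has unstable disk $\mathcal U_n'$ (its parametrization being the one induced from $\mathcal U_n$ by the stabilization, up to isotopy of the disk relative to a neighbourhood of its boundary) and satisfies $H_n'\cap\Gamma^+=\partial^+H_n'$; such that $\Gamma'$ is the anti-surgery of $\Gamma^+$ along $H'_n$. **Theorem.** If $\Gamma'$ is a stabilization of $\Gamma$, then $\Gamma$ and $\Gamma'$ have the same intrinsic contact structure and are formally contact isotopic. That is: $\Gamma'$ is a contact divisor, and there is a smooth embedding $\iota':\Gamma\to M$ with image $\Gamma'$ and $(T\iota')^{-1}(\xi)=\xi_\Gamma$ (a contactomorphism $(\Gamma,\xi_\Gamma)\cong(\Gamma',\xi_{\Gamma'})$), together with a smooth isotopy of embeddings $\phi_T:\Gamma\to M$, $T\in[0,1]$, from the inclusion $\phi_0$ to $\phi_1=\iota'$, and smooth fibrewise injective bundle maps $\Phi_{S,T}:T\Gamma\to TM$ over $\phi_T$, continuous in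 $(S,T)\in[0,1]^2$, such that $\Phi_{0,T}=T\phi_T$ for all $T$; $\Phi_{1,T}$ maps $\xi_\Gamma$ into $\xi$ and is conformally symplectic (with positive factor) from $(\xi_\Gamma,d\alpha|_{\Gamma})$ to $(\xi,d\alpha)$ for all $T$; and $\Phi_{S,0}=T\phi_0$ and $\Phi_{S,1}=T\phi_1$ for all $S$. -/

import Mathlib

open Set Topology Manifold
open scoped ContDiff

noncomputable section

/-- Euclidean space `ℝ^m`. -/
abbrev Euc (m : ℕ) : Type := EuclideanSpace ℝ (Fin m)

/-- `ℝ × ℝ^n × ℝ^n`. Depending on the context its points are written `(t, p, q)` (the `1`-jet space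
of `ℝ^n`) or `(t, x, y)` (the thickening of the Weinstein handle). -/
abbrev Model (n : ℕ) : Type := ℝ × Euc n × Euc n

/-! ### Contact forms and contact divisors -/

section Contact

variable {m : ℕ} {M : Type*} [TopologicalSpace M] [ChartedSpace (Euc m) M]

variable (m M) in
/-- A (not necessarily smooth) differential `1`-form on an `m`-dimensional manifold. -/
abbrev OneForm : Type _ := ∀ x : M, TangentSpace (𝓡 m) x →L[ℝ] ℝ

/-- The form `α` in the coordinates of the preferred chart at `x`. -/
def OneForm.inChart (α : OneForm m M) (x : M) (y : Euc m) : Euc m →L[ℝ] ℝ :=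
  (α ((extChartAt (𝓡 m) x).symm y)).comp
    (mfderiv 𝓘(ℝ, Euc m) (𝓡 m) (extChartAt (𝓡 m) x).symm y :
      Euc m →L[ℝ] TangentSpace (𝓡 m) ((extChartAt (𝓡 m) x).symm y))

/-- The exterior derivative `dα`, computed at `x` in the preferred chart at `x`. The tangent space
at `x` is identified with `ℝ^m` by this very chart. -/
def OneForm.d (α : OneForm m M) (x : M) (u v : TangentSpace (𝓡 m) x) : ℝ :=
  (fderiv ℝ (α.inChart x) (extChartAt (𝓡 m) x x) : Euc m →L[ℝ] Euc m →L[ℝ] ℝ) u v -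
    (fderiv ℝ (α.inChart x) (extChartAt (𝓡 m) x x) : Euc m →L[ℝ] Euc m →L[ℝ] ℝ) v u

/-- The hyperplane field `ξ = ker α`. -/
def OneForm.ker (α : OneForm m M) (x : M) : Submodule ℝ (TangentSpace (𝓡 m) x) :=
  LinearMap.ker (α x).toLinearMap

/-- `α` is a contact form: it is smooth, nowhere zero, and `dα` is nondegenerate on `ξ = ker α`. -/
structure IsContactForm [IsManifold (𝓡 m) ∞ M] (α : OneForm m M) : Prop where
  smooth : ContMDiff (𝓡 m).tangent 𝓘(ℝ, ℝ) ∞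
    (fun v : TangentBundle (𝓡 m) M => α v.proj v.2)
  ne_zero : ∀ x, α x ≠ 0
  nondegenerate : ∀ x, ∀ u ∈ α.ker x, (∀ v ∈ α.ker x, α.d x u v = 0) → u = 0

variable {k : ℕ} {N : Type*} [TopologicalSpace N] [ChartedSpace (Euc k) N]

/-- The pull-back under `Tι` of the hyperplane field `ξ = ker α`. For a contact divisor
`ι : N → M` this is the intrinsic contact structure `ξ ∩ TN`. -/
def OneForm.pullbackKer (α : OneForm m M) (ι : N → M) (x : N) :
    Submodule ℝ (TangentSpace (𝓡 k) x) :=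
  (α.ker (ι x)).comap (mfderiv (𝓡 k) (𝓡 m) ι x).toLinearMap

/-- The pull-back `ι^* dα`, which is the exterior derivative of `ι^* α`. -/
def OneForm.pullbackD (α : OneForm m M) (ι : N → M) (x : N)
    (u v : TangentSpace (𝓡 k) x) : ℝ :=
  α.d (ι x) (mfderiv (𝓡 k) (𝓡 m) ι x u) (mfderiv (𝓡 k) (𝓡 m) ι x v)

variable (k) in
/-- `ι : N → M` is a smooth embedding whose image is a contact submanifold of `(M, ker α)`:
the form `ι^* α` is nowhere zero and its exterior derivative is nondegenerate on its kernel. -/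
structure IsContactSubmanifold (α : OneForm m M) (ι : N → M) : Prop where
  embedding : IsSmoothEmbedding (𝓡 k) (𝓡 m) ∞ ι
  transverse : ∀ x, α.pullbackKer (k := k) ι x ≠ ⊤
  nondegenerate : ∀ x, ∀ u ∈ α.pullbackKer (k := k) ι x,
    (∀ v ∈ α.pullbackKer (k := k) ι x, α.pullbackD (k := k) ι x u v = 0) → u = 0

end Contact

/-! ### Formal contact embeddings and their isotopies -/

section Formal

variable {m : ℕ} {M : Type*} [TopologicalSpace M] [ChartedSpace (Euc m) M]
variable {k : ℕ} {N : Type*} [TopologicalSpace N] [ChartedSpace (Euc k) N]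

/-- A formal contact embedding of `N` with the formal contact structure `(ηN, ωN)` into `M` with
the formal contact structure `(ηM, ωM)`. -/
structure FormalContactEmbedding [IsManifold (𝓡 k) ∞ N] [IsManifold (𝓡 m) ∞ M]
    (ηN : ∀ x : N, Submodule ℝ (TangentSpace (𝓡 k) x))
    (ωN : ∀ x : N, TangentSpace (𝓡 k) x → TangentSpace (𝓡 k) x → ℝ)
    (ηM : ∀ x : M, Submodule ℝ (TangentSpace (𝓡 m) x))
    (ωM : ∀ x : M, TangentSpace (𝓡 m) x → TangentSpace (𝓡 m) x → ℝ) where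
  /-- the underlying embedding -/
  φ : N → M
  /-- the bundle maps `Φ_S : TN → TM` over `φ`, for `S ∈ [0, 1]` -/
  Φ : unitInterval → ∀ x : N, TangentSpace (𝓡 k) x →L[ℝ] TangentSpace (𝓡 m) (φ x)
  embedding : IsSmoothEmbedding (𝓡 k) (𝓡 m) ∞ φ
  start : ∀ x, Φ 0 x = mfderiv (𝓡 k) (𝓡 m) φ x
  injective : ∀ S x, Function.Injective (Φ S x)
  smooth : ∀ S, ContMDiff (𝓡 k).tangent (𝓡 m).tangent ∞
    (fun v : TangentBundle (𝓡 k) N => (⟨φ v.proj, Φ S v.proj v.2⟩ : TangentBundle (𝓡 m) M))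
  continuous : Continuous (fun w : unitInterval × TangentBundle (𝓡 k) N =>
    (⟨φ w.2.proj, Φ w.1 w.2.proj w.2.2⟩ : TangentBundle (𝓡 m) M))
  mapsTo : ∀ x, ∀ u ∈ ηN x, Φ 1 x u ∈ ηM (φ x)
  conformal : ∀ x, ∃ c : ℝ, 0 < c ∧ ∀ u ∈ ηN x, ∀ v ∈ ηN x,
    ωM (φ x) (Φ 1 x u) (Φ 1 x v) = c * ωN x u v

variable {ηN : ∀ x : N, Submodule ℝ (TangentSpace (𝓡 k) x)}
  {ωN : ∀ x : N, TangentSpace (𝓡 k) x → TangentSpace (𝓡 k) x → ℝ}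
  {ηM : ∀ x : M, Submodule ℝ (TangentSpace (𝓡 m) x)}
  {ωM : ∀ x : M, TangentSpace (𝓡 m) x → TangentSpace (𝓡 m) x → ℝ}

/-- A genuine contact embedding, viewed as a formal one: the family `Φ_S` is constant in `S`,
that is, `Φ_S = Tφ` for all `S`. -/
def FormalContactEmbedding.IsGenuine [IsManifold (𝓡 k) ∞ N] [IsManifold (𝓡 m) ∞ M]
    (e : FormalContactEmbedding ηN ωN ηM ωM) : Prop :=
  ∀ S x, e.Φ S x = mfderiv (𝓡 k) (𝓡 m) e.φ x

/-- Formal contact isotopy: a family of formal contact embeddings parametrized by `T ∈ [0, 1]`,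
whose underlying embeddings form a smooth isotopy and whose bundle maps `Φ_{S,T}` depend
continuously on `(S, T)`. -/
def FormallyContactIsotopic [IsManifold (𝓡 k) ∞ N] [IsManifold (𝓡 m) ∞ M]
    (e₀ e₁ : FormalContactEmbedding ηN ωN ηM ωM) : Prop :=
  ∃ e : unitInterval → FormalContactEmbedding ηN ωN ηM ωM,
    e 0 = e₀ ∧ e 1 = e₁ ∧
    ContMDiff ((𝓡∂ 1).prod (𝓡 k)) (𝓡 m) ∞
      (fun w : unitInterval × N => (e w.1).φ w.2) ∧
    Continuous (fun w : (unitInterval × unitInterval) × TangentBundle (𝓡 k) N =>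
      (⟨(e w.1.2).φ w.2.proj, (e w.1.2).Φ w.1.1 w.2.proj w.2.2⟩ : TangentBundle (𝓡 m) M))

end Formal

/-! ### Model Weinstein handles of critical index -/

section Handle

/-- The profile functions `B^-_ε`. -/
structure IsLowerProfile (ε : ℝ) (B : ℝ → ℝ) : Prop where
  smooth : ContDiff ℝ ∞ B
  eq_zero : ∀ ρ, ρ < ε → B ρ = 0
  lt_self : ∀ ρ, 0 < ρ → ρ < 3 * ε → B ρ < ρ
  increasing : ∀ ρ, ε < ρ → ρ < 3 * ε → 0 < deriv B ρ
  eq_self : ∀ ρ, 3 * ε ≤ ρ → B ρ = ρ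

/-- The profile functions `B^+_ε`. -/
structure IsUpperProfile (ε : ℝ) (B : ℝ → ℝ) : Prop where
  smooth : ContDiff ℝ ∞ B
  eq_const : ∀ ρ, ρ < ε → B ρ = 2 * ε
  self_lt : ∀ ρ, ρ < 3 * ε → ρ < B ρ
  increasing : Monotone B
  eq_self : ∀ ρ, 3 * ε ≤ ρ → B ρ = ρ

/-- The parameters determining the geometry of a model handle. -/
structure HandleShape where
  (εS εU : ℝ)
  (lowerS upperS lowerU upperU : ℝ → ℝ)
  εS_pos : 0 < εS
  εU_pos : 0 < εU
  isLowerS : IsLowerProfile εS lowerS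
  isUpperS : IsUpperProfile εS upperS
  isLowerU : IsLowerProfile εU lowerU
  isUpperU : IsUpperProfile εU upperU

variable {n : ℕ}

/-- The Liouville form `β_n = ½ ∑ (x_i dy_i - y_i dx_i) + d (∑ x_i y_i)` of the index `n` handle,
at the point `z = (x, y)` and on the tangent vector `w`. -/
def handleForm (z w : Euc n × Euc n) : ℝ :=
  (1 / 2) * (inner ℝ z.1 w.2 - inner ℝ z.2 w.1) + (inner ℝ w.1 z.2 + inner ℝ z.1 w.2)

namespace HandleShape

variable (s : HandleShape)

/-- The model handle `H_n`. Its points are `(x, y)`, with `x = v^𝒰` the coordinates on the unstable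
manifold and `y = v^𝒮` those on the stable manifold of the Liouville vector field. -/
def handle (n : ℕ) : Set (Euc n × Euc n) :=
  {z | s.lowerS ‖z.2‖ ≤ s.upperS ‖z.1‖ ∧ s.lowerU ‖z.1‖ ≤ s.upperU ‖z.2‖ ∧
    ‖z.1‖ ≤ 3 * max s.εS s.εU ∧ ‖z.2‖ ≤ 3 * max s.εS s.εU}

/-- The concave boundary `∂^- H_n`, where the Liouville vector field points inward. -/
def concaveBdry (n : ℕ) : Set (Euc n × Euc n) :=
  {z | z ∈ s.handle n ∧ s.lowerS ‖z.2‖ = s.upperS ‖z.1‖}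

/-- The convex boundary `∂^+ H_n`, where the Liouville vector field points outward. -/
def convexBdry (n : ℕ) : Set (Euc n × Euc n) :=
  {z | z ∈ s.handle n ∧ s.lowerU ‖z.1‖ = s.upperU ‖z.2‖}

/-- The unstable disk `𝒰_n = {(x, 0) ∈ H_n}`, described by its coordinate `x`. -/
def unstableDisk (n : ℕ) : Set (Euc n) :=
  {x | (x, 0) ∈ s.handle n}

end HandleShape

end Handle

/-! ### Embeddings of models into a contact manifold -/

section Models

variable {n m : ℕ} {M : Type*} [TopologicalSpace M] [ChartedSpace (Euc m) M]

/-- On the set `A`, the map `κ` is an embedding of the model with the hyperplane field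
`{v | θ w v = 0}` into `(M, ker α)` (smooth up to the boundary of `A`). -/
def IsContactModelEmbedding (α : OneForm m M) (A : Set (Model n)) (θ : Model n → Model n → ℝ)
    (κ : Model n → M) : Prop :=
  ∃ O : Set (Model n), IsOpen O ∧ A ⊆ O ∧ ContMDiffOn 𝓘(ℝ, Model n) (𝓡 m) ∞ κ O ∧ InjOn κ O ∧
    (∀ w ∈ O, Function.Injective (mfderiv 𝓘(ℝ, Model n) (𝓡 m) κ w)) ∧
    ∀ w ∈ A, ∀ v : Model n,
      θ w v = 0 ↔ α (κ w) (mfderiv 𝓘(ℝ, Model n) (𝓡 m) κ w (v : TangentSpace 𝓘(ℝ, Model n) w)) = 0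

/-- An ambient Weinstein handle of index `n` in `(M, ker α)`: a Liouville embedding of a model
handle, that is, an embedding of a thickening `[-a, a] × H_n` in which `ker α` is
`ker (dt + β_n)`. -/
structure AmbientHandle (n : ℕ) (s : HandleShape) (α : OneForm m M) where
  thick : Model n → M
  a : ℝ
  a_pos : 0 < a
  isEmbedding : IsContactModelEmbedding α (Icc (-a) a ×ˢ s.handle n)
    (fun w v => v.1 + handleForm w.2 v.2) thick

namespace AmbientHandle

variable {s : HandleShape} {α : OneForm m M} (h : AmbientHandle n s α)

/-- The embedding of the handle itself, at `t = 0`. -/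
def emb (z : Euc n × Euc n) : M := h.thick (0, z)

/-- The handle as a subset of `M`. -/
def carrier : Set M := h.emb '' s.handle n

/-- `∂^- H_n` as a subset of `M`. -/
def concave : Set M := h.emb '' s.concaveBdry n

/-- `∂^+ H_n` as a subset of `M`. -/
def convex : Set M := h.emb '' s.convexBdry n

/-- The parametrization of the unstable disk `𝒰_n`. -/
def core (x : Euc n) : M := h.emb (x, 0)

/-- `𝒰_n` as a subset of `M`. -/
def unstable : Set M := h.core '' s.unstableDisk n

/-- `(H_n, β_n, Γ)` is ambient Weinstein surgery data. -/
def IsSurgeryData (Γ : Set M) : Prop := h.carrier ∩ Γ = h.concave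

/-- The result of the ambient Weinstein surgery of `Γ` along the handle. -/
def surgery (Γ : Set M) : Set M := (Γ \ h.concave) ∪ h.convex

/-- `(H_n, β_n, Γ)` is Weinstein anti-surgery data. -/
def IsAntiSurgeryData (Γ : Set M) : Prop := h.carrier ∩ Γ = h.convex

/-- The result of the ambient Weinstein anti-surgery of `Γ` along the handle. -/
def antiSurgery (Γ : Set M) : Set M := (Γ \ h.convex) ∪ h.concave

end AmbientHandle

end Models

/-! ### Legendrian stabilization in a cusp chart -/

section Cusp

variable {n : ℕ} [NeZero n]

/-- The increasing functions `f` used to write down the cusp. The condition `f'(0) > 0` says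
precisely that `cuspMap` is an immersion. -/
structure IsCuspProfile (ε : ℝ) (f : ℝ → ℝ) : Prop where
  pos : 0 < ε
  smooth : ContDiff ℝ ∞ f
  mono : Monotone f
  deriv_pos : 0 < deriv f 0
  eq_neg_one : ∀ ρ, ρ < -ε → f ρ = -1
  eq_one : ∀ ρ, ε < ρ → f ρ = 1

/-- The standard contact form `dt + ∑ p_i dq_i` at the point `w = (t, p, q)`, on the vector `v`. -/
def stdForm (w v : Model n) : ℝ := v.1 + inner ℝ w.2.1 v.2.2

/-- The Legendrian cusp
`u ↦ (f (u_1 ^ 3), (-(3/2) u_1 f' (u_1 ^ 3), 0, …, 0), (u_1 ^ 2, u_2, …, u_n))`. -/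
def cuspMap (f : ℝ → ℝ) (u : Euc n) : Model n :=
  (f (u 0 ^ 3), EuclideanSpace.single 0 (-(3 / 2) * u 0 * deriv f (u 0 ^ 3)),
    WithLp.toLp 2 (Function.update u.ofLp 0 (u 0 ^ 2)))

/-- `Λ_C`, the image of the cusp. -/
def cusp (n : ℕ) [NeZero n] (f : ℝ → ℝ) : Set (Model n) := range (cuspMap (n := n) f)

/-- `g : ℝ^n → ℝ` is a bump around an embedded circle `γ`: there is a tubular neighbourhood
`τ : γ × 𝔻^{n-1} → ℝ^n` of `γ` (with `γ = ℝ / ℤ`) in which `g` is a function `b` of `|x|^2`, falling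
from `1 + δ` on `γ` to `-1`, and `g = -1` elsewhere. The tubular neighbourhood lies in the region
`{q_1 ^ 3 > ε ^ 2}`, over which `Λ_C` consists of the two sheets `t = ± 1`. -/
def IsCircleBump (ε : ℝ) (g : Euc n → ℝ) : Prop :=
  ∃ (δ : ℝ) (b : ℝ → ℝ) (τ : ℝ × Euc (n - 1) → Euc n),
    0 < δ ∧ δ < 1 ∧
    ContDiff ℝ ∞ b ∧ b 0 = 1 + δ ∧ (∀ ρ, δ < ρ → b ρ = -1) ∧
    ContDiff ℝ ∞ τ ∧ (∀ θ x, τ (θ + 1, x) = τ (θ, x)) ∧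
    (∀ θ θ' x x', ‖x‖ ≤ 1 → ‖x'‖ ≤ 1 → τ (θ, x) = τ (θ', x') →
      x = x' ∧ ∃ j : ℤ, θ' = θ + j) ∧
    (∀ θ x, ‖x‖ ≤ 1 → Function.Injective (fderiv ℝ τ (θ, x))) ∧
    (∀ θ x, ‖x‖ ≤ 1 → ε ^ 2 < τ (θ, x) 0 ^ 3) ∧
    (∀ θ x, ‖x‖ ≤ 1 → g (τ (θ, x)) = b (‖x‖ ^ 2)) ∧
    (∀ q, (∀ θ x, ‖x‖ ≤ 1 → τ (θ, x) ≠ q) → g q = -1)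

open Classical in
/-- The stabilization of the cusp: a point `(-1, 0, q)` of the lower sheet is replaced by the
point `(g q, -dg q, q)` of the `1`-jet lift of `g`, and all other points of `Λ_C` are kept. The
stabilized Legendrian `Λ_γ` is the image of `Λ_C`. -/
def cuspStab (ε : ℝ) (g : Euc n → ℝ) (w : Model n) : Model n :=
  if w.1 = -1 ∧ ε ^ 2 < w.2.2 0 ^ 3 then (g w.2.2, -gradient g w.2.2, w.2.2) else w

/-- The closed ball of radius `R` in `ℝ^{2n+1}`. -/
def modelBall (n : ℕ) (R : ℝ) : Set (Model n) :=
  {w | w.1 ^ 2 + ‖w.2.1‖ ^ 2 + ‖w.2.2‖ ^ 2 ≤ R ^ 2}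

variable {m : ℕ} {M : Type*} [TopologicalSpace M] [ChartedSpace (Euc m) M]

/-- A cusp chart for `Λ ⊆ M`: an embedded contact ball `D ⊆ M` such that the pair `(D, D ∩ Λ)` is
isomorphic to a ball in `(ℝ^{2n+1}, Λ_C)` centred at a point of the cusp. -/
structure CuspChart (n : ℕ) [NeZero n] (α : OneForm m M) (Λ : Set M) where
  (ε R : ℝ)
  f : ℝ → ℝ
  κ : Model n → M
  isCusp : IsCuspProfile ε f
  R_pos : 0 < R
  isEmbedding : IsContactModelEmbedding α (modelBall n R) stdForm κ
  inter : κ '' modelBall n R ∩ Λ = κ '' (modelBall n R ∩ cusp n f)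

/-- The ball `D ⊆ M` of a cusp chart. -/
def CuspChart.disk {α : OneForm m M} {Λ : Set M} (C : CuspChart n α Λ) : Set M :=
  C.κ '' modelBall n C.R

/-- The map `l'` is obtained from the parametrized Legendrian `l : X → M` by a Legendrian
stabilization, along a bump `g`, inside the cusp chart `C` for the image of `X`. The modification
of the cusp has to take place in the interior of the ball. -/
structure CuspChart.IsStabilization {α : OneForm m M} {P : Type*} {X : Set P} {l : P → M}
    (C : CuspChart n α (l '' X)) (l' : P → M) (g : Euc n → ℝ) : Prop where
  bump : IsCircleBump C.ε g
  interior : ∃ r, 0 < r ∧ r < C.R ∧ ∀ w ∈ cusp n C.f, cuspStab C.ε g w ≠ w →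
    w ∈ modelBall n r ∧ cuspStab C.ε g w ∈ modelBall n r
  outside : ∀ x ∈ X, l x ∉ C.disk → l' x = l x
  inside : ∀ x ∈ X, ∀ w ∈ modelBall n C.R, l x = C.κ w → l' x = C.κ (cuspStab C.ε g w)

end Cusp

/-! ### Stabilization of contact divisors -/

section Stabilization

variable {n : ℕ} [NeZero n] {m : ℕ} {M : Type*} [TopologicalSpace M] [ChartedSpace (Euc m) M]

/-- `F₁` is the time-one map of a smooth isotopy `(F_T)` of `ℝ^n` which starts at `F_0 = id` and is
supported in a compact subset of `X`. -/
def IsIsotopicToId (X : Set (Euc n)) (F₁ : Euc n → Euc n) : Prop :=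
  ∃ (F : ℝ × Euc n → Euc n) (K : Set (Euc n)),
    IsCompact K ∧ K ⊆ X ∧ ContDiff ℝ ∞ F ∧
    (∀ x, F (0, x) = x) ∧ (∀ x, F (1, x) = F₁ x) ∧
    ∀ T ∈ Icc (0 : ℝ) 1, (∀ x ∉ K, F (T, x) = x) ∧
      Function.Bijective (fun x => F (T, x)) ∧
      ∀ x, Function.Injective (fderiv ℝ (fun x' => F (T, x')) x)

/-- `Γ'` is a stabilization of `Γ` in `(M, ker α)`. -/
structure StabilizationData (n : ℕ) [NeZero n] (α : OneForm m M) (Γ Γ' : Set M) where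
  s : HandleShape
  /-- the handle `H_n` -/
  h : AmbientHandle n s α
  /-- `(H_n, β_n, Γ)` is Weinstein surgery data; the result of the surgery is `Γ^+` -/
  isSurgeryData : h.IsSurgeryData Γ
  /-- a cusp chart for `𝒰_n` which is disjoint from `Γ^+` (hence from `∂^+ H_n`) -/
  chart : CuspChart n α (h.core '' s.unstableDisk n)
  disjoint : Disjoint chart.disk (h.surgery Γ)
  /-- the parametrized Legendrian disk `𝒰_n'`, a Legendrian stabilization of `𝒰_n` -/
  l' : Euc n → M
  g : Euc n → ℝ
  isStabilization : chart.IsStabilization l' g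
  /-- the stabilized handle `H_n'` -/
  h' : AmbientHandle n s α
  /-- `H_n'` agrees with `H_n` outside of the chart -/
  agree : ∀ z ∈ s.handle n, h.emb z ∉ chart.disk → h'.emb z = h.emb z
  stay : ∀ z ∈ s.handle n, h.emb z ∈ chart.disk → h'.emb z ∈ chart.disk
  /-- The unstable disk of `H_n'` is `𝒰_n'`, up to an isotopy of the parametrizing disk relative to
  its boundary. -/
  F : Euc n → Euc n
  isIsotopic : IsIsotopicToId {x | (x, 0) ∈ s.handle n \ s.convexBdry n} F
  core_eq : ∀ x ∈ s.unstableDisk n, h'.core (F x) = l' x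
  /-- `Γ'` is the result of the anti-surgery of `Γ^+` along `H_n'` -/
  isAntiSurgeryData : h'.IsAntiSurgeryData (h.surgery Γ)
  result : h'.antiSurgery (h.surgery Γ) = Γ'

/-- `Γ'` is a stabilization of `Γ` (along the unstable disk of some ambient handle). -/
def IsDivisorStabilization (n : ℕ) [NeZero n] (α : OneForm m M) (Γ Γ' : Set M) : Prop :=
  Nonempty (StabilizationData n α Γ Γ')

end Stabilization

end

/-! The attaching region of the divisor, the part of `∂^- H_n` off `∂^+ H_n`, can be pushed forward
by the Liouville flow of the handle until, away from `∂^+ H_n`, it lies as close as desired to the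
unstable disk. The flow at time `τ` multiplies `β_n` by `e^τ`, and `β_n` vanishes on the Liouville
field, so the flow time may vary from point to point: every stage induces the same cooriented
hyperplane field on `N`, and the isotopy runs through genuine contact embeddings (`exists_isThin`).
The same flow times can be used inside `H_n'`. Thus it suffices to connect two thin divisors, one
around `𝒰_n` and one around `𝒰_n'`.

In the cusp chart the two disks differ in the lower sheet, which is replaced by the `1`-jet lift of
`g`. Moving it through the jets of `-1 + T (g + 1)` is a path of Legendrians, but it may cross the
upper sheet, where `T (g + 1) = 2` and `T ∇g = 0`. Adding `T (1 - T) W` to the coordinate `p`, with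
`W` tangent to the circles of the tube and therefore orthogonal to `∇g`, removes the crossings. The
displaced path no longer respects the contact form, but its derivative can be replaced by a linear
map which does, through injective maps; at `T = 0` and `T = 1` the displacement vanishes and no
replacement takes place. This is the only step which is formal and not genuine. It is defined on a
whole neighbourhood of the sheet, so it applies to a thin divisor as well as to the disk
(`isFormalDeformation_sheetDeform`, `exists_isSheetData`, `exists_formalIsotopy_sheetMove`).

At `T = 1` it is a map `χ`, locally a contactomorphism near the disk, which carries `𝒰_n` to `𝒰_n'`.
Hence `χ ∘ h` and `h'` differ by a germ `c` of contactomorphisms along the disk, which covers the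
diffeomorphism `F` of the disk and fixes the handle near the boundary (`exists_isCoreGerm`).
Conjugation by the dilations `(t, x, y) ↦ (r t, x, r y)`, which scale `dt - ∑ y_i dx_i`, deforms `c`
for `r → 0` into a fibrewise linear germ. Such a germ is determined by `F` and by its conformal
factor along the disk. The factor is `1` near the boundary, hence positive, so it can be joined to
`1` by a segment while `F` is undone by its isotopy (`IsCoreGerm.exists_families`). These are
genuine contact isotopies relative to the boundary.

The formal contact isotopy is the concatenation of the flow in `H_n`, the formal move in the cusp
chart, the two isotopies of germs, and the reversed flow in `H_n'`
(`exists_formalIsotopy_stabilized`). Every intermediate end point is an injective map whose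
pull-back of `α` is a positive multiple of that of `ι`. This alone makes it a contact embedding with
the same intrinsic contact structure. -/

noncomputable section

set_option linter.unusedSectionVars false

/-! ### Derivatives of maps between vector spaces and manifolds

The tangent spaces of a manifold modelled on `ℝ^m` are copies of `ℝ^m`; the derivatives below are
`mfderiv`, with this identification made. -/

section Derivatives

variable {k : ℕ} {N : Type*} [TopologicalSpace N] [ChartedSpace (Euc k) N]
variable {m : ℕ} {M : Type*} [TopologicalSpace M] [ChartedSpace (Euc m) M]
variable {E : Type*} [NormedAddCommGroup E] [NormedSpace ℝ E]
variable {F : Type*} [NormedAddCommGroup F] [NormedSpace ℝ F]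

/-- The value of a `1`-form. -/
def OneForm.val (α : OneForm m M) (p : M) : Euc m →L[ℝ] ℝ := α p

/-- The exterior derivative of a `1`-form. -/
def OneForm.ext (α : OneForm m M) (p : M) (u v : Euc m) : ℝ := α.d p u v

variable (k m) in
/-- The derivative of a map between manifolds. -/
def derivMap (φ : N → M) (x : N) : Euc k →L[ℝ] Euc m := mfderiv (𝓡 k) (𝓡 m) φ x

variable (m) in
/-- The derivative of a map from a vector space to a manifold. -/
def derivFrom (κ : E → M) (w : E) : E →L[ℝ] Euc m := mfderiv 𝓘(ℝ, E) (𝓡 m) κ w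

variable (k) in
/-- The derivative of a map from a manifold to a vector space. -/
def derivTo (ζ : N → E) (x : N) : Euc k →L[ℝ] E := mfderiv (𝓡 k) 𝓘(ℝ, E) ζ x

theorem derivMap_comp_derivTo {κ : E → M} {ζ : N → E} {x : N}
    (hκ : MDifferentiableAt 𝓘(ℝ, E) (𝓡 m) κ (ζ x))
    (hζ : MDifferentiableAt (𝓡 k) 𝓘(ℝ, E) ζ x) :
    derivMap k m (fun x => κ (ζ x)) x = (derivFrom m κ (ζ x)).comp (derivTo k ζ x) :=
  mfderiv_comp x hκ hζ

theorem derivMap_comp_derivFrom {φ : N → M} {κ : E → N} {w : E}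
    (hφ : MDifferentiableAt (𝓡 k) (𝓡 m) φ (κ w))
    (hκ : MDifferentiableAt 𝓘(ℝ, E) (𝓡 k) κ w) :
    derivFrom m (fun w => φ (κ w)) w = (derivMap k m φ (κ w)).comp (derivFrom k κ w) :=
  mfderiv_comp w hφ hκ

theorem derivFrom_comp_fderiv {κ : F → M} {ψ : E → F} {w : E}
    (hκ : MDifferentiableAt 𝓘(ℝ, F) (𝓡 m) κ (ψ w)) (hψ : DifferentiableAt ℝ ψ w) :
    derivFrom m (fun w => κ (ψ w)) w = (derivFrom m κ (ψ w)).comp (fderiv ℝ ψ w) := by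
  have := mfderiv_comp w hκ hψ.mdifferentiableAt
  rw [mfderiv_eq_fderiv] at this
  exact this

theorem fderiv_comp_derivTo {ψ : E → F} {ζ : N → E} {x : N} (hψ : DifferentiableAt ℝ ψ (ζ x))
    (hζ : MDifferentiableAt (𝓡 k) 𝓘(ℝ, E) ζ x) :
    derivTo k (fun x => ψ (ζ x)) x = (fderiv ℝ ψ (ζ x)).comp (derivTo k ζ x) := by
  have := mfderiv_comp x hψ.mdifferentiableAt hζ
  rw [mfderiv_eq_fderiv] at this
  exact this

theorem derivTo_comp_derivFrom {ζ : M → F} {κ : E → M} {w : E}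
    (hζ : MDifferentiableAt (𝓡 m) 𝓘(ℝ, F) ζ (κ w))
    (hκ : MDifferentiableAt 𝓘(ℝ, E) (𝓡 m) κ w) :
    fderiv ℝ (fun w => ζ (κ w)) w = (derivTo m ζ (κ w)).comp (derivFrom m κ w) := by
  have := mfderiv_comp w hζ hκ
  rw [mfderiv_eq_fderiv] at this
  exact this

/-- `mfderiv` is by definition the derivative of the expression in the preferred charts, and the
chart of a vector space is the identity. -/
theorem hasFDerivAt_derivFrom {κ : E → M} {w : E} (h : MDifferentiableAt 𝓘(ℝ, E) (𝓡 m) κ w) :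
    HasFDerivAt (fun z => extChartAt (𝓡 m) (κ w) (κ z)) (derivFrom m κ w) w := by
  have h2 : HasFDerivWithinAt (fun z => extChartAt (𝓡 m) (κ w) (κ z))
      (derivFrom m κ w) (range (id : E → E)) w := h.hasMFDerivAt.2
  rwa [range_id, hasFDerivWithinAt_univ] at h2

theorem Filter.EventuallyEq.derivMap_eq {φ ψ : N → M} {x : N} (h : φ =ᶠ[𝓝 x] ψ) :
    derivMap k m φ x = derivMap k m ψ x := h.mfderiv_eq

theorem Filter.EventuallyEq.derivTo_eq {φ ψ : N → E} {x : N} (h : φ =ᶠ[𝓝 x] ψ) :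
    derivTo k φ x = derivTo k ψ x := h.mfderiv_eq

theorem Filter.EventuallyEq.derivFrom_eq {φ ψ : E → M} {w : E} (h : φ =ᶠ[𝓝 w] ψ) :
    derivFrom m φ w = derivFrom m ψ w := h.mfderiv_eq

theorem ContMDiffAt.contDiffAt_extChartAt_comp [IsManifold (𝓡 m) ∞ M] {κ : E → M} {w : E}
    (h : ContMDiffAt 𝓘(ℝ, E) (𝓡 m) ∞ κ w) :
    ContDiffAt ℝ ∞ (fun z => extChartAt (𝓡 m) (κ w) (κ z)) w :=
  (contMDiffAt_iff_target.1 h).2.contDiffAt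

variable [FiniteDimensional ℝ E] [IsManifold (𝓡 m) ∞ M]

/-- An injective local diffeomorphism has a smooth inverse. -/
theorem invFunOn_spec {κ : E → M} {O : Set E} (hO : IsOpen O)
    (hκ : ContMDiffOn 𝓘(ℝ, E) (𝓡 m) ∞ κ O) (hinj : InjOn κ O)
    (himm : ∀ w ∈ O, Function.Injective (derivFrom m κ w))
    (hdim : Module.finrank ℝ E = m) {w : E} (hw : w ∈ O) :
    ContMDiffAt (𝓡 m) 𝓘(ℝ, E) ∞ (Function.invFunOn κ O) (κ w) ∧
      (∀ᶠ y in 𝓝 (κ w), Function.invFunOn κ O y ∈ O ∧ κ (Function.invFunOn κ O y) = y) ∧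
      Function.invFunOn κ O (κ w) = w := by
  have hκw : ContMDiffAt 𝓘(ℝ, E) (𝓡 m) ∞ κ w := (hκ w hw).contMDiffAt (hO.mem_nhds hw)
  set e := extChartAt (𝓡 m) (κ w) with he
  set g : E → Euc m := fun z => e (κ z) with hg
  have hgs : ContDiffAt ℝ ∞ g w := hκw.contDiffAt_extChartAt_comp
  have hdim' : Module.finrank ℝ E = Module.finrank ℝ (Euc m) := by simp [hdim]
  let L : E ≃L[ℝ] Euc m :=
    (LinearMap.linearEquivOfInjective (derivFrom m κ w).toLinearMap (himm w hw)
      hdim').toContinuousLinearEquiv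
  have hL : HasFDerivAt g (L : E →L[ℝ] Euc m) w := by
    have h1 : (L : E →L[ℝ] Euc m) = derivFrom m κ w := by ext; rfl
    rw [h1]; exact hasFDerivAt_derivFrom (hκw.mdifferentiableAt (by simp))
  have : CompleteSpace E := FiniteDimensional.complete ℝ E
  set Gi := hgs.localInverse hL (by simp) with hGi
  have hGs : ContDiffAt ℝ ∞ Gi (g w) := hgs.to_localInverse hL (by simp)
  have hGw : Gi (g w) = w := hgs.localInverse_apply_image hL (by simp)
  have hstrict : HasStrictFDerivAt g (L : E →L[ℝ] Euc m) w := hgs.hasStrictFDerivAt' hL (by simp)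
  have hright : ∀ᶠ y in 𝓝 (g w), g (Gi y) = y := hstrict.eventually_right_inverse
  have hec : ContinuousAt e (κ w) := continuousAt_extChartAt (κ w)
  have hGe : Filter.Tendsto (fun y => Gi (e y)) (𝓝 (κ w)) (𝓝 w) := by
    have h1 : ContinuousAt Gi (e (κ w)) := hGs.continuousAt
    have := h1.comp (f := e) hec
    have h2 : (Gi ∘ e) (κ w) = w := hGw
    rw [ContinuousAt, h2] at this
    exact this
  -- The inverse chosen by `invFunOn` agrees near `κ w` with the smooth one from the inverse
  -- function theorem: both values lie in `O`, where `κ` is injective.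
  have hinv : ∀ᶠ y in 𝓝 (κ w), Function.invFunOn κ O y = Gi (e y) ∧
      Function.invFunOn κ O y ∈ O ∧ κ (Function.invFunOn κ O y) = y := by
    have a1 : ∀ᶠ y in 𝓝 (κ w), Gi (e y) ∈ O := hGe.eventually (hO.mem_nhds hw)
    have a2 : ∀ᶠ y in 𝓝 (κ w), κ (Gi (e y)) ∈ e.source :=
      (hκw.continuousAt.tendsto.comp hGe).eventually (extChartAt_source_mem_nhds (κ w))
    have a3 : ∀ᶠ y in 𝓝 (κ w), y ∈ e.source := extChartAt_source_mem_nhds (κ w)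
    have a4 : ∀ᶠ y in 𝓝 (κ w), g (Gi (e y)) = e y := hec.eventually hright
    filter_upwards [a1, a2, a3, a4] with y b1 b2 b3 b4
    have hy : κ (Gi (e y)) = y := e.injOn b2 b3 b4
    have h1 : y ∈ κ '' O := ⟨_, b1, hy⟩
    have h2 := Function.invFunOn_mem h1
    have h3 := Function.invFunOn_eq h1
    exact ⟨hinj h2 b1 (h3.trans hy.symm), h2, h3⟩
  refine ⟨?_, hinv.mono fun y h => h.2, ?_⟩
  · have h1 : ContMDiffAt (𝓡 m) 𝓘(ℝ, E) ∞ (Gi ∘ e) (κ w) :=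
      ContMDiffAt.comp (κ w) (hGs.contMDiffAt) contMDiffAt_extChartAt
    exact h1.congr_of_eventuallyEq (hinv.mono fun y h => h.1)
  · exact hinj.leftInvOn_invFunOn hw

end Derivatives

/-! ### Exterior derivatives and pull-backs -/

section Pullback

variable {m : ℕ} {M : Type*} [TopologicalSpace M] [ChartedSpace (Euc m) M]
  [IsManifold (𝓡 m) ∞ M]
variable {E : Type*} [NormedAddCommGroup E] [NormedSpace ℝ E]

/-- Smoothness of a form is given on the tangent bundle. Evaluated on a constant vector, the chart
expression is that function composed with the tangent map of the inverse chart; in finite dimensions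
such evaluations suffice. -/
theorem OneForm.contDiffOn_inChart {α : OneForm m M}
    (hα : ContMDiff (𝓡 m).tangent 𝓘(ℝ, ℝ) ∞ (fun v : TangentBundle (𝓡 m) M => α v.proj v.2))
    (x : M) : ContDiffOn ℝ ∞ (α.inChart x) (extChartAt (𝓡 m) x).target := by
  refine contDiffOn_clm_apply.2 fun v => ?_
  have hopen : IsOpen (extChartAt (𝓡 m) x).target := isOpen_extChartAt_target x
  have h1 : ContMDiffOn 𝓘(ℝ, Euc m).tangent (𝓡 m).tangent ∞
      (tangentMapWithin 𝓘(ℝ, Euc m) (𝓡 m) (extChartAt (𝓡 m) x).symm (extChartAt (𝓡 m) x).target)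
      (Bundle.TotalSpace.proj ⁻¹' (extChartAt (𝓡 m) x).target) :=
    (contMDiffOn_extChartAt_symm (n := ∞) x).contMDiffOn_tangentMapWithin (by simp)
      hopen.uniqueMDiffOn
  have h2 : ContMDiff 𝓘(ℝ, Euc m) 𝓘(ℝ, Euc m).tangent ∞
      (fun y : Euc m => (⟨y, v⟩ : TangentBundle 𝓘(ℝ, Euc m) (Euc m))) := by
    intro y
    rw [Bundle.contMDiffAt_totalSpace]
    refine ⟨contMDiffAt_id, ?_⟩
    simpa using! contMDiffAt_const
  have h3 := hα.comp_contMDiffOn (h1.comp h2.contMDiffOn (s := (extChartAt (𝓡 m) x).target)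
    (fun y hy => hy))
  have h4 := h3.contDiffOn
  refine h4.congr fun y hy => ?_
  simp only [Function.comp_apply, tangentMapWithin, OneForm.inChart]
  rw [mfderivWithin_of_isOpen hopen hy]
  rfl

/-- The pull-back of `α` under a map from a vector space. -/
def OneForm.pull (α : OneForm m M) (G : E → M) (e : E) : E →L[ℝ] ℝ :=
  (α.val (G e)).comp (derivFrom m G e)

/-- Near `e` the map factors through the chart at `G e`, so the pull-back is one between vector
spaces, in the same chart that defines `α.d`. -/
theorem OneForm.pull_eventuallyEq (α : OneForm m M) {G : E → M} {e : E}
    (hG : ContMDiffAt 𝓘(ℝ, E) (𝓡 m) ∞ G e) :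
    ∀ᶠ e' in 𝓝 e, α.pull G e' = (α.inChart (G e) (extChartAt (𝓡 m) (G e) (G e'))).comp
      (fderiv ℝ (fun z => extChartAt (𝓡 m) (G e) (G z)) e') := by
  have a1 : ∀ᶠ e' in 𝓝 e, ContMDiffAt 𝓘(ℝ, E) (𝓡 m) 1 G e' :=
    (contMDiffAt_iff_contMDiffAt_nhds (by simp)).1 (hG.of_le (by simp : (1 : ℕ∞ω) ≤ ∞))
  have a2 : ∀ᶠ e' in 𝓝 e, G e' ∈ (extChartAt (𝓡 m) (G e)).source :=
    hG.continuousAt.eventually (extChartAt_source_mem_nhds (G e))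
  filter_upwards [a1, a2, a2.eventually_nhds] with e' b1 b2 b3
  have hGd : MDifferentiableAt 𝓘(ℝ, E) (𝓡 m) G e' := b1.mdifferentiableAt (by simp)
  have hext : MDifferentiableAt (𝓡 m) 𝓘(ℝ, Euc m) (extChartAt (𝓡 m) (G e)) (G e') :=
    (contMDiffAt_extChartAt' (n := ∞) (by simpa using b2)).mdifferentiableAt (by simp)
  have hg : DifferentiableAt ℝ (fun z => extChartAt (𝓡 m) (G e) (G z)) e' :=
    (hext.comp e' hGd).differentiableAt
  have htgt : extChartAt (𝓡 m) (G e) (G e') ∈ (extChartAt (𝓡 m) (G e)).target :=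
    (extChartAt (𝓡 m) (G e)).map_source b2
  have hsymm : MDifferentiableAt 𝓘(ℝ, Euc m) (𝓡 m) (extChartAt (𝓡 m) (G e)).symm
      (extChartAt (𝓡 m) (G e) (G e')) :=
    (((contMDiffOn_extChartAt_symm (n := ∞) (G e)) _ htgt).contMDiffAt
      ((isOpen_extChartAt_target (G e)).mem_nhds htgt)).mdifferentiableAt (by simp)
  have heq : G =ᶠ[𝓝 e'] fun z => (extChartAt (𝓡 m) (G e)).symm (extChartAt (𝓡 m) (G e) (G z)) := by
    filter_upwards [b3] with z hz
    exact ((extChartAt (𝓡 m) (G e)).left_inv hz).symm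
  have hpt : (extChartAt (𝓡 m) (G e)).symm (extChartAt (𝓡 m) (G e) (G e')) = G e' :=
    (extChartAt (𝓡 m) (G e)).left_inv b2
  have hin : α.inChart (G e) (extChartAt (𝓡 m) (G e) (G e')) =
      (α.val ((extChartAt (𝓡 m) (G e)).symm (extChartAt (𝓡 m) (G e) (G e')))).comp
        (derivFrom m (extChartAt (𝓡 m) (G e)).symm (extChartAt (𝓡 m) (G e) (G e'))) := rfl
  rw [OneForm.pull, hin, hpt, Filter.EventuallyEq.derivFrom_eq heq, derivFrom_comp_fderiv (κ := (extChartAt (𝓡 m) (G e)).symm)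
    (ψ := fun z => extChartAt (𝓡 m) (G e) (G z)) hsymm hg]
  rfl

/-- The exterior derivative commutes with pull-back: the second derivative of the coordinate
expression of `G` is symmetric and cancels in the antisymmetrization. -/
theorem OneForm.hasFDerivAt_pull {α : OneForm m M}
    (hα : ContMDiff (𝓡 m).tangent 𝓘(ℝ, ℝ) ∞ (fun v : TangentBundle (𝓡 m) M => α v.proj v.2))
    {G : E → M} {e : E} (hG : ContMDiffAt 𝓘(ℝ, E) (𝓡 m) ∞ G e) :
    DifferentiableAt ℝ (α.pull G) e ∧ ∀ u v : E,
      fderiv ℝ (α.pull G) e u v - fderiv ℝ (α.pull G) e v u =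
        α.ext (G e) (derivFrom m G e u) (derivFrom m G e v) := by
  set g : E → Euc m := fun z => extChartAt (𝓡 m) (G e) (G z) with hg
  set C := α.inChart (G e) with hC
  have hgs : ContDiffAt ℝ ∞ g e := hG.contDiffAt_extChartAt_comp
  have hCd : DifferentiableAt ℝ C (g e) :=
    ((OneForm.contDiffOn_inChart hα (G e)).contDiffAt
      (extChartAt_target_mem_nhds (G e))).differentiableAt (by simp)
  have hDg : DifferentiableAt ℝ (fderiv ℝ g) e :=
    (hgs.fderiv_right (m := 1) (by norm_cast)).differentiableAt (by simp)
  have h1 : HasFDerivAt (fun e' => C (g e')) ((fderiv ℝ C (g e)).comp (fderiv ℝ g e)) e :=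
    hCd.hasFDerivAt.comp e (hgs.differentiableAt (by simp)).hasFDerivAt
  have h2 := h1.clm_comp hDg.hasFDerivAt
  have h3 := h2.congr_of_eventuallyEq (α.pull_eventuallyEq hG)
  refine ⟨h3.differentiableAt, fun u v => ?_⟩
  have hsymm : fderiv ℝ (fderiv ℝ g) e u v = fderiv ℝ (fderiv ℝ g) e v u :=
    (hgs.isSymmSndFDerivAt (by simp; norm_cast)).eq u v
  have hM : derivFrom m G e = fderiv ℝ g e :=
    (hasFDerivAt_derivFrom (hG.mdifferentiableAt (by simp))).fderiv.symm
  have hd : α.ext (G e) (derivFrom m G e u) (derivFrom m G e v) =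
      fderiv ℝ C (g e) (derivFrom m G e u) (derivFrom m G e v) -
      fderiv ℝ C (g e) (derivFrom m G e v) (derivFrom m G e u) := rfl
  rw [h3.fderiv, hd, hM]
  simp [hsymm]

/-- If `η₂ = c η₁` with a differentiable function `c`, then `dη₂ = c dη₁` on `ker η₁`. -/
theorem extDeriv_eq_of_proportional {η₁ η₂ : E → E →L[ℝ] ℝ} {e : E}
    (h₁ : DifferentiableAt ℝ η₁ e) (h₂ : DifferentiableAt ℝ η₂ e) (hne : η₁ e ≠ 0)
    (hp : ∀ᶠ e' in 𝓝 e, ∃ c : ℝ, η₂ e' = c • η₁ e') {c : ℝ} (hc : η₂ e = c • η₁ e)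
    {u v : E} (hu : η₁ e u = 0) (hv : η₁ e v = 0) :
    fderiv ℝ η₂ e u v - fderiv ℝ η₂ e v u = c * (fderiv ℝ η₁ e u v - fderiv ℝ η₁ e v u) := by
  -- Evaluation on `R` recovers the factor as `η₂ R / η₁ R`, which is therefore differentiable near
  -- `e`. The term `dc ∧ η₁` of the product rule vanishes on the kernel of `η₁`.
  obtain ⟨R, hR⟩ : ∃ R, η₁ e R ≠ 0 := by
    by_contra! h
    exact hne (ContinuousLinearMap.ext h)
  have d1 : DifferentiableAt ℝ (fun e' => η₁ e' R) e := h₁.clm_apply (differentiableAt_const R)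
  have d2 : DifferentiableAt ℝ (fun e' => η₂ e' R) e := h₂.clm_apply (differentiableAt_const R)
  have df : DifferentiableAt ℝ (fun e' => η₂ e' R / η₁ e' R) e := by
    simp only [div_eq_mul_inv]
    exact d2.mul (d1.inv hR)
  have hcR : η₂ e R / η₁ e R = c := by
    rw [hc]; simp [hR]
  have hev : η₂ =ᶠ[𝓝 e] fun e' => (η₂ e' R / η₁ e' R) • η₁ e' := by
    filter_upwards [hp, d1.continuousAt.eventually_ne hR] with e' ⟨b, hb⟩ hne'
    rw [hb]; simp [hne']
  have h3 := (df.hasFDerivAt.fun_smul h₁.hasFDerivAt).congr_of_eventuallyEq hev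
  rw [h3.fderiv]
  simp [hu, hv, hcR, mul_sub]

end Pullback

/-! ### Proportional pull-backs on manifolds -/

section PullbackManifold

variable {m : ℕ} {M : Type*} [TopologicalSpace M] [ChartedSpace (Euc m) M]
  [IsManifold (𝓡 m) ∞ M]
variable {k : ℕ} {N : Type*} [TopologicalSpace N] [ChartedSpace (Euc k) N]
  [IsManifold (𝓡 k) ∞ N]

/-- A map on a manifold, in the preferred chart at `x`. -/
def inDomainChart {Y : Type*} (φ : N → Y) (x : N) : Euc k → Y :=
  fun y => φ ((extChartAt (𝓡 k) x).symm y)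

theorem contMDiffAt_extChartAt_symm_of_mem (x : N) {y : Euc k}
    (hy : y ∈ (extChartAt (𝓡 k) x).target) :
    ContMDiffAt 𝓘(ℝ, Euc k) (𝓡 k) ∞ (extChartAt (𝓡 k) x).symm y :=
  ((contMDiffOn_extChartAt_symm x) y hy).contMDiffAt ((isOpen_extChartAt_target x).mem_nhds hy)

theorem ContMDiff.contMDiffAt_inDomainChart {φ : N → M} (hφ : ContMDiff (𝓡 k) (𝓡 m) ∞ φ) (x : N)
    {y : Euc k} (hy : y ∈ (extChartAt (𝓡 k) x).target) :
    ContMDiffAt 𝓘(ℝ, Euc k) (𝓡 m) ∞ (inDomainChart φ x) y :=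
  ContMDiffAt.comp y hφ.contMDiffAt (contMDiffAt_extChartAt_symm_of_mem x hy)

theorem inDomainChart_self {Y : Type*} (φ : N → Y) (x : N) :
    inDomainChart φ x (extChartAt (𝓡 k) x x) = φ x := by
  simp [inDomainChart]

theorem derivFrom_inDomainChart {φ : N → M} (hφ : ContMDiff (𝓡 k) (𝓡 m) ∞ φ) (x : N) :
    derivFrom m (inDomainChart φ x) (extChartAt (𝓡 k) x x) = derivMap k m φ x := by
  have h1 := (hasFDerivAt_derivFrom
    ((hφ.contMDiffAt_inDomainChart x (mem_extChartAt_target x)).mdifferentiableAt (by simp)))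
  have h2 : HasFDerivWithinAt (fun z => extChartAt (𝓡 m) (φ x) (inDomainChart φ x z))
      (derivMap k m φ x) (range (id : Euc k → Euc k)) (extChartAt (𝓡 k) x x) :=
    ((hφ x).mdifferentiableAt (by simp)).hasMFDerivAt.2
  rw [range_id, hasFDerivWithinAt_univ] at h2
  rw [inDomainChart_self] at h1
  exact h1.unique h2

theorem derivFrom_inDomainChart_of_mem {φ : N → M} (hφ : ContMDiff (𝓡 k) (𝓡 m) ∞ φ) (x : N)
    {y : Euc k} (hy : y ∈ (extChartAt (𝓡 k) x).target) :
    derivFrom m (inDomainChart φ x) y = (derivMap k m φ ((extChartAt (𝓡 k) x).symm y)).comp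
        (derivFrom k (extChartAt (𝓡 k) x).symm y) :=
  derivMap_comp_derivFrom (κ := (extChartAt (𝓡 k) x).symm) ((hφ _).mdifferentiableAt (by simp))
    ((contMDiffAt_extChartAt_symm_of_mem x hy).mdifferentiableAt (by simp))

/-- If the pull-backs of `α` under two maps are proportional, then so are those of `dα` on the
kernel. -/
theorem OneForm.ext_of_proportional {α : OneForm m M}
    (hα : ContMDiff (𝓡 m).tangent 𝓘(ℝ, ℝ) ∞ (fun v : TangentBundle (𝓡 m) M => α v.proj v.2))
    {ι φ : N → M} (hι : ContMDiff (𝓡 k) (𝓡 m) ∞ ι) (hφ : ContMDiff (𝓡 k) (𝓡 m) ∞ φ)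
    (hprop : ∀ x, ∃ c : ℝ, (α.val (φ x)).comp (derivMap k m φ x) =
      c • (α.val (ι x)).comp (derivMap k m ι x))
    {x : N} (hne : (α.val (ι x)).comp (derivMap k m ι x) ≠ 0) {c : ℝ}
    (hc : (α.val (φ x)).comp (derivMap k m φ x) = c • (α.val (ι x)).comp (derivMap k m ι x))
    {u v : Euc k} (hu : α.val (ι x) (derivMap k m ι x u) = 0)
    (hv : α.val (ι x) (derivMap k m ι x v) = 0) :
    α.ext (φ x) (derivMap k m φ x u) (derivMap k m φ x v) =
      c * α.ext (ι x) (derivMap k m ι x u) (derivMap k m ι x v) := by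
  set y := extChartAt (𝓡 k) x x with hy
  have hyt : y ∈ (extChartAt (𝓡 k) x).target := mem_extChartAt_target x
  have hpull : ∀ {ψ : N → M}, ContMDiff (𝓡 k) (𝓡 m) ∞ ψ →
      α.pull (inDomainChart ψ x) y = (α.val (ψ x)).comp (derivMap k m ψ x) := by
    intro ψ hψ
    rw [OneForm.pull, hy, derivFrom_inDomainChart hψ, inDomainChart_self]
  have hdpull : ∀ {ψ : N → M}, ContMDiff (𝓡 k) (𝓡 m) ∞ ψ →
      fderiv ℝ (α.pull (inDomainChart ψ x)) y u v - fderiv ℝ (α.pull (inDomainChart ψ x)) y v u =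
      α.ext (ψ x) (derivMap k m ψ x u) (derivMap k m ψ x v) := by
    intro ψ hψ
    rw [(OneForm.hasFDerivAt_pull hα (hψ.contMDiffAt_inDomainChart x hyt)).2, hy,
      derivFrom_inDomainChart hψ, inDomainChart_self]
  have hev : ∀ᶠ y' in 𝓝 y, ∃ c : ℝ,
      α.pull (inDomainChart φ x) y' = c • α.pull (inDomainChart ι x) y' := by
    filter_upwards [extChartAt_target_mem_nhds (I := 𝓡 k) x] with y' hy'
    obtain ⟨b, hb⟩ := hprop ((extChartAt (𝓡 k) x).symm y')
    refine ⟨b, ?_⟩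
    rw [OneForm.pull, OneForm.pull, derivFrom_inDomainChart_of_mem hφ x hy',
      derivFrom_inDomainChart_of_mem hι x hy', ← ContinuousLinearMap.comp_assoc,
      ← ContinuousLinearMap.comp_assoc]
    rw [show inDomainChart φ x y' = φ ((extChartAt (𝓡 k) x).symm y') from rfl, hb]
    rfl
  rw [← hdpull hφ, ← hdpull hι]
  refine extDeriv_eq_of_proportional
    (OneForm.hasFDerivAt_pull hα (hι.contMDiffAt_inDomainChart x hyt)).1
    (OneForm.hasFDerivAt_pull hα (hφ.contMDiffAt_inDomainChart x hyt)).1 ?_ hev ?_ ?_ ?_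
  · rwa [hpull hι]
  · rwa [hpull hφ, hpull hι]
  · rw [hpull hι]; exact hu
  · rw [hpull hι]; exact hv

/-- The same for a map from a vector space under which `α` pulls back to a multiple of a given
form. -/
theorem OneForm.ext_of_pull_proportional {E : Type*} [NormedAddCommGroup E] [NormedSpace ℝ E]
    {α : OneForm m M}
    (hα : ContMDiff (𝓡 m).tangent 𝓘(ℝ, ℝ) ∞ (fun v : TangentBundle (𝓡 m) M => α v.proj v.2))
    {κ : E → M} {w : E} (hκ : ContMDiffAt 𝓘(ℝ, E) (𝓡 m) ∞ κ w) {θ : E → E →L[ℝ] ℝ}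
    (hθ : DifferentiableAt ℝ θ w) (hne : θ w ≠ 0)
    (hev : ∀ᶠ w' in 𝓝 w, ∃ c : ℝ, α.pull κ w' = c • θ w') {c : ℝ} (hc : α.pull κ w = c • θ w)
    {u v : E} (hu : θ w u = 0) (hv : θ w v = 0) :
    α.ext (κ w) (derivFrom m κ w u) (derivFrom m κ w v) =
      c * (fderiv ℝ θ w u v - fderiv ℝ θ w v u) := by
  rw [← (OneForm.hasFDerivAt_pull hα hκ).2]
  exact extDeriv_eq_of_proportional hθ (OneForm.hasFDerivAt_pull hα hκ).1 hne hev hc hu hv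

end PullbackManifold

/-! ### A map with injective derivative is an immersion -/

section Immersion

variable {k : ℕ} {N : Type*} [TopologicalSpace N] [ChartedSpace (Euc k) N] [IsManifold (𝓡 k) ∞ N]
variable {m : ℕ} {M : Type*} [TopologicalSpace M] [ChartedSpace (Euc m) M] [IsManifold (𝓡 m) ∞ M]

theorem mem_contDiffGroupoid_of_contDiffOn {G : OpenPartialHomeomorph (Euc m) (Euc m)}
    (h : ContDiffOn ℝ ∞ G G.source) (h' : ContDiffOn ℝ ∞ G.symm G.target) :
    G ∈ contDiffGroupoid ∞ (𝓡 m) := by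
  rw [contDiffGroupoid, mem_groupoid_of_pregroupoid]
  constructor
  · simpa [contDiffPregroupoid] using! h
  · simpa [contDiffPregroupoid] using! h'

theorem chartAt_trans_mem_maximalAtlas (p : M) {G : OpenPartialHomeomorph (Euc m) (Euc m)}
    (h : G ∈ contDiffGroupoid ∞ (𝓡 m)) :
    (chartAt (Euc m) p).trans G ∈ IsManifold.maximalAtlas (𝓡 m) ∞ M := by
  intro e' he'
  have hc := chart_mem_atlas (Euc m) p
  constructor
  · rw [OpenPartialHomeomorph.trans_symm_eq_symm_trans_symm, OpenPartialHomeomorph.trans_assoc]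
    exact (contDiffGroupoid ∞ (𝓡 m)).trans ((contDiffGroupoid ∞ (𝓡 m)).symm h)
      (HasGroupoid.compatible hc he')
  · rw [← OpenPartialHomeomorph.trans_assoc]
    exact (contDiffGroupoid ∞ (𝓡 m)).trans (HasGroupoid.compatible he' hc) h

/-- The inverse function theorem, with the local inverse in the smooth groupoid. -/
theorem exists_mem_contDiffGroupoid {Ξ : Euc m → Euc m} {a : Euc m} (hΞ : ∀ᶠ z in 𝓝 a, ContDiffAt ℝ ∞ Ξ z)
    {L : Euc m ≃L[ℝ] Euc m} (hL : HasFDerivAt Ξ (L : Euc m →L[ℝ] Euc m) a) :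
    ∃ G : OpenPartialHomeomorph (Euc m) (Euc m), a ∈ G.source ∧ (∀ z, G z = Ξ z) ∧
      G ∈ contDiffGroupoid ∞ (𝓡 m) := by
  obtain ⟨U, hU, hUo, haU⟩ := eventually_nhds_iff.1 hΞ
  have hcont : ContinuousOn (fderiv ℝ Ξ) U := fun z hz =>
    ((hU z hz).continuousAt_fderiv (by simp)).continuousWithinAt
  -- Invertibility of the derivative is an open condition. On the restricted domain the inverse is
  -- smooth at every point, as membership in the groupoid requires.
  obtain ⟨O, hO⟩ := (continuousOn_iff'.1 hcont) _ (ContinuousLinearEquiv.isOpen (𝕜 := ℝ) (E := Euc m) (F := Euc m))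
  set G₀ := (hU a haU).toOpenPartialHomeomorph Ξ hL (by simp) with hG₀
  have hG₀a : a ∈ G₀.source := (hU a haU).mem_toOpenPartialHomeomorph_source hL (by simp)
  have hcoe : ∀ z, G₀ z = Ξ z := fun z => rfl
  have hV : IsOpen (O ∩ U) := hO.1.inter hUo
  have haV : a ∈ O ∩ U := by
    rw [← hO.2]
    exact ⟨⟨L, hL.fderiv.symm⟩, haU⟩
  have hsm : ContDiffOn ℝ ∞ (G₀.restr (O ∩ U)) (G₀.restr (O ∩ U)).source := by
    intro z hz
    rw [OpenPartialHomeomorph.restr_source, hV.interior_eq] at hz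
    exact (hU z hz.2.2).contDiffWithinAt
  refine ⟨G₀.restr (O ∩ U), ?_, fun z => rfl, mem_contDiffGroupoid_of_contDiffOn hsm ?_⟩
  · rw [OpenPartialHomeomorph.restr_source, hV.interior_eq]
    exact ⟨hG₀a, haV⟩
  · intro y hy
    have hz : (G₀.restr (O ∩ U)).symm y ∈ (G₀.restr (O ∩ U)).source :=
      (G₀.restr (O ∩ U)).map_target hy
    have hz' := hz
    rw [OpenPartialHomeomorph.restr_source, hV.interior_eq] at hz
    have h2 := hz.2
    rw [← hO.2] at h2
    obtain ⟨L', hL'⟩ := h2.1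
    refine (OpenPartialHomeomorph.contDiffAt_symm (f₀' := L') _ hy ?_ ?_).contDiffWithinAt
    · rw [hL']
      exact ((hU _ h2.2).differentiableAt (by simp)).hasFDerivAt
    · exact hU _ h2.2

theorem exists_equiv_extending {A : Euc k →L[ℝ] Euc m} (hA : Function.Injective A) :
    ∃ Z : (Euc k × Euc (m - k)) ≃L[ℝ] Euc m, ∀ u, Z (u, 0) = A u := by
  obtain ⟨C, hC⟩ := Submodule.exists_isCompl (LinearMap.range A.toLinearMap)
  have hr : Module.finrank ℝ (LinearMap.range A.toLinearMap) = k := by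
    rw [LinearMap.finrank_range_of_inj hA]; simp
  have hCd : Module.finrank ℝ C = m - k := by
    have := Submodule.finrank_add_eq_of_isCompl hC
    rw [hr] at this; simp at this; omega
  have hkm : k + (m - k) = m := by
    have := Submodule.finrank_add_eq_of_isCompl hC
    rw [hr] at this; simp at this; omega
  let e : Euc (m - k) ≃ₗ[ℝ] C := LinearEquiv.ofFinrankEq _ _ (by simp [hCd])
  let Z₀ : (Euc k × Euc (m - k)) →ₗ[ℝ] Euc m :=
    A.toLinearMap.coprod (C.subtype.comp e.toLinearMap)
  have hinj : Function.Injective Z₀ := by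
    rw [injective_iff_map_eq_zero]
    rintro ⟨u, b⟩ h
    have h1 : A u + (e b : Euc m) = 0 := by simpa [Z₀] using h
    have h2 : A u ∈ LinearMap.range A.toLinearMap ⊓ C := by
      refine ⟨⟨u, rfl⟩, ?_⟩
      rw [eq_neg_of_add_eq_zero_left h1]
      exact C.neg_mem (e b).2
    rw [hC.inf_eq_bot, Submodule.mem_bot] at h2
    have hu : u = 0 := hA (by simpa using h2)
    have hb : e b = 0 := by
      rw [h2, zero_add] at h1
      exact Subtype.ext h1
    simp [hu, (LinearEquiv.map_eq_zero_iff e).1 hb]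
  refine ⟨(LinearMap.linearEquivOfInjective Z₀ hinj (by simp [hkm])).toContinuousLinearEquiv,
    fun u => ?_⟩
  change Z₀ (u, 0) = A u
  simp [Z₀]

/-- The derivative is completed to an isomorphism `Z` of `ℝ^k × ℝ^(m-k)` with `ℝ^m`. The map `Ξ`,
which is the coordinate expression of `φ` along the first factor and linear along the second, has
derivative the identity at the point. Composing the chart of `M` with the inverse of `Ξ` turns `φ`
into `u ↦ Z (u, 0)`. -/
theorem isImmersion_of_injective_derivMap {φ : N → M} (hφ : ContMDiff (𝓡 k) (𝓡 m) ∞ φ)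
    (hinj : ∀ x, Function.Injective (derivMap k m φ x)) : IsImmersion (𝓡 k) (𝓡 m) ∞ φ := by
  refine (IsImmersionOfComplement.isImmersion (F := Euc (m - k)) fun x => ?_)
  obtain ⟨Z, hZ⟩ := exists_equiv_extending (hinj x)
  set f : Euc k → Euc m := fun u => extChartAt (𝓡 m) (φ x) (inDomainChart φ x u) with hf
  set u₀ := extChartAt (𝓡 k) x x with hu₀
  have hfs : ∀ᶠ u in 𝓝 u₀, ContDiffAt ℝ ∞ f u := by
    have h1 : ∀ᶠ u in 𝓝 u₀, u ∈ (extChartAt (𝓡 k) x).target := extChartAt_target_mem_nhds x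
    have h2 : ∀ᶠ u in 𝓝 u₀, inDomainChart φ x u ∈ (chartAt (Euc m) (φ x)).source := by
      have hc := (hφ.contMDiffAt_inDomainChart x (mem_extChartAt_target x)).continuousAt
      refine hc.eventually ?_
      rw [inDomainChart_self]
      exact chart_source_mem_nhds _ _
    filter_upwards [h1, h2] with u hu1 hu2
    have := ContMDiffAt.comp u (contMDiffAt_extChartAt' (n := ∞) (I := 𝓡 m) hu2)
      (hφ.contMDiffAt_inDomainChart x hu1)
    exact this.contDiffAt
  have hfd : HasFDerivAt f (derivMap k m φ x) u₀ := by
    have h2 : HasFDerivWithinAt f (derivMap k m φ x) (range (id : Euc k → Euc k)) u₀ :=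
      ((hφ x).mdifferentiableAt (by simp)).hasMFDerivAt.2
    rwa [range_id, hasFDerivWithinAt_univ] at h2
  let B : Euc (m - k) →L[ℝ] Euc m :=
    (Z : (Euc k × Euc (m - k)) →L[ℝ] Euc m).comp (ContinuousLinearMap.inr ℝ _ _)
  let p1 : Euc m →L[ℝ] Euc k :=
    (ContinuousLinearMap.fst ℝ _ _).comp (Z.symm : Euc m →L[ℝ] (Euc k × Euc (m - k)))
  let p2 : Euc m →L[ℝ] Euc (m - k) :=
    (ContinuousLinearMap.snd ℝ _ _).comp (Z.symm : Euc m →L[ℝ] (Euc k × Euc (m - k)))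
  let Ξ : Euc m → Euc m := fun z => f (p1 z) + B (p2 z)
  set a : Euc m := Z (u₀, 0) with ha
  have hp1a : p1 a = u₀ := by simp [p1, ha]
  have hΞs : ∀ᶠ z in 𝓝 a, ContDiffAt ℝ ∞ Ξ z := by
    have h1 : Filter.Tendsto p1 (𝓝 a) (𝓝 u₀) := by
      rw [← hp1a]; exact p1.continuous.continuousAt
    filter_upwards [h1.eventually hfs] with z hz
    exact (ContDiffAt.comp z hz p1.contDiff.contDiffAt).add (B.comp p2).contDiff.contDiffAt
  have hΞd : HasFDerivAt Ξ ((ContinuousLinearEquiv.refl ℝ (Euc m)) : Euc m →L[ℝ] Euc m) a := by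
    have h1 : HasFDerivAt (fun z => f (p1 z)) ((derivMap k m φ x).comp p1) a := by
      have h3 : HasFDerivAt f (derivMap k m φ x) (p1 a) := by rw [hp1a]; exact hfd
      exact h3.comp a p1.hasFDerivAt
    have h2 := h1.add ((B.comp p2).hasFDerivAt (x := a))
    refine h2.congr_fderiv ?_
    ext1 z
    have h4 : z = Z (Z.symm z) := by simp
    have h5 : Z.symm z = (p1 z, 0) + (0, p2 z) := by simp [p1, p2]
    have h6 : z = derivMap k m φ x (p1 z) + B (p2 z) := by
      conv_lhs => rw [h4, h5, map_add, hZ]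
      rfl
    simpa using h6.symm
  obtain ⟨G, haG, hG, hGm⟩ := exists_mem_contDiffGroupoid hΞs hΞd
  have hΞf : ∀ u, Ξ (Z (u, 0)) = f u := by
    intro u; simp [Ξ, p1, p2, B]
  have hcodm : (chartAt (Euc m) (φ x)).trans G.symm ∈ IsManifold.maximalAtlas (𝓡 m) ∞ M :=
    chartAt_trans_mem_maximalAtlas _ ((contDiffGroupoid ∞ (𝓡 m)).symm hGm)
  have hW : IsOpen ((chartAt (Euc k) x).source ∩ (chartAt (Euc k) x) ⁻¹' {u | Z (u, 0) ∈ G.source}) :=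
    (chartAt (Euc k) x).isOpen_inter_preimage
      (G.open_source.preimage (by fun_prop : Continuous fun u : Euc k => Z (u, 0)))
  have hxW : x ∈ (chartAt (Euc k) x).source ∩ (chartAt (Euc k) x) ⁻¹' {u | Z (u, 0) ∈ G.source} :=
    ⟨mem_chart_source _ x, haG⟩
  have hf0 : f u₀ = chartAt (Euc m) (φ x) (φ x) := by
    rw [hf, hu₀]; dsimp only; rw [inDomainChart_self]; simp
  refine IsImmersionAtOfComplement.mk_of_continuousAt (hφ.continuous.continuousAt) Z
    ((chartAt (Euc k) x).restr ((chartAt (Euc k) x).source ∩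
      (chartAt (Euc k) x) ⁻¹' {u | Z (u, 0) ∈ G.source}))
    ((chartAt (Euc m) (φ x)).trans G.symm) ?_ ?_ ?_ hcodm ?_
  · rw [OpenPartialHomeomorph.restr_source, hW.interior_eq]
    exact ⟨mem_chart_source _ x, hxW⟩
  · rw [OpenPartialHomeomorph.trans_source]
    refine ⟨mem_chart_source _ _, ?_⟩
    have := G.map_source haG
    rw [hG, hΞf, hf0] at this
    exact this
  · exact restr_mem_maximalAtlas (contDiffGroupoid ∞ (𝓡 k)) (IsManifold.chart_mem_maximalAtlas x) hW
  · intro u hu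
    have hu2 : u ∈ ((chartAt (Euc k) x).restr ((chartAt (Euc k) x).source ∩
      (chartAt (Euc k) x) ⁻¹' {u | Z (u, 0) ∈ G.source})).target := by
      simpa using hu
    have hu3 := OpenPartialHomeomorph.map_target _ hu2
    rw [OpenPartialHomeomorph.restr_source, hW.interior_eq] at hu3
    have hut : u ∈ (chartAt (Euc k) x).target := by
      have := hu2; simp at this; exact this.1
    have hru : (chartAt (Euc k) x) ((chartAt (Euc k) x).symm u) = u :=
      (chartAt (Euc k) x).right_inv hut
    have hus : Z (u, 0) ∈ G.source := by
      have h9 : (chartAt (Euc k) x) ((chartAt (Euc k) x).symm u) ∈ {u | Z (u, 0) ∈ G.source} := hu3.2.2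
      rw [hru] at h9; exact h9
    have hGz : G.symm (f u) = Z (u, 0) := by
      rw [← hΞf, ← hG]; exact G.left_inv hus
    have : (((chartAt (Euc m) (φ x)).trans G.symm).extend (𝓡 m) ∘ φ ∘
      (((chartAt (Euc k) x).restr ((chartAt (Euc k) x).source ∩
      (chartAt (Euc k) x) ⁻¹' {u | Z (u, 0) ∈ G.source})).extend (𝓡 k)).symm) u = G.symm (f u) := by
      simp [hf, inDomainChart]
    rw [this, hGz]; rfl

theorem isSmoothEmbedding_of_injective [T2Space M] [CompactSpace N] {φ : N → M}
    (hφ : ContMDiff (𝓡 k) (𝓡 m) ∞ φ) (hinj : Function.Injective φ)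
    (himm : ∀ x, Function.Injective (derivMap k m φ x)) : IsSmoothEmbedding (𝓡 k) (𝓡 m) ∞ φ :=
  ⟨isImmersion_of_injective_derivMap hφ himm, (hφ.continuous.isClosedEmbedding hinj).isEmbedding⟩

end Immersion

/-! ### Contact isotopies and formal isotopies -/

section FormalIsotopies

variable {k : ℕ} {N : Type*} [TopologicalSpace N] [ChartedSpace (Euc k) N] [IsManifold (𝓡 k) ∞ N]
variable {m : ℕ} {M : Type*} [TopologicalSpace M] [ChartedSpace (Euc m) M] [IsManifold (𝓡 m) ∞ M]

variable (m) in
/-- A tangent vector, as an element of the tangent bundle. -/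
def tangentVec (p : M) (v : Euc m) : TangentBundle (𝓡 m) M := ⟨p, v⟩

variable (k) in
/-- The pull-back of a form under a map between manifolds. -/
def OneForm.pullMap (α : OneForm m M) (φ : N → M) (x : N) : Euc k →L[ℝ] ℝ :=
  (α.val (φ x)).comp (derivMap k m φ x)

theorem OneForm.pullMap_apply (α : OneForm m M) (φ : N → M) (x : N) (u : Euc k) :
    α.pullMap k φ x u = α.val (φ x) (derivMap k m φ x u) := rfl

theorem OneForm.ext_zero_left (α : OneForm m M) (p : M) (v : Euc m) : α.ext p 0 v = 0 := by
  have : α.ext p 0 v = fderiv ℝ (α.inChart p) (extChartAt (𝓡 m) p p) 0 v -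
    fderiv ℝ (α.inChart p) (extChartAt (𝓡 m) p p) v 0 := rfl
  rw [this]; simp

variable (k) in
/-- `φ` is smooth and injective and induces the same cooriented hyperplane field as `ι`. -/
structure IsContactCopy (α : OneForm m M) (ι φ : N → M) : Prop where
  contMDiff : ContMDiff (𝓡 k) (𝓡 m) ∞ φ
  injective : Function.Injective φ
  pos : ∀ x, ∃ c : ℝ, 0 < c ∧ α.pullMap k φ x = c • α.pullMap k ι x

theorem IsContactSubmanifold.pullMap_ne_zero {α : OneForm m M} {ι : N → M}
    (hι : IsContactSubmanifold k α ι) (x : N) : α.pullMap k ι x ≠ 0 := by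
  intro h
  refine hι.transverse x (eq_top_iff.2 fun w _ => ?_)
  exact DFunLike.congr_fun h w

theorem IsContactSubmanifold.eq_zero {α : OneForm m M} {ι : N → M}
    (hι : IsContactSubmanifold k α ι) {x : N} {u : Euc k} (hu : α.pullMap k ι x u = 0)
    (h : ∀ v, α.pullMap k ι x v = 0 → α.ext (ι x) (derivMap k m ι x u) (derivMap k m ι x v) = 0) :
    u = 0 :=
  hι.nondegenerate x u hu h

theorem IsContactSubmanifold.contMDiff {α : OneForm m M} {ι : N → M}
    (hι : IsContactSubmanifold k α ι) : ContMDiff (𝓡 k) (𝓡 m) ∞ ι :=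
  hι.embedding.contMDiff

theorem IsContactSubmanifold.isContactCopy_self {α : OneForm m M} {ι : N → M}
    (hι : IsContactSubmanifold k α ι) : IsContactCopy k α ι ι :=
  ⟨hι.contMDiff, hι.embedding.isEmbedding.injective, fun _ => ⟨1, one_pos, by simp⟩⟩

/-- The positive factor which relates the `1`-forms also relates their exterior derivatives on the
kernel, so a contact copy is conformally symplectic there. -/
theorem IsContactCopy.ext_eq {α : OneForm m M} (hα : IsContactForm α) {ι φ : N → M}
    (hι : IsContactSubmanifold k α ι) (h : IsContactCopy k α ι φ) (x : N) :
    ∃ c : ℝ, 0 < c ∧ ∀ u v, α.pullMap k ι x u = 0 → α.pullMap k ι x v = 0 →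
      α.ext (φ x) (derivMap k m φ x u) (derivMap k m φ x v) =
        c * α.ext (ι x) (derivMap k m ι x u) (derivMap k m ι x v) := by
  obtain ⟨c, hc, hcx⟩ := h.pos x
  exact ⟨c, hc, fun u v hu hv => OneForm.ext_of_proportional hα.smooth hι.contMDiff h.contMDiff
    (fun y => (h.pos y).imp fun _ h => h.2) (hι.pullMap_ne_zero x) hcx hu hv⟩

theorem IsContactCopy.pullMap_eq_zero_iff {α : OneForm m M} {ι φ : N → M}
    (h : IsContactCopy k α ι φ) (x : N) (u : Euc k) :
    α.pullMap k φ x u = 0 ↔ α.pullMap k ι x u = 0 := by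
  obtain ⟨c, hc, hcx⟩ := h.pos x
  rw [hcx]
  simp [hc.ne']

/-- Immersivity comes for free: a vector killed by the derivative of `φ` lies in the common kernel
and pairs to zero with it under `φ^* dα`, hence under `ι^* dα`, which is nondegenerate there. -/
theorem IsContactCopy.injective_derivMap {α : OneForm m M} (hα : IsContactForm α) {ι φ : N → M}
    (hι : IsContactSubmanifold k α ι) (h : IsContactCopy k α ι φ) (x : N) :
    Function.Injective (derivMap k m φ x) := by
  rw [injective_iff_map_eq_zero]
  intro u hu
  obtain ⟨c, hc, hext⟩ := h.ext_eq hα hι x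
  have hu0 : α.pullMap k ι x u = 0 := by
    rw [← h.pullMap_eq_zero_iff, OneForm.pullMap_apply, hu, map_zero]
  refine hι.eq_zero hu0 fun v hv => ?_
  have := hext u v hu0 hv
  rw [hu, OneForm.ext_zero_left] at this
  exact (mul_eq_zero.1 this.symm).resolve_left hc.ne'

theorem IsContactCopy.isContactSubmanifold [T2Space M] [CompactSpace N] {α : OneForm m M}
    (hα : IsContactForm α) {ι φ : N → M}
    (hι : IsContactSubmanifold k α ι) (h : IsContactCopy k α ι φ) :
    IsContactSubmanifold k α φ ∧
      ∀ x, α.pullbackKer (k := k) φ x = α.pullbackKer (k := k) ι x := by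
  have hker : ∀ x, α.pullbackKer (k := k) φ x = α.pullbackKer (k := k) ι x := fun x =>
    Submodule.ext fun u => h.pullMap_eq_zero_iff x u
  refine ⟨⟨isSmoothEmbedding_of_injective h.contMDiff h.injective
    (h.injective_derivMap hα hι), fun x => ?_, fun x u hu huv => ?_⟩, hker⟩
  · rw [hker]; exact hι.transverse x
  · rw [hker] at hu huv
    obtain ⟨c, hc, hext⟩ := h.ext_eq hα hι x
    refine hι.eq_zero hu fun v hv => ?_
    have h1 := hext u v hu hv
    have h2 : α.ext (φ x) (derivMap k m φ x u) (derivMap k m φ x v) = 0 := huv v hv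
    rw [h2] at h1
    exact (mul_eq_zero.1 h1.symm).resolve_left hc.ne'

variable (k) in
/-- A formal contact isotopy, parametrized by `T ∈ ℝ` and constant outside of `[0, 1]`, relative to
the contact structure which `ι` induces on `N`. -/
structure FormalIsotopy (α : OneForm m M) (ι φ₀ φ₁ : N → M) where
  φ : ℝ → N → M
  Φ : ℝ → ℝ → N → Euc k →L[ℝ] Euc m
  smooth : ContMDiff (𝓘(ℝ, ℝ).prod (𝓡 k)) (𝓡 m) ∞ (fun w : ℝ × N => φ w.1 w.2)
  smooth_lift : ContMDiff (𝓘(ℝ, ℝ × ℝ).prod (𝓡 k).tangent) (𝓡 m).tangent ∞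
    (fun w : (ℝ × ℝ) × TangentBundle (𝓡 k) N =>
      tangentVec m (φ w.1.2 w.2.proj) (Φ w.1.1 w.1.2 w.2.proj w.2.2))
  injective : ∀ T, Function.Injective (φ T)
  start : ∀ T x, Φ 0 T x = derivMap k m (φ T) x
  injective_lift : ∀ S ∈ Icc (0 : ℝ) 1, ∀ T x, Function.Injective (Φ S T x)
  mapsTo : ∀ T x u, α.pullMap k ι x u = 0 → α.val (φ T x) (Φ 1 T x u) = 0
  conformal : ∀ T x, ∃ c : ℝ, 0 < c ∧ ∀ u v, α.pullMap k ι x u = 0 → α.pullMap k ι x v = 0 →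
    α.ext (φ T x) (Φ 1 T x u) (Φ 1 T x v) =
      c * α.ext (ι x) (derivMap k m ι x u) (derivMap k m ι x v)
  initial : ∀ T ≤ 0, φ T = φ₀
  final : ∀ T ≥ 1, φ T = φ₁
  genuine : ∀ S T x, T ≤ 0 ∨ 1 ≤ T → Φ S T x = derivMap k m (φ T) x

/-- Formal isotopies can be concatenated. -/
def FormalIsotopy.trans {α : OneForm m M} {ι φ₀ φ₁ φ₂ : N → M} (A : FormalIsotopy k α ι φ₀ φ₁)
    (B : FormalIsotopy k α ι φ₁ φ₂) : FormalIsotopy k α ι φ₀ φ₂ where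
  -- Both pieces run at triple speed and the middle third is stationary, so the two formulas agree
  -- near `T = 1/2` and the concatenation is smooth.
  φ T := if T < 1 / 2 then A.φ (3 * T) else B.φ (3 * T - 2)
  Φ S T := if T < 1 / 2 then A.Φ S (3 * T) else B.Φ S (3 * T - 2)
  smooth := by
    rintro ⟨T, x⟩
    rcases lt_or_ge T (1 / 2) with hT | hT
    · have h1 : ContMDiff (𝓘(ℝ, ℝ).prod (𝓡 k)) (𝓡 m) ∞ (fun w : ℝ × N => A.φ (3 * w.1) w.2) :=
        A.smooth.comp (((contDiff_const.mul contDiff_id).contMDiff.comp contMDiff_fst).prodMk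
          contMDiff_snd)
      refine (h1 (T, x)).congr_of_eventuallyEq ?_
      filter_upwards [continuous_fst.continuousAt.eventually (gt_mem_nhds hT)] with w hw
      rw [if_pos hw]
    · have h1 : ContMDiff (𝓘(ℝ, ℝ).prod (𝓡 k)) (𝓡 m) ∞ (fun w : ℝ × N => B.φ (3 * w.1 - 2) w.2) :=
        B.smooth.comp ((((contDiff_const.mul contDiff_id).sub contDiff_const).contMDiff.comp
          contMDiff_fst).prodMk contMDiff_snd)
      refine (h1 (T, x)).congr_of_eventuallyEq ?_
      filter_upwards [continuous_fst.continuousAt.eventually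
        (lt_mem_nhds (by linarith : (1 / 3 : ℝ) < T))] with w hw
      split_ifs with h
      · rw [A.final _ (by linarith), B.initial _ (by linarith)]
      · rfl
  smooth_lift := by
    rintro ⟨⟨S, T⟩, v⟩
    rcases lt_or_ge T (1 / 2) with hT | hT
    · have h0 : ContMDiff (𝓘(ℝ, ℝ × ℝ).prod (𝓡 k).tangent) (𝓘(ℝ, ℝ × ℝ).prod (𝓡 k).tangent) ∞
          (fun w : (ℝ × ℝ) × TangentBundle (𝓡 k) N => ((w.1.1, 3 * w.1.2), w.2)) :=
        ((contDiff_fst.prodMk (contDiff_const.mul contDiff_snd)).contMDiff.comp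
          contMDiff_fst).prodMk contMDiff_snd
      have h1 := A.smooth_lift.comp h0
      refine (h1 ((S, T), v)).congr_of_eventuallyEq ?_
      filter_upwards [(continuous_snd.comp continuous_fst).continuousAt.eventually
        (gt_mem_nhds hT)] with w hw
      have hw' : w.1.2 < 1 / 2 := hw
      simp only [Function.comp_apply, if_pos hw']
    · have h0 : ContMDiff (𝓘(ℝ, ℝ × ℝ).prod (𝓡 k).tangent) (𝓘(ℝ, ℝ × ℝ).prod (𝓡 k).tangent) ∞
          (fun w : (ℝ × ℝ) × TangentBundle (𝓡 k) N => ((w.1.1, 3 * w.1.2 - 2), w.2)) :=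
        ((contDiff_fst.prodMk ((contDiff_const.mul contDiff_snd).sub contDiff_const)).contMDiff.comp
          contMDiff_fst).prodMk contMDiff_snd
      have h1 := B.smooth_lift.comp h0
      refine (h1 ((S, T), v)).congr_of_eventuallyEq ?_
      filter_upwards [(continuous_snd.comp continuous_fst).continuousAt.eventually
        (lt_mem_nhds (by linarith : (1 / 3 : ℝ) < T))] with w hw
      have hw' : 1 / 3 < w.1.2 := hw
      simp only [Function.comp_apply]
      rcases lt_or_ge w.1.2 (1 / 2) with h | h
      · rw [if_pos h, if_pos h, A.genuine _ _ _ (Or.inr (by linarith)), B.genuine _ _ _ (Or.inl (by linarith)),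
          A.final _ (by linarith), B.initial _ (by linarith)]
      · rw [if_neg h.not_gt, if_neg h.not_gt]
  injective T := by
    split_ifs
    exacts [A.injective _, B.injective _]
  start T x := by
    split_ifs
    exacts [A.start _ x, B.start _ x]
  injective_lift S hS T x := by
    split_ifs
    exacts [A.injective_lift S hS _ x, B.injective_lift S hS _ x]
  mapsTo T x u hu := by
    split_ifs
    exacts [A.mapsTo _ x u hu, B.mapsTo _ x u hu]
  conformal T x := by
    split_ifs
    exacts [A.conformal _ x, B.conformal _ x]
  initial T hT := by
    rw [if_pos (by linarith), A.initial _ (by linarith)]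
  final T hT := by
    rw [if_neg (by linarith), B.final _ (by linarith)]
  genuine S T x hT := by
    split_ifs
    · exact A.genuine _ _ _ (hT.imp (by intro; linarith) (by intro; linarith))
    · exact B.genuine _ _ _ (hT.imp (by intro; linarith) (by intro; linarith))

/-- A formal isotopy from `ι` to `φ` gives the data required in the definition of formal contact
isotopy. -/
theorem FormalIsotopy.exists_formalContactEmbedding [T2Space M] [CompactSpace N] {α : OneForm m M}
    (hα : IsContactForm α) {ι φ : N → M} (hι : IsContactSubmanifold k α ι)
    (A : FormalIsotopy k α ι ι φ) :
    ∃ e₀ e₁ : FormalContactEmbedding (α.pullbackKer (k := k) ι)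
          (α.pullbackD (k := k) ι) α.ker α.d,
        e₀.φ = ι ∧ e₀.IsGenuine ∧ e₁.φ = φ ∧ e₁.IsGenuine ∧
        FormallyContactIsotopic e₀ e₁ := by
  have hsm : ∀ T, ContMDiff (𝓡 k) (𝓡 m) ∞ (A.φ T) := fun T =>
    A.smooth.comp (contMDiff_const.prodMk contMDiff_id)
  have hcont := A.smooth_lift.continuous
  let e : ℝ → FormalContactEmbedding (α.pullbackKer (k := k) ι)
          (α.pullbackD (k := k) ι) α.ker α.d := fun T =>
    { φ := A.φ T
      Φ := fun S x => A.Φ S T x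
      embedding := isSmoothEmbedding_of_injective (hsm T) (A.injective T) fun x => by
        rw [← A.start]; exact A.injective_lift 0 (by simp) T x
      start := fun x => A.start T x
      injective := fun S x => A.injective_lift S S.2 T x
      smooth := fun S => A.smooth_lift.comp
        ((contMDiff_const (c := ((S : ℝ), T))).prodMk contMDiff_id)
      continuous := hcont.comp
        (((continuous_subtype_val.comp continuous_fst).prodMk continuous_const).prodMk
          continuous_snd)
      mapsTo := fun x u hu => A.mapsTo T x u hu
      conformal := fun x => by
        obtain ⟨c, hc, h⟩ := A.conformal T x
        exact ⟨c, hc, fun u hu v hv => h u v hu hv⟩ }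
  refine ⟨e 0, e 1, A.initial 0 le_rfl, fun S x => A.genuine S 0 x (Or.inl le_rfl),
    A.final 1 le_rfl, fun S x => A.genuine S 1 x (Or.inr le_rfl), fun T => e T, ?_, ?_, ?_, ?_⟩
  · simp
  · simp
  · exact A.smooth.comp ((contMDiff_subtypeVal_Icc.comp contMDiff_fst).prodMk contMDiff_snd)
  · exact hcont.comp (((continuous_subtype_val.comp (continuous_fst.comp continuous_fst)).prodMk
      (continuous_subtype_val.comp (continuous_snd.comp continuous_fst))).prodMk continuous_snd)

theorem mfderiv_prod_apply_zero {φ : ℝ × N → M}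
    (hφ : ContMDiff (𝓘(ℝ, ℝ).prod (𝓡 k)) (𝓡 m) ∞ φ) (T : ℝ) (x : N) (u : Euc k) :
    (mfderiv (𝓘(ℝ, ℝ).prod (𝓡 k)) (𝓡 m) φ (T, x) : ℝ × Euc k →L[ℝ] Euc m) (0, u) =
      derivMap k m (fun x => φ (T, x)) x u := by
  have h := mfderiv_comp x (g := φ) (f := fun x : N => (T, x))
    ((hφ (T, x)).mdifferentiableAt (by simp))
    (mdifferentiableAt_const.prodMk mdifferentiableAt_id)
  rw [mfderiv_prod_right] at h
  exact (DFunLike.congr_fun h u).symm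

/-- The derivatives of a smooth family of maps depend smoothly on all variables. -/
theorem contMDiff_derivMap_family {φ : ℝ × N → M}
    (hφ : ContMDiff (𝓘(ℝ, ℝ).prod (𝓡 k)) (𝓡 m) ∞ φ) :
    ContMDiff (𝓘(ℝ, ℝ).prod (𝓡 k).tangent) (𝓡 m).tangent ∞
      (fun w : ℝ × TangentBundle (𝓡 k) N =>
        tangentVec m (φ (w.1, w.2.proj)) (derivMap k m (fun x => φ (w.1, x)) w.2.proj w.2.2)) := by
  have h1 : ContMDiff (𝓘(ℝ, ℝ).prod (𝓡 k)).tangent (𝓡 m).tangent ∞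
      (tangentMap (𝓘(ℝ, ℝ).prod (𝓡 k)) (𝓡 m) φ) := hφ.contMDiff_tangentMap (by simp)
  -- The derivative at fixed `T` is the tangent map of the whole family on vectors without component
  -- along `ℝ`.
  have h2 : ContMDiff 𝓘(ℝ, ℝ) 𝓘(ℝ, ℝ).tangent ∞
      (fun y : ℝ => (⟨y, (0 : ℝ)⟩ : TangentBundle 𝓘(ℝ, ℝ) ℝ)) := by
    intro y
    rw [Bundle.contMDiffAt_totalSpace]
    exact ⟨contMDiffAt_id, by simpa using! contMDiffAt_const⟩
  have h3 : ContMDiff (𝓘(ℝ, ℝ).prod (𝓡 k).tangent) (𝓘(ℝ, ℝ).tangent.prod (𝓡 k).tangent) ∞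
      (fun w : ℝ × TangentBundle (𝓡 k) N =>
        ((⟨w.1, (0 : ℝ)⟩ : TangentBundle 𝓘(ℝ, ℝ) ℝ), w.2)) :=
    (h2.comp contMDiff_fst).prodMk contMDiff_snd
  have h4 := h1.comp ((contMDiff_equivTangentBundleProd_symm (n := ∞) (I := 𝓘(ℝ, ℝ)) (M := ℝ)
    (I' := 𝓡 k) (M' := N)).comp h3)
  refine h4.congr fun w => ?_
  have h5 := mfderiv_prod_apply_zero hφ w.1 w.2.proj w.2.2
  rw [← h5]
  rfl

/-- Two functionals with the same kernel are proportional. -/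
theorem eq_smul_of_ker_eq {E : Type*} [NormedAddCommGroup E] [NormedSpace ℝ E] {A B : E →L[ℝ] ℝ}
    (h : ∀ u, B u = 0 → A u = 0) {R : E} (hR : B R ≠ 0) : A = (A R / B R) • B := by
  ext u
  have h1 := h (u - (B u / B R) • R) (by simp [hR])
  simp only [map_sub, map_smul, smul_eq_mul, sub_eq_zero] at h1
  rw [h1]
  simp only [FunLike.coe_smul, Pi.smul_apply, smul_eq_mul]
  ring

/-- An isotopy through maps which induce the same hyperplane field is a formal isotopy. -/
theorem exists_formalIsotopy_of_isotopy {α : OneForm m M} (hα : IsContactForm α) {ι : N → M}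
    (hι : IsContactSubmanifold k α ι) {ψ : ℝ → N → M}
    (hs : ContMDiff (𝓘(ℝ, ℝ).prod (𝓡 k)) (𝓡 m) ∞
      (fun w : ℝ × N => ψ (Real.smoothTransition w.1) w.2))
    (hinj : ∀ T ∈ Icc (0 : ℝ) 1, Function.Injective (ψ T))
    (hker : ∀ T ∈ Icc (0 : ℝ) 1, ∀ x u, α.pullMap k (ψ T) x u = 0 ↔ α.pullMap k ι x u = 0)
    (h0 : IsContactCopy k α ι (ψ 0)) :
    IsContactCopy k α ι (ψ 1) ∧ Nonempty (FormalIsotopy k α ι (ψ 0) (ψ 1)) := by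
  set σ : ℝ → ℝ := Real.smoothTransition with hσ
  have hσI : ∀ T, σ T ∈ Icc (0 : ℝ) 1 := fun T =>
    ⟨Real.smoothTransition.nonneg T, Real.smoothTransition.le_one T⟩
  have hσ0 : ∀ T ≤ 0, σ T = 0 := fun T hT => Real.smoothTransition.zero_of_nonpos hT
  have hσ1 : ∀ T ≥ 1, σ T = 1 := fun T hT => Real.smoothTransition.one_of_one_le hT
  set φ : ℝ × N → M := fun w => ψ (σ w.1) w.2 with hφdef
  have hφ : ContMDiff (𝓘(ℝ, ℝ).prod (𝓡 k)) (𝓡 m) ∞ φ := hs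
  have hφT : ∀ T, ContMDiff (𝓡 k) (𝓡 m) ∞ (ψ (σ T)) := fun T =>
    hφ.comp (contMDiff_const.prodMk contMDiff_id)
  have hfam := contMDiff_derivMap_family hφ
  have hcopy : ∀ T, IsContactCopy k α ι (ψ (σ T)) := by
    intro T
    refine ⟨hφT T, hinj _ (hσI T), fun x => ?_⟩
    obtain ⟨R, hR⟩ : ∃ R, α.pullMap k ι x R ≠ 0 := by
      by_contra! h
      exact hι.pullMap_ne_zero x (ContinuousLinearMap.ext h)
    -- The factor is continuous in `T` and has no zero because the kernels agree; it keeps the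
    -- positive sign which it has at `T = 0`.
    have hcont : Continuous fun T => α.pullMap k (ψ (σ T)) x R / α.pullMap k ι x R := by
      have h1 : Continuous fun T : ℝ => (tangentVec m (φ (T, x))
          (derivMap k m (fun x => φ (T, x)) x R)) :=
        hfam.continuous.comp (continuous_id.prodMk (continuous_const (y := tangentVec k x R)))
      exact (hα.smooth.continuous.comp h1).div_const _
    have hne : ∀ T, α.pullMap k (ψ (σ T)) x R / α.pullMap k ι x R ≠ 0 := fun T =>
      div_ne_zero (fun h => hR ((hker _ (hσI T) x R).1 h)) hR
    have hpos0 : 0 < α.pullMap k (ψ (σ 0)) x R / α.pullMap k ι x R := by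
      obtain ⟨c, hc, hcx⟩ := h0.pos x
      rw [hσ0 0 le_rfl, hcx]
      simpa [hR] using hc
    have hpos : 0 < α.pullMap k (ψ (σ T)) x R / α.pullMap k ι x R := by
      by_contra hneg
      obtain ⟨T', hT'⟩ := mem_range_of_exists_le_of_exists_ge hcont ⟨T, not_lt.1 hneg⟩
        ⟨0, hpos0.le⟩
      exact hne T' hT'
    exact ⟨_, hpos, eq_smul_of_ker_eq (fun u hu => (hker _ (hσI T) x u).2 hu) hR⟩
  refine ⟨by simpa [hσ1 1 le_rfl] using hcopy 1, ⟨?_⟩⟩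
  exact
    { φ := fun T => ψ (σ T)
      -- The isotopy is genuine, so nothing has to depend on `S`.
      Φ := fun _ T x => derivMap k m (ψ (σ T)) x
      smooth := hφ
      smooth_lift := hfam.comp ((contDiff_snd.contMDiff.comp contMDiff_fst).prodMk contMDiff_snd)
      injective := fun T => (hcopy T).injective
      start := fun _ _ => rfl
      injective_lift := fun _ _ T x => (hcopy T).injective_derivMap hα hι x
      mapsTo := fun T x u hu => ((hcopy T).pullMap_eq_zero_iff x u).2 hu
      conformal := fun T x => (hcopy T).ext_eq hα hι x
      initial := fun T hT => by rw [hσ0 T hT]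
      final := fun T hT => by rw [hσ1 T hT]
      genuine := fun _ _ _ _ => rfl }

end FormalIsotopies

/-! ### Isotopies which are supported in a model -/

section Glue

variable {k : ℕ} {N : Type*} [TopologicalSpace N] [ChartedSpace (Euc k) N] [IsManifold (𝓡 k) ∞ N]
variable {m : ℕ} {M : Type*} [TopologicalSpace M] [ChartedSpace (Euc m) M] [IsManifold (𝓡 m) ∞ M]

open Classical in
/-- The map which is `f` on `V` and `g` outside of `V`. -/
def glue {X Y : Type*} (V : Set X) (f g : X → Y) (x : X) : Y := if x ∈ V then f x else g x

theorem glue_of_mem {X Y : Type*} {V : Set X} (f g : X → Y) {x : X} (hx : x ∈ V) :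
    glue V f g x = f x := if_pos hx

theorem glue_of_notMem {X Y : Type*} {V : Set X} (f g : X → Y) {x : X} (hx : x ∉ V) :
    glue V f g x = g x := if_neg hx

theorem glue_eventuallyEq_left {X Y : Type*} [TopologicalSpace X] {V : Set X} (hV : IsOpen V)
    (f g : X → Y) {x : X} (hx : x ∈ V) : glue V f g =ᶠ[𝓝 x] f := by
  filter_upwards [hV.mem_nhds hx] with y hy using glue_of_mem f g hy

theorem glue_eventuallyEq_right {X Y : Type*} [TopologicalSpace X] {V C : Set X} (hC : IsClosed C)
    {f g : X → Y} (h : ∀ x ∈ V \ C, f x = g x) {x : X} (hx : x ∉ C) : glue V f g =ᶠ[𝓝 x] g := by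
  filter_upwards [hC.isOpen_compl.mem_nhds hx] with y hy
  by_cases hyV : y ∈ V
  · rw [glue_of_mem _ _ hyV, h y ⟨hyV, hy⟩]
  · exact glue_of_notMem f g hyV

variable {E : Type*} [NormedAddCommGroup E] [NormedSpace ℝ E]

/-- An isotopy which takes place in a model `κ : E → M` and is stationary, equal to `ι`, outside of
a closed subset of `V`. -/
theorem exists_formalIsotopy_of_glue {α : OneForm m M} (hα : IsContactForm α) {ι : N → M}
    (hι : IsContactSubmanifold k α ι) {O : Set E} (hO : IsOpen O) {κ : E → M}
    (hκ : ContMDiffOn 𝓘(ℝ, E) (𝓡 m) ∞ κ O) (hκinj : InjOn κ O)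
    {V C : Set N} (hV : IsOpen V) (hC : IsClosed C) (hCV : C ⊆ V) {μ : ℝ → N → E}
    (hμ : ∀ T ∈ Icc (0 : ℝ) 1, ∀ x ∈ V, ContMDiffAt (𝓘(ℝ, ℝ).prod (𝓡 k)) 𝓘(ℝ, E) ∞
      (fun w : ℝ × N => μ w.1 w.2) (T, x))
    (hμO : ∀ T ∈ Icc (0 : ℝ) 1, ∀ x ∈ V, μ T x ∈ O)
    (heq : ∀ T ∈ Icc (0 : ℝ) 1, ∀ x ∈ V \ C, κ (μ T x) = ι x)
    (hker : ∀ T ∈ Icc (0 : ℝ) 1, ∀ x ∈ V, ∀ u,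
      α.val (κ (μ T x)) (derivFrom m κ (μ T x) (derivTo k (μ T) x u)) = 0 ↔
        α.pullMap k ι x u = 0)
    (hinj : ∀ T ∈ Icc (0 : ℝ) 1, InjOn (μ T) V)
    (hdisj : ∀ T ∈ Icc (0 : ℝ) 1, ∀ x ∈ V, ∀ x' ∉ V, κ (μ T x) ≠ ι x')
    (h0 : IsContactCopy k α ι (glue V (fun x => κ (μ 0 x)) ι)) :
    IsContactCopy k α ι (glue V (fun x => κ (μ 1 x)) ι) ∧
      Nonempty (FormalIsotopy k α ι (glue V (fun x => κ (μ 0 x)) ι)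
        (glue V (fun x => κ (μ 1 x)) ι)) := by
  have hκO : ∀ w ∈ O, ContMDiffAt 𝓘(ℝ, E) (𝓡 m) ∞ κ w := fun w hw =>
    (hκ w hw).contMDiffAt (hO.mem_nhds hw)
  have hμT : ∀ T ∈ Icc (0 : ℝ) 1, ∀ x ∈ V, ContMDiffAt (𝓡 k) 𝓘(ℝ, E) ∞ (μ T) x := fun T hT x hx =>
    ContMDiffAt.comp (g := fun w : ℝ × N => μ w.1 w.2) (f := fun x => (T, x)) x (hμ T hT x hx)
      (contMDiffAt_const.prodMk contMDiffAt_id)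
  -- `V` and the complement of `C` form an open cover of `N`; on the first the glued map is `κ ∘ μ`,
  -- on the second it is `ι`. Smoothness and the condition on the kernels are checked separately on
  -- each.
  refine exists_formalIsotopy_of_isotopy hα hι (ψ := fun T => glue V (fun x => κ (μ T x)) ι)
    ?_ ?_ ?_ h0
  · rintro ⟨T, x⟩
    have hσ : Real.smoothTransition T ∈ Icc (0 : ℝ) 1 :=
      ⟨Real.smoothTransition.nonneg T, Real.smoothTransition.le_one T⟩
    have hσs : ContMDiff (𝓘(ℝ, ℝ).prod (𝓡 k)) (𝓘(ℝ, ℝ).prod (𝓡 k)) ∞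
        (fun w : ℝ × N => (Real.smoothTransition w.1, w.2)) :=
      (Real.smoothTransition.contDiff.contMDiff.comp contMDiff_fst).prodMk contMDiff_snd
    by_cases hx : x ∈ V
    · have h1 : ContMDiffAt (𝓘(ℝ, ℝ).prod (𝓡 k)) 𝓘(ℝ, E) ∞
          (fun w : ℝ × N => μ (Real.smoothTransition w.1) w.2) (T, x) :=
        ContMDiffAt.comp (g := fun w : ℝ × N => μ w.1 w.2) (T, x) (hμ _ hσ x hx) (hσs (T, x))
      have h2 : ContMDiffAt (𝓘(ℝ, ℝ).prod (𝓡 k)) (𝓡 m) ∞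
          (fun w : ℝ × N => κ (μ (Real.smoothTransition w.1) w.2)) (T, x) :=
        ContMDiffAt.comp (g := κ) (T, x) (hκO _ (hμO _ hσ x hx)) h1
      refine h2.congr_of_eventuallyEq ?_
      filter_upwards [continuous_snd.continuousAt.eventually (hV.mem_nhds hx)] with w hw
      exact glue_of_mem _ _ hw
    · have h2 : ContMDiffAt (𝓘(ℝ, ℝ).prod (𝓡 k)) (𝓡 m) ∞ (fun w : ℝ × N => ι w.2) (T, x) :=
        hι.contMDiff.contMDiffAt.comp (T, x) contMDiffAt_snd
      refine h2.congr_of_eventuallyEq ?_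
      filter_upwards [continuous_snd.continuousAt.eventually
        (hC.isOpen_compl.mem_nhds fun h => hx (hCV h))] with w hw
      by_cases hwV : w.2 ∈ V
      · rw [glue_of_mem _ _ hwV]
        exact heq _ ⟨Real.smoothTransition.nonneg _, Real.smoothTransition.le_one _⟩ _ ⟨hwV, hw⟩
      · exact glue_of_notMem _ _ hwV
  · intro T hT x y hxy
    by_cases hx : x ∈ V <;> by_cases hy : y ∈ V
    · simp only [glue_of_mem _ _ hx, glue_of_mem _ _ hy] at hxy
      exact hinj T hT hx hy (hκinj (hμO T hT x hx) (hμO T hT y hy) hxy)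
    · simp only [glue_of_mem _ _ hx, glue_of_notMem _ _ hy] at hxy
      exact absurd hxy (hdisj T hT x hx y hy)
    · simp only [glue_of_notMem _ _ hx, glue_of_mem _ _ hy] at hxy
      exact absurd hxy.symm (hdisj T hT y hy x hx)
    · simp only [glue_of_notMem _ _ hx, glue_of_notMem _ _ hy] at hxy
      exact hι.embedding.isEmbedding.injective hxy
  · intro T hT x u
    by_cases hx : x ∈ V
    · have h1 := glue_eventuallyEq_left hV (fun x => κ (μ T x)) ι hx
      rw [OneForm.pullMap_apply, h1.derivMap_eq, derivMap_comp_derivTo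
        ((hκO _ (hμO T hT x hx)).mdifferentiableAt (by simp))
        ((hμT T hT x hx).mdifferentiableAt (by simp)), glue_of_mem _ _ hx]
      exact hker T hT x hx u
    · have h1 := glue_eventuallyEq_right hC (V := V) (f := fun x => κ (μ T x)) (g := ι) (heq T hT)
        (fun h => hx (hCV h))
      rw [OneForm.pullMap_apply, h1.derivMap_eq, glue_of_notMem _ _ hx]
      rfl

end Glue

/-! ### Models embedded in a contact manifold -/

section ModelEmbedding

variable {n m : ℕ} {M : Type*} [TopologicalSpace M] [ChartedSpace (Euc m) M] [IsManifold (𝓡 m) ∞ M]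

theorem finrank_model (n : ℕ) : Module.finrank ℝ (Model n) = 2 * n + 1 := by
  simp; ring

/-- An open set on which a model embedding is an open embedding, together with the properties of
the embedding on it. -/
structure IsModelDomain (α : OneForm m M) (A : Set (Model n)) (θ : Model n → Model n → ℝ)
    (κ : Model n → M) (O : Set (Model n)) : Prop where
  isOpen : IsOpen O
  subset : A ⊆ O
  contMDiffOn : ContMDiffOn 𝓘(ℝ, Model n) (𝓡 m) ∞ κ O
  injOn : InjOn κ O
  injective_derivFrom : ∀ w ∈ O, Function.Injective (derivFrom m κ w)
  ker : ∀ w ∈ A, ∀ v, θ w v = 0 ↔ α.val (κ w) (derivFrom m κ w v) = 0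

theorem IsContactModelEmbedding.exists_isModelDomain {α : OneForm m M} {A : Set (Model n)}
    {θ : Model n → Model n → ℝ} {κ : Model n → M} (h : IsContactModelEmbedding α A θ κ) :
    ∃ O, IsModelDomain α A θ κ O := by
  obtain ⟨O, h1, h2, h3, h4, h5, h6⟩ := h
  exact ⟨O, h1, h2, h3, h4, h5, h6⟩

namespace IsModelDomain

variable {α : OneForm m M} {A : Set (Model n)} {θ : Model n → Model n → ℝ} {κ : Model n → M}
  {O : Set (Model n)} (h : IsModelDomain α A θ κ O)

include h

theorem contMDiffAt {w : Model n} (hw : w ∈ O) : ContMDiffAt 𝓘(ℝ, Model n) (𝓡 m) ∞ κ w :=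
  (h.contMDiffOn w hw).contMDiffAt (h.isOpen.mem_nhds hw)

theorem mdifferentiableAt {w : Model n} (hw : w ∈ O) :
    MDifferentiableAt 𝓘(ℝ, Model n) (𝓡 m) κ w :=
  (h.contMDiffAt hw).mdifferentiableAt (by simp)

theorem inv_apply {w : Model n} (hw : w ∈ O) : Function.invFunOn κ O (κ w) = w :=
  h.injOn.leftInvOn_invFunOn hw

theorem contMDiffAt_inv (hm : m = 2 * n + 1) {w : Model n} (hw : w ∈ O) :
    ContMDiffAt (𝓡 m) 𝓘(ℝ, Model n) ∞ (Function.invFunOn κ O) (κ w) :=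
  (invFunOn_spec h.isOpen h.contMDiffOn h.injOn h.injective_derivFrom
    ((finrank_model n).trans hm.symm) hw).1

theorem eventually_inv (hm : m = 2 * n + 1) {w : Model n} (hw : w ∈ O) :
    ∀ᶠ y in 𝓝 (κ w), Function.invFunOn κ O y ∈ O ∧ κ (Function.invFunOn κ O y) = y :=
  (invFunOn_spec h.isOpen h.contMDiffOn h.injOn h.injective_derivFrom
    ((finrank_model n).trans hm.symm) hw).2.1

theorem isOpen_image (hm : m = 2 * n + 1) {U : Set (Model n)} (hU : IsOpen U) (hUO : U ⊆ O) :
    IsOpen (κ '' U) := by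
  rw [isOpen_iff_mem_nhds]
  rintro _ ⟨w, hw, rfl⟩
  have h1 := (h.contMDiffAt_inv hm (hUO hw)).continuousAt
  rw [ContinuousAt, h.inv_apply (hUO hw)] at h1
  filter_upwards [h1 (hU.mem_nhds hw), h.eventually_inv hm (hUO hw)] with y hy1 hy2
  exact ⟨_, hy1, hy2.2⟩

theorem isCompact_image {K : Set (Model n)} (hK : IsCompact K) (hKO : K ⊆ O) : IsCompact (κ '' K) :=
  hK.image_of_continuousOn (h.contMDiffOn.continuousOn.mono hKO)

theorem derivTo_inv_comp (hm : m = 2 * n + 1) {w : Model n} (hw : w ∈ O) (v : Model n) :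
    derivTo m (Function.invFunOn κ O) (κ w) (derivFrom m κ w v) = v := by
  have h1 := derivTo_comp_derivFrom ((h.contMDiffAt_inv hm hw).mdifferentiableAt (by simp))
    (h.mdifferentiableAt hw)
  have h2 : (fun w => Function.invFunOn κ O (κ w)) =ᶠ[𝓝 w] id := by
    filter_upwards [h.isOpen.mem_nhds hw] with z hz using h.inv_apply hz
  rw [h2.fderiv_eq, fderiv_id] at h1
  exact (DFunLike.congr_fun h1 v).symm

end IsModelDomain

end ModelEmbedding

/-! ### The geometry of the model handle -/

section Profiles

variable {ε : ℝ} {B : ℝ → ℝ}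

namespace IsLowerProfile

theorem apply_self (h : IsLowerProfile ε B) : B ε = 0 := by
  have h1 : Filter.Tendsto B (𝓝[<] ε) (𝓝 (B ε)) :=
    h.smooth.continuous.continuousAt.tendsto.mono_left nhdsWithin_le_nhds
  have h2 : Filter.Tendsto B (𝓝[<] ε) (𝓝 0) := by
    refine tendsto_const_nhds.congr' ?_
    filter_upwards [self_mem_nhdsWithin] with ρ hρ using (h.eq_zero ρ hρ).symm
  exact tendsto_nhds_unique h1 h2

theorem le_self (h : IsLowerProfile ε B) {ρ : ℝ} (hρ : 0 ≤ ρ) (hε : 0 < ε) : B ρ ≤ ρ := by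
  rcases hρ.eq_or_lt with rfl | h0
  · exact (h.eq_zero 0 hε).le
  · rcases lt_or_ge ρ (3 * ε) with h1 | h1
    · exact (h.lt_self ρ h0 h1).le
    · exact (h.eq_self ρ h1).le

/-- At `3 ε` itself the hypotheses say nothing, but the derivative is continuous and equals `1` to
the right. -/
theorem deriv_pos (h : IsLowerProfile ε B) {ρ : ℝ} (hρ : ε < ρ) : 0 < deriv B ρ := by
  have hd : ∀ ρ, 3 * ε < ρ → deriv B ρ = 1 := fun ρ h1 => by
    have : B =ᶠ[𝓝 ρ] id := by
      filter_upwards [lt_mem_nhds h1] with x hx using h.eq_self x hx.le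
    rw [this.deriv_eq, deriv_id]
  rcases lt_trichotomy ρ (3 * ε) with h1 | h1 | h1
  · exact h.increasing ρ hρ h1
  · have hc : Continuous (deriv B) := h.smooth.continuous_deriv (by simp)
    have h2 : Filter.Tendsto (deriv B) (𝓝[>] ρ) (𝓝 (deriv B ρ)) :=
      hc.continuousAt.tendsto.mono_left nhdsWithin_le_nhds
    have h3 : Filter.Tendsto (deriv B) (𝓝[>] ρ) (𝓝 1) := by
      refine tendsto_const_nhds.congr' ?_
      filter_upwards [self_mem_nhdsWithin] with x hx
      exact (hd x (h1 ▸ hx)).symm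
    rw [tendsto_nhds_unique h2 h3]; exact one_pos
  · rw [hd ρ h1]; exact one_pos

theorem strictMonoOn (h : IsLowerProfile ε B) : StrictMonoOn B (Ici ε) :=
  strictMonoOn_of_deriv_pos (convex_Ici ε) h.smooth.continuous.continuousOn fun ρ hρ => by
    rw [interior_Ici] at hρ; exact h.deriv_pos hρ

theorem monotone (h : IsLowerProfile ε B) : Monotone B := by
  intro a b hab
  rcases lt_or_ge a ε with ha | ha
  · rw [h.eq_zero a ha]
    rcases lt_or_ge b ε with hb | hb
    · rw [h.eq_zero b hb]
    · rw [← h.apply_self]; exact h.strictMonoOn.monotoneOn self_mem_Ici hb hb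
  · exact h.strictMonoOn.monotoneOn ha (ha.trans hab) hab

theorem lt_of_pos (h : IsLowerProfile ε B) {ρ : ℝ} (hρ : 0 < B ρ) : ε < ρ := by
  by_contra! h1
  exact hρ.not_ge (h.apply_self ▸ h.monotone h1)

end IsLowerProfile

namespace IsUpperProfile

theorem self_le (h : IsUpperProfile ε B) (ρ : ℝ) : ρ ≤ B ρ := by
  rcases lt_or_ge ρ (3 * ε) with h1 | h1
  · exact (h.self_lt ρ h1).le
  · exact (h.eq_self ρ h1).ge

theorem two_mul_le (h : IsUpperProfile ε B) (ρ : ℝ) : 2 * ε ≤ B ρ := by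
  rw [← h.eq_const (min ρ (ε - 1)) (lt_of_le_of_lt (min_le_right _ _) (by linarith))]
  exact h.increasing (min_le_left _ _)

/-- Were the value `3 ε` attained at some `ρ < 3 ε`, then by monotonicity the profile would be
constant up to `3 ε` and have slope `1` beyond it, against continuity of its derivative. -/
theorem lt_of_lt (h : IsUpperProfile ε B) {ρ : ℝ} (hρ : ρ < 3 * ε) : B ρ < 3 * ε := by
  have h0 : B (3 * ε) = 3 * ε := h.eq_self _ le_rfl
  refine lt_of_le_of_ne (h0 ▸ h.increasing hρ.le) fun h1 => ?_
  have hc : Continuous (deriv B) := h.smooth.continuous_deriv (by simp)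
  have h2 : Filter.Tendsto (deriv B) (𝓝[>] (3 * ε)) (𝓝 (deriv B (3 * ε))) :=
    hc.continuousAt.tendsto.mono_left nhdsWithin_le_nhds
  have h3 : Filter.Tendsto (deriv B) (𝓝[>] (3 * ε)) (𝓝 1) := by
    refine tendsto_const_nhds.congr' ?_
    filter_upwards [self_mem_nhdsWithin] with x hx
    have : B =ᶠ[𝓝 x] id := by
      filter_upwards [lt_mem_nhds hx] with y hy using h.eq_self y hy.le
    rw [this.deriv_eq, deriv_id]
  have h4 : Filter.Tendsto (deriv B) (𝓝[<] (3 * ε)) (𝓝 (deriv B (3 * ε))) :=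
    hc.continuousAt.tendsto.mono_left nhdsWithin_le_nhds
  have h5 : Filter.Tendsto (deriv B) (𝓝[<] (3 * ε)) (𝓝 0) := by
    refine tendsto_const_nhds.congr' ?_
    filter_upwards [Ioo_mem_nhdsLT hρ] with x hx
    have : B =ᶠ[𝓝 x] fun _ => 3 * ε := by
      filter_upwards [Ioo_mem_nhds hx.1 hx.2] with y hy
      exact le_antisymm (h0 ▸ h.increasing hy.2.le) (h1 ▸ h.increasing hy.1.le)
    rw [this.deriv_eq, deriv_const]
  have := tendsto_nhds_unique h2 h3
  rw [tendsto_nhds_unique h4 h5] at this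
  exact zero_ne_one this

end IsUpperProfile

end Profiles

/-! ### Exit function and Liouville flow of the model handle -/

namespace HandleShape

variable {n : ℕ} (s : HandleShape)

/-- The function which is negative in the handle away from its convex boundary. -/
def exitFn (z : Euc n × Euc n) : ℝ := s.lowerU ‖z.1‖ - s.upperU ‖z.2‖

theorem continuous_exitFn : Continuous (s.exitFn (n := n)) :=
  (s.isLowerU.smooth.continuous.comp continuous_fst.norm).sub
    (s.isUpperU.smooth.continuous.comp continuous_snd.norm)

variable {s} {z : Euc n × Euc n}

theorem exitFn_nonpos (hz : z ∈ s.handle n) : s.exitFn z ≤ 0 := sub_nonpos.2 hz.2.1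

theorem exitFn_neg_iff (hz : z ∈ s.handle n) : s.exitFn z < 0 ↔ z ∉ s.convexBdry n := by
  refine ⟨fun h hc => h.ne (sub_eq_zero.2 hc.2), fun h => lt_of_le_of_ne (exitFn_nonpos hz) ?_⟩
  exact fun h0 => h ⟨hz, sub_eq_zero.1 h0⟩

theorem isCompact_handle (s : HandleShape) (n : ℕ) : IsCompact (s.handle n) := by
  have h1 : IsClosed (s.handle n) := by
    have hx : Continuous fun z : Euc n × Euc n => ‖z.1‖ := continuous_fst.norm
    have hy : Continuous fun z : Euc n × Euc n => ‖z.2‖ := continuous_snd.norm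
    exact (isClosed_le (s.isLowerS.smooth.continuous.comp hy)
      (s.isUpperS.smooth.continuous.comp hx)).inter
      ((isClosed_le (s.isLowerU.smooth.continuous.comp hx)
      (s.isUpperU.smooth.continuous.comp hy)).inter
      ((isClosed_le hx continuous_const).inter (isClosed_le hy continuous_const)))
  refine (isCompact_closedBall (0 : Euc n × Euc n) (3 * max s.εS s.εU)).of_isClosed_subset h1 ?_
  intro z hz
  rw [mem_closedBall_zero_iff, Prod.norm_def]
  exact max_le hz.2.2.1 hz.2.2.2

theorem isCompact_concaveBdry (s : HandleShape) (n : ℕ) : IsCompact (s.concaveBdry n) := by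
  refine (s.isCompact_handle n).inter_right (t := {z | s.lowerS ‖z.2‖ = s.upperS ‖z.1‖}) ?_
  exact isClosed_eq (s.isLowerS.smooth.continuous.comp continuous_snd.norm)
      (s.isUpperS.smooth.continuous.comp continuous_fst.norm)

theorem lt_norm_of_mem_concaveBdry (hz : z ∈ s.concaveBdry n) : s.εS < ‖z.2‖ := by
  refine s.isLowerS.lt_of_pos ?_
  rw [hz.2]
  linarith [s.isUpperS.two_mul_le ‖z.1‖, s.εS_pos]

theorem norm_le_norm_of_mem_concaveBdry (hz : z ∈ s.concaveBdry n) : ‖z.1‖ ≤ ‖z.2‖ :=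
  (s.isUpperS.self_le _).trans (hz.2 ▸ s.isLowerS.le_self (norm_nonneg _) s.εS_pos)

/-- The bounds on the norms are inactive on `∂^- H_n \ ∂^+ H_n`: if `‖y‖` were maximal, the profiles
would be in the range where they are the identity, forcing `‖x‖ = ‖y‖` and a vanishing exit
function. -/
theorem norm_snd_lt (hz : z ∈ s.concaveBdry n) (he : s.exitFn z < 0) :
    ‖z.2‖ < 3 * max s.εS s.εU := by
  refine lt_of_le_of_ne hz.1.2.2.2 fun h => ?_
  have hS : 3 * s.εS ≤ 3 * max s.εS s.εU := by linarith [le_max_left s.εS s.εU]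
  have hU : 3 * s.εU ≤ 3 * max s.εS s.εU := by linarith [le_max_right s.εS s.εU]
  have h1 : s.upperS ‖z.1‖ = 3 * max s.εS s.εU := by
    rw [← hz.2, h, s.isLowerS.eq_self _ hS]
  have h2 : ‖z.1‖ = 3 * max s.εS s.εU := by
    rcases lt_or_ge ‖z.1‖ (3 * s.εS) with h3 | h3
    · exact absurd h1 (((s.isUpperS.lt_of_lt h3).trans_le hS).ne)
    · rwa [s.isUpperS.eq_self _ h3] at h1
  rw [exitFn, h, h2, s.isLowerU.eq_self _ hU, s.isUpperU.eq_self _ hU] at he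
  linarith

/-- Points near a point of `∂^- H_n \ ∂^+ H_n` belong to `∂^- H_n \ ∂^+ H_n` as soon as they satisfy
its defining equation. -/
theorem eventually_mem_concaveBdry (hz : z ∈ s.concaveBdry n) (he : s.exitFn z < 0) :
    ∀ᶠ w in 𝓝 z, s.lowerS ‖w.2‖ = s.upperS ‖w.1‖ → w ∈ s.concaveBdry n ∧ s.exitFn w < 0 := by
  have h1 := norm_snd_lt hz he
  have h2 := (norm_le_norm_of_mem_concaveBdry hz).trans_lt h1
  filter_upwards [s.continuous_exitFn.continuousAt.eventually (gt_mem_nhds he),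
    continuous_fst.norm.continuousAt.eventually (gt_mem_nhds h2),
    continuous_snd.norm.continuousAt.eventually (gt_mem_nhds h1)] with w h3 h4 h5 h6
  exact ⟨⟨⟨h6.le, (sub_neg.1 h3).le, h4.le, h5.le⟩, h6⟩, h3⟩

/-- Together with `norm_le_of_exitFn_le` this translates between levels of the exit function and
radii in the unstable disk. For `‖y‖ < εU` the upper profile is the constant `2 εU`, so the level
`-c` is the sphere on which `lowerU` equals `2 εU - c`. -/
theorem exitFn_le_of_norm_le (s : HandleShape) {z : Euc n × Euc n} {ρ c : ℝ}
    (hρ : s.lowerU ρ = 2 * s.εU - c) (hz : ‖z.1‖ ≤ ρ) : s.exitFn z ≤ -c := by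
  have h1 := s.isLowerU.monotone hz
  have h2 := s.isUpperU.two_mul_le ‖z.2‖
  simp only [exitFn]; linarith

theorem norm_le_of_exitFn_le (s : HandleShape) {z : Euc n × Euc n} {ρ c : ℝ} (hc : c < 2 * s.εU)
    (hρ : s.lowerU ρ = 2 * s.εU - c) (hz : ‖z.2‖ < s.εU) (he : s.exitFn z ≤ -c) : ‖z.1‖ ≤ ρ := by
  rw [exitFn, s.isUpperU.eq_const _ hz] at he
  have h1 : s.εU < ρ := s.isLowerU.lt_of_pos (by linarith)
  by_contra! h2
  have := s.isLowerU.strictMonoOn h1.le (h1.trans h2).le h2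
  linarith

theorem exists_lowerU_eq (s : HandleShape) {c : ℝ} (h0 : 0 < c) (hc : c < 2 * s.εU) :
    ∃ ρ, s.εU < ρ ∧ ρ < 3 * s.εU ∧ s.lowerU ρ = 2 * s.εU - c := by
  have h1 : s.lowerU (3 * s.εU) = 3 * s.εU := s.isLowerU.eq_self _ le_rfl
  have h2 := s.isLowerU.apply_self
  have h3 := s.εU_pos
  obtain ⟨ρ, hρ, h⟩ := intermediate_value_Ioo (show s.εU ≤ 3 * s.εU by linarith)
    s.isLowerU.smooth.continuous.continuousOn
    (show 2 * s.εU - c ∈ Ioo (s.lowerU s.εU) (s.lowerU (3 * s.εU)) from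
      ⟨by linarith, by linarith⟩)
  exact ⟨ρ, hρ.1, hρ.2, h⟩

/-- At `y = 0` all inequalities which define the handle, apart from that of the convex boundary,
hold strictly, so they persist nearby. -/
theorem mem_unstableDisk_of_exitFn {x : Euc n} (h : s.exitFn (x, (0 : Euc n)) < 0) :
    (x, (0 : Euc n)) ∈ interior (s.handle n) := by
  have hU := s.εU_pos
  have hS := s.εS_pos
  have h0 : s.lowerU ‖x‖ < 2 * s.εU := by
    rw [exitFn, norm_zero, s.isUpperU.eq_const 0 hU] at h
    linarith
  have h1 : ‖x‖ < 3 * s.εU := by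
    by_contra! h2
    rw [s.isLowerU.eq_self _ h2] at h0
    linarith
  have h2 : ‖x‖ < 3 * max s.εS s.εU :=
    h1.trans_le (by linarith [le_max_right s.εS s.εU])
  have hx : Continuous fun z : Euc n × Euc n => ‖z.1‖ := continuous_fst.norm
  have hy : Continuous fun z : Euc n × Euc n => ‖z.2‖ := continuous_snd.norm
  rw [mem_interior_iff_mem_nhds]
  have h3 : ‖((x, 0) : Euc n × Euc n).2‖ < s.εS := by simpa using hS
  have h4 : ‖((x, 0) : Euc n × Euc n).2‖ < 3 * max s.εS s.εU := by
    simpa using Or.inl hS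
  filter_upwards [s.continuous_exitFn.continuousAt.eventually (gt_mem_nhds h),
    hx.continuousAt.eventually (gt_mem_nhds h2), hy.continuousAt.eventually (gt_mem_nhds h3),
    hy.continuousAt.eventually (gt_mem_nhds h4)] with w h5 h6 h7 h8
  refine ⟨?_, (sub_neg.1 h5).le, h6.le, h8.le⟩
  rw [s.isLowerS.eq_zero _ h7]
  linarith [s.isUpperS.two_mul_le ‖w.1‖]

/-- The Liouville flow of the model handle. -/
def flow (τ : ℝ) (z : Euc n × Euc n) : Euc n × Euc n :=
  (Real.exp (3 / 2 * τ) • z.1, Real.exp (-(1 / 2) * τ) • z.2)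

theorem norm_flow_fst (τ : ℝ) (z : Euc n × Euc n) :
    ‖(flow τ z).1‖ = Real.exp (3 / 2 * τ) * ‖z.1‖ := by
  rw [flow, norm_smul, Real.norm_of_nonneg (Real.exp_pos _).le]

theorem norm_flow_snd (τ : ℝ) (z : Euc n × Euc n) :
    ‖(flow τ z).2‖ = Real.exp (-(1 / 2) * τ) * ‖z.2‖ := by
  rw [flow, norm_smul, Real.norm_of_nonneg (Real.exp_pos _).le]

theorem flow_zero (z : Euc n × Euc n) : flow 0 z = z := by simp [flow]

theorem flow_add (σ τ : ℝ) (z : Euc n × Euc n) : flow (σ + τ) z = flow σ (flow τ z) := by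
  simp [flow, smul_smul, mul_add, Real.exp_add]

theorem contDiff_flow : ContDiff ℝ ∞ fun w : ℝ × (Euc n × Euc n) => flow w.1 w.2 := by
  unfold flow
  fun_prop

theorem norm_flow_fst_mono (z : Euc n × Euc n) : Monotone fun τ => ‖(flow τ z).1‖ := by
  intro a b hab
  simp only [norm_flow_fst]
  gcongr

theorem norm_flow_snd_anti (z : Euc n × Euc n) : Antitone fun τ => ‖(flow τ z).2‖ := by
  intro a b hab
  simp only [norm_flow_snd]
  refine mul_le_mul_of_nonneg_right (Real.exp_le_exp.2 (by linarith)) (norm_nonneg _)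

theorem exitFn_flow_mono (s : HandleShape) (z : Euc n × Euc n) :
    Monotone fun τ => s.exitFn (flow τ z) := fun _ _ hab =>
  sub_le_sub (s.isLowerU.monotone (norm_flow_fst_mono z hab))
    (s.isUpperU.increasing (norm_flow_snd_anti z hab))

/-- Flowing forward only relaxes the inequality of the concave boundary. The bound on `‖x‖` follows
from the inequality of the convex boundary: a larger `‖x‖` equals its lower profile and would exceed
the upper profile of `‖y‖`. -/
theorem flow_mem_handle (hz : z ∈ s.handle n) {τ : ℝ} (hτ : 0 ≤ τ)
    (he : s.exitFn (flow τ z) ≤ 0) : flow τ z ∈ s.handle n := by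
  have h1 : ‖z.1‖ ≤ ‖(flow τ z).1‖ := by simpa [flow_zero] using norm_flow_fst_mono z hτ
  have h2 : ‖(flow τ z).2‖ ≤ ‖z.2‖ := by simpa [flow_zero] using norm_flow_snd_anti z hτ
  have h3 := h2.trans hz.2.2.2
  refine ⟨(s.isLowerS.monotone h2).trans (hz.1.trans (s.isUpperS.increasing h1)),
    sub_nonpos.1 he, ?_, h3⟩
  have hU : 3 * s.εU ≤ 3 * max s.εS s.εU := by linarith [le_max_right s.εS s.εU]
  by_contra! h4
  have h5 := s.isUpperU.increasing h3
  rw [s.isUpperU.eq_self _ hU] at h5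
  rw [exitFn, s.isLowerU.eq_self _ (hU.trans h4.le)] at he
  linarith

/-- Along the flow `‖x‖` does not decrease, so on the concave boundary `‖y‖` could not decrease
either; but the flow contracts `y`, which is nonzero there. -/
theorem eq_of_flow_mem_concaveBdry {σ : ℝ} (hσ : 0 ≤ σ) (hz : z ∈ s.concaveBdry n)
    (hz' : flow σ z ∈ s.concaveBdry n) : σ = 0 := by
  have h1 : ‖z.1‖ ≤ ‖(flow σ z).1‖ := by simpa [flow_zero] using norm_flow_fst_mono z hσ
  have h2 := lt_norm_of_mem_concaveBdry hz
  have h2' := lt_norm_of_mem_concaveBdry hz'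
  have h3 : ‖z.2‖ ≤ ‖(flow σ z).2‖ := by
    rw [← s.isLowerS.strictMonoOn.le_iff_le h2.le h2'.le, hz.2, hz'.2]
    exact s.isUpperS.increasing h1
  rw [norm_flow_snd] at h3
  have h4 : 0 < ‖z.2‖ := s.εS_pos.trans h2
  have h5 : Real.exp 0 ≤ Real.exp (-(1 / 2) * σ) := by
    rw [Real.exp_zero]
    by_contra! h6
    nlinarith
  rw [Real.exp_le_exp] at h5
  linarith

/-- A flow line of the Liouville field meets `∂^- H_n` only once. -/
theorem eq_of_flow_eq_flow {z' : Euc n × Euc n} (hz : z ∈ s.concaveBdry n)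
    (hz' : z' ∈ s.concaveBdry n) {τ τ' : ℝ} (h : flow τ z = flow τ' z') : z = z' := by
  have key : ∀ {z z' : Euc n × Euc n} {τ τ' : ℝ}, z ∈ s.concaveBdry n → z' ∈ s.concaveBdry n →
      flow τ z = flow τ' z' → τ' ≤ τ → z = z' := by
    intro z z' τ τ' hz hz' h hτ
    have h1 : z' = flow (τ - τ') z := by
      have h2 := congrArg (flow (-τ')) h
      rw [← flow_add, ← flow_add, neg_add_cancel, flow_zero] at h2
      rw [← h2]; congr 1; ring
    have h3 := eq_of_flow_mem_concaveBdry (sub_nonneg.2 hτ) hz (h1 ▸ hz')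
    rw [h1, h3, flow_zero]
  rcases le_total τ' τ with h1 | h1
  · exact key hz hz' h h1
  · exact (key hz' hz h.symm h1).symm

theorem handleForm_eq (z w : Euc n × Euc n) :
    handleForm z w = 3 / 2 * inner ℝ z.1 w.2 + 1 / 2 * inner ℝ z.2 w.1 := by
  rw [handleForm, real_inner_comm z.2 w.1]; ring

/-- The Liouville form expands along the flow and vanishes on the Liouville field. -/
theorem handleForm_flow (τ c : ℝ) (z w : Euc n × Euc n) :
    handleForm (flow τ z) (c • ((3 / 2 : ℝ) • (flow τ z).1, (-(1 / 2) : ℝ) • (flow τ z).2) +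
      flow τ w) = Real.exp τ * handleForm z w := by
  -- Each term of `β_n` contains one expanding and one contracting variable, of joint weight `e^τ`;
  -- on the Liouville field `(3/2 x, -1/2 y)` the two terms of `β_n` cancel.
  have h1 : Real.exp (3 / 2 * τ) * Real.exp (-(1 / 2) * τ) = Real.exp τ := by
    rw [← Real.exp_add]; congr 1; ring
  simp only [handleForm_eq, flow, Prod.fst_add, Prod.snd_add, Prod.smul_fst, Prod.smul_snd,
    inner_add_right, inner_smul_left, inner_smul_right, conj_trivial, ← h1]
  rw [real_inner_comm z.1 z.2]
  ring

theorem hasFDerivAt_flow (τ : ℝ) (z : Euc n × Euc n) :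
    HasFDerivAt (fun w : ℝ × (Euc n × Euc n) => flow w.1 w.2)
      ((ContinuousLinearMap.fst ℝ ℝ (Euc n × Euc n)).smulRight
        ((3 / 2 : ℝ) • (flow τ z).1, (-(1 / 2) : ℝ) • (flow τ z).2) +
      ((Real.exp (3 / 2 * τ) • (ContinuousLinearMap.fst ℝ (Euc n) (Euc n))).prod
        (Real.exp (-(1 / 2) * τ) • (ContinuousLinearMap.snd ℝ (Euc n) (Euc n)))).comp
        (ContinuousLinearMap.snd ℝ ℝ (Euc n × Euc n))) (τ, z) := by
  have key : ∀ c : ℝ, HasFDerivAt (fun w : ℝ × (Euc n × Euc n) => Real.exp (c * w.1))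
      ((Real.exp (c * τ) * c) • ContinuousLinearMap.fst ℝ ℝ (Euc n × Euc n)) (τ, z) := fun c => by
    have h1 : HasFDerivAt (fun w : ℝ × (Euc n × Euc n) => c * w.1)
        (c • ContinuousLinearMap.fst ℝ ℝ (Euc n × Euc n)) (τ, z) :=
      (hasFDerivAt_fst (𝕜 := ℝ) (E := ℝ) (F := Euc n × Euc n)).const_mul c
    have := h1.exp
    rwa [smul_smul] at this
  have hx : HasFDerivAt (fun w : ℝ × (Euc n × Euc n) => w.2.1)
      ((ContinuousLinearMap.fst ℝ (Euc n) (Euc n)).comp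
        (ContinuousLinearMap.snd ℝ ℝ (Euc n × Euc n))) (τ, z) :=
    hasFDerivAt_fst.comp (τ, z) hasFDerivAt_snd
  have hy : HasFDerivAt (fun w : ℝ × (Euc n × Euc n) => w.2.2)
      ((ContinuousLinearMap.snd ℝ (Euc n) (Euc n)).comp
        (ContinuousLinearMap.snd ℝ ℝ (Euc n × Euc n))) (τ, z) :=
    hasFDerivAt_snd.comp (τ, z) hasFDerivAt_snd
  refine (((key (3 / 2)).smul hx).prodMk ((key (-(1 / 2))).smul hy)).congr_fderiv ?_
  ext v <;> simp [flow] <;> ring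

end HandleShape

/-! ### The part of the divisor which lies in the concave boundary of the handle -/

/-- The profile is constant near `0`, so the singularity of the norm is invisible. -/
theorem IsUpperProfile.contDiff_comp_norm {ε : ℝ} {B : ℝ → ℝ} (h : IsUpperProfile ε B) (hε : 0 < ε)
    {E : Type*} [NormedAddCommGroup E] [InnerProductSpace ℝ E] :
    ContDiff ℝ ∞ fun x : E => B ‖x‖ := by
  rw [contDiff_iff_contDiffAt]
  intro x
  by_cases hx : x = 0
  · have h1 : (fun x : E => B ‖x‖) =ᶠ[𝓝 x] fun _ => 2 * ε := by
      have : ‖x‖ < ε := by simpa [hx] using hε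
      filter_upwards [continuous_norm.continuousAt.eventually (gt_mem_nhds this)] with y hy
      exact h.eq_const _ hy
    exact contDiffAt_const.congr_of_eventuallyEq h1
  · exact h.smooth.contDiffAt.comp x (contDiffAt_norm ℝ hx)

theorem exists_local_inverse_of_deriv_ne_zero {B : ℝ → ℝ} (hB : ContDiff ℝ ∞ B) {ρ : ℝ}
    (hρ : deriv B ρ ≠ 0) : ∃ l : ℝ → ℝ, ContDiffAt ℝ ∞ l (B ρ) ∧ l (B ρ) = ρ ∧
      ∀ᶠ y in 𝓝 (B ρ), B (l y) = y := by
  have h1 : HasStrictFDerivAt B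
      ((ContinuousLinearEquiv.unitsEquivAut ℝ (Units.mk0 _ hρ) : ℝ ≃L[ℝ] ℝ) : ℝ →L[ℝ] ℝ) ρ := by
    have := (hB.contDiffAt (x := ρ)).hasStrictDerivAt (by simp)
    refine this.hasStrictFDerivAt.congr_fderiv ?_
    ext; simp
  refine ⟨h1.localInverse _ _ _, hB.contDiffAt.to_localInverse h1.hasFDerivAt (by simp), ?_,
    h1.eventually_right_inverse⟩
  exact h1.localInverse_apply_image

theorem exists_local_left_inverse {E F : Type*} [NormedAddCommGroup E] [NormedSpace ℝ E]
    [NormedAddCommGroup F] [NormedSpace ℝ F] [FiniteDimensional ℝ F] [FiniteDimensional ℝ E]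
    {P : E → F} {u : E}
    (hP : ContDiffAt ℝ ∞ P u) (hinj : Function.Injective (fderiv ℝ P u)) :
    ∃ Q : F → E, ContDiffAt ℝ ∞ Q (P u) ∧ ∀ᶠ u' in 𝓝 u, Q (P u') = u' := by
  obtain ⟨L, hL⟩ := LinearMap.exists_leftInverse_of_injective (fderiv ℝ P u).toLinearMap
    (LinearMap.ker_eq_bot.2 hinj)
  let L' : F →L[ℝ] E := L.toContinuousLinearMap
  have h0 : ContDiffAt ℝ ∞ (fun u => L' (P u)) u := L'.contDiff.contDiffAt.comp u hP
  have h1 : HasStrictFDerivAt (fun u => L' (P u))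
      ((ContinuousLinearEquiv.refl ℝ E : E ≃L[ℝ] E) : E →L[ℝ] E) u := by
    refine (L'.hasStrictFDerivAt.comp u (hP.hasStrictFDerivAt (by simp))).congr_fderiv ?_
    ext v
    exact LinearMap.congr_fun hL v
  haveI : CompleteSpace E := FiniteDimensional.complete ℝ E
  refine ⟨fun w => h1.localInverse _ _ _ (L' w), ?_, h1.eventually_left_inverse⟩
  exact (h0.to_localInverse h1.hasFDerivAt (by simp)).comp (P u) L'.contDiff.contDiffAt

section

variable {k : ℕ} {N : Type*} [TopologicalSpace N] [ChartedSpace (Euc k) N] [IsManifold (𝓡 k) ∞ N]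
variable {n m : ℕ} {M : Type*} [TopologicalSpace M] [ChartedSpace (Euc m) M] [IsManifold (𝓡 m) ∞ M]

/-- If a map to a vector space has a differentiable left inverse and the dimensions agree, then it
is locally surjective. -/
theorem map_nhds_eq_of_leftInverse {E F : Type*} [NormedAddCommGroup E] [NormedSpace ℝ E]
    [NormedAddCommGroup F] [NormedSpace ℝ F] [FiniteDimensional ℝ E] [FiniteDimensional ℝ F]
    (hdim : Module.finrank ℝ E = Module.finrank ℝ F) {H : E → F} {G : F → E} {w : E}
    (hH : ContDiffAt ℝ ∞ H w) (hG : DifferentiableAt ℝ G (H w))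
    (hGH : ∀ᶠ w' in 𝓝 w, G (H w') = w') : Filter.map H (𝓝 w) = 𝓝 (H w) := by
  haveI : CompleteSpace E := FiniteDimensional.complete ℝ E
  haveI : CompleteSpace F := FiniteDimensional.complete ℝ F
  have h1 : HasStrictFDerivAt H (fderiv ℝ H w) w := hH.hasStrictFDerivAt (by simp)
  have h2 : HasFDerivAt (fun w => G (H w)) ((fderiv ℝ G (H w)).comp (fderiv ℝ H w)) w :=
    hG.hasFDerivAt.comp w h1.hasFDerivAt
  have h3 : (fderiv ℝ G (H w)).comp (fderiv ℝ H w) = ContinuousLinearMap.id ℝ E :=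
    h2.unique ((hasFDerivAt_id w).congr_of_eventuallyEq hGH)
  have hinj : Function.Injective (fderiv ℝ H w) := by
    intro a b hab
    have := DFunLike.congr_fun h3 a
    have h' := DFunLike.congr_fun h3 b
    simp only [ContinuousLinearMap.comp_apply, ContinuousLinearMap.id_apply] at this h'
    rw [← this, hab, h']
  have hsurj := (LinearMap.injective_iff_surjective_of_finrank_eq_finrank
    (f := (fderiv ℝ H w).toLinearMap) hdim).1 hinj
  exact h1.map_nhds_eq_of_surj (LinearMap.range_eq_top.2 hsurj)

/-- The divisor and `∂^- H_n` both have dimension `2n - 1`, so an inclusion of the latter in the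
former is locally onto. Charts of `∂^- H_n` are avoided: `R` retracts a neighbourhood in the model
onto `∂^- H_n` by setting `t = 0` and adjusting the length of `y`, and `f` expresses the result in a
chart of the divisor. It remains to see that `f` is open. -/
theorem eventually_mem_concave {s : HandleShape} {α : OneForm m M} {A : Set (Model n)}
    {θ : Model n → Model n → ℝ} {κ : Model n → M} {O : Set (Model n)}
    (h : IsModelDomain α A θ κ O) (hm : m = 2 * n + 1) (hk : k + 2 = m)
    (hA : ∀ z ∈ s.handle n, ((0 : ℝ), z) ∈ A) {ι : N → M} (hι : ContMDiff (𝓡 k) (𝓡 m) ∞ ι)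
    (hemb : IsEmbedding ι) (himm : ∀ x, Function.Injective (derivMap k m ι x))
    (hS : ∀ z ∈ s.concaveBdry n, κ (0, z) ∈ range ι)
    {z₀ : Euc n × Euc n} (hz₀ : z₀ ∈ s.concaveBdry n) (he : s.exitFn z₀ < 0) {x₀ : N}
    (hx₀ : ι x₀ = κ (0, z₀)) :
    ∀ᶠ x in 𝓝 x₀, ∃ z ∈ s.concaveBdry n, s.exitFn z < 0 ∧ ι x = κ (0, z) := by
  set inv := Function.invFunOn κ O with hinv
  set c := extChartAt (𝓡 k) x₀ with hc
  set u₀ : Euc k := c x₀ with hu₀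
  have hw₀ : ((0 : ℝ), z₀) ∈ O := h.subset (hA z₀ hz₀.1)
  -- the divisor in the coordinates of the model
  let P : Euc k → Model n := fun u => inv (inDomainChart ι x₀ u)
  have hi : ContMDiffAt (𝓡 m) 𝓘(ℝ, Model n) ∞ inv (κ (0, z₀)) := h.contMDiffAt_inv hm hw₀
  have hιc : inDomainChart ι x₀ u₀ = κ (0, z₀) := (inDomainChart_self ι x₀).trans hx₀
  have hιs : ContMDiffAt 𝓘(ℝ, Euc k) (𝓡 m) ∞ (inDomainChart ι x₀) u₀ :=
    hι.contMDiffAt_inDomainChart x₀ (mem_extChartAt_target x₀)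
  have hPs : ContDiffAt ℝ ∞ P u₀ := by
    rw [← contMDiffAt_iff_contDiffAt]
    exact ContMDiffAt.comp (g := inv) u₀ (hιc ▸ hi) hιs
  have hP0 : P u₀ = (0, z₀) := (congrArg inv hιc).trans (h.inv_apply hw₀)
  have hPinj : Function.Injective (fderiv ℝ P u₀) := by
    have h1 : fderiv ℝ P u₀ = (derivTo m inv (inDomainChart ι x₀ u₀)).comp
        (derivFrom m (inDomainChart ι x₀) u₀) := by
      refine derivTo_comp_derivFrom (ζ := inv) (κ := inDomainChart ι x₀) ?_
        (hιs.mdifferentiableAt (by simp))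
      rw [hιc]; exact hi.mdifferentiableAt (by simp)
    have h2 : derivFrom m (inDomainChart ι x₀) u₀ = derivMap k m ι x₀ :=
      derivFrom_inDomainChart hι x₀
    have h3 : Function.Injective (derivTo m inv (κ (0, z₀))) := by
      have hsurj : Function.Surjective (derivFrom m κ (0, z₀)) := by
        have := (LinearMap.injective_iff_surjective_of_finrank_eq_finrank
          (f := (derivFrom m κ (0, z₀)).toLinearMap)
          (by rw [finrank_model, ← hm]; simp)).1 (h.injective_derivFrom _ hw₀)
        exact this
      intro a b hab
      obtain ⟨a, rfl⟩ := hsurj a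
      obtain ⟨b, rfl⟩ := hsurj b
      rw [h.derivTo_inv_comp hm hw₀, h.derivTo_inv_comp hm hw₀] at hab
      rw [hab]
    rw [h1, h2, hιc]
    exact h3.comp (himm x₀)
  obtain ⟨Q, hQs, hQ⟩ := exists_local_left_inverse hPs hPinj
  rw [hP0] at hQs
  -- the retraction to the concave boundary
  have hy₀ : s.εS < ‖z₀.2‖ := HandleShape.lt_norm_of_mem_concaveBdry hz₀
  have hy0 : z₀.2 ≠ 0 := norm_pos_iff.1 (s.εS_pos.trans hy₀)
  obtain ⟨l, hls, hl0, hl⟩ := exists_local_inverse_of_deriv_ne_zero s.isLowerS.smooth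
    (s.isLowerS.deriv_pos hy₀).ne'
  rw [hz₀.2] at hls hl0 hl
  let B : Euc n → ℝ := fun x => s.upperS ‖x‖
  have hB : ContDiff ℝ ∞ B := s.isUpperS.contDiff_comp_norm s.εS_pos
  let r : Model n → ℝ := fun w => l (B w.2.1)
  let R : Model n → Model n := fun w => (0, w.2.1, (r w / ‖w.2.2‖) • w.2.2)
  have hrs : ContDiffAt ℝ ∞ r (0, z₀) := by
    have hBs : ContDiffAt ℝ ∞ (fun w : Model n => B w.2.1) (0, z₀) := by fun_prop
    exact ContDiffAt.comp (g := l) (f := fun w : Model n => B w.2.1) (0, z₀) hls hBs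
  have hr0 : r (0, z₀) = ‖z₀.2‖ := hl0
  have hys : ContDiffAt ℝ ∞ (fun w : Model n => w.2.2) (0, z₀) := by fun_prop
  have hns : ContDiffAt ℝ ∞ (fun w : Model n => ‖w.2.2‖) (0, z₀) := hys.norm ℝ hy0
  have hRs : ContDiffAt ℝ ∞ R (0, z₀) := by
    refine contDiffAt_const.prodMk (ContDiffAt.prodMk (by fun_prop) ?_)
    exact (hrs.div hns (norm_ne_zero_iff.2 hy0)).smul hys
  have hR0 : R (0, z₀) = (0, z₀) := by
    show ((0 : ℝ), z₀.1, (r (0, z₀) / ‖z₀.2‖) • z₀.2) = _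
    rw [hr0, div_self (norm_ne_zero_iff.2 hy0), one_smul]
  let f : Model n → Euc k := fun w => Q (R w)
  have hfs : ContDiffAt ℝ ∞ f (0, z₀) :=
    ContDiffAt.comp (g := Q) (f := R) (0, z₀) (hR0.symm ▸ hQs) hRs
  have hRc : Filter.Tendsto R (𝓝 (0, z₀)) (𝓝 (0, z₀)) := by
    have := hRs.continuousAt
    rwa [ContinuousAt, hR0] at this
  have hrpos : ∀ᶠ w in 𝓝 ((0 : ℝ), z₀), 0 < r w :=
    hrs.continuousAt.eventually (lt_mem_nhds (hr0.symm ▸ s.εS_pos.trans hy₀))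
  have hypos : ∀ᶠ w in 𝓝 ((0 : ℝ), z₀), w.2.2 ≠ 0 :=
    hys.continuousAt.eventually (isOpen_ne.mem_nhds hy0)
  have hRnorm : ∀ᶠ w in 𝓝 ((0 : ℝ), z₀), ‖(R w).2.2‖ = r w := by
    filter_upwards [hrpos, hypos] with w h1 h2
    show ‖(r w / ‖w.2.2‖) • w.2.2‖ = r w
    rw [norm_smul, Real.norm_of_nonneg (by positivity),
      div_mul_cancel₀ _ (norm_ne_zero_iff.2 h2)]
  have hRS : ∀ᶠ w in 𝓝 ((0 : ℝ), z₀), (R w).2 ∈ s.concaveBdry n ∧ s.exitFn (R w).2 < 0 := by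
    have h1 : Filter.Tendsto (fun w => (R w).2) (𝓝 (0, z₀)) (𝓝 z₀) :=
      (continuous_snd.tendsto (((0 : ℝ), z₀) : Model n)).comp hRc
    have h2 : Filter.Tendsto (fun w : Model n => B w.2.1) (𝓝 (0, z₀)) (𝓝 (s.upperS ‖z₀.1‖)) :=
      (hB.continuous.comp (continuous_fst.comp continuous_snd)).tendsto (((0 : ℝ), z₀) : Model n)
    filter_upwards [h1.eventually (HandleShape.eventually_mem_concaveBdry hz₀ he),
      h2.eventually hl, hRnorm] with w h3 h4 h5
    exact h3 (by rw [h5]; exact h4)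
  have hRO : ∀ w, (R w).2 ∈ s.concaveBdry n → R w ∈ O := fun w hw => h.subset (hA _ hw.1)
  have hgood : ∀ᶠ w in 𝓝 ((0 : ℝ), z₀), P (f w) = R w ∧ ι (c.symm (f w)) = κ (R w) := by
    have h1 : ∀ᶠ x in 𝓝 x₀, x ∈ c.source ∧ Q (P (c x)) = c x := by
      filter_upwards [extChartAt_source_mem_nhds (I := 𝓡 k) x₀,
        (continuousAt_extChartAt x₀).eventually hQ] with x h1 h2 using ⟨h1, h2⟩
    rw [hemb.isInducing.nhds_eq_comap, Filter.eventually_comap, hx₀] at h1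
    have h2 : Filter.Tendsto (fun w => κ (R w)) (𝓝 (0, z₀)) (𝓝 (κ (0, z₀))) :=
      (h.contMDiffAt hw₀).continuousAt.tendsto.comp hRc
    filter_upwards [hRS, h2.eventually h1] with w h3 h4
    obtain ⟨x, hx⟩ : κ (R w) ∈ range ι := hS _ h3.1
    obtain ⟨h5, h6⟩ := h4 x hx
    have h7 : P (c x) = R w := by
      show inv (ι (c.symm (c x))) = R w
      rw [c.left_inv h5, hx]
      exact h.inv_apply (hRO w h3.1)
    have h8 : f w = c x := by
      show Q (R w) = c x
      rw [← h7, h6]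
    rw [h8, h7, c.left_inv h5]
    exact ⟨rfl, hx⟩
  -- local surjectivity
  have hf0 : f (0, z₀) = u₀ := by
    show Q (R (0, z₀)) = u₀
    rw [hR0, ← hP0]; exact hQ.self_of_nhds
  -- The two quantities lost under `R` are recorded. Since `k + 2 = 2n + 1`, both sides have equal
  -- dimension, and `G`, which restores `t` and the length of `y`, is a local left inverse. So `H`
  -- is locally onto, and with it its first component `f`.
  let H : Model n → Euc k × ℝ × ℝ := fun w => (f w, w.1, ‖w.2.2‖)
  have hHs : ContDiffAt ℝ ∞ H (0, z₀) := hfs.prodMk (contDiffAt_fst.prodMk hns)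
  let G : Euc k × ℝ × ℝ → Model n := fun v =>
    (v.2.1, (P v.1).2.1, (v.2.2 / ‖(P v.1).2.2‖) • (P v.1).2.2)
  have hGs : ContDiffAt ℝ ∞ G (H (0, z₀)) := by
    have h1 : ContDiffAt ℝ ∞ (fun v : Euc k × ℝ × ℝ => P v.1) (H (0, z₀)) := by
      refine ContDiffAt.comp (g := P) (f := fun v : Euc k × ℝ × ℝ => v.1) _ ?_ contDiffAt_fst
      show ContDiffAt ℝ ∞ P (f (0, z₀))
      rw [hf0]; exact hPs
    have h2 : (P (H (0, z₀)).1).2.2 ≠ 0 := by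
      show (P (f (0, z₀))).2.2 ≠ 0
      rw [hf0, hP0]; exact hy0
    refine ContDiffAt.prodMk (by fun_prop) (ContDiffAt.prodMk h1.snd.fst ?_)
    exact ((contDiffAt_snd.snd).div (h1.snd.snd.norm ℝ h2) (norm_ne_zero_iff.2 h2)).smul h1.snd.snd
  have hGH : ∀ᶠ w in 𝓝 ((0 : ℝ), z₀), G (H w) = w := by
    filter_upwards [hgood, hRnorm, hrpos, hypos] with w h1 h2 h3 h4
    show (w.1, (P (f w)).2.1, (‖w.2.2‖ / ‖(P (f w)).2.2‖) • (P (f w)).2.2) = w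
    rw [h1.1, h2]
    show (w.1, w.2.1, (‖w.2.2‖ / r w) • (r w / ‖w.2.2‖) • w.2.2) = w
    have h5 : ‖w.2.2‖ ≠ 0 := norm_ne_zero_iff.2 h4
    rw [smul_smul, div_mul_div_cancel₀ h3.ne', div_self h5, one_smul]
  have hmap : Filter.map f (𝓝 (0, z₀)) = 𝓝 u₀ := by
    have h1 := map_nhds_eq_of_leftInverse (by simp; omega) hHs (hGs.differentiableAt (by simp)) hGH
    have h2 : Filter.map f (𝓝 (0, z₀)) = Filter.map Prod.fst (Filter.map H (𝓝 (0, z₀))) := by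
      rw [Filter.map_map]; rfl
    rw [h2, h1, map_fst_nhds]
    exact congrArg 𝓝 hf0
  have hfin : ∀ᶠ u in 𝓝 u₀, ∃ z ∈ s.concaveBdry n, s.exitFn z < 0 ∧ ι (c.symm u) = κ (0, z) := by
    rw [← hmap, Filter.eventually_map]
    filter_upwards [hgood, hRS] with w h1 h2
    exact ⟨(R w).2, h2.1, h2.2, h1.2⟩
  filter_upwards [extChartAt_source_mem_nhds (I := 𝓡 k) x₀,
    (continuousAt_extChartAt x₀).eventually hfin] with x h1 h2
  rwa [c.left_inv h1] at h2

end

/-! ### Pushing the attaching region along the Liouville flow -/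

section

variable {k : ℕ} {N : Type*} [TopologicalSpace N] [ChartedSpace (Euc k) N] [IsManifold (𝓡 k) ∞ N]
variable {n m : ℕ} {M : Type*} [TopologicalSpace M] [ChartedSpace (Euc m) M] [IsManifold (𝓡 m) ∞ M]

theorem derivTo_zero_prodMk {E : Type*} [NormedAddCommGroup E] [NormedSpace ℝ E] {j : N → E} {x : N}
    (hj : MDifferentiableAt (𝓡 k) 𝓘(ℝ, E) j x) (u : Euc k) :
    derivTo k (fun x => ((0 : ℝ), j x)) x u = (0, derivTo k j x u) := by
  have h1 := fderiv_comp_derivTo (k := k) (ψ := ContinuousLinearMap.inr ℝ ℝ E) (ζ := j) (x := x)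
    (ContinuousLinearMap.inr ℝ ℝ E).differentiableAt hj
  rw [ContinuousLinearMap.fderiv] at h1
  exact DFunLike.congr_fun h1 u

namespace AmbientHandle

variable {s : HandleShape} {α : OneForm m M} (h : AmbientHandle n s α) (ι : N → M)

theorem zero_mem {z : Euc n × Euc n} (hz : z ∈ s.handle n) :
    ((0 : ℝ), z) ∈ Icc (-h.a) h.a ×ˢ s.handle n :=
  ⟨⟨by linarith [h.a_pos], h.a_pos.le⟩, hz⟩

/-- An open neighbourhood of the thickened handle in which it is embedded. -/
def domain : Set (Model n) := h.isEmbedding.exists_isModelDomain.choose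

theorem isModelDomain : IsModelDomain α (Icc (-h.a) h.a ×ˢ s.handle n)
    (fun w v => v.1 + handleForm w.2 v.2) h.thick h.domain :=
  h.isEmbedding.exists_isModelDomain.choose_spec

theorem zero_mem_domain {z : Euc n × Euc n} (hz : z ∈ s.handle n) : ((0 : ℝ), z) ∈ h.domain :=
  h.isModelDomain.subset (h.zero_mem hz)

theorem emb_injOn : InjOn h.emb (s.handle n) := fun _ hz _ hz' hzz =>
  (Prod.mk.inj (h.isModelDomain.injOn (h.zero_mem_domain hz) (h.zero_mem_domain hz') hzz)).2

theorem continuousOn_emb : ContinuousOn h.emb (s.handle n) :=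
  h.isModelDomain.contMDiffOn.continuousOn.comp (Continuous.prodMk_right (0 : ℝ)).continuousOn
    fun _ hz => h.zero_mem_domain hz

theorem val_thick_eq_zero_iff {z : Euc n × Euc n} (hz : z ∈ s.handle n) (w : Euc n × Euc n) :
    α.val (h.thick (0, z)) (derivFrom m h.thick (0, z) (0, w)) = 0 ↔ handleForm z w = 0 := by
  have h1 := h.isModelDomain.ker (0, z) (h.zero_mem hz) (0, w)
  simp only [zero_add] at h1
  exact h1.symm

/-- The points of the divisor in `∂^- H_n \ ∂^+ H_n`. -/
def attach : Set N := {x | ∃ z ∈ s.concaveBdry n, s.exitFn z < 0 ∧ ι x = h.emb z}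

/-- The coordinates in the handle of the points of the divisor. -/
def coord (x : N) : Euc n × Euc n := (Function.invFunOn h.thick h.domain (ι x)).2

variable {h ι}

theorem inv_eq_coord {x : N} (hx : x ∈ h.attach ι) :
    Function.invFunOn h.thick h.domain (ι x) = (0, h.coord ι x) ∧ h.coord ι x ∈ s.concaveBdry n ∧
      s.exitFn (h.coord ι x) < 0 ∧ ι x = h.emb (h.coord ι x) := by
  obtain ⟨z, hz, he, hxz⟩ := hx
  have h1 : Function.invFunOn h.thick h.domain (ι x) = (0, z) := by
    rw [hxz]; exact h.isModelDomain.inv_apply (h.zero_mem_domain hz.1)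
  have h2 : h.coord ι x = z := by rw [coord, h1]
  rw [h2]
  exact ⟨h1, hz, he, hxz⟩

theorem coord_mem_concaveBdry {x : N} (hx : x ∈ h.attach ι) : h.coord ι x ∈ s.concaveBdry n :=
  (inv_eq_coord hx).2.1

theorem exitFn_coord_neg {x : N} (hx : x ∈ h.attach ι) : s.exitFn (h.coord ι x) < 0 :=
  (inv_eq_coord hx).2.2.1

theorem emb_coord {x : N} (hx : x ∈ h.attach ι) : h.emb (h.coord ι x) = ι x :=
  (inv_eq_coord hx).2.2.2.symm

/-- Sublevel sets strictly below `0` are images of compact parts of `∂^- H_n`, whereas the attaching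
region need not be closed. They serve as the closed supports needed for gluing. -/
theorem isClosed_coord_le [T2Space M] (hι : Continuous ι) {c : ℝ} (hc : 0 < c) :
    IsClosed {x | x ∈ h.attach ι ∧ s.exitFn (h.coord ι x) ≤ -c} := by
  have h1 : IsCompact (s.concaveBdry n ∩ {z | s.exitFn z ≤ -c}) :=
    (s.isCompact_concaveBdry n).inter_right (isClosed_le s.continuous_exitFn continuous_const)
  have h2 : IsCompact (h.emb '' (s.concaveBdry n ∩ {z | s.exitFn z ≤ -c})) :=
    h1.image_of_continuousOn (h.continuousOn_emb.mono fun z hz => hz.1.1)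
  convert h2.isClosed.preimage hι using 1
  ext x
  constructor
  · rintro ⟨hx, hc⟩
    exact ⟨_, ⟨coord_mem_concaveBdry hx, hc⟩, emb_coord hx⟩
  · rintro ⟨z, ⟨hz, hzc⟩, hzx⟩
    have hx : x ∈ h.attach ι := ⟨z, hz, lt_of_le_of_lt hzc (by linarith), hzx.symm⟩
    refine ⟨hx, ?_⟩
    rwa [h.emb_injOn (coord_mem_concaveBdry hx).1 hz.1 ((emb_coord hx).trans hzx.symm)]

theorem isOpen_attach (hα : IsContactForm α) (hm : m = 2 * n + 1) (hk : k + 2 = m)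
    (hι : IsContactSubmanifold k α ι) (hs : h.IsSurgeryData (range ι)) : IsOpen (h.attach ι) := by
  rw [isOpen_iff_mem_nhds]
  rintro x ⟨z, hz, he, hx⟩
  refine eventually_mem_concave h.isModelDomain hm hk (fun z hz => h.zero_mem hz) hι.contMDiff
    hι.embedding.isEmbedding (hι.isContactCopy_self.injective_derivMap hα hι) ?_ hz he hx
  intro z hz
  have h1 : h.emb z ∈ h.concave := ⟨z, hz, rfl⟩
  rw [← hs] at h1
  exact h1.2

theorem contMDiffAt_coord (hm : m = 2 * n + 1) (hι : ContMDiff (𝓡 k) (𝓡 m) ∞ ι) {x : N}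
    (hx : x ∈ h.attach ι) : ContMDiffAt (𝓡 k) 𝓘(ℝ, Euc n × Euc n) ∞ (h.coord ι) x := by
  have h1 : ContMDiffAt (𝓡 m) 𝓘(ℝ, Model n) ∞ (Function.invFunOn h.thick h.domain) (ι x) := by
    rw [← emb_coord hx]
    exact h.isModelDomain.contMDiffAt_inv hm (h.zero_mem_domain (coord_mem_concaveBdry hx).1)
  have h2 : ContMDiffAt (𝓡 k) 𝓘(ℝ, Model n) ∞
      (fun x => Function.invFunOn h.thick h.domain (ι x)) x :=
    ContMDiffAt.comp (g := Function.invFunOn h.thick h.domain) x h1 hι.contMDiffAt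
  exact ContMDiffAt.comp (g := fun w : Model n => w.2) x
    contDiff_snd.contMDiff.contMDiffAt h2

theorem handleForm_coord_eq_zero_iff (hm : m = 2 * n + 1) (hι : ContMDiff (𝓡 k) (𝓡 m) ∞ ι)
    (hV : IsOpen (h.attach ι)) {x : N} (hx : x ∈ h.attach ι) (u : Euc k) :
    handleForm (h.coord ι x) (derivTo k (h.coord ι) x u) = 0 ↔ α.pullMap k ι x u = 0 := by
  have hc := (contMDiffAt_coord hm hι hx).mdifferentiableAt (by simp)
  have hz := (coord_mem_concaveBdry hx).1
  have h1 : ι =ᶠ[𝓝 x] fun y => h.thick ((0 : ℝ), h.coord ι y) := by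
    filter_upwards [hV.mem_nhds hx] with y hy using (emb_coord hy).symm
  have hp : ContMDiffAt (𝓡 k) 𝓘(ℝ, Model n) ∞ (fun y => ((0 : ℝ), h.coord ι y)) x :=
    ContMDiffAt.comp (g := ContinuousLinearMap.inr ℝ ℝ (Euc n × Euc n)) x
      (ContinuousLinearMap.inr ℝ ℝ (Euc n × Euc n)).contDiff.contMDiff.contMDiffAt
      (contMDiffAt_coord hm hι hx)
  rw [OneForm.pullMap_apply, h1.derivMap_eq, derivMap_comp_derivTo (κ := h.thick)
    (ζ := fun y => ((0 : ℝ), h.coord ι y)) (h.isModelDomain.mdifferentiableAt (h.zero_mem_domain hz)) (hp.mdifferentiableAt (by simp)),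
    ContinuousLinearMap.comp_apply, derivTo_zero_prodMk hc, ← emb_coord hx]
  exact (h.val_thick_eq_zero_iff hz _).symm

/-- A handle meets the divisor only in `∂^- H_n`; before the exit such a point belongs to the
attaching region. So motions inside the handle never run into the rest of the divisor. -/
theorem emb_ne_of_isSurgeryData (hs : h.IsSurgeryData (range ι)) {z : Euc n × Euc n}
    (hz : z ∈ s.handle n) (he : s.exitFn z < 0) {x : N} (hx : x ∉ h.attach ι) :
    h.emb z ≠ ι x := by
  intro hzx
  have h1 : h.emb z ∈ h.carrier ∩ range ι := ⟨⟨z, hz, rfl⟩, x, hzx.symm⟩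
  rw [hs] at h1
  obtain ⟨z', hz', hzz⟩ := h1
  have := h.emb_injOn hz'.1 hz hzz
  exact hx ⟨z, this ▸ hz', he, hzx.symm⟩

/-- A point which is not in the attaching region is either off `∂^- H_n`, and kept, or in the corner
`∂^- H_n ∩ ∂^+ H_n`, and reinserted with `∂^+ H_n`. -/
theorem mem_surgery {x : N} (hx : x ∉ h.attach ι) : ι x ∈ h.surgery (range ι) := by
  by_cases h1 : ι x ∈ h.concave
  · obtain ⟨z, hz, hzx⟩ := h1
    refine Or.inr ⟨z, ?_, hzx⟩
    by_contra h2
    exact hx ⟨z, hz, (HandleShape.exitFn_neg_iff hz.1).2 h2, hzx.symm⟩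
  · exact Or.inl ⟨⟨x, rfl⟩, h1⟩

/-- The counterpart for the stabilized handle: it meets `Γ^+` only in its convex boundary, and `Γ^+`
contains the part of the divisor outside the attaching region. -/
theorem emb_ne_of_isAntiSurgeryData {h' : AmbientHandle n s α}
    (hs : h'.IsAntiSurgeryData (h.surgery (range ι))) {z : Euc n × Euc n}
    (hz : z ∈ s.handle n) (he : s.exitFn z < 0) {x : N} (hx : x ∉ h.attach ι) :
    h'.emb z ≠ ι x := by
  intro hzx
  have h1 : h'.emb z ∈ h'.carrier ∩ h.surgery (range ι) := ⟨⟨z, hz, rfl⟩, hzx ▸ mem_surgery hx⟩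
  rw [hs] at h1
  obtain ⟨z', hz', hzz⟩ := h1
  have := h'.emb_injOn hz'.1 hz hzz
  exact (HandleShape.exitFn_neg_iff hz).1 he (this ▸ hz')

end AmbientHandle

variable (k) in
/-- A map `j` from the attaching region to the handle which is isotopic to the inclusion by an
isotopy along the Liouville flow, and whose image is close to the unstable disk away from the convex
boundary. -/
structure IsThin {s : HandleShape} {α : OneForm m M} (h : AmbientHandle n s α) (ι : N → M)
    (μ η : ℝ) (j : N → Euc n × Euc n) : Prop where
  contMDiffAt : ∀ x ∈ h.attach ι, ContMDiffAt (𝓡 k) 𝓘(ℝ, Euc n × Euc n) ∞ j x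
  injOn : InjOn j (h.attach ι)
  mem : ∀ x ∈ h.attach ι, j x ∈ s.handle n
  exit_neg : ∀ x ∈ h.attach ι, s.exitFn (j x) < 0
  thin : ∀ x ∈ h.attach ι, s.exitFn (j x) ≤ -(μ / 2) → ‖(j x).2‖ < η
  eq_coord : ∀ x ∈ h.attach ι, -(μ / 8) < s.exitFn (h.coord ι x) → j x = h.coord ι x
  ker : ∀ x ∈ h.attach ι, ∀ u, handleForm (j x) (derivTo k j x u) = 0 ↔ α.pullMap k ι x u = 0

variable [T2Space M] [T2Space N] [SigmaCompactSpace N]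

/-- Along a flow line the exit function is nondecreasing and `‖y‖` nonincreasing, so the admissible
times at each point form a convex set. Locally a constant time is admissible, and a partition of
unity does the rest. -/
theorem exists_flow_time {s : HandleShape} {α : OneForm m M} {h : AmbientHandle n s α}
    {ι : N → M} (hι : Continuous ι) (hV : IsOpen (h.attach ι))
    (hc : ∀ x ∈ h.attach ι, ContinuousAt (h.coord ι) x) {μ η : ℝ} (hμ : 0 < μ) (hη : 0 < η) :
    ∃ τ : N → ℝ, ContMDiff (𝓡 k) 𝓘(ℝ, ℝ) ∞ τ ∧ (∀ x, 0 ≤ τ x) ∧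
      (∀ x ∈ h.attach ι, -(μ / 8) < s.exitFn (h.coord ι x) → τ x = 0) ∧
      ∀ x ∈ h.attach ι, s.exitFn (HandleShape.flow (τ x) (h.coord ι x)) < 0 ∧
        (s.exitFn (HandleShape.flow (τ x) (h.coord ι x)) ≤ -(μ / 2) →
          ‖(HandleShape.flow (τ x) (h.coord ι x)).2‖ < η) := by
  let e : ℝ → N → ℝ := fun τ x => s.exitFn (HandleShape.flow τ (h.coord ι x))
  let y : ℝ → N → ℝ := fun τ x => ‖(HandleShape.flow τ (h.coord ι x)).2‖
  let t : N → Set ℝ := fun x => {τ | 0 ≤ τ ∧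
    (x ∈ h.attach ι → (-(μ / 8) < s.exitFn (h.coord ι x) → τ = 0) ∧ e τ x < 0 ∧
      (e τ x ≤ -(μ / 2) → y τ x < η))}
  have ht : ∀ x, Convex ℝ (t x) := by
    intro x
    rw [convex_iff_ordConnected, ordConnected_def]
    rintro a ⟨ha0, ha⟩ b ⟨hb0, hb⟩ c ⟨hac, hcb⟩
    refine ⟨ha0.trans hac, fun hx => ⟨fun he => ?_, ?_, fun he => ?_⟩⟩
    · exact le_antisymm (hcb.trans ((hb hx).1 he).le) (ha0.trans hac)
    · exact (s.exitFn_flow_mono _ hcb).trans_lt (hb hx).2.1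
    · exact (HandleShape.norm_flow_snd_anti _ hac).trans_lt
        ((ha hx).2.2 ((s.exitFn_flow_mono _ hac).trans he))
  have hce : ∀ τ, ∀ x ∈ h.attach ι, ContinuousAt (e τ) x := fun τ x hx =>
    (s.continuous_exitFn.comp (HandleShape.contDiff_flow.continuous.comp
      (Continuous.prodMk_right τ))).continuousAt.comp (hc x hx)
  have hcy : ∀ τ, ∀ x ∈ h.attach ι, ContinuousAt (y τ) x := fun τ x hx =>
    ((HandleShape.contDiff_flow.continuous.comp
      (Continuous.prodMk_right τ)).snd.norm).continuousAt.comp (hc x hx)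
  have he0 : ∀ x, e 0 x = s.exitFn (h.coord ι x) := fun x => by simp [e, HandleShape.flow_zero]
  have hloc : ∀ x : N, ∃ c : ℝ, ∀ᶠ y in 𝓝 x, c ∈ t y := by
    intro x
    by_cases hx : x ∈ h.attach ι ∧ s.exitFn (h.coord ι x) < -(μ / 8)
    · obtain ⟨hx, hex⟩ := hx
      -- Either the exit function stays negative for all times, and `y` contracts to `0`, or the
      -- flow line reaches the level `-μ/8` and is stopped there, where thinness demands nothing.
      obtain ⟨c, hc0, hc1, hc2⟩ : ∃ c, 0 ≤ c ∧ e c x < 0 ∧ (-(μ / 2) < e c x ∨ y c x < η) := by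
        by_cases hall : ∀ c, 0 ≤ c → e c x < 0
        · have hlim : Filter.Tendsto (fun c => y c x) Filter.atTop (𝓝 0) := by
            simp only [y, HandleShape.norm_flow_snd]
            rw [← zero_mul ‖(h.coord ι x).2‖]
            refine Filter.Tendsto.mul_const _ (Real.tendsto_exp_atBot.comp ?_)
            exact Filter.tendsto_id.const_mul_atTop_of_neg (by norm_num)
          obtain ⟨c, h1, h2⟩ := ((hlim.eventually (gt_mem_nhds hη)).and
            (Filter.eventually_ge_atTop 0)).exists
          exact ⟨c, h2, hall c h2, Or.inr h1⟩
        · push Not at hall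
          obtain ⟨b, hb0, hb⟩ := hall
          have hcont : ContinuousOn (fun c => e c x) (Icc 0 b) :=
            (s.continuous_exitFn.comp (HandleShape.contDiff_flow.continuous.comp
              (Continuous.prodMk_left (h.coord ι x)))).continuousOn
          obtain ⟨c, hc, hc'⟩ := intermediate_value_Icc hb0 hcont
            (show -(μ / 8) ∈ Icc _ _ from ⟨by simpa [he0] using hex.le, by linarith⟩)
          simp only at hc'
          exact ⟨c, hc.1, by linarith, Or.inl (by linarith)⟩
      refine ⟨c, ?_⟩
      have h3 : ∀ᶠ y' in 𝓝 x, -(μ / 2) < e c y' ∨ y c y' < η := by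
        rcases hc2 with h4 | h4
        · filter_upwards [(hce c x hx).eventually (lt_mem_nhds h4)] with y' hy' using Or.inl hy'
        · filter_upwards [(hcy c x hx).eventually (gt_mem_nhds h4)] with y' hy' using Or.inr hy'
      rw [← he0] at hex
      filter_upwards [(hce c x hx).eventually (gt_mem_nhds hc1), h3,
        (hce 0 x hx).eventually (gt_mem_nhds hex)] with y' h5 h6 h7
      refine ⟨hc0, fun _ => ⟨fun h8 => ?_, h5, fun h8 => h6.resolve_left h8.not_gt⟩⟩
      rw [he0] at h7
      exact absurd h8 h7.not_gt
    -- Time zero is admissible off the closed sublevel set of `-μ/4`. This level lies strictly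
    -- between `-μ/2`, where thinness begins, and `-μ/8`, beyond which the time has to vanish.
    · refine ⟨0, ?_⟩
      have hcl := AmbientHandle.isClosed_coord_le (h := h) hι (c := μ / 4) (by positivity)
      have hx' : x ∉ {x | x ∈ h.attach ι ∧ s.exitFn (h.coord ι x) ≤ -(μ / 4)} := fun h1 =>
        hx ⟨h1.1, h1.2.trans_lt (by linarith)⟩
      filter_upwards [hcl.isOpen_compl.mem_nhds hx'] with y' hy'
      refine ⟨le_rfl, fun h1 => ⟨fun _ => rfl, ?_, fun h2 => ?_⟩⟩
      · rw [he0]; exact AmbientHandle.exitFn_coord_neg h1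
      · rw [he0] at h2
        exact absurd ⟨h1, h2.trans (by linarith)⟩ hy'
  obtain ⟨τ, hτ⟩ := exists_contMDiffMap_forall_mem_convex_of_local_const (n := (⊤ : ℕ∞)) (𝓡 k) ht hloc
  exact ⟨τ, τ.contMDiff, fun x => (hτ x).1, fun x hx => ((hτ x).2 hx).1,
    fun x hx => ((hτ x).2 hx).2⟩

/-- A varying flow time adds to the derivative a multiple of the Liouville field, on which `β_n`
vanishes, so only the factor `e^τ` remains. -/
theorem contMDiffAt_flow_coord {z : N → Euc n × Euc n} {τ : N → ℝ} {x : N}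
    (hτ : ContMDiffAt (𝓡 k) 𝓘(ℝ, ℝ) ∞ τ x)
    (hz : ContMDiffAt (𝓡 k) 𝓘(ℝ, Euc n × Euc n) ∞ z x) :
    ContMDiffAt (𝓡 k) 𝓘(ℝ, Euc n × Euc n) ∞ (fun x => HandleShape.flow (τ x) (z x)) x ∧
    ∀ u, handleForm (HandleShape.flow (τ x) (z x))
        (derivTo k (fun x => HandleShape.flow (τ x) (z x)) x u) =
      Real.exp (τ x) * handleForm (z x) (derivTo k z x u) := by
  have hp : ContMDiffAt (𝓡 k) 𝓘(ℝ, ℝ × (Euc n × Euc n)) ∞ (fun x => (τ x, z x)) x :=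
    hτ.prodMk_space hz
  refine ⟨ContMDiffAt.comp (g := fun w : ℝ × (Euc n × Euc n) => HandleShape.flow w.1 w.2) x
    HandleShape.contDiff_flow.contMDiff.contMDiffAt hp, fun u => ?_⟩
  have h1 := fderiv_comp_derivTo (k := k) (ψ := fun w : ℝ × (Euc n × Euc n) =>
      HandleShape.flow w.1 w.2) (ζ := fun x => (τ x, z x)) (x := x)
    (HandleShape.hasFDerivAt_flow _ _).differentiableAt (hp.mdifferentiableAt (by simp))
  have h2 := fderiv_comp_derivTo (k := k) (ψ := ContinuousLinearMap.snd ℝ ℝ (Euc n × Euc n))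
    (ζ := fun x => (τ x, z x)) (x := x)
    (ContinuousLinearMap.snd ℝ ℝ (Euc n × Euc n)).differentiableAt (hp.mdifferentiableAt (by simp))
  rw [ContinuousLinearMap.fderiv] at h2
  have h3 : (derivTo k (fun x => (τ x, z x)) x u).2 = derivTo k z x u :=
    (DFunLike.congr_fun h2 u).symm
  simp only at h1
  rw [h1, (HandleShape.hasFDerivAt_flow _ _).fderiv, ← h3,
    ← HandleShape.handleForm_flow (τ x) (derivTo k (fun x => (τ x, z x)) x u).1]
  rfl

/-- The maps with flow time `c τ`, `0 ≤ c ≤ 1`, stay in the handle before its exit. Hence the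
isotopy can be run in either direction, and inside any handle `h'` which agrees with `h` near the
exit. It is used forwards in `H_n` and backwards in `H_n'`. -/
theorem exists_isThin {s : HandleShape} {α : OneForm m M} (hα : IsContactForm α)
    {h : AmbientHandle n s α} {ι : N → M} (hm : m = 2 * n + 1) (hk : k + 2 = m)
    (hι : IsContactSubmanifold k α ι) (hs : h.IsSurgeryData (range ι)) {μ η : ℝ} (hμ : 0 < μ)
    (hη : 0 < η) :
    ∃ j : N → Euc n × Euc n, IsThin k h ι μ η j ∧ ∀ h' : AmbientHandle n s α,
      (∀ z ∈ s.handle n, s.exitFn z < 0 → ∀ x ∉ h.attach ι, h'.emb z ≠ ι x) →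
      (∀ z ∈ s.handle n, -(μ / 8) < s.exitFn z → h'.emb z = h.emb z) →
      (IsContactCopy k α ι (glue (h.attach ι) (fun x => h'.emb (h.coord ι x)) ι) →
        IsContactCopy k α ι (glue (h.attach ι) (fun x => h'.emb (j x)) ι) ∧
        Nonempty (FormalIsotopy k α ι (glue (h.attach ι) (fun x => h'.emb (h.coord ι x)) ι)
          (glue (h.attach ι) (fun x => h'.emb (j x)) ι))) ∧
      (IsContactCopy k α ι (glue (h.attach ι) (fun x => h'.emb (j x)) ι) →
        IsContactCopy k α ι (glue (h.attach ι) (fun x => h'.emb (h.coord ι x)) ι) ∧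
        Nonempty (FormalIsotopy k α ι (glue (h.attach ι) (fun x => h'.emb (j x)) ι)
          (glue (h.attach ι) (fun x => h'.emb (h.coord ι x)) ι))) := by
  have hV : IsOpen (h.attach ι) := AmbientHandle.isOpen_attach hα hm hk hι hs
  have hcs : ∀ x ∈ h.attach ι, ContMDiffAt (𝓡 k) 𝓘(ℝ, Euc n × Euc n) ∞ (h.coord ι) x :=
    fun x hx => AmbientHandle.contMDiffAt_coord hm hι.contMDiff hx
  obtain ⟨τ, hτs, hτ0, hτz, hτe⟩ := exists_flow_time (k := k) hι.contMDiff.continuous hV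
    (fun x hx => (hcs x hx).continuousAt) hμ hη
  have hinj : ∀ σ : N → ℝ, InjOn (fun x => HandleShape.flow (σ x) (h.coord ι x)) (h.attach ι) := by
    intro σ x hx x' hx' hxx
    have h1 := HandleShape.eq_of_flow_eq_flow (AmbientHandle.coord_mem_concaveBdry hx)
      (AmbientHandle.coord_mem_concaveBdry hx') hxx
    apply hι.embedding.isEmbedding.injective
    rw [← AmbientHandle.emb_coord hx, ← AmbientHandle.emb_coord hx', h1]
  have hexit : ∀ c ∈ Icc (0 : ℝ) 1, ∀ x ∈ h.attach ι,
      s.exitFn (HandleShape.flow (c * τ x) (h.coord ι x)) < 0 := fun c hc x hx =>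
    (s.exitFn_flow_mono _ (mul_le_of_le_one_left (hτ0 x) hc.2)).trans_lt (hτe x hx).1
  have hmem : ∀ c ∈ Icc (0 : ℝ) 1, ∀ x ∈ h.attach ι,
      HandleShape.flow (c * τ x) (h.coord ι x) ∈ s.handle n := fun c hc x hx =>
    HandleShape.flow_mem_handle (AmbientHandle.coord_mem_concaveBdry hx).1
      (mul_nonneg hc.1 (hτ0 x)) (hexit c hc x hx).le
  have hone : (1 : ℝ) ∈ Icc (0 : ℝ) 1 := ⟨zero_le_one, le_rfl⟩
  refine ⟨fun x => HandleShape.flow (τ x) (h.coord ι x), ⟨?_, hinj τ, ?_, fun x hx => (hτe x hx).1,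
    fun x hx => (hτe x hx).2, ?_, ?_⟩, ?_⟩
  · exact fun x hx => (contMDiffAt_flow_coord (hτs x) (hcs x hx)).1
  · intro x hx
    simpa using hmem 1 hone x hx
  · intro x hx hex
    simp only [hτz x hx hex, HandleShape.flow_zero]
  · intro x hx u
    rw [(contMDiffAt_flow_coord (hτs x) (hcs x hx)).2 u,
      ← AmbientHandle.handleForm_coord_eq_zero_iff hm hι.contMDiff hV hx u]
    simp [(Real.exp_pos _).ne']
  · intro h' hdisj hagree
    have key : ∀ a ∈ Icc (0 : ℝ) 1, ∀ b ∈ Icc (0 : ℝ) 1, IsContactCopy k α ι (glue (h.attach ι)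
          (fun x => h'.emb (HandleShape.flow (a * τ x) (h.coord ι x))) ι) →
        IsContactCopy k α ι (glue (h.attach ι)
          (fun x => h'.emb (HandleShape.flow (b * τ x) (h.coord ι x))) ι) ∧
        Nonempty (FormalIsotopy k α ι (glue (h.attach ι)
          (fun x => h'.emb (HandleShape.flow (a * τ x) (h.coord ι x))) ι) (glue (h.attach ι)
          (fun x => h'.emb (HandleShape.flow (b * τ x) (h.coord ι x))) ι)) := by
      intro a ha b hb h0
      have hab : ∀ T ∈ Icc (0 : ℝ) 1, a + T * (b - a) ∈ Icc (0 : ℝ) 1 := fun T hT =>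
        ⟨by nlinarith [ha.1, hb.1, hT.1, hT.2], by nlinarith [ha.2, hb.2, hT.1, hT.2]⟩
      have hfl : ∀ T x, x ∈ h.attach ι → ContMDiffAt (𝓘(ℝ, ℝ).prod (𝓡 k)) 𝓘(ℝ, Model n) ∞
          (fun w : ℝ × N => ((0 : ℝ), HandleShape.flow ((a + w.1 * (b - a)) * τ w.2)
            (h.coord ι w.2))) (T, x) := by
        intro T x hx
        have h1 : ContMDiffAt (𝓘(ℝ, ℝ).prod (𝓡 k)) 𝓘(ℝ, ℝ) ∞
            (fun w : ℝ × N => (a + w.1 * (b - a)) * τ w.2) (T, x) := by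
          have h2 : ContMDiffAt (𝓘(ℝ, ℝ).prod (𝓡 k)) 𝓘(ℝ, ℝ) ∞
              (fun w : ℝ × N => a + w.1 * (b - a)) (T, x) :=
            ContMDiffAt.comp (g := fun T : ℝ => a + T * (b - a)) (T, x)
              (contDiff_const.add (contDiff_id.mul contDiff_const)).contMDiff.contMDiffAt
              contMDiffAt_fst
          exact h2.mul ((hτs x).comp (T, x) contMDiffAt_snd)
        have h3 : ContMDiffAt (𝓘(ℝ, ℝ).prod (𝓡 k)) 𝓘(ℝ, Euc n × Euc n) ∞
            (fun w : ℝ × N => h.coord ι w.2) (T, x) :=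
          ContMDiffAt.comp (g := h.coord ι) (T, x) (hcs x hx) contMDiffAt_snd
        exact ContMDiffAt.comp (g := fun w : ℝ × (Euc n × Euc n) =>
            ((0 : ℝ), HandleShape.flow w.1 w.2)) (T, x)
          (contDiff_const.prodMk HandleShape.contDiff_flow).contMDiff.contMDiffAt
          (h1.prodMk_space h3)
      have := exists_formalIsotopy_of_glue hα hι h'.isModelDomain.isOpen
        h'.isModelDomain.contMDiffOn h'.isModelDomain.injOn hV
        (C := {x | x ∈ h.attach ι ∧ s.exitFn (h.coord ι x) ≤ -(μ / 8)})
        (AmbientHandle.isClosed_coord_le hι.contMDiff.continuous (by positivity)) (fun x hx => hx.1)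
        (μ := fun T x => ((0 : ℝ), HandleShape.flow ((a + T * (b - a)) * τ x) (h.coord ι x)))
        (fun T _ x hx => hfl T x hx)
        (fun T hT x hx => h'.zero_mem_domain (hmem _ (hab T hT) x hx)) ?_ ?_ ?_ ?_ ?_
      · simp only [zero_mul, one_mul, add_zero, add_sub_cancel] at this
        exact this
      · rintro T hT x ⟨hx, hxC⟩
        have hex : -(μ / 8) < s.exitFn (h.coord ι x) := by
          by_contra! h1
          exact hxC ⟨hx, h1⟩
        rw [hτz x hx hex, mul_zero, HandleShape.flow_zero]
        exact (hagree _ (AmbientHandle.coord_mem_concaveBdry hx).1 hex).trans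
          (AmbientHandle.emb_coord hx)
      · intro T hT x hx u
        have h1 : ContMDiffAt (𝓡 k) 𝓘(ℝ, ℝ) ∞ (fun x => (a + T * (b - a)) * τ x) x :=
          contMDiffAt_const.mul (hτs x)
        obtain ⟨h2, h3⟩ := contMDiffAt_flow_coord h1 (hcs x hx)
        rw [derivTo_zero_prodMk (h2.mdifferentiableAt (by simp)),
          h'.val_thick_eq_zero_iff (hmem _ (hab T hT) x hx), h3,
          ← AmbientHandle.handleForm_coord_eq_zero_iff hm hι.contMDiff hV hx u]
        simp [(Real.exp_pos _).ne']
      · intro T hT x hx x' hx' hxx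
        exact hinj (fun x => (a + T * (b - a)) * τ x) hx hx' (Prod.mk.inj hxx).2
      · intro T hT x hx x' hx'
        exact hdisj _ (hmem _ (hab T hT) x hx) (hexit _ (hab T hT) x hx) x' hx'
      · simp only [zero_mul, add_zero]
        exact h0
    have h0 : (0 : ℝ) ∈ Icc (0 : ℝ) 1 := ⟨le_rfl, zero_le_one⟩
    have k1 := key 0 h0 1 hone
    have k2 := key 1 hone 0 h0
    simp only [zero_mul, one_mul, HandleShape.flow_zero] at k1 k2
    exact ⟨k1, k2⟩

end

/-! ### Formal isotopies which are supported in a model -/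

section

variable {k : ℕ} {N : Type*} [TopologicalSpace N] [ChartedSpace (Euc k) N] [IsManifold (𝓡 k) ∞ N]
variable {m : ℕ} {M : Type*} [TopologicalSpace M] [ChartedSpace (Euc m) M] [IsManifold (𝓡 m) ∞ M]
variable {E : Type*} [NormedAddCommGroup E] [NormedSpace ℝ E]

theorem contMDiffAt_derivTo_bundle {ξ : N → E} {U : Set N} (hU : IsOpen U)
    (hξ : ContMDiffOn (𝓡 k) 𝓘(ℝ, E) ∞ ξ U) {v : TangentBundle (𝓡 k) N} (hv : v.proj ∈ U) :
    ContMDiffAt (𝓡 k).tangent 𝓘(ℝ, E) ∞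
      (fun v : TangentBundle (𝓡 k) N => derivTo k ξ v.proj v.2) v := by
  have h1 : ContMDiffOn (𝓡 k).tangent 𝓘(ℝ, E).tangent ∞ (tangentMapWithin (𝓡 k) 𝓘(ℝ, E) ξ U)
      (Bundle.TotalSpace.proj ⁻¹' U) :=
    hξ.contMDiffOn_tangentMapWithin (by simp) hU.uniqueMDiffOn
  have hpre : IsOpen (Bundle.TotalSpace.proj ⁻¹' U : Set (TangentBundle (𝓡 k) N)) :=
    hU.preimage (FiberBundle.continuous_proj _ _)
  have h2 := (h1 v hv).contMDiffAt (hpre.mem_nhds hv)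
  have h3 := (contMDiff_snd_tangentBundle_modelSpace E 𝓘(ℝ, E) (n := ∞)).contMDiffAt.comp v h2
  refine h3.congr_of_eventuallyEq ?_
  filter_upwards [hpre.mem_nhds hv] with v' hv'
  show mfderiv (𝓡 k) 𝓘(ℝ, E) ξ v'.proj v'.2 = mfderivWithin (𝓡 k) 𝓘(ℝ, E) ξ U v'.proj v'.2
  rw [mfderivWithin_of_isOpen hU hv']

theorem contMDiffAt_derivFrom_bundle {κ : E → M} {O : Set E} (hO : IsOpen O)
    (hκ : ContMDiffOn 𝓘(ℝ, E) (𝓡 m) ∞ κ O) {w : E × E} (hw : w.1 ∈ O) :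
    ContMDiffAt 𝓘(ℝ, E × E) (𝓡 m).tangent ∞
      (fun w : E × E => tangentVec m (κ w.1) (derivFrom m κ w.1 w.2)) w := by
  have h1 : ContMDiffOn 𝓘(ℝ, E).tangent (𝓡 m).tangent ∞ (tangentMapWithin 𝓘(ℝ, E) (𝓡 m) κ O)
      (Bundle.TotalSpace.proj ⁻¹' O) :=
    hκ.contMDiffOn_tangentMapWithin (by simp) hO.uniqueMDiffOn
  have hpre : IsOpen (Bundle.TotalSpace.proj ⁻¹' O : Set (TangentBundle 𝓘(ℝ, E) E)) :=
    hO.preimage (FiberBundle.continuous_proj _ _)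
  have h0 : ContMDiff 𝓘(ℝ, E × E) 𝓘(ℝ, E).tangent ∞
      (fun w : E × E => (⟨w.1, w.2⟩ : TangentBundle 𝓘(ℝ, E) E)) := by
    intro y
    rw [Bundle.contMDiffAt_totalSpace]
    exact ⟨contDiff_fst.contMDiff.contMDiffAt, by
      simpa using! contDiff_snd.contMDiff.contMDiffAt⟩
  have h2 := ((h1 (⟨w.1, w.2⟩ : TangentBundle 𝓘(ℝ, E) E) hw).contMDiffAt
    (hpre.mem_nhds hw)).comp w (h0 w)
  refine h2.congr_of_eventuallyEq ?_
  filter_upwards [(hO.preimage continuous_fst).mem_nhds hw] with w' hw'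
  show tangentVec m (κ w'.1) (mfderiv 𝓘(ℝ, E) (𝓡 m) κ w'.1 w'.2) =
    tangentVec m (κ w'.1) (mfderivWithin 𝓘(ℝ, E) (𝓡 m) κ O w'.1 w'.2)
  rw [mfderivWithin_of_isOpen hO hw']

/-- The exterior derivative of a form on a vector space. -/
def formD (θ : E → E →L[ℝ] ℝ) (w u v : E) : ℝ := fderiv ℝ θ w u v - fderiv ℝ θ w v u

/-- A deformation of the points of a model together with a formal derivative of it, which interpolates
between the actual derivative, for `S = 0`, and one which respects the form `θ`, for `S = 1`. -/
structure IsFormalDeformation (θ : E → E →L[ℝ] ℝ) (Ψ : ℝ × E → E) (Θ : (ℝ × ℝ) × E → E →L[ℝ] E) :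
    Prop where
  contDiff : ContDiff ℝ ∞ Ψ
  contDiff_lift : ContDiff ℝ ∞ Θ
  initial : ∀ w, Ψ (0, w) = w
  start : ∀ T w, Θ ((0, T), w) = fderiv ℝ (fun w => Ψ (T, w)) w
  left : ∀ S w, Θ ((S, 0), w) = Θ ((0, 0), w)
  right : ∀ S w, Θ ((S, 1), w) = Θ ((0, 1), w)
  injective : ∀ S T w, Function.Injective (Θ ((S, T), w))
  form : ∀ T w v, θ (Ψ (T, w)) (Θ ((1, T), w) v) = θ w v
  ext : ∀ T w u v, formD θ (Ψ (T, w)) (Θ ((1, T), w) u) (Θ ((1, T), w) v) = formD θ w u v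

/-- In the model `α` is `c θ` with `c` of constant sign. A formal deformation which preserves `θ`
and `dθ` for `S = 1` therefore becomes conformal in `M`, with the positive factor `c (Ψ) / c (ξ)`.
Openness of `U` and the stationary region off `C` allow it to be continued by `ι₁`. -/
theorem exists_formalIsotopy_of_formalDeformation {α : OneForm m M} (hα : IsContactForm α)
    {ι ι₁ : N → M} (hι : IsContactSubmanifold k α ι) (hι₁ : IsContactCopy k α ι ι₁)
    {κ : E → M} {B : Set E} (hB : IsOpen B) (hκ : ContMDiffOn 𝓘(ℝ, E) (𝓡 m) ∞ κ B)
    (hκi : ∀ w ∈ B, Function.Injective (derivFrom m κ w))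
    {θ : E → E →L[ℝ] ℝ} (hθ : Differentiable ℝ θ) (hθ0 : ∀ w, θ w ≠ 0) {c : E → ℝ}
    (hc : ∀ w ∈ B, α.pull κ w = c w • θ w) (hcs : ∀ w ∈ B, ∀ w' ∈ B, 0 < c w * c w')
    {U C : Set N} (hU : IsOpen U) (hC : IsClosed C) (hCU : C ⊆ U) {ξ : N → E}
    (hξ : ContMDiffOn (𝓡 k) 𝓘(ℝ, E) ∞ ξ U) (hκξ : ∀ x ∈ U, κ (ξ x) = ι₁ x)
    (hξB : ∀ x ∈ U, ξ x ∈ B)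
    {Ψ : ℝ × E → E} {Θ : (ℝ × ℝ) × E → E →L[ℝ] E} (hΨ : IsFormalDeformation θ Ψ Θ)
    (hΨB : ∀ T ∈ Icc (0 : ℝ) 1, ∀ x ∈ U, Ψ (T, ξ x) ∈ B)
    (hstat : ∀ x ∈ U \ C, ∀ S T, Ψ (T, ξ x) = ξ x ∧ Θ ((S, T), ξ x) = ContinuousLinearMap.id ℝ E)
    (hinj : ∀ T ∈ Icc (0 : ℝ) 1, Function.Injective (glue U (fun x => κ (Ψ (T, ξ x))) ι₁)) :
    IsContactCopy k α ι (glue U (fun x => κ (Ψ (1, ξ x))) ι₁) ∧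
      Nonempty (FormalIsotopy k α ι ι₁ (glue U (fun x => κ (Ψ (1, ξ x))) ι₁)) := by
  classical
  set σ : ℝ → ℝ := Real.smoothTransition with hσ
  have hσI : ∀ T, σ T ∈ Icc (0 : ℝ) 1 := fun T =>
    ⟨Real.smoothTransition.nonneg T, Real.smoothTransition.le_one T⟩
  have hσ0 : ∀ T ≤ 0, σ T = 0 := fun T hT => Real.smoothTransition.zero_of_nonpos hT
  have hσ1 : ∀ T ≥ 1, σ T = 1 := fun T hT => Real.smoothTransition.one_of_one_le hT
  have hσs : ContDiff ℝ ∞ σ := Real.smoothTransition.contDiff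
  have hκw : ∀ w ∈ B, ContMDiffAt 𝓘(ℝ, E) (𝓡 m) ∞ κ w := fun w hw =>
    (hκ w hw).contMDiffAt (hB.mem_nhds hw)
  have hκd : ∀ w ∈ B, MDifferentiableAt 𝓘(ℝ, E) (𝓡 m) κ w := fun w hw =>
    (hκw w hw).mdifferentiableAt (by simp)
  have hξx : ∀ x ∈ U, ContMDiffAt (𝓡 k) 𝓘(ℝ, E) ∞ ξ x := fun x hx =>
    (hξ x hx).contMDiffAt (hU.mem_nhds hx)
  have hξd : ∀ x ∈ U, MDifferentiableAt (𝓡 k) 𝓘(ℝ, E) ξ x := fun x hx =>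
    (hξx x hx).mdifferentiableAt (by simp)
  have hΨT : ∀ T, ContDiff ℝ ∞ fun w => Ψ (T, w) := fun T =>
    hΨ.contDiff.comp (contDiff_const.prodMk contDiff_id)
  have hc0 : ∀ w ∈ B, c w ≠ 0 := fun w hw h0 => by
    have := hcs w hw w hw
    rw [h0, zero_mul] at this
    exact this.false
  have hpull : ∀ w ∈ B, ∀ v, α.val (κ w) (derivFrom m κ w v) = c w * θ w v := fun w hw v =>
    DFunLike.congr_fun (hc w hw) v
  have hext : ∀ w ∈ B, ∀ u v, θ w u = 0 → θ w v = 0 →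
      α.ext (κ w) (derivFrom m κ w u) (derivFrom m κ w v) = c w * formD θ w u v := by
    intro w hw u v hu hv
    refine OneForm.ext_of_pull_proportional hα.smooth (hκw w hw) (hθ w) (hθ0 w) ?_ (hc w hw) hu hv
    filter_upwards [hB.mem_nhds hw] with w' hw' using ⟨_, hc w' hw'⟩
  have hDι₁ : ∀ x ∈ U, derivMap k m ι₁ x = (derivFrom m κ (ξ x)).comp (derivTo k ξ x) := by
    intro x hx
    have h1 : ι₁ =ᶠ[𝓝 x] fun x => κ (ξ x) := by
      filter_upwards [hU.mem_nhds hx] with y hy using (hκξ y hy).symm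
    rw [h1.derivMap_eq, derivMap_comp_derivTo (hκd _ (hξB x hx)) (hξd x hx)]
  set φ : ℝ → N → M := fun T => glue U (fun x => κ (Ψ (T, ξ x))) ι₁ with hφ
  have hφC : ∀ T x, x ∉ C → φ T x = ι₁ x := by
    intro T x hx
    by_cases hxU : x ∈ U
    · simp only [hφ, glue_of_mem _ _ hxU, (hstat x ⟨hxU, hx⟩ 0 T).1, hκξ x hxU]
    · exact glue_of_notMem _ _ hxU
  have hDφ : ∀ T ∈ Icc (0 : ℝ) 1, ∀ x ∈ U, derivMap k m (φ T) x =
      (derivFrom m κ (Ψ (T, ξ x))).comp ((Θ ((0, T), ξ x)).comp (derivTo k ξ x)) := by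
    intro T hT x hx
    have h1 := glue_eventuallyEq_left hU (fun x => κ (Ψ (T, ξ x))) ι₁ hx
    have h2 := fderiv_comp_derivTo (k := k) (ψ := fun w => Ψ (T, w)) (ζ := ξ) (x := x)
      ((hΨT T).contDiffAt.differentiableAt (by simp)) (hξd x hx)
    have h3 : ContMDiffAt (𝓡 k) 𝓘(ℝ, E) ∞ (fun x => Ψ (T, ξ x)) x :=
      ContMDiffAt.comp (g := fun w => Ψ (T, w)) x (hΨT T).contMDiff.contMDiffAt (hξx x hx)
    rw [hφ, h1.derivMap_eq, derivMap_comp_derivTo (ζ := fun x => Ψ (T, ξ x))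
      (hκd _ (hΨB T hT x hx)) (h3.mdifferentiableAt (by simp)), h2, hΨ.start]
  have hDφC : ∀ T x, x ∉ C → derivMap k m (φ T) x = derivMap k m ι₁ x := by
    intro T x hx
    have h1 : φ T =ᶠ[𝓝 x] ι₁ := by
      filter_upwards [hC.isOpen_compl.mem_nhds hx] with y hy using hφC T y hy
    exact h1.derivMap_eq
  -- The two clauses agree off `C`, where the deformation is stationary with trivial lift. The
  -- smooth transition `σ` makes the family constant outside of `[0, 1]`.
  set Φ : ℝ → ℝ → N → Euc k →L[ℝ] Euc m := fun S T x =>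
    if x ∈ U then (derivFrom m κ (Ψ (σ T, ξ x))).comp ((Θ ((S, σ T), ξ x)).comp (derivTo k ξ x))
    else derivMap k m ι₁ x with hΦ
  have hΦU : ∀ S T, ∀ x ∈ U, Φ S T x =
      (derivFrom m κ (Ψ (σ T, ξ x))).comp ((Θ ((S, σ T), ξ x)).comp (derivTo k ξ x)) :=
    fun S T x hx => if_pos hx
  have hΦC : ∀ S T x, x ∉ C → Φ S T x = derivMap k m ι₁ x := by
    intro S T x hx
    by_cases hxU : x ∈ U
    · rw [hΦU S T x hxU, (hstat x ⟨hxU, hx⟩ S (σ T)).1, (hstat x ⟨hxU, hx⟩ S (σ T)).2,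
        ContinuousLinearMap.id_comp, hDι₁ x hxU]
    · exact if_neg hxU
  have hsmooth : ContMDiff (𝓘(ℝ, ℝ).prod (𝓡 k)) (𝓡 m) ∞ (fun w : ℝ × N => φ (σ w.1) w.2) := by
    rintro ⟨T, x⟩
    by_cases hx : x ∈ U
    · have h1 : ContMDiffAt (𝓘(ℝ, ℝ).prod (𝓡 k)) 𝓘(ℝ, ℝ × E) ∞
          (fun w : ℝ × N => (σ w.1, ξ w.2)) (T, x) :=
        ContMDiffAt.prodMk_space
          (ContMDiffAt.comp (g := σ) (T, x) hσs.contMDiff.contMDiffAt contMDiffAt_fst)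
          (ContMDiffAt.comp (g := ξ) (T, x) (hξx x hx) contMDiffAt_snd)
      have h2 : ContMDiffAt (𝓘(ℝ, ℝ).prod (𝓡 k)) 𝓘(ℝ, E) ∞
          (fun w : ℝ × N => Ψ (σ w.1, ξ w.2)) (T, x) :=
        ContMDiffAt.comp (g := Ψ) (T, x) hΨ.contDiff.contMDiff.contMDiffAt h1
      have h3 : ContMDiffAt (𝓘(ℝ, ℝ).prod (𝓡 k)) (𝓡 m) ∞
          (fun w : ℝ × N => κ (Ψ (σ w.1, ξ w.2))) (T, x) :=
        ContMDiffAt.comp (g := κ) (T, x) (hκw _ (hΨB _ (hσI T) x hx)) h2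
      refine h3.congr_of_eventuallyEq ?_
      filter_upwards [continuous_snd.continuousAt.eventually (hU.mem_nhds hx)] with w hw
      exact glue_of_mem _ _ hw
    · have h2 : ContMDiffAt (𝓘(ℝ, ℝ).prod (𝓡 k)) (𝓡 m) ∞ (fun w : ℝ × N => ι₁ w.2) (T, x) :=
        ContMDiffAt.comp (g := ι₁) (T, x) hι₁.contMDiff.contMDiffAt contMDiffAt_snd
      refine h2.congr_of_eventuallyEq ?_
      filter_upwards [continuous_snd.continuousAt.eventually
        (hC.isOpen_compl.mem_nhds fun h => hx (hCU h))] with w hw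
      exact hφC _ _ hw
  have hlift : ContMDiff (𝓘(ℝ, ℝ × ℝ).prod (𝓡 k).tangent) (𝓡 m).tangent ∞
      (fun w : (ℝ × ℝ) × TangentBundle (𝓡 k) N =>
        tangentVec m (φ (σ w.1.2) w.2.proj) (Φ w.1.1 w.1.2 w.2.proj w.2.2)) := by
    rintro ⟨⟨S, T⟩, v⟩
    have hproj : ContMDiffAt (𝓘(ℝ, ℝ × ℝ).prod (𝓡 k).tangent) (𝓡 k) ∞
        (fun w : (ℝ × ℝ) × TangentBundle (𝓡 k) N => w.2.proj) ((S, T), v) :=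
      ContMDiffAt.comp (g := fun v : TangentBundle (𝓡 k) N => v.proj) ((S, T), v)
        (Bundle.contMDiff_proj (TangentSpace (𝓡 k))).contMDiffAt contMDiffAt_snd
    have hpc : ContinuousAt (fun w : (ℝ × ℝ) × TangentBundle (𝓡 k) N => w.2.proj) ((S, T), v) :=
      hproj.continuousAt
    by_cases hx : v.proj ∈ U
    · have hd : ContMDiffAt (𝓘(ℝ, ℝ × ℝ).prod (𝓡 k).tangent) 𝓘(ℝ, E) ∞
          (fun w : (ℝ × ℝ) × TangentBundle (𝓡 k) N => derivTo k ξ w.2.proj w.2.2) ((S, T), v) :=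
        ContMDiffAt.comp (g := fun v : TangentBundle (𝓡 k) N => derivTo k ξ v.proj v.2) ((S, T), v)
          (contMDiffAt_derivTo_bundle hU hξ hx) contMDiffAt_snd
      have hp : ContMDiffAt (𝓘(ℝ, ℝ × ℝ).prod (𝓡 k).tangent) 𝓘(ℝ, E) ∞
          (fun w : (ℝ × ℝ) × TangentBundle (𝓡 k) N => ξ w.2.proj) ((S, T), v) :=
        ContMDiffAt.comp (g := ξ) ((S, T), v) (hξx _ hx) hproj
      have hall : ContMDiffAt (𝓘(ℝ, ℝ × ℝ).prod (𝓡 k).tangent) 𝓘(ℝ, (ℝ × ℝ) × (E × E)) ∞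
          (fun w : (ℝ × ℝ) × TangentBundle (𝓡 k) N =>
            (w.1, (ξ w.2.proj, derivTo k ξ w.2.proj w.2.2))) ((S, T), v) :=
        ContMDiffAt.prodMk_space contMDiffAt_fst (hp.prodMk_space hd)
      have hG : ContDiff ℝ ∞ (fun w : (ℝ × ℝ) × (E × E) =>
          (Ψ (σ w.1.2, w.2.1), Θ ((w.1.1, σ w.1.2), w.2.1) w.2.2)) := by
        have h1 : ContDiff ℝ ∞ (fun w : (ℝ × ℝ) × (E × E) => (σ w.1.2, w.2.1)) :=
          (hσs.comp contDiff_fst.snd).prodMk contDiff_snd.fst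
        have h2 : ContDiff ℝ ∞ (fun w : (ℝ × ℝ) × (E × E) => ((w.1.1, σ w.1.2), w.2.1)) :=
          (contDiff_fst.fst.prodMk (hσs.comp contDiff_fst.snd)).prodMk contDiff_snd.fst
        exact (hΨ.contDiff.comp h1).prodMk ((hΨ.contDiff_lift.comp h2).clm_apply contDiff_snd.snd)
      have h3 := ContMDiffAt.comp (g := fun w : (ℝ × ℝ) × (E × E) =>
          (Ψ (σ w.1.2, w.2.1), Θ ((w.1.1, σ w.1.2), w.2.1) w.2.2)) ((S, T), v)
        hG.contMDiff.contMDiffAt hall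
      have h4 := ContMDiffAt.comp (g := fun w : E × E =>
          tangentVec m (κ w.1) (derivFrom m κ w.1 w.2)) ((S, T), v)
        (contMDiffAt_derivFrom_bundle hB hκ (hΨB _ (hσI T) _ hx)) h3
      refine h4.congr_of_eventuallyEq ?_
      filter_upwards [hpc.eventually (hU.mem_nhds hx)] with w hw
      rw [hΦU _ _ _ hw]
      simp only [hφ, glue_of_mem _ _ hw]
      rfl
    · have hxC : v.proj ∉ C := fun h => hx (hCU h)
      have h1 : ContMDiffAt (𝓘(ℝ, ℝ × ℝ).prod (𝓡 k).tangent) (𝓡 m).tangent ∞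
          (fun w : (ℝ × ℝ) × TangentBundle (𝓡 k) N => tangentMap (𝓡 k) (𝓡 m) ι₁ w.2)
          ((S, T), v) :=
        ContMDiffAt.comp (g := tangentMap (𝓡 k) (𝓡 m) ι₁) ((S, T), v)
          (hι₁.contMDiff.contMDiff_tangentMap (by simp)).contMDiffAt contMDiffAt_snd
      refine h1.congr_of_eventuallyEq ?_
      filter_upwards [hpc.eventually (hC.isOpen_compl.mem_nhds hxC)] with w hw
      rw [hΦC _ _ _ hw, hφC _ _ hw]
      rfl
  -- the formal derivative for `S = 1`
  have hval : ∀ T, ∀ x ∈ U, ∀ u, α.val (φ (σ T) x) (Φ 1 T x u) =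
      c (Ψ (σ T, ξ x)) / c (ξ x) * α.pullMap k ι₁ x u := by
    intro T x hx u
    have h1 : φ (σ T) x = κ (Ψ (σ T, ξ x)) := glue_of_mem _ _ hx
    rw [hΦU _ _ x hx, h1, OneForm.pullMap_apply, hDι₁ x hx, ← hκξ x hx]
    simp only [ContinuousLinearMap.comp_apply]
    rw [hpull _ (hΨB _ (hσI T) x hx), hpull _ (hξB x hx), hΨ.form]
    field_simp [hc0 _ (hξB x hx)]
  -- Constant sign of `c` makes the quotient positive, as coorientation demands.
  have hratio : ∀ T, ∀ x ∈ U, 0 < c (Ψ (σ T, ξ x)) / c (ξ x) := fun T x hx => by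
    have h1 := hcs _ (hΨB _ (hσI T) x hx) _ (hξB x hx)
    have h2 := hc0 _ (hξB x hx)
    have h3 : c (Ψ (σ T, ξ x)) / c (ξ x) = c (Ψ (σ T, ξ x)) * c (ξ x) / c (ξ x) ^ 2 := by
      field_simp
    rw [h3]; positivity
  have hstart : ∀ T x, Φ 0 T x = derivMap k m (φ (σ T)) x := by
    intro T x
    by_cases hx : x ∈ U
    · rw [hΦU _ _ x hx, hDφ _ (hσI T) x hx]
    · rw [hΦC _ _ x fun h => hx (hCU h), hDφC _ x fun h => hx (hCU h)]
  have hgen : ∀ S T x, T ≤ 0 ∨ 1 ≤ T → Φ S T x = derivMap k m (φ (σ T)) x := by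
    intro S T x hT
    rw [← hstart]
    by_cases hx : x ∈ U
    · rw [hΦU _ _ x hx, hΦU _ _ x hx]
      rcases hT with hT | hT
      · rw [hσ0 T hT, hΨ.left]
      · rw [hσ1 T hT, hΨ.right]
    · rw [hΦC _ _ x fun h => hx (hCU h), hΦC _ _ x fun h => hx (hCU h)]
  have hφ1 : IsContactCopy k α ι (φ 1) := by
    have hs1 : σ 1 = 1 := hσ1 1 le_rfl
    refine ⟨?_, hinj 1 ⟨zero_le_one, le_rfl⟩, fun x => ?_⟩
    · have := hsmooth.comp (contMDiff_const (c := (1 : ℝ)) |>.prodMk contMDiff_id)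
      simpa only [Function.comp_def, hs1] using! this
    · obtain ⟨c', hc', hcx⟩ := hι₁.pos x
      by_cases hx : x ∈ U
      · refine ⟨c (Ψ (σ 1, ξ x)) / c (ξ x) * c', mul_pos (hratio 1 x hx) hc', ?_⟩
        ext u
        have h1 := hval 1 x hx u
        rw [hgen 1 1 x (Or.inr le_rfl), hs1] at h1
        rw [OneForm.pullMap_apply, h1, hcx, hs1]
        simp only [FunLike.coe_smul, Pi.smul_apply, smul_eq_mul]
        ring
      · refine ⟨c', hc', ?_⟩
        rw [← hcx]
        have h2 : x ∉ C := fun h => hx (hCU h)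
        ext u
        rw [OneForm.pullMap_apply, OneForm.pullMap_apply, hDφC 1 x h2, hφC 1 x h2]
  refine ⟨hφ1, ⟨?_⟩⟩
  exact
    { φ := fun T => φ (σ T)
      Φ := Φ
      smooth := hsmooth
      smooth_lift := hlift
      injective := fun T => hinj _ (hσI T)
      start := hstart
      injective_lift := by
        intro S _ T x
        by_cases hx : x ∈ U
        · rw [hΦU _ _ x hx]
          have h1 := hι₁.injective_derivMap hα hι x
          rw [hDι₁ x hx] at h1
          exact (hκi _ (hΨB _ (hσI T) x hx)).comp ((hΨ.injective _ _ _).comp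
            (Function.Injective.of_comp h1))
        · rw [hΦC _ _ x fun h => hx (hCU h)]
          exact hι₁.injective_derivMap hα hι x
      mapsTo := by
        intro T x u hu
        have hu1 := (hι₁.pullMap_eq_zero_iff x u).2 hu
        by_cases hx : x ∈ U
        · rw [hval T x hx u, hu1, mul_zero]
        · have h2 : x ∉ C := fun h => hx (hCU h)
          rw [hΦC _ _ x h2, hφC _ x h2]
          exact hu1
      conformal := by
        intro T x
        obtain ⟨c', hc', hcx⟩ := hι₁.ext_eq hα hι x
        by_cases hx : x ∈ U
        · refine ⟨c (Ψ (σ T, ξ x)) / c (ξ x) * c', mul_pos (hratio T x hx) hc', ?_⟩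
          intro u v hu hv
          have hθu : ∀ u, α.pullMap k ι x u = 0 → θ (ξ x) (derivTo k ξ x u) = 0 := by
            intro u hu
            have hu1 := (hι₁.pullMap_eq_zero_iff x u).2 hu
            rw [OneForm.pullMap_apply, hDι₁ x hx, ← hκξ x hx, ContinuousLinearMap.comp_apply,
              hpull _ (hξB x hx)] at hu1
            exact (mul_eq_zero.1 hu1).resolve_left (hc0 _ (hξB x hx))
          have h1 : φ (σ T) x = κ (Ψ (σ T, ξ x)) := glue_of_mem _ _ hx
          rw [mul_assoc, ← hcx u v hu hv, hΦU _ _ x hx, hDι₁ x hx, h1, ← hκξ x hx]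
          simp only [ContinuousLinearMap.comp_apply]
          rw [hext _ (hΨB _ (hσI T) x hx) _ _ (by rw [hΨ.form]; exact hθu u hu)
            (by rw [hΨ.form]; exact hθu v hv), hΨ.ext,
            hext _ (hξB x hx) _ _ (hθu u hu) (hθu v hv)]
          field_simp [hc0 _ (hξB x hx)]
        · have h2 : x ∉ C := fun h => hx (hCU h)
          refine ⟨c', hc', fun u v hu hv => ?_⟩
          rw [hΦC _ _ x h2, hφC _ x h2]
          exact hcx u v hu hv
      initial := by
        intro T hT
        funext x
        show φ (σ T) x = ι₁ x
        rw [hσ0 T hT]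
        by_cases hx : x ∈ U
        · simp only [hφ, glue_of_mem _ _ hx, hΨ.initial, hκξ x hx]
        · exact glue_of_notMem _ _ hx
      final := by
        intro T hT
        show φ (σ T) = φ 1
        rw [hσ1 T hT]
      genuine := hgen }

end

/-! ### The formal deformation of the lower sheet of the cusp -/

section Gradient

variable {n : ℕ}

theorem inner_gradient (g : Euc n → ℝ) (q u : Euc n) : inner ℝ (gradient g q) u = fderiv ℝ g q u := by
  rw [gradient, InnerProductSpace.toDual_symm_apply]

theorem contDiff_gradient {g : Euc n → ℝ} (hg : ContDiff ℝ ∞ g) : ContDiff ℝ ∞ (gradient g) := by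
  rw [contDiff_euclidean]
  intro i
  have h1 : (fun q => gradient g q i) = fun q => fderiv ℝ g q (EuclideanSpace.single i 1) := by
    funext q
    rw [← inner_gradient, EuclideanSpace.inner_single_right]
    simp
  rw [h1]
  exact (hg.fderiv_right (m := ∞) (by simp)).clm_apply contDiff_const

theorem inner_fderiv_gradient_comm {g : Euc n → ℝ} (hg : ContDiff ℝ ∞ g) (q u v : Euc n) :
    inner ℝ (fderiv ℝ (gradient g) q u) v = inner ℝ (fderiv ℝ (gradient g) q v) u := by
  have hd : DifferentiableAt ℝ (gradient g) q := (contDiff_gradient hg).differentiable (by simp) q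
  have hd' : DifferentiableAt ℝ (fderiv ℝ g) q :=
    (hg.fderiv_right (m := ∞) (by simp)).differentiable (by simp) q
  have key : ∀ u v, inner ℝ (fderiv ℝ (gradient g) q u) v = fderiv ℝ (fderiv ℝ g) q u v := by
    intro u v
    have h1 : HasFDerivAt (fun q => inner ℝ (gradient g q) v)
        ((fderivInnerCLM ℝ (gradient g q, v)).comp ((fderiv ℝ (gradient g) q).prod 0)) q :=
      hd.hasFDerivAt.inner ℝ (hasFDerivAt_const v q)
    have h2 : HasFDerivAt (fun q => fderiv ℝ g q v) ((fderiv ℝ (fderiv ℝ g) q).flip v) q := by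
      simpa using! hd'.hasFDerivAt.clm_apply (hasFDerivAt_const v q)
    simp only [inner_gradient] at h1
    have := DFunLike.congr_fun (h1.unique h2) u
    simpa using! this
  rw [key, key]
  exact (hg.contDiffAt.isSymmSndFDerivAt (by
    rw [minSmoothness_of_isRCLikeNormedField]; exact WithTop.coe_le_coe.2 (le_top (a := (2 : ℕ∞))))) u v

end Gradient

/-! ### The bump function and the vector field along its circle -/

section Bump

variable {n : ℕ} [NeZero n]

theorem tsupport_nhds_compl {g : Euc n → ℝ} {q : Euc n} (hq : q ∉ tsupport fun q => g q + 1) :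
    g =ᶠ[𝓝 q] fun _ => -1 := by
  have := notMem_tsupport_iff_eventuallyEq.1 hq
  filter_upwards [this] with y hy
  have : g y + 1 = 0 := hy
  linarith

/-- A bump around a circle, and a vector field along the circle. -/
theorem IsCircleBump.exists_field {ε : ℝ} {g : Euc n → ℝ} (h : IsCircleBump ε g) :
    ContDiff ℝ ∞ g ∧ IsCompact (tsupport fun q => g q + 1) ∧
      (∀ q ∈ tsupport fun q => g q + 1, ε ^ 2 < q 0 ^ 3) ∧
      ∃ W : Euc n → Euc n, ContDiff ℝ ∞ W ∧ (∀ q, g q = -1 → W q = 0) ∧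
        (∀ q, g q ≠ -1 → W q ≠ 0) ∧ ∀ q, inner ℝ (gradient g q) (W q) = 0 := by
  classical
  obtain ⟨δ, b, τ, hδ0, hδ1, hb, hb0, hbδ, hτ, hper, hinj, himm, hε, hgτ, hgo⟩ := h
  have hperZ : ∀ (j : ℤ) θ x, τ (θ + j, x) = τ (θ, x) := fun j θ x => by
    have hp : Function.Periodic (fun θ => τ (θ, x)) 1 := fun θ => hper θ x
    simpa using hp.int_mul j θ
  set S : Set (Euc n) := τ '' (Icc 0 1 ×ˢ Metric.closedBall 0 (Real.sqrt δ)) with hS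
  have hSc : IsCompact S := (isCompact_Icc.prod (isCompact_closedBall _ _)).image hτ.continuous
  have hsq : Real.sqrt δ < 1 := by
    rw [Real.sqrt_lt' one_pos]; simpa using hδ1
  have hmemS : ∀ θ x, ‖x‖ ≤ Real.sqrt δ → τ (θ, x) ∈ S := by
    intro θ x hx
    refine ⟨(Int.fract θ, x), ⟨⟨Int.fract_nonneg θ, (Int.fract_lt_one θ).le⟩, by simpa using hx⟩, ?_⟩
    rw [← hperZ ⌊θ⌋, Int.fract_add_floor]
  have hgS : ∀ q ∉ S, g q = -1 := by
    intro q hq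
    by_cases h1 : ∃ θ x, ‖x‖ ≤ 1 ∧ τ (θ, x) = q
    · obtain ⟨θ, x, hx, rfl⟩ := h1
      rw [hgτ θ x hx]
      apply hbδ
      by_contra! h2
      exact hq (hmemS θ x (Real.le_sqrt_of_sq_le h2))
    · push Not at h1
      exact hgo q h1
  have hSε : ∀ q ∈ S, ε ^ 2 < q 0 ^ 3 := by
    rintro _ ⟨⟨θ, x⟩, ⟨-, hx⟩, rfl⟩
    exact hε θ x ((by simpa using hx : ‖x‖ ≤ Real.sqrt δ).trans hsq.le)
  have hts : tsupport (fun q => g q + 1) ⊆ S := by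
    refine closure_minimal (fun q hq => ?_) hSc.isClosed
    by_contra h1
    exact hq (by simp [hgS q h1])
  have hev : ∀ q ∉ S, g =ᶠ[𝓝 q] fun _ => -1 := fun q hq => by
    filter_upwards [hSc.isClosed.isOpen_compl.mem_nhds hq] with y hy using hgS y hy
  -- local coordinates along the tube
  have hloc : ∀ q ∈ S, ∃ σ : Euc n → ℝ × Euc (n - 1), ContDiffAt ℝ ∞ σ q ∧
      ∀ᶠ y in 𝓝 q, ‖(σ y).2‖ ≤ 1 ∧ τ (σ y) = y := by
    rintro _ ⟨p, ⟨-, hx⟩, rfl⟩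
    have hx : ‖p.2‖ < 1 := (by simpa using hx : ‖p.2‖ ≤ Real.sqrt δ).trans_lt hsq
    have hdim : Module.finrank ℝ (ℝ × Euc (n - 1)) = Module.finrank ℝ (Euc n) := by
      have := NeZero.one_le (n := n)
      simp; omega
    let L : (ℝ × Euc (n - 1)) ≃L[ℝ] Euc n :=
      (LinearEquiv.ofInjectiveOfFinrankEq (fderiv ℝ τ p).toLinearMap (himm p.1 p.2 hx.le)
        hdim).toContinuousLinearEquiv
    have hL : HasStrictFDerivAt τ (L : ℝ × Euc (n - 1) →L[ℝ] Euc n) p := by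
      refine (hτ.contDiffAt.hasStrictFDerivAt (by simp)).congr_fderiv ?_
      ext v <;> rfl
    refine ⟨hL.localInverse _ _ _, hτ.contDiffAt.to_localInverse hL.hasFDerivAt (by simp), ?_⟩
    have h1 : ContinuousAt (hL.localInverse _ _ _) (τ p) := hL.localInverse_continuousAt
    have h2 : hL.localInverse _ _ _ (τ p) = p := hL.localInverse_apply_image
    have h3 : ∀ᶠ y in 𝓝 (τ p), ‖(hL.localInverse _ _ _ y).2‖ < 1 := by
      refine (continuous_snd.norm.continuousAt.comp h1).eventually (gt_mem_nhds ?_)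
      simpa [h2] using hx
    filter_upwards [h3, hL.eventually_right_inverse] with y hy hy' using ⟨hy.le, hy'⟩
  have hbn : ContDiff ℝ ∞ fun p : ℝ × Euc (n - 1) => b (‖p.2‖ ^ 2) :=
    hb.comp (contDiff_snd.norm_sq ℝ)
  have hg : ContDiff ℝ ∞ g := by
    rw [contDiff_iff_contDiffAt]
    intro q
    by_cases hq : q ∈ S
    · obtain ⟨σ, hσ, hσe⟩ := hloc q hq
      refine (hbn.contDiffAt.comp q hσ).congr_of_eventuallyEq ?_
      filter_upwards [hσe] with y hy
      rw [Function.comp_apply, ← hgτ (σ y).1 (σ y).2 hy.1, Prod.mk.eta, hy.2]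
    · exact contDiffAt_const.congr_of_eventuallyEq (hev q hq)
  refine ⟨hg, hSc.of_isClosed_subset (isClosed_tsupport _) hts, fun q hq => hSε q (hts hq), ?_⟩
  have hperD : ∀ (j : ℤ) θ x, fderiv ℝ τ (θ + j, x) = fderiv ℝ τ (θ, x) := by
    intro j θ x
    have h1 : (fun p : ℝ × Euc (n - 1) => τ (p + ((j : ℝ), 0))) = τ := by
      funext p
      obtain ⟨θ, x⟩ := p
      simpa using hperZ j θ x
    have h2 := fderiv_comp_add_right (𝕜 := ℝ) (f := τ) (x := (θ, x))
      (((j : ℝ), 0) : ℝ × Euc (n - 1))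
    rw [h1] at h2
    simpa using h2.symm
  -- The field is `(g + 1) ∂τ/∂θ`. Since `g` does not depend on the angle, it is tangent to the
  -- levels of `g`, and it vanishes exactly where `g = -1`. Preimages under `τ` differ by whole
  -- periods, under which the derivative of `τ` is invariant.
  let W : Euc n → Euc n := fun q =>
    if hq : ∃ p : ℝ × Euc (n - 1), ‖p.2‖ ≤ 1 ∧ τ p = q then
      (g q + 1) • fderiv ℝ τ hq.choose (1, 0) else 0
  have hW : ∀ p : ℝ × Euc (n - 1), ‖p.2‖ ≤ 1 →
      W (τ p) = (g (τ p) + 1) • fderiv ℝ τ p (1, 0) := by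
    intro p hp
    have hq : ∃ p' : ℝ × Euc (n - 1), ‖p'.2‖ ≤ 1 ∧ τ p' = τ p := ⟨p, hp, rfl⟩
    have h1 : W (τ p) = (g (τ p) + 1) • fderiv ℝ τ hq.choose (1, 0) := dif_pos hq
    obtain ⟨h2, h3⟩ := hq.choose_spec
    rw [h1]
    congr 2
    obtain ⟨h4, j, h5⟩ := hinj p.1 hq.choose.1 p.2 hq.choose.2 hp h2 h3.symm
    have h6 : hq.choose = (p.1 + j, p.2) := Prod.ext h5 h4.symm
    rw [h6, hperD]
  refine ⟨W, ?_, ?_, ?_, ?_⟩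
  · rw [contDiff_iff_contDiffAt]
    intro q
    by_cases hq : q ∈ S
    · obtain ⟨σ, hσ, hσe⟩ := hloc q hq
      have h1 : ContDiffAt ℝ ∞ (fun y => (g y + 1) • fderiv ℝ τ (σ y) (1, 0)) q :=
        (hg.contDiffAt.add contDiffAt_const).smul
          ((ContDiffAt.comp (g := fderiv ℝ τ) q
            (hτ.fderiv_right (m := ∞) (by simp)).contDiffAt hσ).clm_apply contDiffAt_const)
      refine h1.congr_of_eventuallyEq ?_
      filter_upwards [hσe] with y hy
      have := hW (σ y) hy.1
      rwa [hy.2] at this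
    · have h1 : W =ᶠ[𝓝 q] fun _ => 0 := by
        filter_upwards [hev q hq] with y hy
        by_cases h2 : ∃ p : ℝ × Euc (n - 1), ‖p.2‖ ≤ 1 ∧ τ p = y
        · obtain ⟨p, hp, rfl⟩ := h2
          rw [hW p hp, hy]; simp
        · exact dif_neg h2
      exact contDiffAt_const.congr_of_eventuallyEq h1
  · intro q hq
    by_cases h2 : ∃ p : ℝ × Euc (n - 1), ‖p.2‖ ≤ 1 ∧ τ p = q
    · obtain ⟨p, hp, rfl⟩ := h2
      rw [hW p hp, hq]; simp
    · exact dif_neg h2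
  · intro q hq
    have hqS : q ∈ S := by
      by_contra h1
      exact hq (hgS q h1)
    obtain ⟨σ, hσ, hσe⟩ := hloc q hqS
    obtain ⟨h1, h2⟩ := hσe.self_of_nhds
    rw [← h2, hW _ h1, h2]
    refine smul_ne_zero (fun h3 => hq (by linarith)) fun h3 => ?_
    have := himm (σ q).1 (σ q).2 h1 (h3.trans (map_zero _).symm)
    simp at this
  · intro q
    rw [inner_gradient]
    by_cases h2 : ∃ p : ℝ × Euc (n - 1), ‖p.2‖ ≤ 1 ∧ τ p = q
    · obtain ⟨p, hp, rfl⟩ := h2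
      rw [hW p hp, map_smul]
      have h3 : HasDerivAt (fun θ : ℝ => (θ, p.2)) ((1 : ℝ), (0 : Euc (n - 1))) p.1 :=
        (hasDerivAt_id p.1).prodMk (hasDerivAt_const p.1 p.2)
      have h4 : HasFDerivAt (fun p => g (τ p)) ((fderiv ℝ g (τ p)).comp (fderiv ℝ τ p)) p :=
        (hg.differentiable (by simp) _).hasFDerivAt.comp p
          (hτ.differentiable (by simp) p).hasFDerivAt
      have h5 := HasFDerivAt.comp_hasDerivAt (f := fun θ : ℝ => (θ, p.2)) p.1 h4 h3
      have h6 : ((fun p => g (τ p)) ∘ fun θ : ℝ => (θ, p.2)) = fun _ => b (‖p.2‖ ^ 2) := by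
        funext θ
        exact hgτ θ p.2 hp
      rw [h6] at h5
      have h7 : fderiv ℝ g (τ p) (fderiv ℝ τ p (1, 0)) = 0 :=
        h5.unique (hasDerivAt_const _ _)
      rw [h7, smul_zero]
    · have h1 : W q = 0 := dif_neg h2
      rw [h1, map_zero]

end Bump

/-! ### The displaced path of the lower sheet and its formal derivative -/

section Deformation

variable {n : ℕ}

/-- The inner product as a bilinear map. -/
def innerCLM (n : ℕ) : Euc n →L[ℝ] Euc n →L[ℝ] ℝ :=
  LinearMap.toContinuousLinearMap
    { toFun := fun p => innerSL ℝ p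
      map_add' := fun p q => by ext; simp [inner_add_left]
      map_smul' := fun c p => by ext; simp [inner_smul_left] }

@[simp] theorem innerCLM_apply (p u : Euc n) : innerCLM n p u = inner ℝ p u := rfl

/-- The projection `(t, p, q) ↦ q`. -/
def projQ (n : ℕ) : Model n →L[ℝ] Euc n :=
  (ContinuousLinearMap.snd ℝ (Euc n) (Euc n)).comp (ContinuousLinearMap.snd ℝ ℝ (Euc n × Euc n))

/-- The projection `(t, p, q) ↦ p`. -/
def projP (n : ℕ) : Model n →L[ℝ] Euc n :=
  (ContinuousLinearMap.fst ℝ (Euc n) (Euc n)).comp (ContinuousLinearMap.snd ℝ ℝ (Euc n × Euc n))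

/-- The inclusion `p ↦ (0, p, 0)`. -/
def inclP (n : ℕ) : Euc n →L[ℝ] Model n :=
  (ContinuousLinearMap.inr ℝ ℝ (Euc n × Euc n)).comp (ContinuousLinearMap.inl ℝ (Euc n) (Euc n))

@[simp] theorem projQ_apply (w : Model n) : projQ n w = w.2.2 := rfl
@[simp] theorem projP_apply (w : Model n) : projP n w = w.2.1 := rfl
@[simp] theorem inclP_apply (p : Euc n) : inclP n p = (0, p, 0) := rfl

/-- The standard contact form, as a functional depending on the point. -/
def stdFormL (n : ℕ) (w : Model n) : Model n →L[ℝ] ℝ :=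
  ContinuousLinearMap.fst ℝ ℝ (Euc n × Euc n) + (innerCLM n w.2.1).comp (projQ n)

theorem stdFormL_apply (w v : Model n) : stdFormL n w v = stdForm w v := rfl

theorem hasFDerivAt_stdFormL (w : Model n) : HasFDerivAt (stdFormL n)
    ((((ContinuousLinearMap.compL ℝ (Model n) (Euc n) ℝ).flip (projQ n)).comp (innerCLM n)).comp
      (projP n)) w := by
  have h1 : HasFDerivAt (fun w : Model n => (((ContinuousLinearMap.compL ℝ (Model n) (Euc n) ℝ).flip
      (projQ n)).comp (innerCLM n)).comp (projP n) w)
      ((((ContinuousLinearMap.compL ℝ (Model n) (Euc n) ℝ).flip (projQ n)).comp (innerCLM n)).comp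
      (projP n)) w := ContinuousLinearMap.hasFDerivAt _
  exact h1.const_add (ContinuousLinearMap.fst ℝ ℝ (Euc n × Euc n))

theorem formD_stdFormL (w u v : Model n) :
    formD (stdFormL n) w u v = inner ℝ u.2.1 v.2.2 - inner ℝ v.2.1 u.2.2 := by
  rw [formD, (hasFDerivAt_stdFormL w).fderiv]
  rfl

theorem stdFormL_ne_zero (w : Model n) : stdFormL n w ≠ 0 := by
  intro h
  have := DFunLike.congr_fun h ((1, 0, 0) : Model n)
  simp [stdFormL] at this

/-- The deformation which moves the lower sheet of the cusp to the `1`-jet lift of `g`, displaced in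
the direction of `W` at intermediate times. -/
def sheetDeform (g : Euc n → ℝ) (W : Euc n → Euc n) (v : ℝ × Model n) : Model n :=
  (v.2.1 + v.1 * (g v.2.2.2 + 1),
    v.2.2.1 - v.1 • gradient g v.2.2.2 + (v.1 * (1 - v.1)) • W v.2.2.2, v.2.2.2)

/-- The formal derivative of `sheetDeform`. -/
def sheetDeformLift (g : Euc n → ℝ) (W : Euc n → Euc n) (v : (ℝ × ℝ) × Model n) :
    Model n →L[ℝ] Model n :=
  ContinuousLinearMap.id ℝ (Model n) +
    ((ContinuousLinearMap.inl ℝ ℝ (Euc n × Euc n)).comp ((v.1.2 • fderiv ℝ g v.2.2.2 -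
      (v.1.1 * (v.1.2 * (1 - v.1.2))) • innerCLM n (W v.2.2.2)).comp (projQ n)) +
    (inclP n).comp ((-(v.1.2 • fderiv ℝ (gradient g) v.2.2.2) +
      ((1 - v.1.1) * (v.1.2 * (1 - v.1.2))) • fderiv ℝ W v.2.2.2).comp (projQ n)))

theorem sheetDeformLift_apply (g : Euc n → ℝ) (W : Euc n → Euc n) (S T : ℝ) (w v : Model n) :
    sheetDeformLift g W ((S, T), w) v =
      (v.1 + (T * fderiv ℝ g w.2.2 v.2.2 - S * (T * (1 - T)) * inner ℝ (W w.2.2) v.2.2),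
        v.2.1 + (-(T • fderiv ℝ (gradient g) w.2.2 v.2.2) +
          ((1 - S) * (T * (1 - T))) • fderiv ℝ W w.2.2 v.2.2), v.2.2) := by
  simp [sheetDeformLift, Prod.ext_iff]

/-- The jets of `T (g + 1)` preserve `θ = dt + ∑ p_i dq_i`; the displacement adds `T (1 - T) ⟨W,
dq⟩` to `θ` and the derivative of `W` to that of the map. For `S = 1` the lift subtracts the first
from the `t` component and omits the second, so `θ` and `dθ` are preserved, the latter by symmetry
of the Hessian. Each lift changes `(t, p)` only by a function of `q`, whence injectivity. The factor
`T (1 - T)` makes `S` irrelevant at both ends. -/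
theorem isFormalDeformation_sheetDeform {g : Euc n → ℝ} (hg : ContDiff ℝ ∞ g) {W : Euc n → Euc n}
    (hW : ContDiff ℝ ∞ W) :
    IsFormalDeformation (stdFormL n) (sheetDeform g W) (sheetDeformLift g W) where
  contDiff := by
    have h1 := contDiff_gradient hg
    unfold sheetDeform
    fun_prop
  contDiff_lift := by
    have h1 := contDiff_gradient hg
    have h2 : ContDiff ℝ ∞ (fderiv ℝ g) := hg.fderiv_right (by simp)
    have h3 : ContDiff ℝ ∞ (fderiv ℝ W) := hW.fderiv_right (by simp)
    have h4 : ContDiff ℝ ∞ (fderiv ℝ (gradient g)) := h1.fderiv_right (by simp)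
    have h5 : ContDiff ℝ ∞ fun v : (ℝ × ℝ) × Model n => v.2.2.2 := by fun_prop
    have h6 : ContDiff ℝ ∞ fun v : (ℝ × ℝ) × Model n => innerCLM n (W v.2.2.2) :=
      (innerCLM n).contDiff.comp (hW.comp h5)
    have h7 : ContDiff ℝ ∞ fun v : (ℝ × ℝ) × Model n => v.1.1 * (v.1.2 * (1 - v.1.2)) := by fun_prop
    have h8 : ContDiff ℝ ∞ fun v : (ℝ × ℝ) × Model n =>
      (1 - v.1.1) * (v.1.2 * (1 - v.1.2)) := by fun_prop
    have h9 : ContDiff ℝ ∞ fun v : (ℝ × ℝ) × Model n => v.1.2 := by fun_prop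
    refine contDiff_const.add (ContDiff.add ?_ ?_)
    · exact contDiff_const.clm_comp (((h9.smul (h2.comp h5)).sub (h7.smul h6)).clm_comp
        contDiff_const)
    · exact contDiff_const.clm_comp (((h9.smul (h4.comp h5)).neg.add
        (h8.smul (h3.comp h5))).clm_comp contDiff_const)
  initial := fun w => by simp [sheetDeform]
  start := by
    intro T w
    have hq : HasFDerivAt (fun w : Model n => w.2.2) (projQ n) w := (projQ n).hasFDerivAt
    have hp : HasFDerivAt (fun w : Model n => w.2.1) (projP n) w := (projP n).hasFDerivAt
    have hg1 : HasFDerivAt (fun w : Model n => g w.2.2) ((fderiv ℝ g w.2.2).comp (projQ n)) w :=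
      HasFDerivAt.comp (g := g) w (hg.differentiable (by simp) _).hasFDerivAt hq
    have hg2 : HasFDerivAt (fun w : Model n => gradient g w.2.2)
        ((fderiv ℝ (gradient g) w.2.2).comp (projQ n)) w :=
      HasFDerivAt.comp (g := gradient g) w
        ((contDiff_gradient hg).differentiable (by simp) _).hasFDerivAt hq
    have hW1 : HasFDerivAt (fun w : Model n => W w.2.2) ((fderiv ℝ W w.2.2).comp (projQ n)) w :=
      HasFDerivAt.comp (g := W) w (hW.differentiable (by simp) _).hasFDerivAt hq
    have ht : HasFDerivAt (fun w : Model n => w.1) (ContinuousLinearMap.fst ℝ ℝ (Euc n × Euc n)) w :=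
      hasFDerivAt_fst
    have h1 := (ht.add ((hg1.add_const 1).const_mul T)).prodMk
      (((hp.sub (hg2.const_smul T)).add (hW1.const_smul (T * (1 - T)))).prodMk hq)
    have h2 : fderiv ℝ (fun w => sheetDeform g W (T, w)) w = _ := h1.fderiv
    rw [h2]
    refine ContinuousLinearMap.ext fun v => ?_
    rw [sheetDeformLift_apply]
    simp only [ContinuousLinearMap.prod_apply, ContinuousLinearMap.add_apply,
      ContinuousLinearMap.sub_apply, ContinuousLinearMap.smul_apply,
      ContinuousLinearMap.comp_apply, projQ_apply, projP_apply, ContinuousLinearMap.coe_fst',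
      smul_eq_mul, Prod.mk.injEq]
    refine ⟨by ring, ?_, trivial⟩
    rw [sub_zero, one_mul]
    abel
  left := fun S w => by ext v <;> simp [sheetDeformLift_apply]
  right := fun S w => by ext v <;> simp [sheetDeformLift_apply]
  injective := by
    intro S T w
    rw [injective_iff_map_eq_zero]
    intro v hv
    rw [sheetDeformLift_apply, Prod.ext_iff, Prod.ext_iff] at hv
    obtain ⟨h1, h2, h3⟩ := hv
    simp only [Prod.fst_zero, Prod.snd_zero] at h1 h2 h3
    rw [h3] at h1 h2
    refine Prod.ext ?_ (Prod.ext ?_ h3)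
    · simpa using h1
    · simpa using h2
  form := by
    intro T w v
    rw [stdFormL_apply, stdFormL_apply, sheetDeformLift_apply]
    simp only [stdForm, sheetDeform, inner_add_left, inner_sub_left, real_inner_smul_left,
      inner_gradient]
    ring
  ext := by
    intro T w u v
    rw [formD_stdFormL, formD_stdFormL, sheetDeformLift_apply, sheetDeformLift_apply]
    simp only [sub_self, zero_mul, zero_smul, add_zero, inner_add_left, inner_neg_left,
      real_inner_smul_left, inner_fderiv_gradient_comm hg w.2.2 u.2.2 v.2.2]
    ring

end Deformation

/-! ### The formal isotopy in the cusp chart -/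

section CuspGeometry

variable {n : ℕ} [NeZero n]

theorem deriv_eq_zero_of_cuspProfile {ε : ℝ} {f : ℝ → ℝ} (hf : IsCuspProfile ε f) {ρ : ℝ}
    (hρ : ε < |ρ|) : deriv f ρ = 0 := by
  rcases lt_abs.1 hρ with h | h
  · have : f =ᶠ[𝓝 ρ] fun _ => 1 := by
      filter_upwards [lt_mem_nhds h] with x hx using hf.eq_one x hx
    rw [this.deriv_eq, deriv_const]
  · have : f =ᶠ[𝓝 ρ] fun _ => -1 := by
      filter_upwards [gt_mem_nhds (lt_neg_of_lt_neg h)] with x hx using hf.eq_neg_one x hx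
    rw [this.deriv_eq, deriv_const]

/-- Over this region `|u_1 ^ 3| > ε`, where `f` is locally constant with value `±1`. -/
theorem cusp_sheets {ε : ℝ} {f : ℝ → ℝ} (hf : IsCuspProfile ε f) {w : Model n} (hw : w ∈ cusp n f)
    (hq : ε ^ 2 < w.2.2 0 ^ 3) : w.2.1 = 0 ∧ (w.1 = -1 ∨ w.1 = 1) := by
  obtain ⟨u, rfl⟩ := hw
  have h1 : (cuspMap f u).2.2 0 = u 0 ^ 2 := by simp [cuspMap]
  rw [h1] at hq
  have h2 : ε < |u 0 ^ 3| := by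
    apply lt_of_pow_lt_pow_left₀ 2 (abs_nonneg _)
    rw [sq_abs]
    calc ε ^ 2 < (u 0 ^ 2) ^ 3 := hq
      _ = (u 0 ^ 3) ^ 2 := by ring
  refine ⟨?_, ?_⟩
  · simp [cuspMap, deriv_eq_zero_of_cuspProfile hf h2]
  · rcases lt_abs.1 h2 with h | h
    · exact Or.inr (hf.eq_one _ h)
    · exact Or.inl (hf.eq_neg_one _ (lt_neg_of_lt_neg h))

theorem mem_cusp {ε : ℝ} {f : ℝ → ℝ} (hf : IsCuspProfile ε f) {q : Euc n} (hq : ε ^ 2 < q 0 ^ 3) :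
    ((-1 : ℝ), (0 : Euc n), q) ∈ cusp n f ∧ ((1 : ℝ), (0 : Euc n), q) ∈ cusp n f := by
  have hε := hf.pos
  have h0 : 0 < q 0 := by
    by_contra! h
    have : q 0 ^ 3 ≤ 0 := by
      have : q 0 ^ 3 = q 0 * q 0 ^ 2 := by ring
      rw [this]; exact mul_nonpos_of_nonpos_of_nonneg h (sq_nonneg _)
    nlinarith [sq_nonneg ε]
  have h1 : ε < Real.sqrt (q 0) ^ 3 := by
    apply lt_of_pow_lt_pow_left₀ 2 (by positivity)
    calc ε ^ 2 < q 0 ^ 3 := hq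
      _ = (Real.sqrt (q 0) ^ 2) ^ 3 := by rw [Real.sq_sqrt h0.le]
      _ = (Real.sqrt (q 0) ^ 3) ^ 2 := by ring
  have key : ∀ r : ℝ, r ^ 2 = q 0 → ε < |r ^ 3| → (f (r ^ 3), (0 : Euc n), q) ∈ cusp n f := by
    intro r hr hr3
    refine ⟨WithLp.toLp 2 (Function.update q.ofLp 0 r), ?_⟩
    simp only [cuspMap, Function.update_self, Function.update_idem, hr,
      deriv_eq_zero_of_cuspProfile hf hr3, mul_zero, Function.update_eq_self]
    rw [(EuclideanSpace.single_eq_zero_iff (i := (0 : Fin n)) (a := (0 : ℝ))).2 rfl]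
  constructor
  · have h2 := key (-Real.sqrt (q 0)) (by rw [neg_sq, Real.sq_sqrt h0.le])
      (by rw [Odd.neg_pow (by decide), abs_neg]; exact h1.trans_le (le_abs_self _))
    rwa [hf.eq_neg_one _ (by rw [Odd.neg_pow (by decide)]; linarith)] at h2
  · have h2 := key (Real.sqrt (q 0)) (Real.sq_sqrt h0.le) (h1.trans_le (le_abs_self _))
    rwa [hf.eq_one _ h1] at h2

/-- The square of the Euclidean norm on the model. -/
def normSqM (w : Model n) : ℝ := w.1 ^ 2 + ‖w.2.1‖ ^ 2 + ‖w.2.2‖ ^ 2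

theorem continuous_normSqM : Continuous (normSqM (n := n)) := by
  unfold normSqM; fun_prop

/-- Convexity is used twice: the straight path between the lower sheet and its modification stays in
the ball, and the ball is connected. -/
theorem convexOn_normSqM : ConvexOn ℝ univ (normSqM (n := n)) := by
  have key : ∀ {E : Type} [NormedAddCommGroup E] [NormedSpace ℝ E],
      ConvexOn ℝ univ fun x : E => ‖x‖ ^ 2 := fun {E} _ _ =>
    (convexOn_norm convex_univ).pow (fun x _ => norm_nonneg x) 2
  have h1 := (key (E := ℝ)).comp_linearMap
    (ContinuousLinearMap.fst ℝ ℝ (Euc n × Euc n)).toLinearMap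
  have h2 := (key (E := Euc n)).comp_linearMap (projP n).toLinearMap
  have h3 := (key (E := Euc n)).comp_linearMap (projQ n).toLinearMap
  have h4 := (h1.add h2).add h3
  simp only [preimage_univ] at h4
  have h5 : normSqM (n := n) = (fun x => ‖x‖ ^ 2) ∘ (ContinuousLinearMap.fst ℝ ℝ (Euc n × Euc n)) +
      (fun x => ‖x‖ ^ 2) ∘ (projP n) + (fun x => ‖x‖ ^ 2) ∘ (projQ n) := by
    funext w
    simp [normSqM]
  rw [h5]
  exact h4

theorem isCompact_modelBall (R : ℝ) : IsCompact (modelBall n R) := by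
  have h1 : IsClosed (modelBall n R) := isClosed_le continuous_normSqM continuous_const
  refine (isCompact_closedBall (0 : Model n) |R|).of_isClosed_subset h1 fun w hw => ?_
  have hw : w.1 ^ 2 + ‖w.2.1‖ ^ 2 + ‖w.2.2‖ ^ 2 ≤ R ^ 2 := hw
  have h2 := sq_nonneg w.1
  have h3 := sq_nonneg ‖w.2.1‖
  have h4 := sq_nonneg ‖w.2.2‖
  rw [mem_closedBall_zero_iff, Prod.norm_def, Prod.norm_def]
  refine max_le (sq_le_sq.1 (by linarith)) (max_le ?_ ?_)
  · rw [← abs_of_nonneg (norm_nonneg w.2.1)]; exact sq_le_sq.1 (by linarith)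
  · rw [← abs_of_nonneg (norm_nonneg w.2.2)]; exact sq_le_sq.1 (by linarith)

/-- The properties of the deformation of the lower sheet, for a displacement `W` and a size `e` of
the neighbourhood of the sheet. -/
structure IsSheetData (ε R : ℝ) (g : Euc n → ℝ) (W : Euc n → Euc n) (e : ℝ) : Prop where
  contDiff : ContDiff ℝ ∞ g
  contDiff_field : ContDiff ℝ ∞ W
  isCompact : IsCompact (tsupport fun q => g q + 1)
  region : ∀ q ∈ tsupport fun q => g q + 1, ε ^ 2 < q 0 ^ 3
  field_eq_zero : ∀ q, g q = -1 → W q = 0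
  pos : 0 < e
  le : e ≤ 1 / 2
  ball : ∀ T ∈ Icc (0 : ℝ) 1, ∀ w : Model n, w.2.2 ∈ (tsupport fun q => g q + 1) → |w.1 + 1| ≤ e →
    ‖w.2.1‖ ≤ e → normSqM (sheetDeform g W (T, w)) < R ^ 2
  sep : ∀ T ∈ Icc (0 : ℝ) 1, ∀ w : Model n, w.2.2 ∈ (tsupport fun q => g q + 1) → |w.1 + 1| ≤ e →
    ‖w.2.1‖ ≤ e → |(sheetDeform g W (T, w)).1 - 1| ≤ e → ‖(sheetDeform g W (T, w)).2.1‖ ≤ e → False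

/-- The moving sheet could meet the upper one only where `T (g + 1) = 2` and `-T ∇g + T (1 - T) W =
0`. Pairing the second equation with `W`, which is orthogonal to `∇g` and nonzero there, gives `T =
1`; then `g = 1` and `∇g = 0`, which `hemb` excludes. Compactness makes this quantitative, and the
size `e` of the neighbourhood of the sheet is chosen afterwards. -/
theorem exists_isSheetData {ε r R : ℝ} {g : Euc n → ℝ} (hg : IsCircleBump ε g) (hr : 0 < r)
    (hrR : r < R)
    (hin : ∀ q, g q ≠ -1 → normSqM ((-1 : ℝ), (0 : Euc n), q) ≤ r ^ 2 ∧
      normSqM (g q, -gradient g q, q) ≤ r ^ 2)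
    (hemb : ∀ q, g q = 1 → gradient g q ≠ 0) :
    ∃ W e, IsSheetData ε R g W e := by
  obtain ⟨hgs, hSc, hSε, W₀, hW₀s, hW₀0, hW₀n, hW₀⟩ := hg.exists_field
  set S := tsupport fun q => g q + 1 with hS
  have hgr := contDiff_gradient hgs
  have hinS : ∀ q ∈ S, normSqM ((-1 : ℝ), (0 : Euc n), q) ≤ r ^ 2 ∧
      normSqM (g q, -gradient g q, q) ≤ r ^ 2 := by
    intro q hq
    have h1 : IsClosed {q : Euc n | normSqM ((-1 : ℝ), (0 : Euc n), q) ≤ r ^ 2 ∧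
      normSqM (g q, -gradient g q, q) ≤ r ^ 2} := by
      refine (isClosed_le (continuous_normSqM.comp ?_) continuous_const).inter
        (isClosed_le (continuous_normSqM.comp ?_) continuous_const)
      · fun_prop
      · exact hgs.continuous.prodMk (hgr.continuous.neg.prodMk continuous_id)
    refine closure_minimal (fun q hq => hin q fun h2 => ?_) h1 hq
    exact (Function.mem_support.1 hq) (by simp [h2])
  -- the undisplaced path of the sheet
  let P : ℝ × Euc n → Model n := fun v =>
    (-1 + v.1 * (g v.2 + 1), -(v.1 • gradient g v.2), v.2)
  have hPc : Continuous P := by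
    have := hgs.continuous
    have := hgr.continuous
    fun_prop
  have hPin : ∀ v ∈ Icc (0 : ℝ) 1 ×ˢ S, normSqM (P v) < R ^ 2 := by
    rintro ⟨T, q⟩ ⟨hT, hq⟩
    have h1 := convexOn_normSqM.2 (mem_univ ((-1 : ℝ), (0 : Euc n), q))
      (mem_univ (g q, -gradient g q, q)) (sub_nonneg.2 hT.2) hT.1 (sub_add_cancel 1 T)
    have h2 : (1 - T) • ((-1 : ℝ), (0 : Euc n), q) + T • (g q, -gradient g q, q) = P (T, q) := by
      simp only [P, Prod.smul_mk, Prod.mk_add_mk, smul_eq_mul, smul_zero, zero_add, smul_neg,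
        Prod.mk.injEq]
      refine ⟨by ring, trivial, ?_⟩
      rw [← add_smul, sub_add_cancel, one_smul]
    rw [h2] at h1
    obtain ⟨h3, h4⟩ := hinS q hq
    simp only [smul_eq_mul] at h1
    nlinarith [hT.1, hT.2]
  have hKc : IsCompact (P '' (Icc (0 : ℝ) 1 ×ˢ S)) := (isCompact_Icc.prod hSc).image hPc
  obtain ⟨δ, hδ, hδs⟩ := hKc.exists_thickening_subset_open
    (isOpen_lt continuous_normSqM (continuous_const (y := R ^ 2)))
    (by rintro _ ⟨v, hv, rfl⟩; exact hPin v hv)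
  obtain ⟨b, hb⟩ := hSc.exists_bound_of_continuousOn hW₀s.continuous.continuousOn
  -- The field is scaled down so that the displacement uses at most half of the room `δ` which the
  -- undisplaced path has inside the ball.
  set a : ℝ := δ / (2 * (|b| + 1)) with ha
  have ha0 : 0 < a := by positivity
  have hWb : ∀ q ∈ S, ‖a • W₀ q‖ < δ / 2 := by
    intro q hq
    rw [norm_smul, Real.norm_of_nonneg ha0.le, ha]
    have h1 : ‖W₀ q‖ < |b| + 1 := ((hb q hq).trans (le_abs_self b)).trans_lt (by linarith)
    calc δ / (2 * (|b| + 1)) * ‖W₀ q‖ < δ / (2 * (|b| + 1)) * (|b| + 1) := by gcongr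
      _ = δ / 2 := by field_simp
  -- the distance from the upper sheet
  let D : ℝ × Euc n → ℝ := fun v => |v.1 * (g v.2 + 1) - 2| +
    ‖-(v.1 • gradient g v.2) + (v.1 * (1 - v.1)) • a • W₀ v.2‖
  have hDc : Continuous D := by
    have := hgs.continuous
    have := hgr.continuous
    have := hW₀s.continuous
    fun_prop
  have hDpos : ∀ v ∈ Icc (0 : ℝ) 1 ×ˢ S, 0 < D v := by
    rintro ⟨T, q⟩ ⟨hT, hq⟩
    refine lt_of_le_of_ne (by positivity) fun h0 => ?_
    have h1 : |T * (g q + 1) - 2| = 0 ∧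
        ‖-(T • gradient g q) + (T * (1 - T)) • a • W₀ q‖ = 0 :=
      (add_eq_zero_iff_of_nonneg (abs_nonneg _) (norm_nonneg _)).1 h0.symm
    have h2 : T * (g q + 1) = 2 := by linarith [abs_eq_zero.1 h1.1]
    have h3 := norm_eq_zero.1 h1.2
    have hT0 : T ≠ 0 := fun h => by rw [h, zero_mul] at h2; norm_num at h2
    have hgq : g q ≠ -1 := fun h => by rw [h] at h2; norm_num at h2
    have h4 : inner ℝ (-(T • gradient g q) + (T * (1 - T)) • a • W₀ q) (W₀ q) = (0 : ℝ) := by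
      rw [h3, inner_zero_left]
    rw [inner_add_left, inner_neg_left, real_inner_smul_left, hW₀, real_inner_smul_left,
      real_inner_smul_left, real_inner_self_eq_norm_sq, mul_zero, neg_zero, zero_add] at h4
    have h5 : ‖W₀ q‖ ≠ 0 := norm_ne_zero_iff.2 (hW₀n q hgq)
    have h6 : 1 - T = 0 := by
      by_contra h7
      exact (mul_ne_zero (mul_ne_zero hT0 h7) (mul_ne_zero ha0.ne' (pow_ne_zero 2 h5))) h4
    have h7 : T = 1 := by linarith
    subst h7
    refine hemb q (by linarith) ?_
    simpa using h3
  obtain ⟨d, hd, hdD⟩ : ∃ d > 0, ∀ v ∈ Icc (0 : ℝ) 1 ×ˢ S, d ≤ D v := by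
    rcases (Icc (0 : ℝ) 1 ×ˢ S).eq_empty_or_nonempty with h1 | h1
    · exact ⟨1, one_pos, by simp [h1]⟩
    · obtain ⟨v, hv, hmin⟩ := (isCompact_Icc.prod hSc).exists_isMinOn h1 hDc.continuousOn
      exact ⟨D v, hDpos v hv, fun v' hv' => hmin hv'⟩
  -- The bound `1/2` keeps neighbourhoods of the sheets `t = ±1` apart, `δ/4` keeps the motion in
  -- the ball, and `d/8` makes the four errors of size `e` add up to less than the distance `d` from
  -- the upper sheet.
  set e : ℝ := min (1 / 2) (min (δ / 4) (d / 8)) with he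
  have he0 : 0 < e := by positivity
  have he1 : e ≤ 1 / 2 := min_le_left _ _
  have he2 : e ≤ δ / 4 := (min_le_right _ _).trans (min_le_left _ _)
  have he3 : e ≤ d / 8 := (min_le_right _ _).trans (min_le_right _ _)
  refine ⟨fun q => a • W₀ q, e, hgs, hW₀s.const_smul a, hSc, hSε,
    fun q hq => by simp [hW₀0 q hq], he0, he1, ?_, ?_⟩
  · intro T hT w hq ht hp
    refine hδs ?_
    rw [Metric.mem_thickening_iff]
    refine ⟨P (T, w.2.2), ⟨(T, w.2.2), ⟨hT, hq⟩, rfl⟩, ?_⟩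
    rw [dist_eq_norm]
    have h1 : sheetDeform g (fun q => a • W₀ q) (T, w) - P (T, w.2.2) =
        (w.1 + 1, w.2.1 + (T * (1 - T)) • a • W₀ w.2.2, 0) := by
      simp only [sheetDeform, P, Prod.mk_sub_mk, Prod.mk.injEq]
      refine ⟨by ring, by abel, sub_self _⟩
    rw [h1, Prod.norm_def, Prod.norm_def]
    refine max_lt (ht.trans_lt (by linarith)) (max_lt ?_ (by simpa using hδ))
    have h2 : ‖(T * (1 - T)) • a • W₀ w.2.2‖ ≤ ‖a • W₀ w.2.2‖ := by
      rw [norm_smul]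
      refine mul_le_of_le_one_left (norm_nonneg _) ?_
      rw [Real.norm_eq_abs, abs_le]
      constructor <;> nlinarith [hT.1, hT.2]
    calc ‖w.2.1 + (T * (1 - T)) • a • W₀ w.2.2‖
        ≤ ‖w.2.1‖ + ‖(T * (1 - T)) • a • W₀ w.2.2‖ := norm_add_le _ _
      _ < δ := by linarith [hWb _ hq]
  · intro T hT w hq ht hp ht' hp'
    have h1 := hdD (T, w.2.2) ⟨hT, hq⟩
    simp only [sheetDeform] at ht' hp'
    have h2 : |T * (g w.2.2 + 1) - 2| ≤ e + e := by
      have : T * (g w.2.2 + 1) - 2 = (w.1 + T * (g w.2.2 + 1) - 1) - (w.1 + 1) := by ring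
      rw [this]
      exact (abs_sub _ _).trans (add_le_add ht' ht)
    have h3 : ‖-(T • gradient g w.2.2) + (T * (1 - T)) • a • W₀ w.2.2‖ ≤ e + e := by
      have : -(T • gradient g w.2.2) + (T * (1 - T)) • a • W₀ w.2.2 =
        (w.2.1 - T • gradient g w.2.2 + (T * (1 - T)) • a • W₀ w.2.2) - w.2.1 := by abel
      rw [this]
      exact (norm_sub_le _ _).trans (add_le_add hp' hp)
    have h4 : D (T, w.2.2) ≤ (e + e) + (e + e) := add_le_add h2 h3
    linarith

namespace IsSheetData

variable {ε R e : ℝ} {g : Euc n → ℝ} {W : Euc n → Euc n}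

theorem sheetDeform_eq (h : IsSheetData ε R g W e) {w : Model n}
    (hw : w.2.2 ∉ tsupport fun q => g q + 1) (T : ℝ) : sheetDeform g W (T, w) = w := by
  have h1 := tsupport_nhds_compl hw
  have h2 : g w.2.2 = -1 := h1.self_of_nhds
  have h3 : gradient g w.2.2 = 0 := by
    rw [gradient, h1.fderiv_eq]; simp
  simp [sheetDeform, h2, h3, h.field_eq_zero _ h2]

theorem sheetDeformLift_eq (h : IsSheetData ε R g W e) {w : Model n}
    (hw : w.2.2 ∉ tsupport fun q => g q + 1) (S T : ℝ) :
    sheetDeformLift g W ((S, T), w) = ContinuousLinearMap.id ℝ (Model n) := by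
  have h1 := tsupport_nhds_compl hw
  have h2 : W =ᶠ[𝓝 w.2.2] fun _ => 0 := by
    filter_upwards [h1] with q hq using h.field_eq_zero q hq
  have h3 : gradient g =ᶠ[𝓝 w.2.2] fun _ => 0 := by
    filter_upwards [h1.eventually_nhds] with q hq
    rw [gradient, Filter.EventuallyEq.fderiv_eq hq]; simp
  refine ContinuousLinearMap.ext fun v => ?_
  rw [sheetDeformLift_apply, h1.fderiv_eq, h2.fderiv_eq, h3.fderiv_eq, h2.self_of_nhds]
  simp

theorem sheetDeform_injective (g : Euc n → ℝ) (W : Euc n → Euc n) (T : ℝ) :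
    Function.Injective fun w => sheetDeform g W (T, w) := by
  intro w w' hww
  simp only [sheetDeform, Prod.mk.injEq] at hww
  obtain ⟨h1, h2, h3⟩ := hww
  rw [h3] at h1 h2
  refine Prod.ext (by linarith) (Prod.ext ?_ h3)
  simpa using h2

end IsSheetData

/-- The neighbourhood of the part of the lower sheet which is modified. -/
def sheetBox (R : ℝ) (g : Euc n → ℝ) (e : ℝ) : Set (Model n) :=
  {w | w ∈ modelBall n R ∧ |w.1 + 1| ≤ e / 2 ∧ ‖w.2.1‖ ≤ e / 2 ∧ w.2.2 ∈ tsupport fun q => g q + 1}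

theorem isCompact_sheetBox (R : ℝ) (g : Euc n → ℝ) (e : ℝ) : IsCompact (sheetBox R g e) := by
  refine (isCompact_modelBall R).inter_right (t := {w : Model n | |w.1 + 1| ≤ e / 2 ∧
    ‖w.2.1‖ ≤ e / 2 ∧ w.2.2 ∈ tsupport fun q => g q + 1}) ?_
  have h1 : Continuous fun w : Model n => |w.1 + 1| := by fun_prop
  have h2 : Continuous fun w : Model n => ‖w.2.1‖ := by fun_prop
  exact (isClosed_le h1 continuous_const).inter ((isClosed_le h2 continuous_const).inter
    ((isClosed_tsupport _).preimage (projQ n).continuous))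

end CuspGeometry

/-! ### The stabilizing map on the contact manifold -/

section Chart

variable {k : ℕ} {N : Type*} [TopologicalSpace N] [ChartedSpace (Euc k) N] [IsManifold (𝓡 k) ∞ N]
variable {n : ℕ} [NeZero n] {m : ℕ} {M : Type*} [TopologicalSpace M] [ChartedSpace (Euc m) M]
  [IsManifold (𝓡 m) ∞ M]

/-- In the interior of the ball of a cusp chart, the contact form is a multiple of the standard
form, with a factor of constant sign. -/
theorem IsModelDomain.exists_factor {α : OneForm m M} (hα : IsContactForm α) {κ : Model n → M}
    {R : ℝ} {O : Set (Model n)} (h : IsModelDomain α (modelBall n R) stdForm κ O) :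
    ∃ c : Model n → ℝ, (∀ w, normSqM w < R ^ 2 → α.pull κ w = c w • stdFormL n w) ∧
      ∀ w, normSqM w < R ^ 2 → ∀ w', normSqM w' < R ^ 2 → 0 < c w * c w' := by
  let E : Model n := (1, 0, 0)
  let c : Model n → ℝ := fun w => α.pull κ w E
  have hE : ∀ w, stdFormL n w E = 1 := fun w => by simp [stdFormL, E]
  have hker : ∀ w, normSqM w < R ^ 2 → ∀ v, stdFormL n w v = 0 ↔ α.pull κ w v = 0 :=
    fun w hw v => h.ker w (le_of_lt hw : _ ≤ R ^ 2) v
  have hc0 : ∀ w, normSqM w < R ^ 2 → c w ≠ 0 := fun w hw h0 => by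
    have := (hker w hw E).2 h0
    rw [hE] at this
    exact one_ne_zero this
  have hO : ∀ w, normSqM w < R ^ 2 → w ∈ O := fun w hw => h.subset (le_of_lt hw : _ ≤ R ^ 2)
  have hcont : ContinuousOn c {w | normSqM w < R ^ 2} := fun w hw =>
    (((OneForm.hasFDerivAt_pull hα.smooth (h.contMDiffAt (hO w hw))).1.continuousAt.clm_apply
      continuousAt_const)).continuousWithinAt
  have hpre : IsPreconnected {w : Model n | normSqM w < R ^ 2} := by
    have := (convexOn_normSqM (n := n)).convex_lt (R ^ 2)
    simp only [mem_univ, true_and] at this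
    exact this.isPreconnected
  refine ⟨c, fun w hw => ?_, fun w hw w' hw' => ?_⟩
  · have h1 := eq_smul_of_ker_eq (A := α.pull κ w) (B := stdFormL n w)
      (fun u hu => (hker w hw u).1 hu) (R := E) (by rw [hE]; exact one_ne_zero)
    rwa [hE, div_one] at h1
  -- A change of sign would produce a zero of `c`, since the open ball is connected.
  · by_contra hneg
    rw [not_lt] at hneg
    have h0 : (0 : ℝ) ∈ c '' {w | normSqM w < R ^ 2} := by
      rcases mul_nonpos_iff.1 hneg with ⟨h1, h2⟩ | ⟨h1, h2⟩
      · exact hpre.intermediate_value hw' hw hcont ⟨h2, h1⟩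
      · exact hpre.intermediate_value hw hw' hcont ⟨h1, h2⟩
    obtain ⟨w₀, hw₀, h1⟩ := h0
    exact hc0 w₀ hw₀ h1

/-- The modification of `M` near the lower sheet of the cusp which stabilizes the cusp. -/
def sheetMove (κ : Model n → M) (O : Set (Model n)) (R : ℝ) (g : Euc n → ℝ) (W : Euc n → Euc n)
    (e : ℝ) : M → M :=
  glue (κ '' sheetBox R g e) (fun p => κ (sheetDeform g W (1, Function.invFunOn κ O p))) id

/-- By `hnear`, over the support of the bump the divisor enters the ball only close to one of the
two sheets. The part near the lower sheet is moved, the rest stays. The sizes `e / 2` and `e`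
provide the closed set `C` inside the open set `U` on which the formal deformation takes place. -/
theorem exists_formalIsotopy_sheetMove [T2Space M] {α : OneForm m M} (hα : IsContactForm α)
    (hm : m = 2 * n + 1) {ι ι₁ : N → M} (hι : IsContactSubmanifold k α ι)
    (hι₁ : IsContactCopy k α ι ι₁) {κ : Model n → M} {R : ℝ} {O : Set (Model n)}
    (h : IsModelDomain α (modelBall n R) stdForm κ O) {ε e : ℝ} {g : Euc n → ℝ} {W : Euc n → Euc n}
    (hs : IsSheetData ε R g W e)
    (hnear : ∀ x, ∀ w ∈ modelBall n R, κ w = ι₁ x → w.2.2 ∈ (tsupport fun q => g q + 1) →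
      (|w.1 + 1| ≤ e / 2 ∧ ‖w.2.1‖ ≤ e / 2) ∨ (|w.1 - 1| ≤ e ∧ ‖w.2.1‖ ≤ e)) :
    IsContactCopy k α ι (fun x => sheetMove κ O R g W e (ι₁ x)) ∧
      Nonempty (FormalIsotopy k α ι ι₁ (fun x => sheetMove κ O R g W e (ι₁ x))) := by
  obtain ⟨c, hc, hcs⟩ := h.exists_factor hα
  set S := tsupport fun q => g q + 1 with hS
  set B : Set (Model n) := {w | normSqM w < R ^ 2} with hB
  have hBo : IsOpen B := isOpen_lt continuous_normSqM continuous_const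
  have hBb : B ⊆ modelBall n R := fun w hw => (le_of_lt hw : _ ≤ R ^ 2)
  have hBO : B ⊆ O := hBb.trans h.subset
  set Q : Set (Model n) := {w | |w.1 + 1| < e ∧ ‖w.2.1‖ < e} with hQ
  have hQo : IsOpen Q := by
    have h1 : Continuous fun w : Model n => |w.1 + 1| := by fun_prop
    have h2 : Continuous fun w : Model n => ‖w.2.1‖ := by fun_prop
    exact (isOpen_lt h1 continuous_const).inter (isOpen_lt h2 continuous_const)
  have he := hs.pos
  have hKB : ∀ w ∈ sheetBox R g e, w ∈ B ∩ Q := by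
    rintro w ⟨h1, h2, h3, h4⟩
    refine ⟨?_, h2.trans_lt (by linarith), h3.trans_lt (by linarith)⟩
    have := hs.ball 0 ⟨le_rfl, zero_le_one⟩ w h4 (h2.trans (by linarith)) (h3.trans (by linarith))
    rwa [(isFormalDeformation_sheetDeform hs.contDiff hs.contDiff_field).initial] at this
  set inv := Function.invFunOn κ O with hinv
  have hinvw : ∀ w ∈ B, inv (κ w) = w := fun w hw => h.inv_apply (hBO hw)
  set U : Set N := ι₁ ⁻¹' (κ '' (B ∩ Q)) with hU
  set C : Set N := ι₁ ⁻¹' (κ '' sheetBox R g e) with hC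
  have hUo : IsOpen U := (h.isOpen_image hm (hBo.inter hQo) (inter_subset_left.trans hBO)).preimage
    hι₁.contMDiff.continuous
  have hCc : IsClosed C := (h.isCompact_image (isCompact_sheetBox R g e)
    (fun w hw => hBO (hKB w hw).1)).isClosed.preimage hι₁.contMDiff.continuous
  have hCU : C ⊆ U := by
    rintro x ⟨w, hw, hwx⟩
    exact ⟨w, hKB w hw, hwx⟩
  let ξ : N → Model n := fun x => inv (ι₁ x)
  have hξ : ∀ x ∈ U, ξ x ∈ B ∩ Q ∧ κ (ξ x) = ι₁ x := by
    rintro x ⟨w, hw, hwx⟩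
    have : ξ x = w := by
      show inv (ι₁ x) = w
      rw [← hwx, hinvw w hw.1]
    rw [this]
    exact ⟨hw, hwx⟩
  have hξs : ContMDiffOn (𝓡 k) 𝓘(ℝ, Model n) ∞ ξ U := by
    intro x hx
    refine ContMDiffAt.contMDiffWithinAt ?_
    refine ContMDiffAt.comp (g := inv) x ?_ hι₁.contMDiff.contMDiffAt
    rw [← (hξ x hx).2]
    exact h.contMDiffAt_inv hm (hBO (hξ x hx).1.1)
  -- A point of `U` over the support is not near the upper sheet as `e ≤ 1/2`, so it is within `e /
  -- 2` of the lower one. Elsewhere in `U` the deformation is stationary.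
  have hUC : ∀ x ∈ U, (ξ x).2.2 ∈ S → x ∈ C := by
    intro x hx hq
    obtain ⟨⟨h1, h2⟩, h3⟩ := hξ x hx
    rcases hnear x (ξ x) (hBb h1) h3 hq with h4 | h4
    · exact ⟨ξ x, ⟨hBb h1, h4.1, h4.2, hq⟩, h3⟩
    · exfalso
      have h5 := abs_lt.1 h2.1
      have h6 := abs_le.1 h4.1
      linarith [hs.le, h5.1, h5.2, h6.1, h6.2]
  have hΨ := isFormalDeformation_sheetDeform hs.contDiff hs.contDiff_field
  have hΨB : ∀ T ∈ Icc (0 : ℝ) 1, ∀ x ∈ U, sheetDeform g W (T, ξ x) ∈ B := by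
    intro T hT x hx
    obtain ⟨⟨h1, h2⟩, h3⟩ := hξ x hx
    by_cases hq : (ξ x).2.2 ∈ S
    · exact hs.ball T hT _ hq h2.1.le h2.2.le
    · rw [hs.sheetDeform_eq hq]; exact h1
  -- If a point moved over the support hits `ι₁ x'`, then the latter is near the lower sheet, hence
  -- in `U`, or near the upper one, which `sep` forbids.
  have hmix : ∀ T ∈ Icc (0 : ℝ) 1, ∀ x ∈ U, ∀ x' ∉ U, κ (sheetDeform g W (T, ξ x)) ≠ ι₁ x' := by
    intro T hT x hx x' hx' hxx
    obtain ⟨⟨h1, h2⟩, h3⟩ := hξ x hx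
    by_cases hq : (ξ x).2.2 ∈ S
    · have h4 := hΨB T hT x hx
      rcases hnear x' _ (hBb h4) hxx hq with h5 | h5
      · exact hx' ⟨_, ⟨h4, h5.1.trans_lt (by linarith), h5.2.trans_lt (by linarith)⟩, hxx⟩
      · exact hs.sep T hT _ hq h2.1.le h2.2.le h5.1 h5.2
    · rw [hs.sheetDeform_eq hq, h3] at hxx
      exact hx' (hι₁.injective hxx ▸ hx)
  have hfin : glue U (fun x => κ (sheetDeform g W (1, ξ x))) ι₁ =
      fun x => sheetMove κ O R g W e (ι₁ x) := by
    funext x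
    by_cases hxC : x ∈ C
    · rw [glue_of_mem _ _ (hCU hxC), sheetMove, glue_of_mem _ _ (show ι₁ x ∈ _ from hxC)]
    · rw [sheetMove, glue_of_notMem _ _ (show ι₁ x ∉ _ from hxC), id]
      by_cases hxU : x ∈ U
      · rw [glue_of_mem _ _ hxU, hs.sheetDeform_eq fun hq => hxC (hUC x hxU hq), (hξ x hxU).2]
      · exact glue_of_notMem _ _ hxU
  rw [← hfin]
  refine exists_formalIsotopy_of_formalDeformation hα hι hι₁ hBo (h.contMDiffOn.mono hBO)
    (fun w hw => h.injective_derivFrom w (hBO hw))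
    (fun w => (hasFDerivAt_stdFormL w).differentiableAt) stdFormL_ne_zero hc hcs hUo hCc hCU hξs
    (fun x hx => (hξ x hx).2) (fun x hx => (hξ x hx).1.1) hΨ hΨB ?_ ?_
  · rintro x ⟨hx, hxC⟩ S' T
    have hq : (ξ x).2.2 ∉ S := fun hq => hxC (hUC x hx hq)
    exact ⟨hs.sheetDeform_eq hq T, hs.sheetDeformLift_eq hq S' T⟩
  · intro T hT x y hxy
    by_cases hx : x ∈ U <;> by_cases hy : y ∈ U
    · simp only [glue_of_mem _ _ hx, glue_of_mem _ _ hy] at hxy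
      have h1 := IsSheetData.sheetDeform_injective g W T
        (h.injOn (hBO (hΨB T hT x hx)) (hBO (hΨB T hT y hy)) hxy)
      apply hι₁.injective
      rw [← (hξ x hx).2, ← (hξ y hy).2, h1]
    · simp only [glue_of_mem _ _ hx, glue_of_notMem _ _ hy] at hxy
      exact absurd hxy (hmix T hT x hx y hy)
    · simp only [glue_of_notMem _ _ hx, glue_of_mem _ _ hy] at hxy
      exact absurd hxy.symm (hmix T hT y hy x hx)
    · simp only [glue_of_notMem _ _ hx, glue_of_notMem _ _ hy] at hxy
      exact hι₁.injective hxy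

end Chart

/-! ### Division of smooth maps by a parameter -/

section Hadamard

-- A cut-off `χ`, equal to `1` on `[0, 1]`, gives the integrand compact support in `t`. The integral
-- is then the value at `0` of the convolution of the indicator of `[0, 1]` with the reflected
-- integrand, and convolutions depend smoothly on parameters.
open MeasureTheory in
theorem contDiffOn_intervalIntegral {P F : Type*} [NormedAddCommGroup P] [NormedSpace ℝ P]
    [NormedAddCommGroup F] [NormedSpace ℝ F] [CompleteSpace F] {s : Set P} (hs : IsOpen s)
    {φ : P × ℝ → F} (hφ : ContDiffOn ℝ ∞ φ (s ×ˢ Ioo (-1) 2)) :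
    ContDiffOn ℝ ∞ (fun p => ∫ t in (0 : ℝ)..1, φ (p, t)) s := by
  let χ : ContDiffBump (1 / 2 : ℝ) := ⟨1, 5 / 4, by norm_num, by norm_num⟩
  have hχ1 : ∀ t ∈ Icc (0 : ℝ) 1, χ t = 1 := fun t ht => by
    apply χ.one_of_mem_closedBall
    rw [Metric.mem_closedBall, Real.dist_eq, abs_le]
    show -1 ≤ t - 1 / 2 ∧ t - 1 / 2 ≤ 1
    constructor <;> linarith [ht.1, ht.2]
  have hχ0 : tsupport χ ⊆ Icc (-(3 / 4)) (7 / 4) := by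
    rw [χ.tsupport_eq]
    intro t ht
    rw [Metric.mem_closedBall, Real.dist_eq, abs_le] at ht
    have h1 : -(5 / 4 : ℝ) ≤ t - 1 / 2 := ht.1
    have h2 : t - 1 / 2 ≤ (5 / 4 : ℝ) := ht.2
    constructor <;> linarith
  let g : P → ℝ → F := fun p x => χ (-x) • φ (p, -x)
  have hg : ContDiffOn ℝ ∞ ↿g (s ×ˢ univ) := by
    rintro ⟨p, x⟩ ⟨hp, -⟩
    by_cases hx : -x ∈ Ioo (-1 : ℝ) 2
    · have h1 : ContDiffAt ℝ ∞ φ (p, -x) := (hφ (p, -x) ⟨hp, hx⟩).contDiffAt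
        ((hs.prod isOpen_Ioo).mem_nhds ⟨hp, hx⟩)
      have h2 : ContDiffAt ℝ ∞ (fun q : P × ℝ => (q.1, -q.2)) (p, x) := by fun_prop
      have h3 : ContDiffAt ℝ ∞ (fun q : P × ℝ => φ (q.1, -q.2)) (p, x) :=
        ContDiffAt.comp (g := φ) (p, x) h1 h2
      have h4 : ContDiffAt ℝ ∞ (fun q : P × ℝ => χ (-q.2)) (p, x) :=
        χ.contDiff.contDiffAt.comp (p, x) (by fun_prop)
      exact (h4.smul h3).contDiffWithinAt
    · have h1 : -x ∉ tsupport χ := fun h => hx ⟨by linarith [(hχ0 h).1], by linarith [(hχ0 h).2]⟩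
      have h2 : ↿g =ᶠ[𝓝 (p, x)] fun _ => 0 := by
        have hc : ContinuousAt (fun q : P × ℝ => -q.2) (p, x) := by fun_prop
        filter_upwards [hc.eventually ((isClosed_tsupport χ).isOpen_compl.mem_nhds h1)] with q hq
        show χ (-q.2) • φ (q.1, -q.2) = 0
        rw [image_eq_zero_of_notMem_tsupport hq, zero_smul]
      exact (contDiffAt_const.congr_of_eventuallyEq h2).contDiffWithinAt
  have hgs : ∀ p, ∀ x, p ∈ s → x ∉ Icc (-(7 / 4) : ℝ) (3 / 4) → g p x = 0 := by
    intro p x _ hx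
    have h1 : -x ∉ tsupport χ := fun h => hx ⟨by linarith [(hχ0 h).2], by linarith [(hχ0 h).1]⟩
    show χ (-x) • φ (p, -x) = 0
    rw [image_eq_zero_of_notMem_tsupport h1, zero_smul]
  let f : ℝ → ℝ := (Icc (0 : ℝ) 1).indicator fun _ => 1
  have hf : LocallyIntegrable f volume :=
    ((integrableOn_const (by simp)).integrable_indicator measurableSet_Icc).locallyIntegrable
  have key := contDiffOn_convolution_right_with_param_comp (n := (⊤ : ℕ∞)) (μ := volume)
    (ContinuousLinearMap.lsmul ℝ ℝ) (v := fun _ : P => (0 : ℝ)) contDiffOn_const hs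
    isCompact_Icc hgs hf hg
  refine key.congr fun p hp => ?_
  rw [intervalIntegral.integral_of_le zero_le_one, ← integral_Icc_eq_integral_Ioc,
    ← integral_indicator measurableSet_Icc]
  refine integral_congr_ae (Filter.Eventually.of_forall fun t => ?_)
  simp only [ContinuousLinearMap.lsmul_apply, f, g, zero_sub, neg_neg]
  by_cases ht : t ∈ Icc (0 : ℝ) 1
  · rw [indicator_of_mem ht, indicator_of_mem ht, hχ1 t ht, one_smul, one_smul]
  · rw [indicator_of_notMem ht, indicator_of_notMem ht, zero_smul]

/-- A smooth map `f (x, v)` which vanishes for `v = 0` satisfies `f (x, r v) = r q (r, x, v)` with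
a smooth map `q`. -/
theorem exists_smooth_quotient {X E F : Type*} [NormedAddCommGroup X] [NormedSpace ℝ X]
    [NormedAddCommGroup E] [NormedSpace ℝ E] [NormedAddCommGroup F] [NormedSpace ℝ F]
    [CompleteSpace F] {A : Set X} (hA : IsOpen A) {η : ℝ} {f : X × E → F}
    (hf : ContDiffOn ℝ ∞ f (A ×ˢ Metric.ball 0 η)) (h0 : ∀ x ∈ A, f (x, 0) = 0) :
    ∃ q : ℝ × X × E → F, ContDiffOn ℝ ∞ q {p | p.2.1 ∈ A ∧ |p.1| * ‖p.2.2‖ < η / 2} ∧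
      (∀ r x v, x ∈ A → |r| * ‖v‖ < η / 2 → f (x, r • v) = r • q (r, x, v)) ∧
      (∀ x v, q (0, x, v) = fderiv ℝ f (x, 0) (0, v)) ∧ ∀ r x, q (r, x, 0) = 0 := by
  have hO : IsOpen (A ×ˢ Metric.ball (0 : E) η) := hA.prod Metric.isOpen_ball
  set s : Set (ℝ × X × E) := {p | p.2.1 ∈ A ∧ |p.1| * ‖p.2.2‖ < η / 2} with hs
  have hso : IsOpen s := (hA.preimage (by fun_prop)).inter
    (isOpen_lt (f := fun p : ℝ × X × E => |p.1| * ‖p.2.2‖) (by fun_prop) continuous_const)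
  -- Hadamard's lemma: `f (x, r v) = r ∫₀¹ D₂f (x, t r v) v dt`. Smoothness of the integral needs
  -- the integrand for `t` in `(-1, 2)`, whence the bound `η / 2`.
  let φ : (ℝ × X × E) × ℝ → F := fun w =>
    fderiv ℝ f (w.1.2.1, (w.2 * w.1.1) • w.1.2.2) (0, w.1.2.2)
  have hmem : ∀ p ∈ s, ∀ t ∈ Ioo (-1 : ℝ) 2, (p.2.1, (t * p.1) • p.2.2) ∈
      A ×ˢ Metric.ball (0 : E) η := by
    rintro p ⟨hp1, hp2⟩ t ht
    refine ⟨hp1, ?_⟩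
    rw [mem_ball_zero_iff, norm_smul, norm_mul, Real.norm_eq_abs, Real.norm_eq_abs, mul_assoc]
    have h1 : |t| < 2 := abs_lt.2 ⟨by linarith [ht.1], ht.2⟩
    have h2 : 0 ≤ |p.1| * ‖p.2.2‖ := by positivity
    nlinarith [abs_nonneg t]
  have hφ : ContDiffOn ℝ ∞ φ (s ×ˢ Ioo (-1) 2) := by
    have h1 : ContDiffOn ℝ ∞ (fderiv ℝ f) (A ×ˢ Metric.ball 0 η) :=
      hf.fderiv_of_isOpen hO (by simp)
    have h2 : ContDiffOn ℝ ∞ (fun w : (ℝ × X × E) × ℝ =>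
        (w.1.2.1, (w.2 * w.1.1) • w.1.2.2)) (s ×ˢ Ioo (-1) 2) := by
      apply ContDiff.contDiffOn; fun_prop
    have h3 : ContDiffOn ℝ ∞ (fun w : (ℝ × X × E) × ℝ => ((0 : X), w.1.2.2)) (s ×ˢ Ioo (-1) 2) := by
      apply ContDiff.contDiffOn; fun_prop
    exact (h1.comp h2 fun w hw => hmem w.1 hw.1 w.2 hw.2).clm_apply h3
  refine ⟨fun p => ∫ t in (0 : ℝ)..1, φ (p, t), contDiffOn_intervalIntegral hso hφ, ?_, ?_, ?_⟩
  · intro r x v hx hv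
    have hp : (r, x, v) ∈ s := ⟨hx, hv⟩
    have hI : ∀ t ∈ uIcc (0 : ℝ) 1, t ∈ Ioo (-1 : ℝ) 2 := fun t ht => by
      rw [uIcc_of_le zero_le_one] at ht
      exact ⟨by linarith [ht.1], by linarith [ht.2]⟩
    have hd : ∀ t ∈ uIcc (0 : ℝ) 1, HasDerivAt (fun t : ℝ => f (x, (t * r) • v))
        (r • φ ((r, x, v), t)) t := by
      intro t ht
      have h1 : DifferentiableAt ℝ f (x, (t * r) • v) :=
        ((hf _ (hmem _ hp t (hI t ht))).contDiffAt
          (hO.mem_nhds (hmem _ hp t (hI t ht)))).differentiableAt (by simp)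
      have h2 : HasDerivAt (fun t : ℝ => (x, (t * r) • v)) ((0 : X), r • v) t := by
        refine (hasDerivAt_const t x).prodMk ?_
        have := ((hasDerivAt_id t).mul_const r).smul_const v
        simpa using this
      have h3 := h1.hasFDerivAt.comp_hasDerivAt t h2
      have h4 : fderiv ℝ f (x, (t * r) • v) ((0 : X), r • v) = r • φ ((r, x, v), t) := by
        show _ = r • fderiv ℝ f (x, (t * r) • v) (0, v)
        rw [← map_smul, Prod.smul_mk, smul_zero]
      rw [h4] at h3
      exact h3
    have hc : ContinuousOn (fun t : ℝ => φ ((r, x, v), t)) (uIcc 0 1) :=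
      hφ.continuousOn.comp (by fun_prop) fun t ht => ⟨hp, hI t ht⟩
    have h5 := intervalIntegral.integral_eq_sub_of_hasDerivAt hd
      ((hc.const_smul r).intervalIntegrable)
    rw [intervalIntegral.integral_smul] at h5
    rw [h5]
    simp [h0 x hx]
  · intro x v
    simp [φ]
  · intro r x
    have : ∀ t : ℝ, φ ((r, x, 0), t) = 0 := fun t => by
      show fderiv ℝ f _ ((0 : X), (0 : E)) = 0
      rw [← Prod.zero_eq_mk, map_zero]
    simp [this]

end Hadamard

/-! ### Contact germs along a Legendrian disk and their linearization -/

section Rescaling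

variable {n : ℕ}

/-- The form `dt - ∑ y_i dx_i`. -/
def jetForm (n : ℕ) (w : Model n) : Model n →L[ℝ] ℝ :=
  ContinuousLinearMap.fst ℝ ℝ (Euc n × Euc n) - (innerCLM n w.2.2).comp (projP n)

theorem jetForm_apply (w v : Model n) : jetForm n w v = v.1 - inner ℝ w.2.2 v.2.1 := rfl

theorem continuous_jetForm : Continuous fun p : Model n × Model n => jetForm n p.1 p.2 := by
  simp only [jetForm_apply]; fun_prop

/-- The contact dilation `(t, x, y) ↦ (r t, x, r y)`. -/
def rescale (n : ℕ) (r : ℝ) : Model n →L[ℝ] Model n :=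
  (r • ContinuousLinearMap.fst ℝ ℝ (Euc n × Euc n)).prod ((projP n).prod (r • projQ n))

theorem rescale_apply (r : ℝ) (w : Model n) : rescale n r w = (r * w.1, w.2.1, r • w.2.2) := rfl

theorem rescale_injective {r : ℝ} (hr : r ≠ 0) : Function.Injective (rescale n r) := by
  intro w w' h
  simp only [rescale_apply, Prod.mk.injEq] at h
  exact Prod.ext (mul_left_cancel₀ hr h.1) (Prod.ext h.2.1 (smul_right_injective _ hr h.2.2))

theorem jetForm_rescale (r : ℝ) (w v : Model n) :
    jetForm n (rescale n r w) (rescale n r v) = r * jetForm n w v := by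
  simp only [jetForm_apply, rescale_apply, real_inner_smul_left]; ring

/-- Neighbourhoods of a disk in the zero section. -/
def coreBox (n : ℕ) (ρ η : ℝ) : Set (Model n) := {w | ‖w.2.1‖ < ρ ∧ ‖(w.1, w.2.2)‖ < η}

theorem isOpen_coreBox (ρ η : ℝ) : IsOpen (coreBox n ρ η) :=
  (isOpen_lt (f := fun w : Model n => ‖w.2.1‖) (by fun_prop) continuous_const).inter
    (isOpen_lt (f := fun w : Model n => ‖(w.1, w.2.2)‖) (by fun_prop) continuous_const)

theorem core_mem_coreBox {ρ η : ℝ} (hη : 0 < η) {x : Euc n} (hx : ‖x‖ < ρ) :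
    ((0 : ℝ), x, (0 : Euc n)) ∈ coreBox n ρ η := ⟨hx, by simpa using hη⟩

/-- The germ of a contactomorphism along a disk in the zero section, which induces the
diffeomorphism `F` of the disk and is the identity on the slice `t = (3/2) ⟨x, y⟩` near the
boundary. -/
structure IsCoreGerm (ρ₁ ρ η : ℝ) (F : Euc n → Euc n) (c : Model n → Model n) : Prop where
  contDiffOn : ContDiffOn ℝ ∞ c (coreBox n ρ η)
  injOn : InjOn c (coreBox n ρ η)
  core : ∀ x, ‖x‖ < ρ → c (0, x, 0) = (0, F x, 0)
  ker : ∀ w ∈ coreBox n ρ η, ∀ v, jetForm n (c w) (fderiv ℝ c w v) = 0 ↔ jetForm n w v = 0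
  slice : ∀ w ∈ coreBox n ρ η, w.1 = 3 / 2 * inner ℝ w.2.1 w.2.2 → ρ₁ < ‖w.2.1‖ → c w = w

/-- An isotopy of germs of contactomorphisms along a disk in the zero section. -/
structure IsCoreFamily (ρ₁ ρ η : ℝ) (E : ℝ × Model n → Model n) : Prop where
  contDiffAt : ∀ T ∈ Icc (0 : ℝ) 1, ∀ w ∈ coreBox n ρ η, ContDiffAt ℝ ∞ E (T, w)
  injOn : ∀ T ∈ Icc (0 : ℝ) 1, InjOn (fun w => E (T, w)) (coreBox n ρ η)
  core : ∀ T ∈ Icc (0 : ℝ) 1, ∀ x, ‖x‖ < ρ →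
    ∃ x', E (T, (0, x, 0)) = (0, x', 0) ∧ (‖x‖ ≤ ρ₁ → ‖x'‖ ≤ ρ₁)
  ker : ∀ T ∈ Icc (0 : ℝ) 1, ∀ w ∈ coreBox n ρ η, ∀ v,
    jetForm n (E (T, w)) (fderiv ℝ (fun w => E (T, w)) w v) = 0 ↔ jetForm n w v = 0
  slice : ∀ T ∈ Icc (0 : ℝ) 1, ∀ w ∈ coreBox n ρ η, w.1 = 3 / 2 * inner ℝ w.2.1 w.2.2 →
    ρ₁ < ‖w.2.1‖ → E (T, w) = w

/-- The conformal factor of a contactomorphism. -/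
def jetFactor (c : Model n → Model n) (w : Model n) : ℝ := jetForm n (c w) (fderiv ℝ c w (1, 0, 0))

theorem jetForm_fderiv_eq {c : Model n → Model n} {w : Model n}
    (h : ∀ v, jetForm n (c w) (fderiv ℝ c w v) = 0 ↔ jetForm n w v = 0) (v : Model n) :
    jetForm n (c w) (fderiv ℝ c w v) = jetFactor c w * jetForm n w v := by
  have h1 : jetForm n w (1, 0, 0) = 1 := by simp [jetForm_apply]
  have h2 := eq_smul_of_ker_eq (A := (jetForm n (c w)).comp (fderiv ℝ c w)) (B := jetForm n w)
    (fun u hu => (h u).2 hu) (R := (1, 0, 0)) (by rw [h1]; exact one_ne_zero)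
  rw [h1, div_one] at h2
  exact DFunLike.congr_fun h2 v

theorem jetFactor_ne_zero {c : Model n → Model n} {w : Model n}
    (h : ∀ v, jetForm n (c w) (fderiv ℝ c w v) = 0 ↔ jetForm n w v = 0) : jetFactor c w ≠ 0 := by
  intro h0
  have := (h (1, 0, 0)).1 h0
  simp [jetForm_apply] at this

theorem contDiffOn_jetFactor {c : Model n → Model n} {ρ η : ℝ}
    (hc : ContDiffOn ℝ ∞ c (coreBox n ρ η)) : ContDiffOn ℝ ∞ (jetFactor c) (coreBox n ρ η) := by
  have h4 := (hc.fderiv_of_isOpen (m := ∞) (isOpen_coreBox ρ η) (by simp)).clm_apply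
    (contDiffOn_const (c := (((1 : ℝ), (0 : Euc n), (0 : Euc n)) : Model n)))
  unfold jetFactor
  simp only [jetForm_apply]
  exact h4.fst.sub (hc.snd.snd.inner ℝ h4.snd.fst)

theorem continuousOn_jetFactor {c : Model n → Model n} {ρ η : ℝ}
    (hc : ContDiffOn ℝ ∞ c (coreBox n ρ η)) : ContinuousOn (jetFactor c) (coreBox n ρ η) :=
  (contDiffOn_jetFactor hc).continuousOn

theorem contDiffOn_jetFactor_core {c : Model n → Model n} {ρ η : ℝ} (hη : 0 < η)
    (hc : ContDiffOn ℝ ∞ c (coreBox n ρ η)) :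
    ContDiffOn ℝ ∞ (fun x => jetFactor c (0, x, 0)) (Metric.ball (0 : Euc n) ρ) := by
  have hi : ContDiffOn ℝ ∞ (fun x : Euc n => (((0 : ℝ), x, (0 : Euc n)) : Model n))
      (Metric.ball (0 : Euc n) ρ) := ContDiff.contDiffOn (by fun_prop)
  exact (contDiffOn_jetFactor hc).comp hi fun x hx => core_mem_coreBox hη (by simpa using hx)

/-- The family of rescalings of a contact germ, which extends smoothly to `r = 0`. -/
structure IsRescaling (ρ η : ℝ) (c : Model n → Model n) (E : ℝ × Model n → Model n) : Prop where
  contDiffOn : ContDiffOn ℝ ∞ E {p | ‖p.2.2.1‖ < ρ ∧ |p.1| * ‖(p.2.1, p.2.2.2)‖ < η}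
  rescale_eq : ∀ r w, ‖w.2.1‖ < ρ → |r| * ‖(w.1, w.2.2)‖ < η →
    rescale n r (E (r, w)) = c (rescale n r w)
  fst_core : ∀ r x, (E (r, (0, x, 0))).1 = 0 ∧ (E (r, (0, x, 0))).2.2 = 0
  /-- For `r = 0` the map is linear in the fibres. -/
  linear : ∃ L : Euc n → (ℝ × Euc n →L[ℝ] ℝ × Euc n), ∀ t x y,
    E (0, (t, x, y)) = ((L x (t, y)).1, (c (0, x, 0)).2.1, (L x (t, y)).2)

theorem isOpen_rescaling_domain (ρ η : ℝ) :
    IsOpen {p : ℝ × Model n | ‖p.2.2.1‖ < ρ ∧ |p.1| * ‖(p.2.1, p.2.2.2)‖ < η} :=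
  (isOpen_lt (f := fun p : ℝ × Model n => ‖p.2.2.1‖) (by fun_prop) continuous_const).inter
    (isOpen_lt (f := fun p : ℝ × Model n => |p.1| * ‖(p.2.1, p.2.2.2)‖) (by fun_prop)
      continuous_const)

/-- The germ preserves the zero section, so its components `t` and `y` vanish there and can be
divided by `r` by Hadamard's lemma. The component `x` has weight zero and requires only a
substitution. The quotient at `r = 0` is the fibre derivative. -/
theorem IsCoreGerm.exists_isRescaling {ρ₁ ρ η : ℝ} {F : Euc n → Euc n} {c : Model n → Model n}
    (h : IsCoreGerm ρ₁ ρ η F c) (hη : 0 < η) : ∃ E, IsRescaling ρ (η / 2) c E := by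
  let f : Euc n × (ℝ × Euc n) → ℝ × Euc n := fun p =>
    ((c (p.2.1, p.1, p.2.2)).1, (c (p.2.1, p.1, p.2.2)).2.2)
  have hf : ContDiffOn ℝ ∞ f (Metric.ball 0 ρ ×ˢ Metric.ball 0 η) := by
    have h1 : ContDiffOn ℝ ∞ (fun p : Euc n × (ℝ × Euc n) => c (p.2.1, p.1, p.2.2))
        (Metric.ball 0 ρ ×ˢ Metric.ball 0 η) := by
      refine h.contDiffOn.comp (ContDiff.contDiffOn (by fun_prop)) ?_
      rintro p ⟨hp1, hp2⟩
      exact ⟨by simpa using hp1, by simpa using hp2⟩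
    exact h1.fst.prodMk h1.snd.snd
  have hball : ∀ x : Euc n, ‖x‖ < ρ → x ∈ Metric.ball (0 : Euc n) ρ := fun x hx => by simpa using hx
  obtain ⟨q, hqs, hq, hq0, hqz⟩ := exists_smooth_quotient Metric.isOpen_ball hf (fun x hx => by
    have := h.core x (by simpa using hx)
    simp [f, this])
  refine ⟨fun p => ((q (p.1, p.2.2.1, (p.2.1, p.2.2.2))).1,
    (c (p.1 * p.2.1, p.2.2.1, p.1 • p.2.2.2)).2.1, (q (p.1, p.2.2.1, (p.2.1, p.2.2.2))).2),
    ?_, ?_, ?_, ?_⟩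
  · have h1 : ContDiffOn ℝ ∞ (fun p : ℝ × Model n => q (p.1, p.2.2.1, (p.2.1, p.2.2.2)))
        {p | ‖p.2.2.1‖ < ρ ∧ |p.1| * ‖(p.2.1, p.2.2.2)‖ < η / 2} :=
      hqs.comp (ContDiff.contDiffOn (by fun_prop)) fun p hp => ⟨hball _ hp.1, hp.2⟩
    have h2 : ContDiffOn ℝ ∞ (fun p : ℝ × Model n => c (p.1 * p.2.1, p.2.2.1, p.1 • p.2.2.2))
        {p | ‖p.2.2.1‖ < ρ ∧ |p.1| * ‖(p.2.1, p.2.2.2)‖ < η / 2} := by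
      refine h.contDiffOn.comp (ContDiff.contDiffOn (by fun_prop)) ?_
      rintro p ⟨hp1, hp2⟩
      refine ⟨hp1, ?_⟩
      have h3 : ((p.1 * p.2.1, p.1 • p.2.2.2) : ℝ × Euc n) = p.1 • (p.2.1, p.2.2.2) := rfl
      show ‖((p.1 * p.2.1, p.1 • p.2.2.2) : ℝ × Euc n)‖ < η
      rw [h3, norm_smul, Real.norm_eq_abs]
      linarith
    exact h1.fst.prodMk (h2.snd.fst.prodMk h1.snd)
  · intro r w hx hr
    have h1 := hq r w.2.1 (w.1, w.2.2) (hball _ hx) hr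
    simp only [f, Prod.smul_mk, smul_eq_mul, Prod.ext_iff, Prod.smul_fst, Prod.smul_snd] at h1
    rw [rescale_apply, rescale_apply]
    exact Prod.ext h1.1.symm (Prod.ext rfl h1.2.symm)
  · intro r x
    have h1 := hqz r x
    rw [Prod.zero_eq_mk] at h1
    simp [h1]
  · refine ⟨fun x => (fderiv ℝ f (x, 0)).comp (ContinuousLinearMap.inr ℝ (Euc n) (ℝ × Euc n)), ?_⟩
    intro t x y
    simp [hq0]

namespace IsRescaling

variable {ρ₁ ρ η : ℝ} {F : Euc n → Euc n} {c : Model n → Model n} {E : ℝ × Model n → Model n}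

theorem mem_domain {r : ℝ} (hr : r ∈ Icc (0 : ℝ) 1) {w : Model n} (hw : w ∈ coreBox n ρ η) :
    (r, w) ∈ {p : ℝ × Model n | ‖p.2.2.1‖ < ρ ∧ |p.1| * ‖(p.2.1, p.2.2.2)‖ < η} := by
  refine ⟨hw.1, lt_of_le_of_lt (mul_le_of_le_one_left (norm_nonneg _) ?_) hw.2⟩
  rw [abs_of_nonneg hr.1]; exact hr.2

theorem rescale_mem {r : ℝ} (hr : r ∈ Icc (0 : ℝ) 1) {w : Model n} (hw : w ∈ coreBox n ρ η) :
    rescale n r w ∈ coreBox n ρ η := by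
  refine ⟨hw.1, ?_⟩
  have h3 : ((r * w.1, r • w.2.2) : ℝ × Euc n) = r • (w.1, w.2.2) := rfl
  show ‖((r * w.1, r • w.2.2) : ℝ × Euc n)‖ < η
  rw [h3, norm_smul, Real.norm_eq_abs]
  exact (mem_domain hr hw).2

theorem contDiffAt (hE : IsRescaling ρ η c E) {r : ℝ} (hr : r ∈ Icc (0 : ℝ) 1) {w : Model n}
    (hw : w ∈ coreBox n ρ η) : ContDiffAt ℝ ∞ E (r, w) :=
  (hE.contDiffOn _ (mem_domain hr hw)).contDiffAt
    ((isOpen_rescaling_domain ρ η).mem_nhds (mem_domain hr hw))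

theorem contDiffAt_slice (hE : IsRescaling ρ η c E) {r : ℝ} (hr : r ∈ Icc (0 : ℝ) 1)
    {w : Model n} (hw : w ∈ coreBox n ρ η) : ContDiffAt ℝ ∞ (fun w => E (r, w)) w :=
  ContDiffAt.comp (g := E) w (hE.contDiffAt hr hw) (by fun_prop)

theorem fderiv_slice (hE : IsRescaling ρ η c E) {r : ℝ} (hr : r ∈ Icc (0 : ℝ) 1)
    {w : Model n} (hw : w ∈ coreBox n ρ η) (v : Model n) :
    fderiv ℝ (fun w => E (r, w)) w v = fderiv ℝ E (r, w) (0, v) := by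
  have h1 : HasFDerivAt (fun w : Model n => (r, w)) (ContinuousLinearMap.inr ℝ ℝ (Model n)) w :=
    hasFDerivAt_prodMk_right r w
  have h2 : HasFDerivAt (fun w => E (r, w)) ((fderiv ℝ E (r, w)).comp
      (ContinuousLinearMap.inr ℝ ℝ (Model n))) w :=
    HasFDerivAt.comp (g := E) w ((hE.contDiffAt hr hw).differentiableAt (by simp)).hasFDerivAt h1
  rw [h2.fderiv]
  rfl

/-- A property of the rescalings which is closed holds for `r = 0` if it holds for `r > 0`. -/
theorem eq_of_continuousOn {f g : ℝ → ℝ} (hf : ContinuousOn f (Icc 0 1))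
    (hg : ContinuousOn g (Icc 0 1)) (h : ∀ r ∈ Ioc (0 : ℝ) 1, f r = g r) : f 0 = g 0 := by
  have h1 : EqOn f g (closure (Ioc (0 : ℝ) 1) ∩ Icc 0 1) := by
    have hc : closure (Ioc (0 : ℝ) 1) = Icc 0 1 := closure_Ioc zero_ne_one
    rw [hc, inter_self]
    exact EqOn.of_subset_closure h hf hg Ioc_subset_Icc_self hc.ge
  exact h1 ⟨by rw [closure_Ioc zero_ne_one]; exact ⟨le_rfl, zero_le_one⟩, le_rfl, zero_le_one⟩

theorem continuousOn_slice (hE : IsRescaling ρ η c E) {w : Model n} (hw : w ∈ coreBox n ρ η) :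
    ContinuousOn (fun r => E (r, w)) (Icc 0 1) :=
  hE.contDiffOn.continuousOn.comp (by fun_prop) fun _ hr => mem_domain hr hw

/-- For `r > 0` the dilation multiplies the form by `r` on both sides of the conjugation, and this
factor cancels; the case `r = 0` follows by continuity. -/
theorem jetForm_eq (hE : IsRescaling ρ η c E) (hc : ContDiffOn ℝ ∞ c (coreBox n ρ η))
    (hker : ∀ w ∈ coreBox n ρ η, ∀ v, jetForm n (c w) (fderiv ℝ c w v) = 0 ↔ jetForm n w v = 0)
    {r : ℝ} (hr : r ∈ Icc (0 : ℝ) 1) {w : Model n} (hw : w ∈ coreBox n ρ η) (v : Model n) :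
    jetForm n (E (r, w)) (fderiv ℝ (fun w => E (r, w)) w v) =
      jetFactor c (rescale n r w) * jetForm n w v := by
  have hcw : ∀ w ∈ coreBox n ρ η, ContDiffAt ℝ ∞ c w := fun w hw =>
    (hc w hw).contDiffAt ((isOpen_coreBox ρ η).mem_nhds hw)
  have hpos : ∀ r ∈ Ioc (0 : ℝ) 1, jetForm n (E (r, w)) (fderiv ℝ (fun w => E (r, w)) w v) =
      jetFactor c (rescale n r w) * jetForm n w v := by
    intro r hr
    have hrI : r ∈ Icc (0 : ℝ) 1 := ⟨hr.1.le, hr.2⟩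
    have h1 : (fun w => rescale n r (E (r, w))) =ᶠ[𝓝 w] fun w => c (rescale n r w) := by
      filter_upwards [(isOpen_coreBox ρ η).mem_nhds hw] with w' hw'
      exact hE.rescale_eq r w' (mem_domain hrI hw').1 (mem_domain hrI hw').2
    have h2 : HasFDerivAt (fun w => rescale n r (E (r, w)))
        ((rescale n r).comp (fderiv ℝ (fun w => E (r, w)) w)) w :=
      (rescale n r).hasFDerivAt.comp w
        ((hE.contDiffAt_slice hrI hw).differentiableAt (by simp)).hasFDerivAt
    have h3 : HasFDerivAt (fun w => c (rescale n r w))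
        ((fderiv ℝ c (rescale n r w)).comp (rescale n r)) w :=
      HasFDerivAt.comp (g := c) w
        ((hcw _ (rescale_mem hrI hw)).differentiableAt (by simp)).hasFDerivAt
        (rescale n r).hasFDerivAt
    have h4 := DFunLike.congr_fun (h2.unique (h3.congr_of_eventuallyEq h1)) v
    simp only [ContinuousLinearMap.comp_apply] at h4
    have h5 := jetForm_fderiv_eq (hker _ (rescale_mem hrI hw)) (rescale n r v)
    have h1w : rescale n r (E (r, w)) = c (rescale n r w) := h1.self_of_nhds
    rw [← h4, ← h1w, jetForm_rescale, jetForm_rescale] at h5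
    have h6 := hr.1.ne'
    apply mul_left_cancel₀ h6
    linarith
  rcases hr.1.eq_or_lt with rfl | h0
  · have hd : ContinuousOn (fderiv ℝ E)
        {p | ‖p.2.2.1‖ < ρ ∧ |p.1| * ‖(p.2.1, p.2.2.2)‖ < η} :=
      hE.contDiffOn.continuousOn_fderiv_of_isOpen (isOpen_rescaling_domain ρ η) (by simp)
    refine eq_of_continuousOn ?_ ?_ hpos
    · have h1 : ContinuousOn (fun r => (E (r, w), fderiv ℝ E (r, w) (0, v))) (Icc (0 : ℝ) 1) :=
        (hE.continuousOn_slice hw).prodMk ((hd.comp (by fun_prop)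
          fun _ hr => mem_domain hr hw).clm_apply continuousOn_const)
      refine (continuous_jetForm.comp_continuousOn h1).congr fun r hr => ?_
      rw [hE.fderiv_slice hr hw]
      rfl
    · refine ContinuousOn.mul ?_ continuousOn_const
      have hres : ContinuousOn (fun r : ℝ => rescale n r w) (Icc 0 1) := by
        simp only [rescale_apply]; fun_prop
      have hmaps : MapsTo (fun r : ℝ => rescale n r w) (Icc 0 1) (coreBox n ρ η) :=
        fun _ hr => rescale_mem hr hw
      exact (continuousOn_jetFactor hc).comp hres hmaps
  · exact hpos r ⟨h0, hr.2⟩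

/-- The slice `t = (3/2) ⟨x, y⟩` is invariant under dilations because `t` and `y` have the same
weight. -/
theorem slice_eq (hE : IsRescaling ρ η c E)
    (hs : ∀ w ∈ coreBox n ρ η, w.1 = 3 / 2 * inner ℝ w.2.1 w.2.2 → ρ₁ < ‖w.2.1‖ → c w = w)
    {r : ℝ} (hr : r ∈ Icc (0 : ℝ) 1) {w : Model n} (hw : w ∈ coreBox n ρ η)
    (h1 : w.1 = 3 / 2 * inner ℝ w.2.1 w.2.2) (h2 : ρ₁ < ‖w.2.1‖) : E (r, w) = w := by
  have hpos : ∀ r ∈ Ioc (0 : ℝ) 1, E (r, w) = w := by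
    intro r hr
    have hrI : r ∈ Icc (0 : ℝ) 1 := ⟨hr.1.le, hr.2⟩
    apply rescale_injective hr.1.ne'
    rw [hE.rescale_eq r w (mem_domain hrI hw).1 (mem_domain hrI hw).2]
    refine hs _ (rescale_mem hrI hw) ?_ h2
    simp only [rescale_apply, real_inner_smul_right, h1]
    ring
  rcases hr.1.eq_or_lt with rfl | h0
  · have hc : closure (Ioc (0 : ℝ) 1) = Icc 0 1 := closure_Ioc zero_ne_one
    exact EqOn.of_subset_closure (f := fun r => E (r, w)) (g := fun _ => w) hpos
      (hE.continuousOn_slice hw) continuousOn_const Ioc_subset_Icc_self hc.ge ⟨le_rfl, zero_le_one⟩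
  · exact hpos r ⟨h0, hr.2⟩

theorem core_eq (hE : IsRescaling ρ η c E) (hη : 0 < η)
    (hc : ∀ x, ‖x‖ < ρ → c (0, x, 0) = (0, F x, 0)) (r : ℝ) {x : Euc n}
    (hx : ‖x‖ < ρ) : E (r, (0, x, 0)) = (0, F x, 0) := by
  obtain ⟨h1, h2⟩ := hE.fst_core r x
  have h3 := hE.rescale_eq r (0, x, 0) hx (by simpa using hη)
  simp only [rescale_apply, mul_zero, smul_zero, hc x hx, Prod.mk.injEq] at h3
  exact Prod.ext h1 (Prod.ext h3.2.1 h2)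

/-- The linearization of a contact germ along the disk is determined by the conformal factor and
the induced diffeomorphism of the disk. -/
theorem zero_eq (hE : IsRescaling ρ η c E) (hη : 0 < η) (hc : ContDiffOn ℝ ∞ c (coreBox n ρ η))
    (hcore : ∀ x, ‖x‖ < ρ → c (0, x, 0) = (0, F x, 0))
    (hker : ∀ w ∈ coreBox n ρ η, ∀ v, jetForm n (c w) (fderiv ℝ c w v) = 0 ↔ jetForm n w v = 0)
    {w : Model n} (hw : w ∈ coreBox n ρ η) :
    (E (0, w)).1 = jetFactor c (0, w.2.1, 0) * w.1 ∧ (E (0, w)).2.1 = F w.2.1 ∧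
      ∀ u, inner ℝ (E (0, w)).2.2 (fderiv ℝ F w.2.1 u) =
        jetFactor c (0, w.2.1, 0) * inner ℝ w.2.2 u +
          w.1 * fderiv ℝ (fun x => jetFactor c (0, x, 0)) w.2.1 u := by
  obtain ⟨L, hL⟩ := hE.linear
  have h0 : (0 : ℝ) ∈ Icc (0 : ℝ) 1 := ⟨le_rfl, zero_le_one⟩
  have hform : ∀ w ∈ coreBox n ρ η, ∀ v, jetForm n (E (0, w)) (fderiv ℝ (fun w => E (0, w)) w v) =
      jetFactor c (0, w.2.1, 0) * jetForm n w v := fun w hw v => by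
    rw [hE.jetForm_eq hc hker h0 hw v]
    simp [rescale_apply]
  have hmid : ∀ w ∈ coreBox n ρ η, (E (0, w)).2.1 = F w.2.1 := fun w hw => by
    rw [show w = (w.1, w.2.1, w.2.2) from rfl, hL, hcore _ hw.1]
  -- the first component
  have hfst : ∀ w ∈ coreBox n ρ η, (E (0, w)).1 = jetFactor c (0, w.2.1, 0) * w.1 := by
    intro w hw
    have hd := ((hE.contDiffAt_slice h0 hw).differentiableAt (by simp)).hasFDerivAt
    -- By linearity in the fibres the derivative in the direction `(t, 0, y)` is the pair of fibre
    -- components of the image. The form sees only their `t` part, and the conformal identity gives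
    -- the first component.
    have hline : HasDerivAt (fun a : ℝ => w + a • ((w.1, 0, w.2.2) : Model n))
        ((w.1, 0, w.2.2) : Model n) 0 := by
      simpa using ((hasDerivAt_id (0 : ℝ)).smul_const ((w.1, 0, w.2.2) : Model n)).const_add w
    have h1 : HasDerivAt (fun a : ℝ => E (0, w + a • ((w.1, 0, w.2.2) : Model n)))
        (fderiv ℝ (fun w => E (0, w)) w (w.1, 0, w.2.2)) 0 := by
      have hw0 : w + (0 : ℝ) • ((w.1, 0, w.2.2) : Model n) = w := by simp
      exact HasFDerivAt.comp_hasDerivAt (l := fun w => E (0, w)) (0 : ℝ) (by rw [hw0]; exact hd) hline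
    have h2 : (fun a : ℝ => E (0, w + a • ((w.1, 0, w.2.2) : Model n))) = fun a : ℝ =>
        E (0, w) + a • (((E (0, w)).1, 0, (E (0, w)).2.2) : Model n) := by
      funext a
      have h3 : w + a • ((w.1, 0, w.2.2) : Model n) =
          ((1 + a) * w.1, w.2.1, (1 + a) • w.2.2) := by
        refine Prod.ext ?_ (Prod.ext ?_ ?_)
        · simp; ring
        · simp
        · simp [add_smul]
      have h4 : (((1 + a) * w.1, (1 + a) • w.2.2) : ℝ × Euc n) = (1 + a) • (w.1, w.2.2) := rfl
      rw [h3, hL, h4, map_smul, show E (0, w) = E (0, (w.1, w.2.1, w.2.2)) from rfl, hL]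
      refine Prod.ext ?_ (Prod.ext ?_ ?_)
      · simp; ring
      · simp
      · simp [add_smul]
    rw [h2] at h1
    have h5 : HasDerivAt (fun a : ℝ => E (0, w) + a • (((E (0, w)).1, 0, (E (0, w)).2.2) : Model n))
        (((E (0, w)).1, 0, (E (0, w)).2.2) : Model n) 0 := by
      simpa using ((hasDerivAt_id (0 : ℝ)).smul_const
        (((E (0, w)).1, 0, (E (0, w)).2.2) : Model n)).const_add (E (0, w))
    have h6 := hform w hw (w.1, 0, w.2.2)
    rw [h1.unique h5] at h6
    simpa [jetForm_apply] using h6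
  refine ⟨hfst w hw, hmid w hw, fun u => ?_⟩
  -- In the directions of `x` the derivative of the first component is `t dl`, with `l` the
  -- conformal factor along the disk. The conformal identity then determines the pairing of the `y`
  -- component with the image of `DF`.
  have hd := ((hE.contDiffAt_slice h0 hw).differentiableAt (by simp)).hasFDerivAt
  have hline : HasFDerivAt (fun x : Euc n => ((w.1, x, w.2.2) : Model n)) (inclP n) w.2.1 := by
    refine ((hasFDerivAt_const w.1 w.2.1).prodMk
      ((hasFDerivAt_id w.2.1).prodMk (hasFDerivAt_const w.2.2 w.2.1))).congr_fderiv ?_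
    exact ContinuousLinearMap.ext fun v => rfl
  have h1 : HasFDerivAt (fun x : Euc n => E (0, (w.1, x, w.2.2)))
      ((fderiv ℝ (fun w => E (0, w)) w).comp (inclP n)) w.2.1 :=
    HasFDerivAt.comp (g := fun w => E (0, w)) w.2.1 hd hline
  have hev : ∀ᶠ x in 𝓝 w.2.1, ((w.1, x, w.2.2) : Model n) ∈ coreBox n ρ η := by
    have hc : Continuous fun x : Euc n => ((w.1, x, w.2.2) : Model n) := by fun_prop
    exact hc.continuousAt.eventually ((isOpen_coreBox ρ η).mem_nhds hw)
  have h2 : HasFDerivAt F ((projP n).comp ((fderiv ℝ (fun w => E (0, w)) w).comp (inclP n)))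
      w.2.1 := by
    refine ((projP n).hasFDerivAt.comp w.2.1 h1).congr_of_eventuallyEq ?_
    filter_upwards [hev] with x hx using (hmid _ hx).symm
  -- the conformal factor is differentiable along the disk
  have hcw := contDiffOn_jetFactor_core hη hc
  have hfac : DifferentiableAt ℝ (fun x => jetFactor c (0, x, 0)) w.2.1 :=
    ((hcw _ (by simpa using hw.1)).contDiffAt
      (Metric.isOpen_ball.mem_nhds (by simpa using hw.1))).differentiableAt (by simp)
  have h5 : HasFDerivAt (fun x : Euc n => (E (0, (w.1, x, w.2.2))).1)
      (w.1 • fderiv ℝ (fun x => jetFactor c (0, x, 0)) w.2.1) w.2.1 := by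
    refine (hfac.hasFDerivAt.mul_const w.1).congr_of_eventuallyEq ?_
    filter_upwards [hev] with x hx using hfst _ hx
  have h6 := ((ContinuousLinearMap.fst ℝ ℝ (Euc n × Euc n)).hasFDerivAt.comp w.2.1 h1).unique h5
  have h7 := DFunLike.congr_fun h6 u
  have h8 := hform w hw (inclP n u)
  rw [jetForm_apply, jetForm_apply] at h8
  rw [h2.fderiv]
  simp only [ContinuousLinearMap.comp_apply, ContinuousLinearMap.coe_fst',
    FunLike.coe_smul, Pi.smul_apply, smul_eq_mul, projP_apply] at h7 ⊢
  rw [h7] at h8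
  simp only [inclP_apply] at h8 ⊢
  linarith

end IsRescaling

end Rescaling

/-! ### Isotopies of linear contact germs along a disk -/

section LinearGerms

variable {n : ℕ}

/-- The vector representing a functional. -/
def dualVec (l : Euc n →L[ℝ] ℝ) : Euc n := (InnerProductSpace.toDual ℝ (Euc n)).symm l

theorem inner_dualVec (l : Euc n →L[ℝ] ℝ) (u : Euc n) : inner ℝ (dualVec l) u = l u := by
  rw [dualVec, InnerProductSpace.toDual_symm_apply]

theorem dualVec_innerCLM (y : Euc n) : dualVec (innerCLM n y) = y :=
  ext_inner_right ℝ fun u => by rw [inner_dualVec, innerCLM_apply]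

theorem dualVec_zero : dualVec (0 : Euc n →L[ℝ] ℝ) = 0 := by simp [dualVec]

theorem contDiff_dualVec : ContDiff ℝ ∞ (dualVec (n := n)) := by
  rw [contDiff_euclidean]
  intro i
  have h1 : (fun l : Euc n →L[ℝ] ℝ => dualVec l i) = fun l => l (EuclideanSpace.single i 1) := by
    funext l
    rw [← inner_dualVec, EuclideanSpace.inner_single_right]
    simp
  rw [h1]
  exact contDiff_id.clm_apply contDiff_const

/-- The derivative of a family of maps in the direction of the space variable. -/
def spaceDeriv (Φ : ℝ × Euc n → Euc n) (p : ℝ × Euc n) : Euc n →L[ℝ] Euc n :=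
  (fderiv ℝ Φ p).comp (ContinuousLinearMap.inr ℝ ℝ (Euc n))

theorem hasFDerivAt_spaceDeriv {Φ : ℝ × Euc n → Euc n} (hΦ : ContDiff ℝ ∞ Φ) (T : ℝ) (x : Euc n) :
    HasFDerivAt (fun x => Φ (T, x)) (spaceDeriv Φ (T, x)) x :=
  HasFDerivAt.comp (g := Φ) x (hΦ.differentiable (by simp) _).hasFDerivAt
    (hasFDerivAt_prodMk_right T x)

theorem contDiff_spaceDeriv {Φ : ℝ × Euc n → Euc n} (hΦ : ContDiff ℝ ∞ Φ) :
    ContDiff ℝ ∞ (spaceDeriv Φ) :=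
  (hΦ.fderiv_right (m := ∞) (by simp)).clm_comp contDiff_const

theorem exists_equiv_of_injective {A : Euc n →L[ℝ] Euc n} (hA : Function.Injective A) :
    ∃ e : Euc n ≃L[ℝ] Euc n, (e : Euc n →L[ℝ] Euc n) = A :=
  ⟨(LinearEquiv.ofInjectiveEndo A.toLinearMap hA).toContinuousLinearEquiv,
    ContinuousLinearMap.ext fun _ => rfl⟩

theorem inverse_apply_self {A : Euc n →L[ℝ] Euc n} (hA : Function.Injective A) (u : Euc n) :
    A.inverse (A u) = u := by
  obtain ⟨e, rfl⟩ := exists_equiv_of_injective hA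
  rw [ContinuousLinearMap.inverse_equiv]
  simp

theorem contDiffAt_inverse {A : Euc n →L[ℝ] Euc n} (hA : Function.Injective A) :
    ContDiffAt ℝ ∞ (ContinuousLinearMap.inverse : (Euc n →L[ℝ] Euc n) → _) A := by
  obtain ⟨e, rfl⟩ := exists_equiv_of_injective hA
  exact contDiffAt_map_inverse e

/-- The family of linear contact germs with conformal factors interpolating between `l` and `1`,
which covers the isotopy `Φ`, traversed backwards. -/
def linearGerm (l : Euc n → ℝ) (Φ : ℝ × Euc n → Euc n) (p : ℝ × Model n) : Model n :=
  (((1 - p.1) * l p.2.2.1 + p.1) * p.2.1, Φ (1 - p.1, p.2.2.1),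
    dualVec ((((1 - p.1) * l p.2.2.1 + p.1) • innerCLM n p.2.2.2 +
      (p.2.1 * (1 - p.1)) • fderiv ℝ l p.2.2.1).comp
        (spaceDeriv Φ (1 - p.1, p.2.2.1)).inverse))

/-- This equation defines the third component. It is the one which `IsRescaling.zero_eq` derives for
a linearization, now with the factor `(1 - T) l + T` and the disk map `Φ (1 - T, ·)`. -/
theorem inner_linearGerm {l : Euc n → ℝ} {Φ : ℝ × Euc n → Euc n} {T : ℝ} {w : Model n}
    (hinj : Function.Injective (spaceDeriv Φ (1 - T, w.2.1))) (u : Euc n) :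
    inner ℝ (linearGerm l Φ (T, w)).2.2 (spaceDeriv Φ (1 - T, w.2.1) u) =
      ((1 - T) * l w.2.1 + T) * inner ℝ w.2.2 u + w.1 * (1 - T) * fderiv ℝ l w.2.1 u := by
  simp only [linearGerm, inner_dualVec, ContinuousLinearMap.comp_apply, inverse_apply_self hinj]
  rfl

theorem contDiffAt_linearGerm {l : Euc n → ℝ} {Φ : ℝ × Euc n → Euc n} (hΦ : ContDiff ℝ ∞ Φ)
    {ρ : ℝ} (hl : ContDiffOn ℝ ∞ l (Metric.ball 0 ρ)) {T : ℝ} {w : Model n} (hw : ‖w.2.1‖ < ρ)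
    (hinj : Function.Injective (spaceDeriv Φ (1 - T, w.2.1))) :
    ContDiffAt ℝ ∞ (linearGerm l Φ) (T, w) := by
  have hwb : w.2.1 ∈ Metric.ball (0 : Euc n) ρ := by simpa using hw
  have hx : ContDiffAt ℝ ∞ (fun p : ℝ × Model n => p.2.2.1) (T, w) := by fun_prop
  have hl' : ContDiffAt ℝ ∞ (fun p : ℝ × Model n => l p.2.2.1) (T, w) :=
    ContDiffAt.comp (g := l) (T, w) ((hl _ hwb).contDiffAt (Metric.isOpen_ball.mem_nhds hwb)) hx
  have hdl : ContDiffAt ℝ ∞ (fun p : ℝ × Model n => fderiv ℝ l p.2.2.1) (T, w) :=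
    ContDiffAt.comp (g := fderiv ℝ l) (T, w)
      ((hl.fderiv_of_isOpen (m := ∞) Metric.isOpen_ball (by simp) _ hwb).contDiffAt
        (Metric.isOpen_ball.mem_nhds hwb)) hx
  have hp : ContDiffAt ℝ ∞ (fun p : ℝ × Model n => (1 - p.1, p.2.2.1)) (T, w) := by fun_prop
  have hΦ' : ContDiffAt ℝ ∞ (fun p : ℝ × Model n => Φ (1 - p.1, p.2.2.1)) (T, w) :=
    ContDiffAt.comp (g := Φ) (T, w) hΦ.contDiffAt hp
  have hD : ContDiffAt ℝ ∞ (fun p : ℝ × Model n => spaceDeriv Φ (1 - p.1, p.2.2.1)) (T, w) :=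
    ContDiffAt.comp (g := spaceDeriv Φ) (T, w) (contDiff_spaceDeriv hΦ).contDiffAt hp
  have hG : ContDiffAt ℝ ∞ (fun p : ℝ × Model n => (spaceDeriv Φ (1 - p.1, p.2.2.1)).inverse)
      (T, w) :=
    ContDiffAt.comp (g := ContinuousLinearMap.inverse) (T, w) (contDiffAt_inverse hinj) hD
  have ha : ContDiffAt ℝ ∞ (fun p : ℝ × Model n => (1 - p.1) * l p.2.2.1 + p.1) (T, w) :=
    ((contDiffAt_const.sub contDiffAt_fst).mul hl').add contDiffAt_fst
  have ht : ContDiffAt ℝ ∞ (fun p : ℝ × Model n => p.2.1) (T, w) := by fun_prop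
  have hi : ContDiffAt ℝ ∞ (fun p : ℝ × Model n => innerCLM n p.2.2.2) (T, w) :=
    (innerCLM n).contDiff.contDiffAt.comp (T, w)
      (by fun_prop : ContDiffAt ℝ ∞ (fun p : ℝ × Model n => p.2.2.2) (T, w))
  have hb : ContDiffAt ℝ ∞ (fun p : ℝ × Model n => p.2.1 * (1 - p.1)) (T, w) := by fun_prop
  exact (ha.mul ht).prodMk (hΦ'.prodMk (contDiff_dualVec.contDiffAt.comp (T, w)
    (((ha.smul hi).add (hb.smul hdl)).clm_comp hG)))

/-- A conformal factor which does not vanish on the disk and is `1` near the boundary is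
positive. -/
theorem pos_of_ne_zero_of_eq_one [NeZero n] {l : Euc n → ℝ} {ρ₁ ρ : ℝ} (h0 : 0 < ρ₁) (hρ : ρ₁ < ρ)
    (hl : ContinuousOn l (Metric.ball 0 ρ)) (hne : ∀ x, ‖x‖ < ρ → l x ≠ 0)
    (hone : ∀ x, ρ₁ < ‖x‖ → ‖x‖ < ρ → l x = 1) {x : Euc n} (hx : ‖x‖ < ρ) : 0 < l x := by
  by_contra hneg
  rw [not_lt] at hneg
  let x₀ : Euc n := EuclideanSpace.single 0 ((ρ₁ + ρ) / 2)
  have hx₀ : ‖x₀‖ = (ρ₁ + ρ) / 2 := by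
    rw [EuclideanSpace.norm_single, Real.norm_of_nonneg (by linarith)]
  have h1 : l x₀ = 1 := hone x₀ (by rw [hx₀]; linarith) (by rw [hx₀]; linarith)
  obtain ⟨y, hy, hy0⟩ := (convex_ball (0 : Euc n) ρ).isPreconnected.intermediate_value
    (show x ∈ Metric.ball (0 : Euc n) ρ by simpa using hx)
    (show x₀ ∈ Metric.ball (0 : Euc n) ρ by rw [mem_ball_zero_iff, hx₀]; linarith)
    hl (show (0 : ℝ) ∈ Icc (l x) (l x₀) from ⟨hneg, by rw [h1]; exact zero_le_one⟩)
  exact hne y (by simpa using hy) hy0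

/-- An isotopy of `ℝ^n` starting at the identity with support in a ball. -/
structure IsBallIsotopy (ρ₁ : ℝ) (Φ : ℝ × Euc n → Euc n) : Prop where
  contDiff : ContDiff ℝ ∞ Φ
  zero : ∀ x, Φ (0, x) = x
  injective : ∀ T ∈ Icc (0 : ℝ) 1, Function.Injective fun x => Φ (T, x)
  outside : ∀ T ∈ Icc (0 : ℝ) 1, ∀ x, ρ₁ < ‖x‖ → Φ (T, x) = x
  injective_spaceDeriv : ∀ T ∈ Icc (0 : ℝ) 1, ∀ x, Function.Injective (spaceDeriv Φ (T, x))

/-- A point of the ball cannot be sent outside, where every point is already its own image. -/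
theorem IsBallIsotopy.norm_le {ρ₁ : ℝ} {Φ : ℝ × Euc n → Euc n} (h : IsBallIsotopy ρ₁ Φ) {T : ℝ}
    (hT : T ∈ Icc (0 : ℝ) 1) {x : Euc n} (hx : ‖x‖ ≤ ρ₁) : ‖Φ (T, x)‖ ≤ ρ₁ := by
  by_contra! h1
  have h2 := h.injective T hT (h.outside T hT _ h1)
  simp only at h2
  rw [h2] at h1
  exact h1.not_ge hx

/-- Convex combinations of the positive factor `l` with `1` are positive, so the germs stay
injective and contact. Beyond `ρ₁` both the factor and the disk map are trivial, and the germ is the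
identity on the entire fibre. -/
theorem isCoreFamily_linearGerm {l : Euc n → ℝ} {Φ : ℝ × Euc n → Euc n} {ρ₁ ρ : ℝ} (η : ℝ)
    (hΦ : IsBallIsotopy ρ₁ Φ) (hl : ContDiffOn ℝ ∞ l (Metric.ball 0 ρ))
    (hpos : ∀ x, ‖x‖ < ρ → 0 < l x) (hone : ∀ x, ρ₁ < ‖x‖ → ‖x‖ < ρ → l x = 1) :
    IsCoreFamily ρ₁ ρ η (linearGerm l Φ) ∧ ∀ w, linearGerm l Φ (1, w) = w := by
  have hI : ∀ T ∈ Icc (0 : ℝ) 1, 1 - T ∈ Icc (0 : ℝ) 1 := fun T hT =>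
    ⟨by linarith [hT.2], by linarith [hT.1]⟩
  have hlT : ∀ T ∈ Icc (0 : ℝ) 1, ∀ x, ‖x‖ < ρ → 0 < (1 - T) * l x + T := by
    intro T hT x hx
    have h1 := hpos x hx
    rcases hT.1.eq_or_lt with rfl | h2
    · simpa using h1
    · have := mul_nonneg (hI T hT).1 h1.le
      linarith
  have hs : ∀ T ∈ Icc (0 : ℝ) 1, ∀ w ∈ coreBox n ρ η, ContDiffAt ℝ ∞ (linearGerm l Φ) (T, w) :=
    fun T hT w hw => contDiffAt_linearGerm hΦ.contDiff hl hw.1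
      (hΦ.injective_spaceDeriv _ (hI T hT) _)
  have hid : ∀ T x, (fun x => Φ (T, x)) =ᶠ[𝓝 x] id →
      spaceDeriv Φ (T, x) = ContinuousLinearMap.id ℝ (Euc n) := fun T x h =>
    (hasFDerivAt_spaceDeriv hΦ.contDiff T x).unique ((hasFDerivAt_id x).congr_of_eventuallyEq h)
  refine ⟨⟨hs, ?_, ?_, ?_, ?_⟩, ?_⟩
  · intro T hT w hw w' hw' hww
    simp only at hww
    have h1 : w.2.1 = w'.2.1 :=
      hΦ.injective _ (hI T hT) (show Φ (1 - T, w.2.1) = Φ (1 - T, w'.2.1) from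
        congrArg (fun z : Model n => z.2.1) hww)
    have h2 : ((1 - T) * l w.2.1 + T) * w.1 = ((1 - T) * l w'.2.1 + T) * w'.1 :=
      congrArg (fun z : Model n => z.1) hww
    have hne := (hlT T hT _ hw.1).ne'
    rw [← h1] at h2
    have h3 := mul_left_cancel₀ hne h2
    refine Prod.ext h3 (Prod.ext h1 (ext_inner_right ℝ fun u => ?_))
    have h4 := inner_linearGerm (l := l) (T := T) (w := w)
      (hΦ.injective_spaceDeriv _ (hI T hT) _) u
    have h5 := inner_linearGerm (l := l) (T := T) (w := w')
      (hΦ.injective_spaceDeriv _ (hI T hT) _) u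
    rw [hww, h1] at h4
    rw [h4, h3] at h5
    rw [h1] at hne
    exact mul_left_cancel₀ hne (by linarith)
  · intro T hT x hx
    refine ⟨Φ (1 - T, x), ?_, fun h => hΦ.norm_le (hI T hT) h⟩
    simp [linearGerm, dualVec_zero]
  · intro T hT w hw v
    have hd := (hs T hT w hw).differentiableAt (by simp)
    have hdT : HasFDerivAt (fun w => linearGerm l Φ (T, w))
        (fderiv ℝ (fun w => linearGerm l Φ (T, w)) w) w :=
      (DifferentiableAt.comp (g := linearGerm l Φ) w hd (by fun_prop)).hasFDerivAt
    have hwb : w.2.1 ∈ Metric.ball (0 : Euc n) ρ := by simpa using hw.1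
    have hlx : HasFDerivAt l (fderiv ℝ l w.2.1) w.2.1 :=
      (((hl _ hwb).contDiffAt (Metric.isOpen_ball.mem_nhds hwb)).differentiableAt
        (by simp)).hasFDerivAt
    have hx : HasFDerivAt (fun w : Model n => w.2.1) (projP n) w := (projP n).hasFDerivAt
    have hl1 : HasFDerivAt (fun w : Model n => l w.2.1) ((fderiv ℝ l w.2.1).comp (projP n)) w :=
      HasFDerivAt.comp (g := l) w hlx hx
    have ht : HasFDerivAt (fun w : Model n => w.1) (ContinuousLinearMap.fst ℝ ℝ (Euc n × Euc n)) w :=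
      hasFDerivAt_fst
    have h1 : HasFDerivAt (fun w : Model n => ((1 - T) * l w.2.1 + T) * w.1) _ w :=
      ((hl1.const_mul (1 - T)).add_const T).mul ht
    have h2 : HasFDerivAt (fun w : Model n => Φ (1 - T, w.2.1))
        ((spaceDeriv Φ (1 - T, w.2.1)).comp (projP n)) w :=
      HasFDerivAt.comp (g := fun x => Φ (1 - T, x)) w
        (hasFDerivAt_spaceDeriv hΦ.contDiff (1 - T) w.2.1) hx
    have h3 := DFunLike.congr_fun
      (((ContinuousLinearMap.fst ℝ ℝ (Euc n × Euc n)).hasFDerivAt.comp w hdT).unique h1) v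
    have h4 := DFunLike.congr_fun (((projP n).hasFDerivAt.comp w hdT).unique h2) v
    have h3' : (fderiv ℝ (fun w => linearGerm l Φ (T, w)) w v).1 =
        ((1 - T) * l w.2.1 + T) * v.1 + w.1 * ((1 - T) * fderiv ℝ l w.2.1 v.2.1) := h3
    have h4' : (fderiv ℝ (fun w => linearGerm l Φ (T, w)) w v).2.1 =
        spaceDeriv Φ (1 - T, w.2.1) v.2.1 := h4
    rw [jetForm_apply, h3', h4', inner_linearGerm (hΦ.injective_spaceDeriv _ (hI T hT) _),
      jetForm_apply]
    have h5 : ((1 - T) * l w.2.1 + T) * v.1 + w.1 * ((1 - T) * fderiv ℝ l w.2.1 v.2.1) -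
        (((1 - T) * l w.2.1 + T) * inner ℝ w.2.2 v.2.1 +
          w.1 * (1 - T) * fderiv ℝ l w.2.1 v.2.1) =
        ((1 - T) * l w.2.1 + T) * (v.1 - inner ℝ w.2.2 v.2.1) := by ring
    rw [h5, mul_eq_zero]
    exact ⟨fun h => h.resolve_left (hlT T hT _ hw.1).ne', Or.inr⟩
  · intro T hT w hw _ hρw
    have hev : ∀ᶠ x in 𝓝 w.2.1, ρ₁ < ‖x‖ ∧ ‖x‖ < ρ := by
      filter_upwards [continuous_norm.continuousAt.eventually (lt_mem_nhds hρw),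
        continuous_norm.continuousAt.eventually (gt_mem_nhds hw.1)] with x h1 h2 using ⟨h1, h2⟩
    have h1 : l =ᶠ[𝓝 w.2.1] fun _ => 1 := by
      filter_upwards [hev] with x hx using hone x hx.1 hx.2
    have h2 := hid (1 - T) w.2.1 (by
      filter_upwards [hev] with x hx using hΦ.outside _ (hI T hT) x hx.1)
    simp only [linearGerm, h2, h1.fderiv_eq, h1.self_of_nhds, hΦ.outside _ (hI T hT) _ hρw,
      ContinuousLinearMap.inverse_id, ContinuousLinearMap.comp_id, mul_one, sub_add_cancel,
      one_mul, one_smul, fderiv_fun_const, Pi.zero_apply, smul_zero, add_zero, dualVec_innerCLM]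
  · intro w
    have h2 := hid 0 w.2.1 (Filter.Eventually.of_forall hΦ.zero)
    simp only [linearGerm, sub_self, zero_mul, zero_add, one_mul, one_smul, mul_zero, zero_smul,
      add_zero, h2, hΦ.zero, ContinuousLinearMap.inverse_id, ContinuousLinearMap.comp_id,
      dualVec_innerCLM]

/-- A contact germ along a disk which induces a diffeomorphism isotopic to the identity is isotopic
to the identity. -/
theorem IsCoreGerm.exists_families [NeZero n] {ρ₁ ρ η : ℝ} {Φ : ℝ × Euc n → Euc n}
    {c : Model n → Model n} (h : IsCoreGerm ρ₁ ρ η (fun x => Φ (1, x)) c)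
    (hΦ : IsBallIsotopy ρ₁ Φ) (h0 : 0 < ρ₁) (hρ : ρ₁ < ρ) (hη : 0 < η) :
    ∃ E₁ E₂ : ℝ × Model n → Model n, IsCoreFamily ρ₁ ρ (η / 2) E₁ ∧ IsCoreFamily ρ₁ ρ (η / 2) E₂ ∧
      (∀ w ∈ coreBox n ρ (η / 2), E₁ (0, w) = c w) ∧
      (∀ w ∈ coreBox n ρ (η / 2), E₁ (1, w) = E₂ (0, w)) ∧ ∀ w, E₂ (1, w) = w := by
  obtain ⟨E, hE⟩ := h.exists_isRescaling hη
  have hη2 : 0 < η / 2 := by linarith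
  have hsub : coreBox n ρ (η / 2) ⊆ coreBox n ρ η := fun w hw => ⟨hw.1, hw.2.trans (by linarith)⟩
  have hc := h.contDiffOn.mono hsub
  have hker : ∀ w ∈ coreBox n ρ (η / 2), ∀ v,
      jetForm n (c w) (fderiv ℝ c w v) = 0 ↔ jetForm n w v = 0 := fun w hw => h.ker w (hsub hw)
  have hslice : ∀ w ∈ coreBox n ρ (η / 2), w.1 = 3 / 2 * inner ℝ w.2.1 w.2.2 → ρ₁ < ‖w.2.1‖ →
      c w = w := fun w hw => h.slice w (hsub hw)
  have hz : (0 : ℝ) ∈ Icc (0 : ℝ) 1 := ⟨le_rfl, zero_le_one⟩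
  have hI : ∀ T ∈ Icc (0 : ℝ) 1, 1 - T ∈ Icc (0 : ℝ) 1 := fun T hT =>
    ⟨by linarith [hT.2], by linarith [hT.1]⟩
  set l : Euc n → ℝ := fun x => jetFactor c (0, x, 0) with hl
  have hls : ContDiffOn ℝ ∞ l (Metric.ball 0 ρ) := contDiffOn_jetFactor_core hη2 hc
  -- The linearization fixes the points of the slice with `y = s x`, `t = (3/2) s ‖x‖^2`, but
  -- multiplies `t` by `l x`. Since `t ≠ 0`, the factor is `1`.
  have hone : ∀ x, ρ₁ < ‖x‖ → ‖x‖ < ρ → l x = 1 := by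
    intro x hx1 hx2
    have hx0 : 0 < ‖x‖ := h0.trans hx1
    have hcont : Continuous fun s : ℝ => ‖((3 / 2 * (s * ‖x‖ ^ 2), s • x) : ℝ × Euc n)‖ := by
      fun_prop
    have hev : ∀ᶠ s in 𝓝[>] (0 : ℝ), ‖((3 / 2 * (s * ‖x‖ ^ 2), s • x) : ℝ × Euc n)‖ < η / 2 :=
      (hcont.continuousAt.eventually (gt_mem_nhds (by simpa using hη2))).filter_mono
        nhdsWithin_le_nhds
    obtain ⟨s, hs1, hs2⟩ := (hev.and self_mem_nhdsWithin).exists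
    have hs0 : 0 < s := hs2
    let w : Model n := (3 / 2 * (s * ‖x‖ ^ 2), x, s • x)
    have hw : w ∈ coreBox n ρ (η / 2) := ⟨hx2, hs1⟩
    have h1 := hE.slice_eq hslice hz hw (by
      simp only [w, real_inner_smul_right, real_inner_self_eq_norm_sq]) hx1
    have h2 := (hE.zero_eq hη2 hc h.core hker hw).1
    rw [h1] at h2
    have h3 : w.1 ≠ 0 := by
      have : 0 < 3 / 2 * (s * ‖x‖ ^ 2) := by positivity
      exact this.ne'
    have h4 : l x * w.1 = 1 * w.1 := by rw [one_mul]; exact h2.symm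
    exact mul_right_cancel₀ h3 h4
  have hpos : ∀ x, ‖x‖ < ρ → 0 < l x := fun x hx =>
    pos_of_ne_zero_of_eq_one h0 hρ hls.continuousOn
      (fun x hx => jetFactor_ne_zero (hker _ (core_mem_coreBox hη2 hx))) hone hx
  obtain ⟨hE₂, hE₂1⟩ := isCoreFamily_linearGerm (η / 2) hΦ hls hpos hone
  -- Both germs satisfy the same equations for the three components, and these determine a germ
  -- because `DF` is surjective.
  have hjoin : ∀ w ∈ coreBox n ρ (η / 2), E (0, w) = linearGerm l Φ (0, w) := by
    intro w hw
    obtain ⟨h1, h2, h3⟩ := hE.zero_eq hη2 hc h.core hker hw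
    have hone' : (1 : ℝ) ∈ Icc (0 : ℝ) 1 := ⟨zero_le_one, le_rfl⟩
    have hi := hΦ.injective_spaceDeriv 1 hone' w.2.1
    have hD : fderiv ℝ (fun x => Φ (1, x)) w.2.1 = spaceDeriv Φ (1, w.2.1) :=
      (hasFDerivAt_spaceDeriv hΦ.contDiff 1 w.2.1).fderiv
    refine Prod.ext ?_ (Prod.ext ?_ (ext_inner_right ℝ fun u => ?_))
    · rw [h1]; simp [linearGerm, l]
    · rw [h2]; simp [linearGerm]
    · obtain ⟨e, he⟩ := exists_equiv_of_injective hi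
      obtain ⟨u, rfl⟩ := e.surjective u
      have h4 : e u = spaceDeriv Φ (1, w.2.1) u := by rw [← he]; rfl
      have h5 := h3 u
      have h6 := inner_linearGerm (l := l) (Φ := Φ) (T := 0) (w := w) (by rwa [sub_zero]) u
      rw [sub_zero] at h6
      rw [h4, h6, ← hD, h5]
      simp [l]
  refine ⟨fun p => E (1 - p.1, p.2), linearGerm l Φ, ⟨?_, ?_, ?_, ?_, ?_⟩, hE₂, ?_, ?_, hE₂1⟩
  · intro T hT w hw
    exact ContDiffAt.comp (g := E) (T, w) (hE.contDiffAt (hI T hT) hw) (by fun_prop)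
  · intro T hT w hw w' hw' hww
    simp only at hww
    -- Injectivity for `r = 0` is not a limit of that for `r > 0`; it is read off from the linear
    -- germ.
    rcases (hI T hT).1.eq_or_lt with h1 | h1
    · rw [← h1, hjoin w hw, hjoin w' hw'] at hww
      exact hE₂.injOn 0 hz hw hw' hww
    · have h2 := congrArg (rescale n (1 - T)) hww
      rw [hE.rescale_eq _ w (IsRescaling.mem_domain (hI T hT) hw).1
          (IsRescaling.mem_domain (hI T hT) hw).2,
        hE.rescale_eq _ w' (IsRescaling.mem_domain (hI T hT) hw').1
          (IsRescaling.mem_domain (hI T hT) hw').2] at h2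
      exact rescale_injective h1.ne' (h.injOn (hsub (IsRescaling.rescale_mem (hI T hT) hw))
        (hsub (IsRescaling.rescale_mem (hI T hT) hw')) h2)
  · intro T hT x hx
    exact ⟨Φ (1, x), hE.core_eq hη2 h.core _ hx,
      fun h1 => hΦ.norm_le ⟨zero_le_one, le_rfl⟩ h1⟩
  · intro T hT w hw v
    show jetForm n (E (1 - T, w)) (fderiv ℝ (fun w => E (1 - T, w)) w v) = 0 ↔ _
    rw [hE.jetForm_eq hc hker (hI T hT) hw v, mul_eq_zero]
    exact ⟨fun h1 => h1.resolve_left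
      (jetFactor_ne_zero (hker _ (IsRescaling.rescale_mem (hI T hT) hw))), Or.inr⟩
  · intro T hT w hw h1 h2
    exact hE.slice_eq hslice (hI T hT) hw h1 h2
  · intro w hw
    have h1 := hE.rescale_eq 1 w hw.1 (by simpa using hw.2)
    have h2 : ∀ w : Model n, rescale n 1 w = w := fun w => by simp [rescale_apply]
    rw [h2, h2] at h1
    simpa using h1
  · intro w hw
    simpa using hjoin w hw

end LinearGerms

/-! ### Isotopies of contact germs along the unstable disk -/

section Shear

variable {n : ℕ}

/-- The change of coordinates `(t, x, y) ↦ (t + (3/2) ⟨x, y⟩, x, y)`, which carries `dt + β_n` to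
`dt - ∑ y_i dx_i`. -/
def shear (w : Model n) : Model n := (w.1 + 3 / 2 * inner ℝ w.2.1 w.2.2, w.2)

/-- The inverse of `shear`. -/
def unshear (w : Model n) : Model n := (w.1 - 3 / 2 * inner ℝ w.2.1 w.2.2, w.2)

@[simp] theorem shear_unshear (w : Model n) : shear (unshear w) = w := by simp [shear, unshear]

@[simp] theorem unshear_shear (w : Model n) : unshear (shear w) = w := by simp [shear, unshear]

@[simp] theorem shear_core (t : ℝ) (x : Euc n) : shear (t, x, 0) = (t, x, 0) := by simp [shear]

@[simp] theorem unshear_core (t : ℝ) (x : Euc n) : unshear (t, x, 0) = (t, x, 0) := by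
  simp [unshear]

theorem contDiff_inner_snd : ContDiff ℝ ∞ fun w : Model n => (inner ℝ w.2.1 w.2.2 : ℝ) :=
  contDiff_snd.fst.inner ℝ contDiff_snd.snd

theorem contDiff_shear : ContDiff ℝ ∞ (shear (n := n)) :=
  (contDiff_fst.add (contDiff_const.mul contDiff_inner_snd)).prodMk contDiff_snd

theorem contDiff_unshear : ContDiff ℝ ∞ (unshear (n := n)) :=
  (contDiff_fst.sub (contDiff_const.mul contDiff_inner_snd)).prodMk contDiff_snd

theorem fderiv_shear (w v : Model n) : fderiv ℝ shear w v =
    (v.1 + 3 / 2 * (inner ℝ w.2.1 v.2.2 + inner ℝ v.2.1 w.2.2), v.2) := by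
  have h1 : HasFDerivAt (fun w : Model n => w.2.1) (projP n) w := (projP n).hasFDerivAt
  have h2 : HasFDerivAt (fun w : Model n => w.2.2) (projQ n) w := (projQ n).hasFDerivAt
  have h3 := ((hasFDerivAt_fst (𝕜 := ℝ) (p := w)).add ((h1.inner ℝ h2).const_mul (3 / 2))).prodMk
    (hasFDerivAt_snd (𝕜 := ℝ) (p := w))
  have h4 : fderiv ℝ shear w = _ := h3.fderiv
  rw [h4]
  simp

theorem jetForm_shear (w v : Model n) :
    jetForm n (shear w) (fderiv ℝ shear w v) = v.1 + handleForm w.2 v.2 := by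
  rw [fderiv_shear, jetForm_apply, HandleShape.handleForm_eq]
  simp only [shear]
  rw [real_inner_comm v.2.1 w.2.2]
  ring

theorem shear_slice (z : Euc n × Euc n) :
    (shear ((0 : ℝ), z)).1 = 3 / 2 * inner ℝ (shear ((0 : ℝ), z)).2.1 (shear ((0 : ℝ), z)).2.2 := by
  simp [shear]

open Classical in
/-- The points of the slice `t = 0` moved by an isotopy of contact germs. -/
def coreMove (ρ : ℝ) (E : ℝ × Model n → Model n) (T : ℝ) (z : Euc n × Euc n) : Model n :=
  if ‖z.1‖ < ρ then unshear (E (T, shear (0, z))) else (0, z)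

theorem coreMove_of_lt {ρ : ℝ} (E : ℝ × Model n → Model n) (T : ℝ) {z : Euc n × Euc n}
    (hz : ‖z.1‖ < ρ) : coreMove ρ E T z = unshear (E (T, shear (0, z))) := if_pos hz

theorem coreMove_of_le {ρ : ℝ} (E : ℝ × Model n → Model n) (T : ℝ) {z : Euc n × Euc n}
    (hz : ρ ≤ ‖z.1‖) : coreMove ρ E T z = (0, z) := if_neg hz.not_gt

/-- After shearing, the slice `t = 0` of the handle is `t = (3/2) ⟨x, y⟩`, on which the isotopy is
stationary beyond `ρ₁`. So the two clauses of `coreMove` agree on an annulus and fit together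
smoothly. -/
theorem IsCoreFamily.coreMove_eq {ρ₁ ρ₂ ρ η : ℝ} {E : ℝ × Model n → Model n}
    (hE : IsCoreFamily ρ₁ ρ η E) {T : ℝ} (hT : T ∈ Icc (0 : ℝ) 1) {z : Euc n × Euc n}
    (hz : ρ₁ < ‖z.1‖) (hbox : ‖z.1‖ < ρ₂ → shear (0, z) ∈ coreBox n ρ η) :
    coreMove ρ₂ E T z = (0, z) := by
  rcases lt_or_ge ‖z.1‖ ρ₂ with h | h
  · rw [coreMove_of_lt E T h, hE.slice T hT _ (hbox h) (shear_slice z) hz, unshear_shear]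
  · exact coreMove_of_le E T h

/-- The points close to the core stay in the domain where they can be controlled. -/
theorem IsCoreFamily.exists_thin {ρ₁ ρ₂ ρ η : ℝ} {E : ℝ × Model n → Model n}
    (hE : IsCoreFamily ρ₁ ρ η E) (h12 : ρ₁ < ρ₂) (h2 : ρ₂ < ρ) (hη : 0 < η) {U : Set (Model n)}
    (hU : ∀ x : Euc n, ‖x‖ ≤ ρ₂ → U ∈ 𝓝 ((0 : ℝ), x, (0 : Euc n))) :
    ∃ δ > 0, ∀ z : Euc n × Euc n, ‖z.1‖ ≤ ρ₂ → ‖z.2‖ < δ → shear (0, z) ∈ coreBox n ρ η ∧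
      ∀ T ∈ Icc (0 : ℝ) 1, unshear (E (T, shear (0, z))) ∈ U ∧
        (‖z.1‖ ≤ ρ₁ → ‖(unshear (E (T, shear (0, z)))).2.1‖ < ρ₂) := by
  let B : Euc n × (ℝ × Euc n) → Model n := fun v => unshear (E (v.2.1, shear (0, v.2.2, v.1)))
  have hsc : ∀ v : Euc n × (ℝ × Euc n), ContinuousAt
      (fun v : Euc n × (ℝ × Euc n) => shear ((0 : ℝ), v.2.2, v.1)) v := fun v =>
    (contDiff_shear.continuous.comp (by fun_prop)).continuousAt
  -- The conditions are open and hold for `y = 0`, where the isotopy moves the disk within itself.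
  -- Compactness of the set of all `(T, x)` gives a uniform bound for `‖y‖`.
  have h0 : ∀ᶠ y in 𝓝 (0 : Euc n), ∀ v ∈ Icc (0 : ℝ) 1 ×ˢ Metric.closedBall (0 : Euc n) ρ₂,
      shear (0, v.2, y) ∈ coreBox n ρ η ∧ B (y, v) ∈ U ∧ (‖v.2‖ ≤ ρ₁ → ‖(B (y, v)).2.1‖ < ρ₂) := by
    refine (isCompact_Icc.prod (isCompact_closedBall _ _)).eventually_forall_of_forall_eventually
      (P := fun y v => shear (0, v.2, y) ∈ coreBox n ρ η ∧ B (y, v) ∈ U ∧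
        (‖v.2‖ ≤ ρ₁ → ‖(B (y, v)).2.1‖ < ρ₂)) ?_
    rintro ⟨T, x⟩ ⟨hT, hx⟩
    have hT : T ∈ Icc (0 : ℝ) 1 := hT
    have hx : ‖x‖ ≤ ρ₂ := by simpa using hx
    have hbox := core_mem_coreBox hη (hx.trans_lt h2)
    have hBc : ContinuousAt B (0, T, x) := by
      have h3 : ContinuousAt E (T, shear ((0 : ℝ), x, (0 : Euc n))) := by
        rw [shear_core]; exact (hE.contDiffAt T hT _ hbox).continuousAt
      have h4 : ContinuousAt (fun v : Euc n × (ℝ × Euc n) =>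
          (v.2.1, shear ((0 : ℝ), v.2.2, v.1))) (0, T, x) :=
        continuousAt_snd.fst.prodMk (hsc _)
      exact contDiff_unshear.continuous.continuousAt.comp
        (ContinuousAt.comp (g := E) (x := ((0 : Euc n), T, x)) h3 h4)
    obtain ⟨x', hB, hx'1, hx'2⟩ : ∃ x', B (0, T, x) = (0, x', 0) ∧ ‖x'‖ ≤ ρ₂ ∧
        (‖x‖ ≤ ρ₁ → ‖x'‖ < ρ₂) := by
      rcases le_or_gt ‖x‖ ρ₁ with h3 | h3
      · obtain ⟨x', h4, h5⟩ := hE.core T hT x (hx.trans_lt h2)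
        refine ⟨x', by simp [B, h4], (h5 h3).trans h12.le, fun _ => (h5 h3).trans_lt h12⟩
      · have h4 := hE.slice T hT _ hbox (by simp) h3
        exact ⟨x, by simp [B, h4], hx, fun h => absurd h h3.not_ge⟩
    have e1 : ∀ᶠ v in 𝓝 ((0 : Euc n), T, x), shear ((0 : ℝ), v.2.2, v.1) ∈ coreBox n ρ η :=
      (hsc _).eventually (by
        simp only [shear_core]; exact (isOpen_coreBox ρ η).mem_nhds hbox)
    have e2 : ∀ᶠ v in 𝓝 ((0 : Euc n), T, x), B v ∈ U := hBc.eventually (by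
      rw [hB]; exact hU x' hx'1)
    have e3 : ∀ᶠ v in 𝓝 ((0 : Euc n), T, x), ‖v.2.2‖ ≤ ρ₁ → ‖(B v).2.1‖ < ρ₂ := by
      rcases le_or_gt ‖x‖ ρ₁ with h3 | h3
      · have h4 : ContinuousAt (fun v => ‖(B v).2.1‖) (0, T, x) := hBc.snd.fst.norm
        filter_upwards [h4.eventually (gt_mem_nhds (by simp only [hB]; exact hx'2 h3))] with v hv _ using hv
      · have h4 : ContinuousAt (fun v : Euc n × (ℝ × Euc n) => ‖v.2.2‖) (0, T, x) :=
          continuousAt_snd.snd.norm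
        filter_upwards [h4.eventually (lt_mem_nhds h3)] with v hv h5 using absurd h5 hv.not_ge
    filter_upwards [e1, e2, e3] with v h3 h4 h5 using ⟨h3, h4, h5⟩
  obtain ⟨δ, hδ, hδs⟩ := Metric.eventually_nhds_iff.1 h0
  refine ⟨δ, hδ, fun z hz1 hz2 => ⟨?_, fun T hT => ?_⟩⟩
  · exact (hδs (by simpa using hz2) (0, z.1) ⟨⟨le_rfl, zero_le_one⟩, by simpa using hz1⟩).1
  · exact (hδs (by simpa using hz2) (T, z.1) ⟨hT, by simpa using hz1⟩).2

end Shear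

/-! ### Isotopies of divisors induced by isotopies of germs -/

section CoreIsotopy

variable {k : ℕ} {N : Type*} [TopologicalSpace N] [ChartedSpace (Euc k) N] [IsManifold (𝓡 k) ∞ N]
variable {n m : ℕ} {M : Type*} [TopologicalSpace M] [ChartedSpace (Euc m) M] [IsManifold (𝓡 m) ∞ M]

theorem IsThin.mono {s : HandleShape} {α : OneForm m M} {h : AmbientHandle n s α} {ι : N → M}
    {μ η η' : ℝ} {j : N → Euc n × Euc n} (hj : IsThin k h ι μ η j) (hη : η ≤ η') :
    IsThin k h ι μ η' j :=
  { hj with thin := fun x hx he => (hj.thin x hx he).trans_le hη }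

theorem IsCoreFamily.handleForm_derivTo_eq_zero_iff {ρ₁ ρ η : ℝ} {E : ℝ × Model n → Model n}
    (hE : IsCoreFamily ρ₁ ρ η E) {T : ℝ} (hT : T ∈ Icc (0 : ℝ) 1) {j : N → Euc n × Euc n} {x : N}
    (hj : MDifferentiableAt (𝓡 k) 𝓘(ℝ, Euc n × Euc n) j x) (hx : shear (0, j x) ∈ coreBox n ρ η)
    (u : Euc k) :
    (derivTo k (fun y => unshear (E (T, shear (0, j y)))) x u).1 +
        handleForm (unshear (E (T, shear (0, j x)))).2
          (derivTo k (fun y => unshear (E (T, shear (0, j y)))) x u).2 = 0 ↔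
      handleForm (j x) (derivTo k j x u) = 0 := by
  have hET : DifferentiableAt ℝ (fun w => E (T, w)) (shear (0, j x)) :=
    (ContDiffAt.comp (g := E) (n := ∞) _ (hE.contDiffAt T hT _ hx)
      (by fun_prop)).differentiableAt (by simp)
  have hsh : ∀ w : Model n, DifferentiableAt ℝ shear w := contDiff_shear.differentiable (by simp)
  have hun : ∀ w : Model n, DifferentiableAt ℝ unshear w :=
    contDiff_unshear.differentiable (by simp)
  have hj0 : MDifferentiableAt (𝓡 k) 𝓘(ℝ, Model n) (fun y => ((0 : ℝ), j y)) x :=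
    MDifferentiableAt.comp (g := ContinuousLinearMap.inr ℝ ℝ (Euc n × Euc n)) x
      (ContinuousLinearMap.inr ℝ ℝ (Euc n × Euc n)).differentiableAt.mdifferentiableAt hj
  have hj1 : MDifferentiableAt (𝓡 k) 𝓘(ℝ, Model n) (fun y => shear ((0 : ℝ), j y)) x :=
    MDifferentiableAt.comp (g := shear) x (hsh _).mdifferentiableAt hj0
  have hj2 : MDifferentiableAt (𝓡 k) 𝓘(ℝ, Model n) (fun y => E (T, shear ((0 : ℝ), j y))) x :=
    MDifferentiableAt.comp (g := fun w => E (T, w)) x hET.mdifferentiableAt hj1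
  have hj3 : MDifferentiableAt (𝓡 k) 𝓘(ℝ, Model n)
      (fun y => unshear (E (T, shear ((0 : ℝ), j y)))) x :=
    MDifferentiableAt.comp (g := unshear) x (hun _).mdifferentiableAt hj2
  have c1 := fderiv_comp_derivTo (k := k) (ψ := shear) (ζ := fun y => ((0 : ℝ), j y)) (hsh _) hj0
  have c2 := fderiv_comp_derivTo (k := k) (ψ := fun w => E (T, w))
    (ζ := fun y => shear ((0 : ℝ), j y)) hET hj1
  have c3 := fderiv_comp_derivTo (k := k) (ψ := shear)
    (ζ := fun y => unshear (E (T, shear ((0 : ℝ), j y)))) (hsh _) hj3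
  simp only [shear_unshear] at c3
  have c4 := DFunLike.congr_fun c3 u
  rw [ContinuousLinearMap.comp_apply] at c4
  rw [← jetForm_shear, ← c4, shear_unshear, c2,
    ContinuousLinearMap.comp_apply, hE.ker T hT _ hx, c1, ContinuousLinearMap.comp_apply,
    jetForm_shear, derivTo_zero_prodMk hj, zero_add]

/-- An isotopy of contact germs along the unstable disk induces an isotopy of divisors which are
close to the unstable disk. -/
theorem exists_formalIsotopy_coreMove [T2Space M] [CompactSpace N] {s : HandleShape}
    {α : OneForm m M} (hα : IsContactForm α) {h h' : AmbientHandle n s α} {ι : N → M}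
    (hm : m = 2 * n + 1) (hk : k + 2 = m) (hι : IsContactSubmanifold k α ι)
    (hs : h.IsSurgeryData (range ι))
    (hdisj : ∀ z ∈ s.handle n, s.exitFn z < 0 → ∀ x ∉ h.attach ι, h'.emb z ≠ ι x) {μ : ℝ}
    (hμ : 0 < μ) (hagree : ∀ z ∈ s.handle n, -(μ / 8) < s.exitFn z → h'.emb z = h.emb z)
    {ρ₁ ρ₂ ρ η : ℝ} (h12 : ρ₁ < ρ₂) (h2 : ρ₂ < ρ) (hη : 0 < η)
    (hρ₂ : s.lowerU ρ₂ = 2 * s.εU - μ / 2) {E : ℝ × Model n → Model n}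
    (hE : IsCoreFamily ρ₁ ρ η E) :
    ∃ δ > 0, ∀ j, IsThin k h ι μ δ j →
      (∀ x ∈ h.attach ι, ‖(j x).1‖ < ρ₂ → shear (0, j x) ∈ coreBox n ρ η) ∧
      (IsContactCopy k α ι (glue (h.attach ι) (fun x => h'.thick (coreMove ρ₂ E 0 (j x))) ι) →
      IsContactCopy k α ι (glue (h.attach ι) (fun x => h'.thick (coreMove ρ₂ E 1 (j x))) ι) ∧
      Nonempty (FormalIsotopy k α ι
        (glue (h.attach ι) (fun x => h'.thick (coreMove ρ₂ E 0 (j x))) ι)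
        (glue (h.attach ι) (fun x => h'.thick (coreMove ρ₂ E 1 (j x))) ι))) := by
  have hV : IsOpen (h.attach ι) := AmbientHandle.isOpen_attach hα hm hk hι hs
  have hcl : IsClosed (ι '' (h.attach ι)ᶜ) :=
    (hV.isClosed_compl.isCompact.image hι.contMDiff.continuous).isClosed
  -- The moved points leave the slice `t = 0`, so they have to be kept in the thickened handle and
  -- away from the compact rest of the divisor. Both hold in a neighbourhood of the disk of radius
  -- `ρ₂`.
  set U : Set (Model n) := {w | w ∈ Icc (-h'.a) h'.a ×ˢ s.handle n ∧
    h'.thick w ∉ ι '' (h.attach ι)ᶜ} with hUdef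
  have hIcc : Icc (-h'.a) h'.a ∈ 𝓝 (0 : ℝ) := Icc_mem_nhds (neg_lt_zero.2 h'.a_pos) h'.a_pos
  have hU : ∀ x : Euc n, ‖x‖ ≤ ρ₂ → U ∈ 𝓝 ((0 : ℝ), x, (0 : Euc n)) := by
    intro x hx
    have he : s.exitFn (x, (0 : Euc n)) < 0 :=
      (s.exitFn_le_of_norm_le (z := (x, (0 : Euc n))) hρ₂ hx).trans_lt (by linarith)
    have hint := HandleShape.mem_unstableDisk_of_exitFn he
    have h1 : Icc (-h'.a) h'.a ×ˢ s.handle n ∈ 𝓝 ((0 : ℝ), x, (0 : Euc n)) :=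
      prod_mem_nhds hIcc (mem_interior_iff_mem_nhds.1 hint)
    have h3 : h'.thick (0, x, 0) ∉ ι '' (h.attach ι)ᶜ := by
      rintro ⟨x', hx', hxx⟩
      exact hdisj _ (interior_subset hint) he x' hx' hxx.symm
    have h4 := (h'.isModelDomain.contMDiffAt (h'.zero_mem_domain
      (interior_subset hint))).continuousAt.eventually (hcl.isOpen_compl.mem_nhds h3)
    filter_upwards [h1, h4] with w hw hw' using ⟨hw, hw'⟩
  obtain ⟨δ, hδ, hδE⟩ := hE.exists_thin h12 h2 hη hU
  refine ⟨δ, hδ, fun j hj => ?_⟩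
  have hthin : ∀ x ∈ h.attach ι, ‖(j x).1‖ ≤ ρ₂ → ‖(j x).2‖ < δ := fun x hx h1 =>
    hj.thin x hx (s.exitFn_le_of_norm_le hρ₂ h1)
  have hbox : ∀ x ∈ h.attach ι, ‖(j x).1‖ < ρ₂ → shear (0, j x) ∈ coreBox n ρ η :=
    fun x hx h1 => (hδE _ h1.le (hthin x hx h1.le)).1
  refine ⟨hbox, fun hcopy => ?_⟩
  have hσ : ∀ T : ℝ, Real.smoothTransition T ∈ Icc (0 : ℝ) 1 := fun T =>
    ⟨Real.smoothTransition.nonneg T, Real.smoothTransition.le_one T⟩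
  -- the shape of the isotopy near the points of the attaching region
  have hfar : ∀ x ∈ h.attach ι, ρ₂ ≤ ‖(j x).1‖ → ∀ᶠ y in 𝓝 x, ∀ T,
      coreMove ρ₂ E (Real.smoothTransition T) (j y) = (0, j y) := by
    intro x hx hρ
    have h1 : ContinuousAt (fun y => ‖(j y).1‖) x := (hj.contMDiffAt x hx).continuousAt.fst.norm
    filter_upwards [hV.mem_nhds hx, h1.eventually (lt_mem_nhds (h12.trans_le hρ))] with y hy hy' T
    exact hE.coreMove_eq (hσ T) hy' (hbox y hy)
  have hnear : ∀ x ∈ h.attach ι, ‖(j x).1‖ < ρ₂ → ∀ᶠ y in 𝓝 x, ∀ T,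
      coreMove ρ₂ E (Real.smoothTransition T) (j y) =
        unshear (E (Real.smoothTransition T, shear (0, j y))) := by
    intro x hx hρ
    have h1 : ContinuousAt (fun y => ‖(j y).1‖) x := (hj.contMDiffAt x hx).continuousAt.fst.norm
    filter_upwards [h1.eventually (gt_mem_nhds hρ)] with y hy T
    exact coreMove_of_lt E _ hy
  have hinc : ContDiff ℝ ∞ fun z : Euc n × Euc n => shear ((0 : ℝ), z) :=
    contDiff_shear.comp (contDiff_const.prodMk contDiff_id)
  have hmem : ∀ T x, x ∈ h.attach ι → ‖(j x).1‖ < ρ₂ →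
      unshear (E (Real.smoothTransition T, shear (0, j x))) ∈ U := fun T x hx hρ =>
    ((hδE _ hρ.le (hthin x hx hρ.le)).2 _ (hσ T)).1
  have hI : ∀ T x, x ∈ h.attach ι →
      coreMove ρ₂ E (Real.smoothTransition T) (j x) ∈ Icc (-h'.a) h'.a ×ˢ s.handle n := by
    intro T x hx
    rcases lt_or_ge ‖(j x).1‖ ρ₂ with hρ | hρ
    · rw [coreMove_of_lt E _ hρ]; exact (hmem T x hx hρ).1
    · rw [coreMove_of_le E _ hρ]; exact h'.zero_mem (hj.mem x hx)
  have := exists_formalIsotopy_of_glue hα hι h'.isModelDomain.isOpen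
    h'.isModelDomain.contMDiffOn h'.isModelDomain.injOn hV
    (C := {x | x ∈ h.attach ι ∧ s.exitFn (h.coord ι x) ≤ -(μ / 8)})
    (AmbientHandle.isClosed_coord_le hι.contMDiff.continuous (by positivity)) (fun x hx => hx.1)
    (μ := fun T x => coreMove ρ₂ E (Real.smoothTransition T) (j x)) ?_
    (fun T _ x hx => h'.isModelDomain.subset (hI T x hx)) ?_ ?_ ?_ ?_ ?_
  · simp only [Real.smoothTransition.zero, Real.smoothTransition.one] at this
    exact this
  · intro T hT x hx
    have hjs : ContMDiffAt (𝓘(ℝ, ℝ).prod (𝓡 k)) 𝓘(ℝ, Euc n × Euc n) ∞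
        (fun w : ℝ × N => j w.2) (T, x) :=
      ContMDiffAt.comp (g := j) (T, x) (hj.contMDiffAt x hx) contMDiffAt_snd
    rcases lt_or_ge ‖(j x).1‖ ρ₂ with hρ | hρ
    · have h1 : ContMDiffAt (𝓘(ℝ, ℝ).prod (𝓡 k)) 𝓘(ℝ, ℝ) ∞
          (fun w : ℝ × N => Real.smoothTransition w.1) (T, x) :=
        ContMDiffAt.comp (g := Real.smoothTransition) (T, x)
          Real.smoothTransition.contDiff.contMDiff.contMDiffAt contMDiffAt_fst
      have h3 : ContMDiffAt (𝓘(ℝ, ℝ).prod (𝓡 k)) 𝓘(ℝ, ℝ × Model n) ∞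
          (fun w : ℝ × N => (Real.smoothTransition w.1, shear ((0 : ℝ), j w.2))) (T, x) :=
        h1.prodMk_space (ContMDiffAt.comp (g := fun z : Euc n × Euc n => shear ((0 : ℝ), z)) (T, x)
          hinc.contMDiff.contMDiffAt hjs)
      have h4 : ContMDiffAt (𝓘(ℝ, ℝ).prod (𝓡 k)) 𝓘(ℝ, Model n) ∞
          (fun w : ℝ × N => unshear (E (Real.smoothTransition w.1, shear ((0 : ℝ), j w.2)))) (T, x) :=
        ContMDiffAt.comp (g := fun v : ℝ × Model n => unshear (E v)) (T, x)
          (ContDiffAt.contMDiffAt (contDiff_unshear.contDiffAt.comp _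
            (hE.contDiffAt _ (hσ T) _ (hbox x hx hρ)))) h3
      refine h4.congr_of_eventuallyEq ?_
      filter_upwards [continuousAt_snd.eventually (hnear x hx hρ)] with w hw using hw w.1
    · have h4 : ContMDiffAt (𝓘(ℝ, ℝ).prod (𝓡 k)) 𝓘(ℝ, Model n) ∞
          (fun w : ℝ × N => ((0 : ℝ), j w.2)) (T, x) :=
        ContMDiffAt.comp (g := ContinuousLinearMap.inr ℝ ℝ (Euc n × Euc n)) (T, x)
          (ContinuousLinearMap.inr ℝ ℝ (Euc n × Euc n)).contDiff.contMDiff.contMDiffAt hjs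
      refine h4.congr_of_eventuallyEq ?_
      filter_upwards [continuousAt_snd.eventually (hfar x hx hρ)] with w hw using hw w.1
  · rintro T hT x ⟨hx, hxC⟩
    have hex : -(μ / 8) < s.exitFn (h.coord ι x) := by
      by_contra! h1
      exact hxC ⟨hx, h1⟩
    have hjc := hj.eq_coord x hx hex
    -- The radius `ρ₂` bounds a region of exit level at most `-μ/2`, which is disjoint from the
    -- region where `j` is still the inclusion.
    have hρ : ρ₂ ≤ ‖(j x).1‖ := by
      by_contra! h1
      have := s.exitFn_le_of_norm_le hρ₂ h1.le
      rw [hjc] at this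
      linarith
    simp only [coreMove_of_le E _ hρ]
    rw [hjc]
    exact (hagree _ (AmbientHandle.coord_mem_concaveBdry hx).1 hex).trans
      (AmbientHandle.emb_coord hx)
  · intro T hT x hx u
    have hjd := (hj.contMDiffAt x hx).mdifferentiableAt (n := ∞) (by simp)
    rw [← hj.ker x hx u]
    rcases lt_or_ge ‖(j x).1‖ ρ₂ with hρ | hρ
    · have h1 : (fun y => coreMove ρ₂ E (Real.smoothTransition T) (j y)) =ᶠ[𝓝 x]
          fun y => unshear (E (Real.smoothTransition T, shear (0, j y))) := by
        filter_upwards [hnear x hx hρ] with y hy using hy T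
      rw [h1.derivTo_eq, coreMove_of_lt E _ hρ,
        ← hE.handleForm_derivTo_eq_zero_iff (hσ T) hjd (hbox x hx hρ) u]
      exact (h'.isModelDomain.ker _ (hmem T x hx hρ).1 _).symm
    · have h1 : (fun y => coreMove ρ₂ E (Real.smoothTransition T) (j y)) =ᶠ[𝓝 x]
          fun y => ((0 : ℝ), j y) := by
        filter_upwards [hfar x hx hρ] with y hy using hy T
      rw [h1.derivTo_eq, coreMove_of_le E _ hρ, derivTo_zero_prodMk hjd]
      exact h'.val_thick_eq_zero_iff (hj.mem x hx) _
  · intro T hT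
    -- A moved point does not reach a stationary one: from within `ρ₁` it stays inside `ρ₂`, and
    -- between the two radii it does not move.
    have key : ∀ x ∈ h.attach ι, ∀ y ∈ h.attach ι, ‖(j x).1‖ < ρ₂ → ρ₂ ≤ ‖(j y).1‖ →
        unshear (E (Real.smoothTransition T, shear (0, j x))) = (0, j y) → x = y := by
      intro x hx y hy hρ hρ' hxy
      rcases le_or_gt ‖(j x).1‖ ρ₁ with h1 | h1
      · have h3 := ((hδE _ hρ.le (hthin x hx hρ.le)).2 _ (hσ T)).2 h1
        rw [hxy] at h3
        exact absurd h3 hρ'.not_gt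
      · rw [hE.slice _ (hσ T) _ (hbox x hx hρ) (shear_slice _) h1, unshear_shear] at hxy
        exact hj.injOn hx hy (Prod.mk.inj hxy).2
    intro x hx y hy hxy
    simp only at hxy
    rcases lt_or_ge ‖(j x).1‖ ρ₂ with hρ | hρ <;> rcases lt_or_ge ‖(j y).1‖ ρ₂ with hρ' | hρ'
    · rw [coreMove_of_lt E _ hρ, coreMove_of_lt E _ hρ'] at hxy
      have h1 := congrArg shear hxy
      rw [shear_unshear, shear_unshear] at h1
      have h3 := congrArg unshear (hE.injOn _ (hσ T) (hbox x hx hρ) (hbox y hy hρ') h1)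
      rw [unshear_shear, unshear_shear] at h3
      exact hj.injOn hx hy (Prod.mk.inj h3).2
    · rw [coreMove_of_lt E _ hρ, coreMove_of_le E _ hρ'] at hxy
      exact key x hx y hy hρ hρ' hxy
    · rw [coreMove_of_le E _ hρ, coreMove_of_lt E _ hρ'] at hxy
      exact (key y hy x hx hρ' hρ hxy.symm).symm
    · rw [coreMove_of_le E _ hρ, coreMove_of_le E _ hρ'] at hxy
      exact hj.injOn hx hy (Prod.mk.inj hxy).2
  · intro T hT x hx x' hx' hxx
    rcases lt_or_ge ‖(j x).1‖ ρ₂ with hρ | hρ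
    · simp only [coreMove_of_lt E _ hρ] at hxx
      exact (hmem T x hx hρ).2 ⟨x', hx', hxx.symm⟩
    · simp only [coreMove_of_le E _ hρ] at hxx
      exact hdisj _ (hj.mem x hx) (hj.exit_neg x hx) x' hx' hxx
  · simp only [Real.smoothTransition.zero]
    exact hcopy

end CoreIsotopy

/-! ### The contact germ relating two handles with the same unstable disk -/

section CoreGerm

variable {n m : ℕ} {M : Type*} [TopologicalSpace M] [ChartedSpace (Euc m) M] [IsManifold (𝓡 m) ∞ M]

theorem fderiv_shear_unshear (w v : Model n) :
    fderiv ℝ shear (unshear w) (fderiv ℝ unshear w v) = v := by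
  have h1 : HasFDerivAt (fun w : Model n => shear (unshear w))
      ((fderiv ℝ shear (unshear w)).comp (fderiv ℝ unshear w)) w :=
    HasFDerivAt.comp (g := shear) w (contDiff_shear.differentiable (by simp) _).hasFDerivAt
      (contDiff_unshear.differentiable (by simp) _).hasFDerivAt
  simp only [shear_unshear] at h1
  exact (DFunLike.congr_fun (h1.unique (hasFDerivAt_id w)) v)

theorem exists_coreBox_subset {ρ : ℝ} {Ω : Set (Model n)} (hΩ : IsOpen Ω)
    (h : ∀ x : Euc n, ‖x‖ ≤ ρ → ((0 : ℝ), x, (0 : Euc n)) ∈ Ω) : ∃ η > 0, coreBox n ρ η ⊆ Ω := by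
  have hc : Continuous fun x : Euc n => ((0 : ℝ), x, (0 : Euc n)) := by fun_prop
  obtain ⟨η, hη, hs⟩ := ((isCompact_closedBall (0 : Euc n) ρ).image hc).exists_thickening_subset_open
    hΩ (by rintro _ ⟨x, hx, rfl⟩; exact h x (by simpa using hx))
  refine ⟨η, hη, fun w hw => hs (Metric.mem_thickening_iff.2
    ⟨_, ⟨w.2.1, by simpa using hw.1.le, rfl⟩, ?_⟩)⟩
  have h1 : w - ((0 : ℝ), w.2.1, (0 : Euc n)) = (w.1, 0, w.2.2) := by
    refine Prod.ext ?_ (Prod.ext ?_ ?_) <;> simp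
  rw [dist_eq_norm, h1]
  have h2 := hw.2
  rw [Prod.norm_mk] at h2
  rw [Prod.norm_mk, Prod.norm_mk, norm_zero, max_eq_right (norm_nonneg w.2.2)]
  exact h2

/-- If `χ` is a local contactomorphism of `M` which carries the unstable disk of `h` to that of `h'`
then the handles are related by a contact germ. -/
theorem exists_isCoreGerm {s : HandleShape} {α : OneForm m M} (hm : m = 2 * n + 1)
    {h h' : AmbientHandle n s α} {χ : M → M} {Q : Set M} (hQ : IsOpen Q)
    (hχs : ∀ p ∈ Q, ContMDiffAt (𝓡 m) (𝓡 m) ∞ χ p)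
    (hχk : ∀ p ∈ Q, ∀ u, α.val (χ p) (derivMap m m χ p u) = 0 ↔ α.val p u = 0)
    (hχi : ∀ p ∈ Q, ∃ U ∈ 𝓝 p, InjOn χ U) {F : Euc n → Euc n} (hF : Function.Injective F)
    {ρ₁ ρ : ℝ} (hρ : ∀ x : Euc n, ‖x‖ ≤ ρ → s.exitFn (x, (0 : Euc n)) < 0 ∧
      s.exitFn (F x, (0 : Euc n)) < 0)
    (hcore : ∀ x, ‖x‖ ≤ ρ → h.core x ∈ Q ∧ χ (h.core x) = h'.core (F x))
    (hslice : ∀ z ∈ s.handle n, ρ₁ < ‖z.1‖ → ‖z.2‖ < s.εU → χ (h.emb z) = h'.emb z) :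
    ∃ η > 0, ∃ c, IsCoreGerm ρ₁ ρ η F c ∧
      ∀ w ∈ coreBox n ρ η, h'.thick (unshear (c w)) = χ (h.thick (unshear w)) := by
  set P := h.thick with hP
  set P' := h'.thick with hP'
  set inv := Function.invFunOn P' h'.domain with hinv
  have hA : ∀ h : AmbientHandle n s α, IsOpen (Ioo (-h.a) h.a ×ˢ interior (s.handle n)) :=
    fun h => isOpen_Ioo.prod isOpen_interior
  have hAI : ∀ h : AmbientHandle n s α, Ioo (-h.a) h.a ×ˢ interior (s.handle n) ⊆
    Icc (-h.a) h.a ×ˢ s.handle n := fun h => prod_mono Ioo_subset_Icc_self interior_subset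
  have hAO : ∀ h : AmbientHandle n s α, Ioo (-h.a) h.a ×ˢ interior (s.handle n) ⊆ h.domain :=
    fun h => (hAI h).trans h.isModelDomain.subset
  have hA0 : ∀ (h : AmbientHandle n s α) (x : Euc n), s.exitFn (x, (0 : Euc n)) < 0 →
      ((0 : ℝ), x, (0 : Euc n)) ∈ Ioo (-h.a) h.a ×ˢ interior (s.handle n) := fun h x hx =>
    ⟨⟨neg_lt_zero.2 h.a_pos, h.a_pos⟩, HandleShape.mem_unstableDisk_of_exitFn hx⟩
  set Ω₁ : Set (Model n) := (Ioo (-h.a) h.a ×ˢ interior (s.handle n)) ∩ P ⁻¹' Q with hΩ₁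
  have hΩ₁o : IsOpen Ω₁ := (h.isModelDomain.contMDiffOn.continuousOn.mono (hAO h)).isOpen_inter_preimage
    (hA h) hQ
  have hfs : ∀ w ∈ Ω₁, ContMDiffAt 𝓘(ℝ, Model n) (𝓡 m) ∞ (fun w => χ (P w)) w := fun w hw =>
    ContMDiffAt.comp (g := χ) w (hχs _ hw.2) (h.isModelDomain.contMDiffAt (hAO h hw.1))
  set Ω₂ : Set (Model n) := Ω₁ ∩ (fun w => χ (P w)) ⁻¹'
    (P' '' (Ioo (-h'.a) h'.a ×ˢ interior (s.handle n))) with hΩ₂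
  have hΩ₂o : IsOpen Ω₂ := ContinuousOn.isOpen_inter_preimage
    (fun w hw => (hfs w hw).continuousAt.continuousWithinAt) hΩ₁o
    (h'.isModelDomain.isOpen_image hm (hA h') (hAO h'))
  -- The germ is `χ` read in the coordinates of the two handles; shearing at both ends turns `dt +
  -- β_n` into `dt - ∑ y_i dx_i`.
  let c' : Model n → Model n := fun w => inv (χ (P w))
  have hc' : ∀ w ∈ Ω₂, c' w ∈ Ioo (-h'.a) h'.a ×ˢ interior (s.handle n) ∧
      P' (c' w) = χ (P w) := by
    rintro w ⟨hw, a, ha, haw⟩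
    have h1 : c' w = a := by
      have haw : P' a = χ (P w) := haw
      simp only [c']
      rw [← haw]
      exact h'.isModelDomain.inv_apply (hAO h' ha)
    rw [h1]
    exact ⟨ha, haw⟩
  have hc's : ∀ w ∈ Ω₂, ContDiffAt ℝ ∞ c' w := by
    intro w hw
    rw [← contMDiffAt_iff_contDiffAt]
    have h1 : ContMDiffAt (𝓡 m) 𝓘(ℝ, Model n) ∞ inv (χ (P w)) := by
      rw [← (hc' w hw).2]
      exact h'.isModelDomain.contMDiffAt_inv hm (hAO h' (hc' w hw).1)
    exact ContMDiffAt.comp (g := inv) w h1 (hfs w hw.1)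
  have hc'k : ∀ w ∈ Ω₂, ∀ v, (fderiv ℝ c' w v).1 + handleForm (c' w).2 (fderiv ℝ c' w v).2 = 0 ↔
      v.1 + handleForm w.2 v.2 = 0 := by
    intro w hw v
    have h1 := h'.isModelDomain.ker (c' w) (hAI h' (hc' w hw).1) (fderiv ℝ c' w v)
    have h2 := h.isModelDomain.ker w (hAI h hw.1.1) v
    have h3 : (fun w => P' (c' w)) =ᶠ[𝓝 w] fun w => χ (P w) := by
      filter_upwards [hΩ₂o.mem_nhds hw] with y hy using (hc' y hy).2
    have h4 := derivFrom_comp_fderiv (m := m) (κ := P') (ψ := c') (w := w)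
      (h'.isModelDomain.mdifferentiableAt (hAO h' (hc' w hw).1))
      ((hc's w hw).differentiableAt (by simp))
    have h5 := derivMap_comp_derivFrom (k := m) (m := m) (φ := χ) (κ := P) (w := w)
      ((hχs _ hw.1.2).mdifferentiableAt (by simp)) (h.isModelDomain.mdifferentiableAt (hAO h hw.1.1))
    rw [h3.derivFrom_eq, h5] at h4
    have h6 := DFunLike.congr_fun h4 v
    rw [ContinuousLinearMap.comp_apply, ContinuousLinearMap.comp_apply] at h6
    rw [h1, h2, ← h6]
    have h7 := hχk _ hw.1.2 (derivFrom m P w v)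
    rw [← (hc' w hw).2] at h7
    exact h7
  have hcore' : ∀ x : Euc n, ‖x‖ ≤ ρ → ((0 : ℝ), x, (0 : Euc n)) ∈ Ω₂ ∧
      c' (0, x, 0) = (0, F x, 0) := by
    intro x hx
    have h1 : χ (P (0, x, 0)) = P' (0, F x, 0) := (hcore x hx).2
    have h2 := hA0 h' _ (hρ x hx).2
    refine ⟨⟨⟨hA0 h x (hρ x hx).1, (hcore x hx).1⟩, _, h2, h1.symm⟩, ?_⟩
    simp only [c', h1]
    exact h'.isModelDomain.inv_apply (hAO h' h2)
  -- the germ in the sheared coordinates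
  let c : Model n → Model n := fun w => shear (c' (unshear w))
  have hcs : ∀ w, unshear w ∈ Ω₂ → ContDiffAt ℝ ∞ c w := fun w hw =>
    contDiff_shear.contDiffAt.comp w (ContDiffAt.comp (g := c') w (hc's _ hw)
      contDiff_unshear.contDiffAt)
  have hΩo : IsOpen (unshear ⁻¹' Ω₂) := hΩ₂o.preimage contDiff_unshear.continuous
  have hKc : IsCompact ((fun x : Euc n => ((0 : ℝ), x, (0 : Euc n))) '' Metric.closedBall 0 ρ) :=
    (isCompact_closedBall (0 : Euc n) ρ).image (by fun_prop)
  have hcc : ∀ x : Euc n, ‖x‖ ≤ ρ → c (0, x, 0) = (0, F x, 0) := fun x hx => by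
    simp only [c, unshear_core, (hcore' x hx).2, shear_core]
  have hKm : ∀ w ∈ (fun x : Euc n => ((0 : ℝ), x, (0 : Euc n))) '' Metric.closedBall 0 ρ,
      unshear w ∈ Ω₂ := by
    rintro _ ⟨x, hx, rfl⟩
    simp only [unshear_core]
    exact (hcore' x (by simpa using hx)).1
  -- A continuous map which is injective on a compact set and locally injective at its points is
  -- injective on a neighbourhood of it. On the disk the injectivity is that of `F`.
  obtain ⟨t, ht, htinj⟩ := Set.InjOn.exists_mem_nhdsSet (f := c) (s :=
      (fun x : Euc n => ((0 : ℝ), x, (0 : Euc n))) '' Metric.closedBall 0 ρ) (by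
    rintro _ ⟨x, hx, rfl⟩ _ ⟨y, hy, rfl⟩ hxy
    simp only [hcc x (by simpa using hx), hcc y (by simpa using hy)] at hxy
    have := hF (Prod.mk.inj (Prod.mk.inj hxy).2).1
    rw [this]) hKc (fun w hw => (hcs w (hKm w hw)).continuousAt) (by
    intro w hw
    have h1 := hKm w hw
    obtain ⟨U, hU, hUi⟩ := hχi _ h1.1.2
    have h2 : ContinuousAt (fun w => P (unshear w)) w :=
      ContinuousAt.comp (g := P) (h.isModelDomain.contMDiffAt (hAO h h1.1.1)).continuousAt
        contDiff_unshear.continuous.continuousAt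
    refine ⟨_, Filter.inter_mem (h2.preimage_mem_nhds hU) (hΩo.mem_nhds h1), ?_⟩
    rintro a ⟨ha, haΩ⟩ b ⟨hb, hbΩ⟩ hab
    have h3 : c' (unshear a) = c' (unshear b) := by
      have := congrArg unshear hab
      simpa only [c, unshear_shear] using this
    have h4 : χ (P (unshear a)) = χ (P (unshear b)) := by
      rw [← (hc' _ haΩ).2, ← (hc' _ hbΩ).2, h3]
    have h5 := congrArg shear (h.isModelDomain.injOn (hAO h haΩ.1.1) (hAO h hbΩ.1.1) (hUi ha hb h4))
    simpa only [shear_unshear] using h5)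
  obtain ⟨V, hVo, hKV, hVt⟩ := mem_nhdsSet_iff_exists.1 ht
  obtain ⟨η, hη, hbox⟩ := exists_coreBox_subset (ρ := ρ) (hVo.inter hΩo) (fun x hx =>
    ⟨hKV ⟨x, by simpa using hx, rfl⟩, hKm _ ⟨x, by simpa using hx, rfl⟩⟩)
  have hsub : coreBox n ρ (min η s.εU) ⊆ coreBox n ρ η := fun w hw =>
    ⟨hw.1, hw.2.trans_le (min_le_left _ _)⟩
  refine ⟨min η s.εU, lt_min hη s.εU_pos, c, ⟨?_, ?_, ?_, ?_, ?_⟩, ?_⟩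
  · exact fun w hw => (hcs w (hbox (hsub hw)).2).contDiffWithinAt
  · exact htinj.mono fun w hw => hVt (hbox (hsub hw)).1
  · exact fun x hx => hcc x hx.le
  · intro w hw v
    have hΩw := (hbox (hsub hw)).2
    have h1 : HasFDerivAt c ((fderiv ℝ shear (c' (unshear w))).comp
        ((fderiv ℝ c' (unshear w)).comp (fderiv ℝ unshear w))) w :=
      HasFDerivAt.comp (g := shear) w (contDiff_shear.differentiable (by simp) _).hasFDerivAt
        (HasFDerivAt.comp (g := c') w ((hc's _ hΩw).differentiableAt (by simp)).hasFDerivAt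
          (contDiff_unshear.differentiable (by simp) _).hasFDerivAt)
    rw [h1.fderiv, ContinuousLinearMap.comp_apply, ContinuousLinearMap.comp_apply, jetForm_shear,
      hc'k _ hΩw, ← jetForm_shear, fderiv_shear_unshear, shear_unshear]
  · intro w hw h1 h2
    have hΩw := (hbox (hsub hw)).2
    -- Unsheared, the slice is `t = 0`, where `hslice` compares the handles themselves. The box has
    -- size at most `εU` because `hslice` requires `‖y‖ < εU`.
    have h3 : unshear w = (0, w.2) := Prod.ext (by simp [unshear, h1]) rfl
    have hz : w.2 ∈ s.handle n := by
      have := hΩw.1.1.2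
      rw [h3] at this
      exact interior_subset this
    have h4 : ‖w.2.2‖ < s.εU :=
      ((norm_snd_le (w.1, w.2.2)).trans_lt hw.2).trans_le (min_le_right _ _)
    have h5 : c' (unshear w) = unshear w := by
      rw [h3]
      have h6 : χ (P (0, w.2)) = P' (0, w.2) := hslice _ hz h2 h4
      simp only [c', h6]
      exact h'.isModelDomain.inv_apply (h'.zero_mem_domain hz)
    simp only [c, h5, shear_unshear]
  · intro w hw
    simp only [c, unshear_shear]
    exact (hc' _ (hbox (hsub hw)).2).2

end CoreGerm

/-! ### The stabilizing map near the cusp -/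

section SheetMove

variable {n m : ℕ} [NeZero n] {M : Type*} [TopologicalSpace M] [ChartedSpace (Euc m) M]
  [IsManifold (𝓡 m) ∞ M]

/-- The interior of the neighbourhood of the lower sheet. -/
def sheetNhd (n : ℕ) [NeZero n] (R e : ℝ) : Set (Model n) :=
  {w | normSqM w < R ^ 2 ∧ |w.1 + 1| < e / 2 ∧ ‖w.2.1‖ < e / 2}

theorem isOpen_sheetNhd (R e : ℝ) : IsOpen (sheetNhd n R e) := by
  have h1 : Continuous fun w : Model n => |w.1 + 1| := by fun_prop
  have h2 : Continuous fun w : Model n => ‖w.2.1‖ := by fun_prop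
  exact (isOpen_lt continuous_normSqM continuous_const).inter
    ((isOpen_lt h1 continuous_const).inter (isOpen_lt h2 continuous_const))

variable {α : OneForm m M} {κ : Model n → M} {R : ℝ} {O : Set (Model n)} {ε e : ℝ} {g : Euc n → ℝ}
  {W : Euc n → Euc n}

theorem sheetMove_eventuallyEq_id [T2Space M] (h : IsModelDomain α (modelBall n R) stdForm κ O)
    {p : M} (hp : p ∉ κ '' sheetBox R g e) : sheetMove κ O R g W e =ᶠ[𝓝 p] id := by
  have h1 : IsClosed (κ '' sheetBox R g e) := (h.isCompact_image (isCompact_sheetBox R g e)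
    fun w hw => h.subset hw.1).isClosed
  filter_upwards [h1.isOpen_compl.mem_nhds hp] with q hq using glue_of_notMem _ _ hq

theorem sheetMove_apply (h : IsModelDomain α (modelBall n R) stdForm κ O)
    (hs : IsSheetData ε R g W e) {w : Model n} (hw : w ∈ sheetNhd n R e) :
    sheetMove κ O R g W e (κ w) = κ (sheetDeform g W (1, w)) := by
  have hwb : w ∈ modelBall n R := (le_of_lt hw.1 : _ ≤ R ^ 2)
  by_cases hq : w.2.2 ∈ tsupport fun q => g q + 1
  · have hmem : κ w ∈ κ '' sheetBox R g e := ⟨w, ⟨hwb, hw.2.1.le, hw.2.2.le, hq⟩, rfl⟩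
    rw [sheetMove, glue_of_mem _ _ hmem, h.inv_apply (h.subset hwb)]
  · rw [hs.sheetDeform_eq hq, sheetMove, glue_of_notMem, id]
    rintro ⟨w', hw', hww⟩
    rw [h.injOn (h.subset hw'.1) (h.subset hwb) hww] at hw'
    exact hq hw'.2.2.2

theorem sheetDeform_mem (hs : IsSheetData ε R g W e) {w : Model n} (hw : w ∈ sheetNhd n R e) :
    sheetDeform g W (1, w) ∈ modelBall n R := by
  by_cases hq : w.2.2 ∈ tsupport fun q => g q + 1
  · have he := hs.pos
    exact (hs.ball 1 ⟨zero_le_one, le_rfl⟩ w hq (hw.2.1.le.trans (by linarith))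
      (hw.2.2.le.trans (by linarith))).le
  · rw [hs.sheetDeform_eq hq]
    exact (le_of_lt hw.1 : _ ≤ R ^ 2)

theorem sheetMove_eventuallyEq (hm : m = 2 * n + 1)
    (h : IsModelDomain α (modelBall n R) stdForm κ O)
    (hs : IsSheetData ε R g W e) {w : Model n} (hw : w ∈ sheetNhd n R e) :
    sheetMove κ O R g W e =ᶠ[𝓝 (κ w)]
      fun p => κ (sheetDeform g W (1, Function.invFunOn κ O p)) := by
  have hwO : w ∈ O := h.subset (le_of_lt hw.1 : _ ≤ R ^ 2)
  have h1 := (h.contMDiffAt_inv hm hwO).continuousAt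
  rw [ContinuousAt, h.inv_apply hwO] at h1
  filter_upwards [h1 ((isOpen_sheetNhd R e).mem_nhds hw), h.eventually_inv hm hwO] with p hp hp'
  conv_lhs => rw [← hp'.2]
  exact sheetMove_apply h hs hp

/-- Away from the boundary of the neighbourhood of the lower sheet, the stabilizing map is a local
contactomorphism. -/
theorem sheetMove_isLocalContact [T2Space M] (hm : m = 2 * n + 1)
    (h : IsModelDomain α (modelBall n R) stdForm κ O) (hs : IsSheetData ε R g W e) {p : M}
    (hp : p ∈ (κ '' sheetBox R g e)ᶜ ∪ κ '' sheetNhd n R e) :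
    ContMDiffAt (𝓡 m) (𝓡 m) ∞ (sheetMove κ O R g W e) p ∧
    (∀ u, α.val (sheetMove κ O R g W e p) (derivMap m m (sheetMove κ O R g W e) p u) = 0 ↔
      α.val p u = 0) ∧ ∃ U ∈ 𝓝 p, InjOn (sheetMove κ O R g W e) U := by
  rcases hp with hp | ⟨w, hw, rfl⟩
  · have h1 := sheetMove_eventuallyEq_id (W := W) h hp
    refine ⟨contMDiffAt_id.congr_of_eventuallyEq h1, fun u => ?_, _, h1, fun a ha b hb hab => ?_⟩
    · have h2 : derivMap m m (id : M → M) p = ContinuousLinearMap.id ℝ (Euc m) := mfderiv_id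
      rw [h1.derivMap_eq, h2, h1.self_of_nhds]
      rfl
    · have ha : sheetMove κ O R g W e a = a := ha
      have hb : sheetMove κ O R g W e b = b := hb
      rwa [ha, hb] at hab
  · have hdef := isFormalDeformation_sheetDeform hs.contDiff hs.contDiff_field
    have hwO : w ∈ O := h.subset (le_of_lt hw.1 : _ ≤ R ^ 2)
    have hΨO := h.subset (sheetDeform_mem hs hw)
    have h1 := sheetMove_eventuallyEq hm h hs hw
    have hΨs : ContDiff ℝ ∞ fun w => sheetDeform g W (1, w) :=
      hdef.contDiff.comp (contDiff_const.prodMk contDiff_id)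
    have hinv := h.contMDiffAt_inv hm hwO
    have h2 : ContMDiffAt (𝓡 m) 𝓘(ℝ, Model n) ∞
        (fun p => sheetDeform g W (1, Function.invFunOn κ O p)) (κ w) :=
      ContMDiffAt.comp (g := fun w => sheetDeform g W (1, w)) (κ w)
        hΨs.contMDiff.contMDiffAt hinv
    have hκΨ : ContMDiffAt 𝓘(ℝ, Model n) (𝓡 m) ∞ κ
        (sheetDeform g W (1, Function.invFunOn κ O (κ w))) := by
      rw [h.inv_apply hwO]; exact h.contMDiffAt hΨO
    refine ⟨(ContMDiffAt.comp (g := κ) (κ w) hκΨ h2).congr_of_eventuallyEq h1, fun u => ?_,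
      κ '' sheetNhd n R e, (h.isOpen_image hm (isOpen_sheetNhd R e) fun w hw =>
        h.subset (le_of_lt hw.1 : _ ≤ R ^ 2)).mem_nhds ⟨w, hw, rfl⟩, ?_⟩
    · obtain ⟨v, rfl⟩ : ∃ v, derivFrom m κ w v = u :=
        (LinearMap.injective_iff_surjective_of_finrank_eq_finrank
          (f := (derivFrom m κ w).toLinearMap) (by rw [finrank_model]; simp [hm])).1
          (h.injective_derivFrom w hwO) u
      have h3 := derivMap_comp_derivFrom (k := m) (m := m) (φ := sheetMove κ O R g W e) (κ := κ)
        (w := w) (((ContMDiffAt.comp (g := κ) (κ w) hκΨ h2).congr_of_eventuallyEq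
          h1).mdifferentiableAt (by simp)) (h.mdifferentiableAt hwO)
      have h4 : (fun w => sheetMove κ O R g W e (κ w)) =ᶠ[𝓝 w]
          fun w => κ (sheetDeform g W (1, w)) := by
        filter_upwards [(isOpen_sheetNhd R e).mem_nhds hw] with y hy using sheetMove_apply h hs hy
      have h5 := derivFrom_comp_fderiv (m := m) (κ := κ) (ψ := fun w => sheetDeform g W (1, w))
        (w := w) (h.mdifferentiableAt hΨO) (hΨs.differentiable (by simp) w)
      rw [h4.derivFrom_eq, h5] at h3
      have h6 := DFunLike.congr_fun h3 v
      rw [ContinuousLinearMap.comp_apply, ContinuousLinearMap.comp_apply] at h6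
      -- At `T = 1` the lift for `S = 1` is the actual derivative, so the actual map preserves the
      -- standard form.
      have h7 := hdef.form 1 w v
      rw [hdef.right 1 w, hdef.start 1 w, stdFormL_apply, stdFormL_apply] at h7
      rw [← h6, sheetMove_apply h hs hw, ← h.ker _ (sheetDeform_mem hs hw), h7,
        h.ker w (le_of_lt hw.1 : _ ≤ R ^ 2)]
    · rintro _ ⟨a, ha, rfl⟩ _ ⟨b, hb, rfl⟩ hab
      rw [sheetMove_apply h hs ha, sheetMove_apply h hs hb] at hab
      have h3 := h.injOn (h.subset (sheetDeform_mem hs ha)) (h.subset (sheetDeform_mem hs hb)) hab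
      rw [IsSheetData.sheetDeform_injective g W 1 h3]

end SheetMove

/-! ### Stabilizations of divisors -/

namespace StabilizationData

variable {n m : ℕ} [NeZero n] {M : Type*} [TopologicalSpace M] [ChartedSpace (Euc m) M]
  [IsManifold (𝓡 m) ∞ M] {α : OneForm m M} {Γ Γ' : Set M} (d : StabilizationData n α Γ Γ')

/-- An open neighbourhood of the ball on which the cusp chart is an embedding. -/
def chartDomain : Set (Model n) := d.chart.isEmbedding.exists_isModelDomain.choose

theorem isModelDomain_chart :
    IsModelDomain α (modelBall n d.chart.R) stdForm d.chart.κ d.chartDomain :=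
  d.chart.isEmbedding.exists_isModelDomain.choose_spec

theorem isClosed_disk [T2Space M] : IsClosed d.chart.disk :=
  (d.isModelDomain_chart.isCompact_image (isCompact_modelBall _)
    d.isModelDomain_chart.subset).isClosed

theorem notMem_disk_of_convexBdry {z : Euc n × Euc n} (hz : z ∈ d.s.convexBdry n) :
    d.h.emb z ∉ d.chart.disk := fun h =>
  disjoint_left.1 d.disjoint h (Or.inr ⟨z, hz, rfl⟩)

theorem emb_eq_of_convexBdry {z : Euc n × Euc n} (hz : z ∈ d.s.convexBdry n) :
    d.h'.emb z = d.h.emb z := d.agree z hz.1 (d.notMem_disk_of_convexBdry hz)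

theorem convex_eq : d.h'.convex = d.h.convex :=
  image_congr fun _ hz => d.emb_eq_of_convexBdry hz

theorem exists_margin {s : HandleShape} {K : Set (Euc n × Euc n)} (hK : IsCompact K)
    (h : ∀ z ∈ K, s.exitFn z < 0) : ∃ c > 0, ∀ z ∈ K, s.exitFn z ≤ -c := by
  rcases K.eq_empty_or_nonempty with rfl | hne
  · exact ⟨1, one_pos, by simp⟩
  · obtain ⟨z, hz, hmax⟩ := hK.exists_isMaxOn hne s.continuous_exitFn.continuousOn
    exact ⟨-s.exitFn z, neg_pos.2 (h z hz), fun z' hz' => by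
      have : s.exitFn z' ≤ s.exitFn z := hmax hz'
      linarith⟩

/-- The ball of the cusp chart and the support of the isotopy of the disk stay away from the convex
boundary. -/
theorem exists_isBallIsotopy [T2Space M] : ∃ (μ ρ₁ : ℝ) (Φ : ℝ × Euc n → Euc n), 0 < μ ∧
    μ < 2 * d.s.εU ∧ 0 < ρ₁ ∧ d.s.lowerU ρ₁ = 2 * d.s.εU - μ ∧ IsBallIsotopy ρ₁ Φ ∧
    (∀ x, Φ (1, x) = d.F x) ∧
    ∀ z ∈ d.s.handle n, d.h.emb z ∈ d.chart.disk → d.s.exitFn z ≤ -μ := by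
  obtain ⟨Φ, K, hK, hKX, hΦ, hΦ0, hΦ1, hΦT⟩ := d.isIsotopic
  have hD : IsCompact (d.s.handle n ∩ d.h.emb ⁻¹' d.chart.disk) :=
    (d.s.isCompact_handle n).of_isClosed_subset (d.h.continuousOn_emb.preimage_isClosed_of_isClosed
      (d.s.isCompact_handle n).isClosed d.isClosed_disk) inter_subset_left
  have hK' : IsCompact ((fun x : Euc n => (x, (0 : Euc n))) '' K) := hK.image (by fun_prop)
  obtain ⟨c, hc, hcz⟩ := exists_margin (s := d.s) (hD.union hK') (by
    rintro z (⟨hz, hzD⟩ | ⟨x, hx, rfl⟩)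
    · exact (HandleShape.exitFn_neg_iff hz).2 fun h => d.notMem_disk_of_convexBdry h hzD
    · exact (HandleShape.exitFn_neg_iff (hKX hx).1).2 (hKX hx).2)
  have hU := d.s.εU_pos
  -- The cap by `εU` keeps `2 εU - μ` positive, so that `lowerU` takes this value at a radius `ρ₁ >
  -- εU`.
  have hμ : 0 < min c d.s.εU := lt_min hc hU
  have hμc : min c d.s.εU ≤ c := min_le_left _ _
  have hμU : min c d.s.εU < 2 * d.s.εU := (min_le_right _ _).trans_lt (by linarith)
  obtain ⟨ρ₁, h1, -, h3⟩ := d.s.exists_lowerU_eq hμ hμU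
  refine ⟨min c d.s.εU, ρ₁, Φ, hμ, hμU, hU.trans h1, h3, ⟨hΦ, hΦ0,
    fun T hT => (hΦT T hT).2.1.injective, fun T hT x hx => (hΦT T hT).1 x fun hxK => ?_,
    fun T hT x => ?_⟩, hΦ1, fun z hz hzD => (hcz z (Or.inl ⟨hz, hzD⟩)).trans (neg_le_neg hμc)⟩
  · have h4 := d.s.norm_le_of_exitFn_le (z := (x, (0 : Euc n))) hμU h3 (by simpa using hU)
      ((hcz _ (Or.inr ⟨x, hxK, rfl⟩)).trans (neg_le_neg hμc))
    exact hx.not_ge h4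
  · rw [← (hasFDerivAt_spaceDeriv hΦ T x).fderiv]
    exact (hΦT T hT).2.2 x

variable {d}

/-- On the unstable disk `l'` is the core of an embedded handle composed with the injective map `F`.
This is where embeddedness of the stabilized Legendrian comes from. -/
theorem injOn_stabilized {ρ₁ μ : ℝ} {Φ : ℝ × Euc n → Euc n} (hμ : 0 < μ)
    (hρ : d.s.lowerU ρ₁ = 2 * d.s.εU - μ) (hΦ : IsBallIsotopy ρ₁ Φ) (hΦF : ∀ x, Φ (1, x) = d.F x) :
    InjOn d.l' (d.s.unstableDisk n) := by
  have h1 : (1 : ℝ) ∈ Icc (0 : ℝ) 1 := ⟨zero_le_one, le_rfl⟩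
  have hmaps : ∀ x ∈ d.s.unstableDisk n, (d.F x, (0 : Euc n)) ∈ d.s.handle n := by
    intro x hx
    rcases le_or_gt ‖x‖ ρ₁ with h2 | h2
    · have h3 := hΦ.norm_le h1 h2
      rw [hΦF] at h3
      exact interior_subset (HandleShape.mem_unstableDisk_of_exitFn
        ((d.s.exitFn_le_of_norm_le (z := (d.F x, (0 : Euc n))) hρ h3).trans_lt (by linarith)))
    · rw [← hΦF, hΦ.outside 1 h1 x h2]; exact hx
  intro x hx y hy hxy
  rw [← d.core_eq x hx, ← d.core_eq y hy] at hxy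
  have h2 := (Prod.mk.inj (d.h'.emb_injOn (hmaps x hx) (hmaps y hy) hxy)).1
  rw [← hΦF, ← hΦF] at h2
  exact hΦ.injective 1 h1 h2

theorem mem_cusp_of_core {x : Euc n} (hx : x ∈ d.s.unstableDisk n) {w : Model n}
    (hw : w ∈ modelBall n d.chart.R) (hxw : d.h.core x = d.chart.κ w) : w ∈ cusp n d.chart.f := by
  have h1 : d.chart.κ w ∈ d.chart.κ '' modelBall n d.chart.R ∩ d.h.core '' d.s.unstableDisk n :=
    ⟨⟨w, hw, rfl⟩, x, hx, hxw⟩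
  rw [d.chart.inter] at h1
  obtain ⟨w', ⟨hw', hc⟩, hww⟩ := h1
  have hO := d.isModelDomain_chart
  rwa [← hO.injOn (hO.subset hw') (hO.subset hw) hww]

theorem exists_core_eq {w : Model n} (hw : w ∈ modelBall n d.chart.R) (hc : w ∈ cusp n d.chart.f) :
    ∃ x ∈ d.s.unstableDisk n, d.h.core x = d.chart.κ w := by
  have h1 : d.chart.κ w ∈ d.chart.κ '' (modelBall n d.chart.R ∩ cusp n d.chart.f) :=
    ⟨w, ⟨hw, hc⟩, rfl⟩
  rw [← d.chart.inter] at h1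
  exact h1.2

theorem cuspStab_lower (q : Euc n) (hq : d.chart.ε ^ 2 < q 0 ^ 3) :
    cuspStab d.chart.ε d.g ((-1 : ℝ), (0 : Euc n), q) = (d.g q, -gradient d.g q, q) :=
  if_pos ⟨rfl, hq⟩

variable (d) in
-- If `g = 1` and `∇g = 0` at some `q`, the modified lower sheet would pass through `(1, 0, q)`, a
-- point of the unmodified upper sheet, and `l'` would have a double point.
theorem exists_sheetData (hinj : InjOn d.l' (d.s.unstableDisk n)) :
    ∃ W e, IsSheetData d.chart.ε d.chart.R d.g W e := by
  obtain ⟨-, -, hreg, -⟩ := d.isStabilization.bump.exists_field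
  have hreg' : ∀ q, d.g q ≠ -1 → d.chart.ε ^ 2 < q 0 ^ 3 := fun q hq =>
    hreg q (subset_tsupport _ fun h => hq (by linarith))
  obtain ⟨r, hr, hrR, hin⟩ := d.isStabilization.interior
  have hin' : ∀ q, d.g q ≠ -1 → ((-1 : ℝ), (0 : Euc n), q) ∈ modelBall n r ∧
      (d.g q, -gradient d.g q, q) ∈ modelBall n r := by
    intro q hq
    have h1 := cuspStab_lower (d := d) q (hreg' q hq)
    have h2 := hin _ (mem_cusp d.chart.isCusp (hreg' q hq)).1 (by
      rw [h1]
      exact fun h => hq (Prod.mk.inj h).1)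
    rwa [h1] at h2
  refine exists_isSheetData d.isStabilization.bump hr hrR hin' fun q hq h0 => ?_
  have hq1 : d.g q ≠ -1 := by rw [hq]; norm_num
  have hsub : modelBall n r ⊆ modelBall n d.chart.R := fun w hw =>
    le_trans (show _ ≤ r ^ 2 from hw) (by nlinarith)
  obtain ⟨h1, h2⟩ := hin' q hq1
  rw [hq, h0, neg_zero] at h2
  obtain ⟨c1, c2⟩ := mem_cusp d.chart.isCusp (hreg' q hq1)
  obtain ⟨x, hx, hxw⟩ := exists_core_eq (hsub h1) c1
  obtain ⟨y, hy, hyw⟩ := exists_core_eq (hsub h2) c2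
  have e1 := d.isStabilization.inside x hx _ (hsub h1) hxw
  have e2 := d.isStabilization.inside y hy _ (hsub h2) hyw
  rw [cuspStab_lower q (hreg' q hq1), hq, h0, neg_zero] at e1
  rw [cuspStab, if_neg (by norm_num)] at e2
  have h3 := hinj hx hy (e1.trans e2.symm)
  rw [h3, hyw] at hxw
  have hO := d.isModelDomain_chart
  have h4 := hO.injOn (hO.subset (hsub h2)) (hO.subset (hsub h1)) hxw
  have h5 : (1 : ℝ) = -1 := (Prod.mk.inj h4).1
  norm_num at h5

/-- The stabilizing map carries the unstable disk of the handle to the stabilized disk. -/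
theorem sheetMove_core {W : Euc n → Euc n} {e : ℝ}
    (hs : IsSheetData d.chart.ε d.chart.R d.g W e) {x : Euc n} (hx : x ∈ d.s.unstableDisk n) :
    d.h.core x ∈ (d.chart.κ '' sheetBox d.chart.R d.g e)ᶜ ∪ d.chart.κ '' sheetNhd n d.chart.R e ∧
      sheetMove d.chart.κ d.chartDomain d.chart.R d.g W e (d.h.core x) = d.l' x := by
  have hO := d.isModelDomain_chart
  have he := hs.pos
  have hlow : ∀ q ∈ tsupport fun q => d.g q + 1,
      ((-1 : ℝ), (0 : Euc n), q) ∈ sheetNhd n d.chart.R e := by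
    intro q hq
    refine ⟨?_, by simpa using he, by simpa using he⟩
    have := hs.ball 0 ⟨le_rfl, zero_le_one⟩ ((-1 : ℝ), (0 : Euc n), q) hq (by simpa using he.le)
      (by simpa using he.le)
    rwa [(isFormalDeformation_sheetDeform hs.contDiff hs.contDiff_field).initial] at this
  by_cases hbox : d.h.core x ∈ d.chart.κ '' sheetBox d.chart.R d.g e
  · obtain ⟨w, hw, hwx⟩ := hbox
    have hc := mem_cusp_of_core hx hw.1 hwx.symm
    have hreg := hs.region _ hw.2.2.2
    obtain ⟨h1, h2⟩ := cusp_sheets d.chart.isCusp hc hreg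
    -- The box is within `e / 2 ≤ 1/4` of `t = -1`, so it misses the upper sheet.
    have h3 : w.1 = -1 := by
      refine h2.resolve_right fun h3 => ?_
      have h4 := hw.2.1
      have := hs.le
      rw [h3, abs_of_pos (by norm_num)] at h4
      linarith
    have h4 : w = (-1, 0, w.2.2) := Prod.ext h3 (Prod.ext h1 rfl)
    have h5 : w ∈ sheetNhd n d.chart.R e := by rw [h4]; exact hlow _ hw.2.2.2
    rw [← hwx]
    refine ⟨Or.inr ⟨w, h5, rfl⟩, ?_⟩
    rw [sheetMove_apply hO hs h5, d.isStabilization.inside x hx w hw.1 hwx.symm]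
    have h6 : cuspStab d.chart.ε d.g w = (d.g w.2.2, -gradient d.g w.2.2, w.2.2) :=
      if_pos ⟨h3, hreg⟩
    rw [h6]
    congr 1
    simp only [sheetDeform, h1, h3]
    simp
  · refine ⟨Or.inl hbox, ?_⟩
    rw [sheetMove, glue_of_notMem _ _ hbox, id]
    by_cases hD : d.h.core x ∈ d.chart.disk
    · obtain ⟨w, hw, hwx⟩ := hD
      rw [d.isStabilization.inside x hx w hw hwx.symm, ← hwx]
      congr 1
      symm
      -- A point of the lower sheet outside the box is not over the support, where the jet of `g` is
      -- that of `-1` and the stabilization changes nothing.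
      by_cases h1 : w.1 = -1 ∧ d.chart.ε ^ 2 < w.2.2 0 ^ 3
      · have h2 := (cusp_sheets d.chart.isCusp (mem_cusp_of_core hx hw hwx.symm) h1.2).1
        have h3 : w.2.2 ∉ tsupport fun q => d.g q + 1 := fun hq =>
          hbox ⟨w, ⟨hw, by simp [h1.1]; linarith, by simp [h2]; linarith, hq⟩, hwx⟩
        have h4 := tsupport_nhds_compl h3
        have h5 : gradient d.g w.2.2 = 0 := by
          rw [gradient, h4.fderiv_eq]
          simp
        rw [cuspStab, if_pos h1, h4.self_of_nhds, h5, neg_zero, ← h2, ← h1.1]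
      · exact if_neg h1
    · exact (d.isStabilization.outside x hx hD).symm

/-- The points of the handle close to the unstable disk are close to the cusp. -/
theorem exists_near_sheets [T2Space M] {W : Euc n → Euc n} {e : ℝ}
    (hs : IsSheetData d.chart.ε d.chart.R d.g W e) :
    ∃ η > 0, ∀ z ∈ d.s.handle n, ‖z.2‖ < η → ∀ w ∈ modelBall n d.chart.R,
      d.chart.κ w = d.h.emb z → w.2.2 ∈ (tsupport fun q => d.g q + 1) →
      (|w.1 + 1| ≤ e / 2 ∧ ‖w.2.1‖ ≤ e / 2) ∨ (|w.1 - 1| ≤ e ∧ ‖w.2.1‖ ≤ e) := by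
  have hO := d.isModelDomain_chart
  have he := hs.pos
  set A : Set (Model n) := {w | (|w.1 + 1| < e / 2 ∧ ‖w.2.1‖ < e / 2) ∨
    (|w.1 - 1| < e ∧ ‖w.2.1‖ < e)} with hA
  have hAo : IsOpen A := by
    have h1 : Continuous fun w : Model n => |w.1 + 1| := by fun_prop
    have h2 : Continuous fun w : Model n => |w.1 - 1| := by fun_prop
    have h3 : Continuous fun w : Model n => ‖w.2.1‖ := by fun_prop
    exact ((isOpen_lt h1 continuous_const).inter (isOpen_lt h3 continuous_const)).union
      ((isOpen_lt h2 continuous_const).inter (isOpen_lt h3 continuous_const))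
  -- The points of the ball over the support which are far from both sheets form a compact set. Its
  -- trace in the handle misses the unstable disk, which meets the ball in `Λ_C`, so `‖y‖` is
  -- bounded below there.
  set B : Set (Model n) := modelBall n d.chart.R ∩
    ((projQ n ⁻¹' tsupport fun q => d.g q + 1) ∩ Aᶜ) with hB
  have hBc : IsCompact B := (isCompact_modelBall _).inter_right
    (((isClosed_tsupport _).preimage (projQ n).continuous).inter hAo.isClosed_compl)
  have hκB : IsClosed (d.chart.κ '' B) :=
    (hO.isCompact_image hBc fun w hw => hO.subset hw.1).isClosed
  have hK : IsCompact (d.s.handle n ∩ d.h.emb ⁻¹' (d.chart.κ '' B)) :=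
    (d.s.isCompact_handle n).of_isClosed_subset (d.h.continuousOn_emb.preimage_isClosed_of_isClosed
      (d.s.isCompact_handle n).isClosed hκB) inter_subset_left
  have hpos : ∀ z ∈ d.s.handle n ∩ d.h.emb ⁻¹' (d.chart.κ '' B), 0 < ‖z.2‖ := by
    rintro z ⟨hz, w, hw, hwz⟩
    rw [norm_pos_iff]
    intro h0
    have hz0 : z = (z.1, 0) := Prod.ext rfl h0
    rw [hz0] at hz hwz
    have hc := mem_cusp_of_core (d := d) hz hw.1 hwz.symm
    obtain ⟨h1, h2⟩ := cusp_sheets d.chart.isCusp hc (hs.region _ hw.2.1)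
    refine hw.2.2 (h2.imp (fun h3 => ?_) fun h3 => ?_)
    · rw [h1, h3]; simpa using he
    · rw [h1, h3]; simpa using he
  obtain ⟨η, hη, hηK⟩ : ∃ η > 0, ∀ z ∈ d.s.handle n ∩ d.h.emb ⁻¹' (d.chart.κ '' B),
      η ≤ ‖z.2‖ := by
    rcases (d.s.handle n ∩ d.h.emb ⁻¹' (d.chart.κ '' B)).eq_empty_or_nonempty with h1 | h1
    · exact ⟨1, one_pos, by simp [h1]⟩
    · obtain ⟨z, hz, hmin⟩ := hK.exists_isMinOn h1 (f := fun z => ‖z.2‖) (by fun_prop)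
      exact ⟨‖z.2‖, hpos z hz, fun z' hz' => hmin hz'⟩
  refine ⟨η, hη, fun z hz hzη w hw hwz hq => ?_⟩
  by_contra h1
  refine (hηK z ⟨hz, w, ⟨hw, hq, fun h2 => h1 ?_⟩, hwz⟩).not_gt hzη
  exact h2.imp (fun h => ⟨h.1.le, h.2.le⟩) fun h => ⟨h.1.le, h.2.le⟩

end StabilizationData

/-! ### The parametrized stabilized divisor and its formal isotopy -/

section Stabilized

variable {k : ℕ} {N : Type*} [TopologicalSpace N] [ChartedSpace (Euc k) N] [IsManifold (𝓡 k) ∞ N]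
variable {n m : ℕ} [NeZero n] {M : Type*} [TopologicalSpace M] [ChartedSpace (Euc m) M]
  [IsManifold (𝓡 m) ∞ M] {α : OneForm m M} {ι : N → M} {Γ' : Set M}

namespace StabilizationData

variable (d : StabilizationData n α (range ι) Γ')

/-- The parametrization of the stabilized divisor. -/
def stabilized : N → M := glue (d.h.attach ι) (fun x => d.h'.emb (d.h.coord ι x)) ι

/-- Only the corner `∂^- H_n ∩ ∂^+ H_n` needs care: the anti-surgery removes it with `∂^+ H_n'` and
returns it with `∂^- H_n'`. There both handles agree, because the cusp chart is disjoint from `∂^+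
H_n`. -/
theorem range_stabilized : range d.stabilized = Γ' := by
  have hsurj : ∀ z ∈ d.s.concaveBdry n, ∃ x, ι x = d.h.emb z := by
    intro z hz
    have h1 : d.h.emb z ∈ d.h.concave := ⟨z, hz, rfl⟩
    rw [← d.isSurgeryData] at h1
    exact h1.2
  refine Eq.trans ?_ d.result
  ext p
  constructor
  · rintro ⟨x, rfl⟩
    by_cases hx : x ∈ d.h.attach ι
    · rw [stabilized, glue_of_mem _ _ hx]
      exact Or.inr ⟨_, AmbientHandle.coord_mem_concaveBdry hx, rfl⟩
    · rw [stabilized, glue_of_notMem _ _ hx]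
      by_cases h1 : ι x ∈ d.h.concave
      · obtain ⟨z, hz, hzx⟩ := h1
        have hzc : z ∈ d.s.convexBdry n := by
          by_contra h2
          exact hx ⟨z, hz, (HandleShape.exitFn_neg_iff hz.1).2 h2, hzx.symm⟩
        exact Or.inr ⟨z, hz, (d.emb_eq_of_convexBdry hzc).trans hzx⟩
      · refine Or.inl ⟨Or.inl ⟨⟨x, rfl⟩, h1⟩, fun h2 => h1 ?_⟩
        rw [d.convex_eq] at h2
        obtain ⟨z, hz, hzx⟩ := h2
        rw [← d.isSurgeryData]
        exact ⟨⟨z, hz.1, hzx⟩, x, rfl⟩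
  · rintro (⟨h1 | h1, h2⟩ | ⟨z, hz, rfl⟩)
    · obtain ⟨⟨x, rfl⟩, h3⟩ := h1
      refine ⟨x, glue_of_notMem _ _ fun hx => h3 ?_⟩
      exact ⟨_, AmbientHandle.coord_mem_concaveBdry hx, AmbientHandle.emb_coord hx⟩
    · rw [d.convex_eq] at h2
      exact absurd h1 h2
    · obtain ⟨x, hx⟩ := hsurj z hz
      refine ⟨x, ?_⟩
      by_cases hxV : x ∈ d.h.attach ι
      · rw [stabilized, glue_of_mem _ _ hxV, d.h.emb_injOn
          (AmbientHandle.coord_mem_concaveBdry hxV).1 hz.1 ((AmbientHandle.emb_coord hxV).trans hx)]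
      · have hzc : z ∈ d.s.convexBdry n := by
          by_contra h2
          exact hxV ⟨z, hz, (HandleShape.exitFn_neg_iff hz.1).2 h2, hx⟩
        rw [stabilized, glue_of_notMem _ _ hxV, d.emb_eq_of_convexBdry hzc, hx]

/-- Near `y = 0` the radii `ρ₁ < ρ₂ < ρ₃` are the exit levels `-μ`, `-μ/2` and `-μ/4`. The first
bounds the cusp chart and the isotopy of the disk, the second is where motions of germs are cut off,
the third bounds the domain of the germs. Five isotopies are joined, each starting at the contact
copy reached by the previous one. -/
theorem exists_formalIsotopy_stabilized [T2Space M] [T2Space N] [CompactSpace N]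
    (hα : IsContactForm α) (hm : m = 2 * n + 1) (hk : k + 2 = m)
    (hι : IsContactSubmanifold k α ι) :
    IsContactCopy k α ι d.stabilized ∧ Nonempty (FormalIsotopy k α ι ι d.stabilized) := by
  obtain ⟨μ, ρ₁, Φ, hμ, hμU, hρ₁0, hρ₁, hΦ, hΦF, hD⟩ := d.exists_isBallIsotopy
  obtain ⟨W, e, hs⟩ := d.exists_sheetData (injOn_stabilized hμ hρ₁ hΦ hΦF)
  obtain ⟨ρ₂, -, -, hρ₂⟩ := d.s.exists_lowerU_eq (c := μ / 2) (by positivity) (by linarith)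
  obtain ⟨ρ₃, -, -, hρ₃⟩ := d.s.exists_lowerU_eq (c := μ / 4) (by positivity) (by linarith)
  have h12 : ρ₁ < ρ₂ := by
    by_contra! h1
    have := d.s.isLowerU.monotone h1
    linarith
  have h23 : ρ₂ < ρ₃ := by
    by_contra! h1
    have := d.s.isLowerU.monotone h1
    linarith
  set χ : M → M := sheetMove d.chart.κ d.chartDomain d.chart.R d.g W e with hχ
  have hO := d.isModelDomain_chart
  have hone : (1 : ℝ) ∈ Icc (0 : ℝ) 1 := ⟨zero_le_one, le_rfl⟩
  have hχD : ∀ p ∉ d.chart.disk, χ p = p := fun p hp =>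
    glue_of_notMem _ _ fun ⟨w, hw, hwp⟩ => hp ⟨w, hw.1, hwp⟩
  -- For small `y` the margin `μ` translates into the radius `ρ₁`: beyond it the handle is off the
  -- ball, where `χ` is the identity and the two handles coincide.
  have hoff : ∀ z ∈ d.s.handle n, ‖z.2‖ < d.s.εU → ρ₁ < ‖z.1‖ → d.h.emb z ∉ d.chart.disk :=
    fun z hz h1 h2 h3 => h2.not_ge (d.s.norm_le_of_exitFn_le hμU hρ₁ h1 (hD z hz h3))
  have hχe : ∀ z ∈ d.s.handle n, d.h.emb z ∉ d.chart.disk → χ (d.h.emb z) = d.h'.emb z :=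
    fun z hz h1 => by rw [hχD _ h1, d.agree z hz h1]
  have hFn : ∀ x, ‖x‖ ≤ ρ₃ → ‖d.F x‖ ≤ ρ₃ := by
    intro x hx
    rw [← hΦF]
    rcases le_or_gt ‖x‖ ρ₁ with h1 | h1
    · exact (hΦ.norm_le hone h1).trans (h12.trans h23).le
    · rwa [hΦ.outside 1 hone x h1]
  have hex : ∀ x : Euc n, ‖x‖ ≤ ρ₃ → d.s.exitFn (x, (0 : Euc n)) < 0 := fun x hx =>
    (d.s.exitFn_le_of_norm_le (z := (x, (0 : Euc n))) hρ₃ hx).trans_lt (by linarith)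
  have hdisk : ∀ x : Euc n, ‖x‖ ≤ ρ₃ → x ∈ d.s.unstableDisk n := fun x hx =>
    interior_subset (s := d.s.handle n) (HandleShape.mem_unstableDisk_of_exitFn (hex x hx))
  have hQ : IsOpen ((d.chart.κ '' sheetBox d.chart.R d.g e)ᶜ ∪
      d.chart.κ '' sheetNhd n d.chart.R e) :=
    (hO.isCompact_image (isCompact_sheetBox _ _ _) fun w hw =>
      hO.subset hw.1).isClosed.isOpen_compl.union
      (hO.isOpen_image hm (isOpen_sheetNhd _ _) fun w hw =>
        hO.subset (le_of_lt hw.1 : _ ≤ d.chart.R ^ 2))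
  obtain ⟨η, hη, c, hc, hcχ⟩ := exists_isCoreGerm (h := d.h) (h' := d.h') (χ := χ) hm hQ
    (fun p hp => (sheetMove_isLocalContact hm hO hs hp).1)
    (fun p hp => (sheetMove_isLocalContact hm hO hs hp).2.1)
    (fun p hp => (sheetMove_isLocalContact hm hO hs hp).2.2)
    (F := fun x => Φ (1, x)) (hΦ.injective 1 hone) (ρ₁ := ρ₁) (ρ := ρ₃)
    (fun x hx => ⟨hex x hx, by rw [hΦF]; exact hex _ (hFn x hx)⟩)
    (fun x hx => ⟨(sheetMove_core hs (hdisk x hx)).1, by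
      rw [hΦF, d.core_eq x (hdisk x hx)]; exact (sheetMove_core hs (hdisk x hx)).2⟩)
    (fun z hz h1 h2 => hχe z hz (hoff z hz h2 h1))
  obtain ⟨E₁, E₂, hE₁, hE₂, hE₁c, hE₁₂, hE₂e⟩ :=
    hc.exists_families hΦ hρ₁0 (h12.trans h23) hη
  have hdisj' : ∀ z ∈ d.s.handle n, d.s.exitFn z < 0 → ∀ x ∉ d.h.attach ι, d.h'.emb z ≠ ι x :=
    fun z hz he x hx => AmbientHandle.emb_ne_of_isAntiSurgeryData d.isAntiSurgeryData hz he hx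
  have hagree : ∀ z ∈ d.s.handle n, -(μ / 8) < d.s.exitFn z → d.h'.emb z = d.h.emb z :=
    fun z hz he => d.agree z hz fun h1 => by linarith [hD z hz h1]
  obtain ⟨δ₁, hδ₁, hiso₁⟩ := exists_formalIsotopy_coreMove (k := k) hα hm hk hι d.isSurgeryData
    hdisj' hμ hagree h12 h23 (half_pos hη) hρ₂ hE₁
  obtain ⟨δ₂, hδ₂, hiso₂⟩ := exists_formalIsotopy_coreMove (k := k) hα hm hk hι d.isSurgeryData
    hdisj' hμ hagree h12 h23 (half_pos hη) hρ₂ hE₂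
  obtain ⟨δ₃, hδ₃, hnear⟩ := exists_near_sheets hs
  -- A single thinness serves all purposes: `δ₁` and `δ₂` for the two isotopies of germs, `δ₃` for
  -- closeness to the sheets of the cusp, `εU` for the translation of exit levels into radii.
  obtain ⟨j, hj, hflow⟩ := exists_isThin (k := k) hα hm hk hι d.isSurgeryData hμ
    (lt_min (lt_min hδ₁ hδ₂) (lt_min hδ₃ d.s.εU_pos))
  obtain ⟨hbox, hiso₁⟩ := hiso₁ j (hj.mono ((min_le_left _ _).trans (min_le_left _ _)))
  obtain ⟨-, hiso₂⟩ := hiso₂ j (hj.mono ((min_le_left _ _).trans (min_le_right _ _)))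
  have hthin : ∀ x ∈ d.h.attach ι, d.h.emb (j x) ∈ d.chart.disk →
      ‖(j x).2‖ < δ₃ ∧ ‖(j x).2‖ < d.s.εU := by
    intro x hx h1
    have h2 := hj.thin x hx ((hD _ (hj.mem x hx) h1).trans (by linarith))
    exact ⟨h2.trans_le ((min_le_right _ _).trans (min_le_left _ _)),
      h2.trans_le ((min_le_right _ _).trans (min_le_right _ _))⟩
  have hιD : ∀ x ∉ d.h.attach ι, ι x ∉ d.chart.disk := fun x hx h1 =>
    disjoint_left.1 d.disjoint h1 (AmbientHandle.mem_surgery hx)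
  -- the attaching region is pushed towards the unstable disk
  have e0 : glue (d.h.attach ι) (fun x => d.h.emb (d.h.coord ι x)) ι = ι := by
    funext x
    by_cases hx : x ∈ d.h.attach ι
    · rw [glue_of_mem _ _ hx, AmbientHandle.emb_coord hx]
    · exact glue_of_notMem _ _ hx
  have hstart := (hflow d.h (fun z hz he x hx =>
    AmbientHandle.emb_ne_of_isSurgeryData d.isSurgeryData hz he hx) fun _ _ _ => rfl).1
  rw [e0] at hstart
  obtain ⟨c1, ⟨A1⟩⟩ := hstart hι.isContactCopy_self
  -- the formal isotopy in the cusp chart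
  obtain ⟨c2, ⟨A2⟩⟩ := exists_formalIsotopy_sheetMove hα hm hι c1 hO hs (by
    intro x w hw hwx hq
    by_cases hx : x ∈ d.h.attach ι
    · rw [glue_of_mem _ _ hx] at hwx
      exact hnear _ (hj.mem x hx) (hthin x hx (hwx ▸ ⟨w, hw, rfl⟩)).1 w hw hwx hq
    · rw [glue_of_notMem _ _ hx] at hwx
      exact absurd (hwx ▸ ⟨w, hw, rfl⟩) (hιD x hx))
  -- Within `ρ₂` this is the relation `χ ∘ h = h' ∘ c` in sheared coordinates. Beyond it the points
  -- lie off the ball, so `χ` fixes them and the handles agree.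
  have e2 : (fun x => χ (glue (d.h.attach ι) (fun x => d.h.emb (j x)) ι x)) =
      glue (d.h.attach ι) (fun x => d.h'.thick (coreMove ρ₂ E₁ 0 (j x))) ι := by
    funext x
    by_cases hx : x ∈ d.h.attach ι
    · rw [glue_of_mem _ _ hx, glue_of_mem _ _ hx]
      rcases lt_or_ge ‖(j x).1‖ ρ₂ with hρ | hρ
      · have h1 := hbox x hx hρ
        rw [coreMove_of_lt _ _ hρ, hE₁c _ h1, hcχ _ ⟨h1.1, h1.2.trans (half_lt_self hη)⟩,
          unshear_shear]
        rfl
      · rw [coreMove_of_le _ _ hρ]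
        exact hχe _ (hj.mem x hx) fun h1 =>
          hoff _ (hj.mem x hx) (hthin x hx h1).2 (h12.trans_le hρ) h1
    · rw [glue_of_notMem _ _ hx, glue_of_notMem _ _ hx, hχD _ (hιD x hx)]
  rw [e2] at c2 A2
  -- the contact germ along the unstable disk is isotopic to the identity
  obtain ⟨c3, ⟨A3⟩⟩ := hiso₁ c2
  have e3 : glue (d.h.attach ι) (fun x => d.h'.thick (coreMove ρ₂ E₁ 1 (j x))) ι =
      glue (d.h.attach ι) (fun x => d.h'.thick (coreMove ρ₂ E₂ 0 (j x))) ι := by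
    funext x
    by_cases hx : x ∈ d.h.attach ι
    · rw [glue_of_mem _ _ hx, glue_of_mem _ _ hx]
      rcases lt_or_ge ‖(j x).1‖ ρ₂ with hρ | hρ
      · rw [coreMove_of_lt _ _ hρ, coreMove_of_lt _ _ hρ, hE₁₂ _ (hbox x hx hρ)]
      · rw [coreMove_of_le _ _ hρ, coreMove_of_le _ _ hρ]
    · rw [glue_of_notMem _ _ hx, glue_of_notMem _ _ hx]
  rw [e3] at c3 A3
  obtain ⟨c4, ⟨A4⟩⟩ := hiso₂ c3
  have e4 : (fun x => d.h'.thick (coreMove ρ₂ E₂ 1 (j x))) = fun x => d.h'.emb (j x) := by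
    funext x
    rcases lt_or_ge ‖(j x).1‖ ρ₂ with hρ | hρ
    · rw [coreMove_of_lt _ _ hρ, hE₂e, unshear_shear]; rfl
    · rw [coreMove_of_le _ _ hρ]; rfl
  rw [e4] at c4 A4
  -- the attaching region is pulled back in the stabilized handle
  obtain ⟨c5, ⟨A5⟩⟩ := (hflow d.h' hdisj' hagree).2 c4
  exact ⟨c5, ⟨(((A1.trans A2).trans A3).trans A4).trans A5⟩⟩

end StabilizationData

end Stabilized

end

theorem mainTheorem8 (n : ℕ) [NeZero n] (hn : 2 ≤ n)
    {M : Type*} [TopologicalSpace M] [T2Space M] [SecondCountableTopology M] [CompactSpace M]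
    [ChartedSpace (Euc (2 * n + 1)) M] [IsManifold (𝓡 (2 * n + 1)) ∞ M]
    {N : Type*} [TopologicalSpace N] [T2Space N] [SecondCountableTopology N] [CompactSpace N]
    [ChartedSpace (Euc (2 * n - 1)) N] [IsManifold (𝓡 (2 * n - 1)) ∞ N]
    (α : OneForm (2 * n + 1) M) (hα : IsContactForm α)
    (ι : N → M) (hι : IsContactSubmanifold (2 * n - 1) α ι)
    (Γ' : Set M) (hΓ' : IsDivisorStabilization n α (range ι) Γ') :
    ∃ ι' : N → M, IsContactSubmanifold (2 * n - 1) α ι' ∧ range ι' = Γ' ∧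
      (∀ x, α.pullbackKer (k := 2 * n - 1) ι' x = α.pullbackKer (k := 2 * n - 1) ι x) ∧
      ∃ e₀ e₁ : FormalContactEmbedding (α.pullbackKer (k := 2 * n - 1) ι)
          (α.pullbackD (k := 2 * n - 1) ι) α.ker α.d,
        e₀.φ = ι ∧ e₀.IsGenuine ∧ e₁.φ = ι' ∧ e₁.IsGenuine ∧
        FormallyContactIsotopic e₀ e₁ := by
  obtain ⟨d⟩ := hΓ'
  obtain ⟨h1, ⟨A⟩⟩ := d.exists_formalIsotopy_stabilized (k := 2 * n - 1) hα rfl (by omega) hι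
  obtain ⟨h2, h3⟩ := h1.isContactSubmanifold hα hι
  exact ⟨d.stabilized, h2, d.range_stabilized, h3, A.exists_formalContactEmbedding hα hι⟩
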